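/- **Theorem (offline 3-sided colour frequency reporting).** Let $P$ be a family of $n$ points in $\mathbb{R}^2$, each of which has a colour from $\{1,\dots,\phi\}$, let $\mathcal{Q}$ be a family of $m$ 3-sided queries of the form $Q=[x_1,x_2]\times(-\infty,y)$, and let $2\le s\le n$ be an integer parameter. The answer to a query $Q$ is the set of all pairs $(c,f)$ such that $f>0$ is the number of points of colour $c$ in $Q$; let $k_Q$ be the number of these pairs and $K=\sum_{Q\in\mathcal{Q}}k_Q$. All queries can be answered in $$O\bigl(n\log^2 n\cdot s\log_s n+m\log n+K\log_s n\bigr)$$ time, using $O(n+m)$ working space. Precisely: there are one pointer-machine program and one constant $C$ such that for all $n,m,\phi,s,P,\mathcal{Q}$ as above the program, given linked lists of the points and of the queries, together with $s$, terminates after at most $C\,(n\log^2 n\cdot s\log_s n+m\log n+K\log_s n)$ steps, has at most $C(n+m)$ records (each with a constant number of fields, input included) in memory at any time, computes no integer larger than $C(n+m)$, and writes to a write-only stream, in some order of the queries, each query exactly once followed by the pairs of its answer (in any order). The output stream does not count as memory. A step of the pointer machine allocates or frees a record, copies a value between registers or between a register and a field of a record reached by a pointer, sets a register to the null pointer or a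 constant integer, adds or subtracts (truncated at $0$) two non-negative integers, tests two values for equality, compares two coordinates, two colours or two integers, or writes an item to the stream. -/

import Mathlib

namespace FreqReport

/-! ### The geometric problem -/

/-- A point of the plane with a colour from a palette of `φ` colours. -/
structure ColoredPoint (φ : ℕ) where
  pos : ℝ × ℝ
  color : Fin φ

/-- The 3-sided query `[x₁, x₂] × (-∞, y)`. -/
structure Query where
  x₁ : ℝ
  x₂ : ℝ
  y : ℝ

/-- The query range `[x₁, x₂] × (-∞, y)`. -/
def Query.range (q : Query) : Set (ℝ × ℝ) := Set.Icc q.x₁ q.x₂ ×ˢ Set.Iio q.y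

/-- The frequency of colour `c` in the query `q`: the number of points of colour `c` in its range. -/
noncomputable def freq {n φ : ℕ} (P : Fin n → ColoredPoint φ) (q : Query) (c : Fin φ) : ℕ :=
  Set.ncard {i : Fin n | (P i).color = c ∧ (P i).pos ∈ q.range}

/-- The output size `k_q` of one query: the number of colours that occur in its range. -/
noncomputable def outputSize {n φ : ℕ} (P : Fin n → ColoredPoint φ) (q : Query) : ℕ :=
  Set.ncard {c : Fin φ | 0 < freq P q c}

/-- The total output size `K = ∑ k_q`. -/
noncomputable def totalOutputSize {n m φ : ℕ} (P : Fin n → ColoredPoint φ) (Q : Fin m → Query) :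
    ℕ :=
  ∑ j, outputSize P (Q j)

/-! ### A pointer machine

The memory consists of records, which can only be reached through pointers; there is no address
arithmetic. A program has finitely many registers and uses finitely many field names, since both
are fixed indices that occur in its text. Coordinates and colours can only be copied and compared;
integers can moreover be added and subtracted. -/

/-- The content of a register or of a field of a record. -/
inductive Val where
  | nil
  | ptr (a : ℕ)
  | num (k : ℕ)
  | coord (x : ℝ)
  | color (c : ℕ)

/-- An item of the (write-only) output stream: the announcement of the query whose input record has
address `a`, or a (colour, count) tuple that belongs to the query announced last. -/
inductive Event where
  | query (a : ℕ)
  | tuple (c f : ℕ)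

/-- A record; every field is `nil` when the record is allocated. -/
abbrev Record := ℕ → Val

/-- A machine configuration. The last four components only measure resources: the number of steps
made, the number of records allocated at present, the largest number of records that were allocated
at the same time, and the largest integer computed. -/
structure State where
  reg : ℕ → Val
  heap : ℕ → Option Record
  fresh : ℕ
  out : List Event
  time : ℕ
  live : ℕ
  peak : ℕ
  maxNum : ℕ

/-- The integer held by a value (`0` if it is of another kind). -/
def Val.magnitude : Val → ℕ
  | .num k => k
  | _ => 0

/-- One step of time passes. -/
def State.tick (σ : State) : State := { σ with time := σ.time + 1 }

/-- Write the value `v` into register `d`. -/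
def State.put (σ : State) (d : ℕ) (v : Val) : State :=
  { σ with reg := Function.update σ.reg d v, maxNum := max σ.maxNum v.magnitude }

/-- The elementary instructions; arguments `d`, `r`, `r₁`, `r₂`, `v` are names of registers and `f`
is the name of a field. -/
inductive Instr where
  | setNil (d : ℕ)
  | setNum (d k : ℕ)
  | move (d r : ℕ)
  | load (d r f : ℕ)
  | store (r f v : ℕ)
  | alloc (d : ℕ)
  | free (r : ℕ)
  | add (d r₁ r₂ : ℕ)
  | sub (d r₁ r₂ : ℕ)
  | reportQuery (r : ℕ)
  | reportTuple (r₁ r₂ : ℕ)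

/-- The effect of an instruction, without its unit cost; `none` is a run-time error. -/
def Instr.effect (σ : State) : Instr → Option State
  | .setNil d => some (σ.put d .nil)
  | .setNum d k => some (σ.put d (.num k))
  | .move d r => some (σ.put d (σ.reg r))
  | .load d r f =>
    match σ.reg r with
    | .ptr a => (σ.heap a).map fun ρ => σ.put d (ρ f)
    | _ => none
  | .store r f v =>
    match σ.reg r with
    | .ptr a => (σ.heap a).map fun ρ =>
        { σ with heap := Function.update σ.heap a (some (Function.update ρ f (σ.reg v))) }
    | _ => none
  | .alloc d =>
    some { σ with
      reg := Function.update σ.reg d (.ptr σ.fresh)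
      heap := Function.update σ.heap σ.fresh (some fun _ => .nil)
      fresh := σ.fresh + 1
      live := σ.live + 1
      peak := max σ.peak (σ.live + 1) }
  | .free r =>
    match σ.reg r with
    | .ptr a => (σ.heap a).map fun _ =>
        { σ with heap := Function.update σ.heap a none, live := σ.live - 1 }
    | _ => none
  | .add d r₁ r₂ =>
    match σ.reg r₁, σ.reg r₂ with
    | .num k, .num l => some (σ.put d (.num (k + l)))
    | _, _ => none
  | .sub d r₁ r₂ =>
    match σ.reg r₁, σ.reg r₂ with
    | .num k, .num l => some (σ.put d (.num (k - l)))
    | _, _ => none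
  | .reportQuery r =>
    match σ.reg r with
    | .ptr a => some { σ with out := σ.out ++ [.query a] }
    | _ => none
  | .reportTuple r₁ r₂ =>
    match σ.reg r₁, σ.reg r₂ with
    | .color c, .num k => some { σ with out := σ.out ++ [.tuple c k] }
    | _, _ => none

/-- The tests on two registers: equality of arbitrary values, and order of two coordinates, of two
integers or of two colours. -/
inductive Test where
  | eq (r₁ r₂ : ℕ)
  | lt (r₁ r₂ : ℕ)

open Classical in
/-- The outcome of a test; `none` is a run-time error. -/
noncomputable def Test.eval (σ : State) : Test → Option Bool
  | .eq r₁ r₂ => some (decide (σ.reg r₁ = σ.reg r₂))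
  | .lt r₁ r₂ =>
    match σ.reg r₁, σ.reg r₂ with
    | .coord x, .coord y => some (decide (x < y))
    | .num k, .num l => some (decide (k < l))
    | .color c, .color d => some (decide (c < d))
    | _, _ => none

/-- Programs. -/
inductive Program where
  | skip
  | instr (i : Instr)
  | seq (p₁ p₂ : Program)
  | ite (t : Test) (p₁ p₂ : Program)
  | loop (t : Test) (p : Program)

/-- `Exec p σ σ'`: started in `σ`, the program `p` terminates without a run-time error in `σ'`.
Every instruction and every evaluation of a test takes one step; `loop t p` repeats `p` as long as
`t` holds. -/
inductive Exec : Program → State → State → Prop where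
  | skip (σ : State) : Exec .skip σ σ
  | instr (i : Instr) (σ σ' : State) (h : i.effect σ = some σ') : Exec (.instr i) σ σ'.tick
  | seq (p₁ p₂ : Program) (σ σ' σ'' : State) (h₁ : Exec p₁ σ σ') (h₂ : Exec p₂ σ' σ'') :
      Exec (.seq p₁ p₂) σ σ''
  | iteTrue (t : Test) (p₁ p₂ : Program) (σ σ' : State) (ht : t.eval σ = some true)
      (h : Exec p₁ σ.tick σ') : Exec (.ite t p₁ p₂) σ σ'
  | iteFalse (t : Test) (p₁ p₂ : Program) (σ σ' : State) (ht : t.eval σ = some false)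
      (h : Exec p₂ σ.tick σ') : Exec (.ite t p₁ p₂) σ σ'
  | loopTrue (t : Test) (p : Program) (σ σ' σ'' : State) (ht : t.eval σ = some true)
      (h₁ : Exec p σ.tick σ') (h₂ : Exec (.loop t p) σ' σ'') : Exec (.loop t p) σ σ''
  | loopFalse (t : Test) (p : Program) (σ : State) (ht : t.eval σ = some false) :
      Exec (.loop t p) σ σ.tick

/-! ### Input and output -/

/-- A pointer to item number `i` of a linked list of `len` records stored at the addresses
`base, base + 1, …`; it is `nil` if there is no such item. -/
def listPtr (base len i : ℕ) : Val := if i < len then .ptr (base + i) else .nil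

/-- The input record of point number `i`: pointer to the next point, coordinates, colour. -/
def pointRecord {n φ : ℕ} (P : Fin n → ColoredPoint φ) (i : Fin n) : Record
  | 0 => listPtr 0 n (i + 1)
  | 1 => .coord (P i).pos.1
  | 2 => .coord (P i).pos.2
  | 3 => .color (P i).color
  | _ => .nil

/-- The input record of query number `j`: pointer to the next query, and `x₁`, `x₂`, `y`.
Its address is `n + j`. -/
def queryRecord {m : ℕ} (n : ℕ) (Q : Fin m → Query) (j : Fin m) : Record
  | 0 => listPtr n m (j + 1)
  | 1 => .coord (Q j).x₁
  | 2 => .coord (Q j).x₂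
  | 3 => .coord (Q j).y
  | _ => .nil

/-- The initial configuration: the points and the queries are given as linked lists, the heads of
which are in registers 0 and 1, and the parameter `s` is in register 2. -/
def initial {n m φ : ℕ} (P : Fin n → ColoredPoint φ) (Q : Fin m → Query) (s : ℕ) : State where
  reg
    | 0 => listPtr 0 n 0
    | 1 => listPtr n m 0
    | 2 => .num s
    | _ => .nil
  heap a :=
    if h : a < n then some (pointRecord P ⟨a, h⟩)
    else if h' : a - n < m then some (queryRecord n Q ⟨a - n, h'⟩)
    else none
  fresh := n + m
  out := []
  time := 0
  live := n + m
  peak := n + m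
  maxNum := s

/-- `l` lists, in some order and without repetition, the pairs of a colour that occurs in the range
of `q` and its frequency. -/
def IsAnswer {n φ : ℕ} (P : Fin n → ColoredPoint φ) (q : Query) (l : List (Fin φ × ℕ)) : Prop :=
  l.Nodup ∧ ∀ c f, (c, f) ∈ l ↔ 0 < f ∧ f = freq P q c

/-- The part of the output stream that belongs to query number `j`. -/
def block {φ : ℕ} (n m : ℕ) (ans : Fin m → List (Fin φ × ℕ)) (j : Fin m) : List Event :=
  .query (n + j) :: (ans j).map fun a => .tuple a.1 a.2

/-- The stream `out` answers every query exactly once, in some order of the queries, and all tuples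
of a query are together. -/
def AnswersAll {n m φ : ℕ} (P : Fin n → ColoredPoint φ) (Q : Fin m → Query) (out : List Event) :
    Prop :=
  ∃ (order : Equiv.Perm (Fin m)) (ans : Fin m → List (Fin φ × ℕ)),
    (∀ j, IsAnswer P (Q j) (ans j)) ∧
    out = (List.ofFn order).flatMap (block n m ans)

end FreqReport

/-! Sweep the points in descending order of y. When the queries with a given upper bound are due,
exactly the points below that bound survive, so a 3-sided query becomes one-dimensional: report the
colours, with multiplicities, of the survivors whose x-rank lies in an interval (lo, hi]. The data
structure need only support deletions.

A colour that occurs in (lo, hi] has a unique first point there: its rank exceeds lo while the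
preceding survivor of the same colour, if any, has rank at most lo (`exists_first`, `FKey.unique`).
With the rank of that preceding survivor as key, the first points are found by a 3-sided search in a
priority search tree. Reversing all ranks (`Scene.mirror`) gives the last points in the same way.
Now number the points by colour and, within a colour, by x-rank. The survivors of a colour in the
range are those between its first point f and its last point l in this order (`first_last_iff`), so
the frequency is the rank of l minus the rank of f plus one, both taken among the survivors
(`card_between`). As colours are contiguous in this order, a doubly linked list of the survivors
gives the preceding point of the same colour, and a deletion changes at most one further key in each
of the two search trees (`FKey.delete`, `Drop_spec`).

The rank among the survivors is the original rank minus the number of deleted points before it. In a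
complete binary tree over the colour order, the heights divisible by b = ⌊log₂ s⌋ are marked, and a
node of such a height below the root counts the deleted leaves that lie to its left but below its
next marked proper ancestor, where the root always serves as the last one. A rank query adds one
counter per marked height, which costs O(log_s n) (`Rank_spec`); a deletion increments at most 2^b ≤
s counters per marked height (`Update_spec`). This is the trade-off governed by s.

One tree with 2^h leaves, n ≤ 2^h < 2n, serves all purposes, each of which has its own columns: heap
sort of the points in three orders, location of query coordinates, the two priority search trees and
the counters. It is traversed without a stack by links to the left child and to the preorder
successor of a subtree. Since colours cannot be used as addresses, the points of a colour share a
representative record, through which the rank of the first point passes from the search for first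
points to the search for last points.

The total is O(n (s log_s n + log n) + m log n + K log_s n), which `cost_le` compares with the
claimed bound; the factor log² n serves there only to absorb smaller terms.

Correctness on the pointer machine is obtained through an abstract machine that never frees a record
and treats integers above `B` as errors. `Ex.exec` transfers its runs, so the peak memory is the
number of records ever allocated and `B` bounds all integers. Programs are specified by weakest
preconditions; what they leave alone is read off their text by `Ex.frame`. -/

set_option linter.unusedSimpArgs false
set_option linter.unusedVariables false

namespace FreqReport

/-! ### An abstract machine: memory as one array per field, no deallocation -/

/-- Machine configurations without the derived resource counters. -/
structure M where
  reg : ℕ → Val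
  mem : ℕ → ℕ → Val
  fresh : ℕ
  out : List Event
  time : ℕ

namespace M

def tick (s : M) : M := { s with time := s.time + 1 }

def set (s : M) (d : ℕ) (v : Val) : M :=
  { s with reg := Function.update s.reg d v, time := s.time + 1 }

def sto (s : M) (f a : ℕ) (v : Val) : M :=
  { s with mem := Function.update s.mem f (Function.update (s.mem f) a v), time := s.time + 1 }

def new (s : M) (d : ℕ) : M :=
  { s with reg := Function.update s.reg d (.ptr s.fresh), fresh := s.fresh + 1, time := s.time + 1 }

def emit (s : M) (e : Event) : M := { s with out := s.out ++ [e], time := s.time + 1 }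

/-- The state after the loop test of `whileNN`, where `v` is the value of the flag. -/
def ent (s : M) (v : Val) : M :=
  { s with reg := Function.update (Function.update s.reg 3 .nil) 4 v, time := s.time + 4 }

variable (s : M) (d f a : ℕ) (v : Val) (e : Event)

@[simp] theorem tick_reg : s.tick.reg = s.reg := rfl
@[simp] theorem tick_mem : s.tick.mem = s.mem := rfl
@[simp] theorem tick_fresh : s.tick.fresh = s.fresh := rfl
@[simp] theorem tick_out : s.tick.out = s.out := rfl
@[simp] theorem tick_time : s.tick.time = s.time + 1 := rfl
@[simp] theorem set_reg (i : ℕ) : (s.set d v).reg i = if i = d then v else s.reg i := by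
  simp [set, Function.update_apply]
@[simp] theorem set_mem : (s.set d v).mem = s.mem := rfl
@[simp] theorem set_fresh : (s.set d v).fresh = s.fresh := rfl
@[simp] theorem set_out : (s.set d v).out = s.out := rfl
@[simp] theorem set_time : (s.set d v).time = s.time + 1 := rfl
@[simp] theorem sto_reg : (s.sto f a v).reg = s.reg := rfl
@[simp] theorem sto_mem (g : ℕ) :
    (s.sto f a v).mem g = if g = f then Function.update (s.mem f) a v else s.mem g := by
  simp [sto, Function.update_apply]
@[simp] theorem sto_fresh : (s.sto f a v).fresh = s.fresh := rfl
@[simp] theorem sto_out : (s.sto f a v).out = s.out := rfl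
@[simp] theorem sto_time : (s.sto f a v).time = s.time + 1 := rfl
@[simp] theorem new_reg (i : ℕ) : (s.new d).reg i = if i = d then .ptr s.fresh else s.reg i := by
  simp [new, Function.update_apply]
@[simp] theorem new_mem : (s.new d).mem = s.mem := rfl
@[simp] theorem new_fresh : (s.new d).fresh = s.fresh + 1 := rfl
@[simp] theorem new_out : (s.new d).out = s.out := rfl
@[simp] theorem new_time : (s.new d).time = s.time + 1 := rfl
@[simp] theorem emit_reg : (s.emit e).reg = s.reg := rfl
@[simp] theorem emit_mem : (s.emit e).mem = s.mem := rfl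
@[simp] theorem emit_fresh : (s.emit e).fresh = s.fresh := rfl
@[simp] theorem emit_out : (s.emit e).out = s.out ++ [e] := rfl
@[simp] theorem emit_time : (s.emit e).time = s.time + 1 := rfl
@[simp] theorem ent_reg (i : ℕ) :
    (s.ent v).reg i = if i = 4 then v else if i = 3 then .nil else s.reg i := by
  simp [ent, Function.update_apply]
@[simp] theorem ent_mem : (s.ent v).mem = s.mem := rfl
@[simp] theorem ent_fresh : (s.ent v).fresh = s.fresh := rfl
@[simp] theorem ent_out : (s.ent v).out = s.out := rfl
@[simp] theorem ent_time : (s.ent v).time = s.time + 4 := rfl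

end M

/-- Both values are coordinates, both integers, or both colours. -/
def Val.Cmp : Val → Val → Prop
  | .coord _, .coord _ => True
  | .num _, .num _ => True
  | .color _, .color _ => True
  | _, _ => False

/-- The order of two comparable values. -/
def Val.Lt : Val → Val → Prop
  | .coord x, .coord y => x < y
  | .num k, .num l => k < l
  | .color c, .color d => c < d
  | _, _ => False

@[simp] theorem Val.cmp_num (k l : ℕ) : Val.Cmp (.num k) (.num l) := trivial
@[simp] theorem Val.lt_num (k l : ℕ) : Val.Lt (.num k) (.num l) ↔ k < l := Iff.rfl
@[simp] theorem Val.cmp_coord (k l : ℝ) : Val.Cmp (.coord k) (.coord l) := trivial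
@[simp] theorem Val.lt_coord (k l : ℝ) : Val.Lt (.coord k) (.coord l) ↔ k < l := Iff.rfl
@[simp] theorem Val.cmp_color (k l : ℕ) : Val.Cmp (.color k) (.color l) := trivial

def M.Holds (s : M) : Test → Prop
  | .eq a b => s.reg a = s.reg b
  | .lt a b => Val.Cmp (s.reg a) (s.reg b) ∧ Val.Lt (s.reg a) (s.reg b)

def M.Fails (s : M) : Test → Prop
  | .eq a b => s.reg a ≠ s.reg b
  | .lt a b => Val.Cmp (s.reg a) (s.reg b) ∧ ¬ Val.Lt (s.reg a) (s.reg b)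

/-- Big-step semantics of the abstract machine; integers above `B` are errors. -/
inductive Ex (B : ℕ) : Program → M → M → Prop where
  | skip (s : M) : Ex B .skip s s
  | setNil (d : ℕ) (s : M) : Ex B (.instr (.setNil d)) s (s.set d .nil)
  | setNum (d k : ℕ) (s : M) (h : k ≤ B) : Ex B (.instr (.setNum d k)) s (s.set d (.num k))
  | move (d r : ℕ) (s : M) : Ex B (.instr (.move d r)) s (s.set d (s.reg r))
  | load (d r f a : ℕ) (s : M) (h : s.reg r = .ptr a) (ha : a < s.fresh) :
      Ex B (.instr (.load d r f)) s (s.set d (s.mem f a))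
  | store (r f v a : ℕ) (s : M) (h : s.reg r = .ptr a) (ha : a < s.fresh) :
      Ex B (.instr (.store r f v)) s (s.sto f a (s.reg v))
  | alloc (d : ℕ) (s : M) : Ex B (.instr (.alloc d)) s (s.new d)
  | add (d r₁ r₂ k l : ℕ) (s : M) (h₁ : s.reg r₁ = .num k) (h₂ : s.reg r₂ = .num l)
      (h : k + l ≤ B) : Ex B (.instr (.add d r₁ r₂)) s (s.set d (.num (k + l)))
  | sub (d r₁ r₂ k l : ℕ) (s : M) (h₁ : s.reg r₁ = .num k) (h₂ : s.reg r₂ = .num l) :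
      Ex B (.instr (.sub d r₁ r₂)) s (s.set d (.num (k - l)))
  | reportQuery (r a : ℕ) (s : M) (h : s.reg r = .ptr a) :
      Ex B (.instr (.reportQuery r)) s (s.emit (.query a))
  | reportTuple (r₁ r₂ c k : ℕ) (s : M) (h₁ : s.reg r₁ = .color c) (h₂ : s.reg r₂ = .num k) :
      Ex B (.instr (.reportTuple r₁ r₂)) s (s.emit (.tuple c k))
  | seq (p q : Program) (s s' s'' : M) (h₁ : Ex B p s s') (h₂ : Ex B q s' s'') :
      Ex B (.seq p q) s s''
  | iteTrue (t : Test) (p q : Program) (s s' : M) (ht : s.Holds t) (h : Ex B p s.tick s') :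
      Ex B (.ite t p q) s s'
  | iteFalse (t : Test) (p q : Program) (s s' : M) (ht : s.Fails t) (h : Ex B q s.tick s') :
      Ex B (.ite t p q) s s'
  | loopTrue (t : Test) (p : Program) (s s' s'' : M) (ht : s.Holds t) (h₁ : Ex B p s.tick s')
      (h₂ : Ex B (.loop t p) s' s'') : Ex B (.loop t p) s s''
  | loopFalse (t : Test) (p : Program) (s : M) (ht : s.Fails t) : Ex B (.loop t p) s s.tick

/-- The abstract state `s` describes the machine configuration `σ`. -/
structure Rel (B : ℕ) (σ : State) (s : M) : Prop where
  reg : σ.reg = s.reg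
  heap : ∀ a, σ.heap a = if a < s.fresh then some (fun f => s.mem f a) else none
  fresh : σ.fresh = s.fresh
  live : σ.live = s.fresh
  peak : σ.peak = s.fresh
  out : σ.out = s.out
  time : σ.time = s.time
  maxNum : σ.maxNum ≤ B
  regB : ∀ r, (s.reg r).magnitude ≤ B
  memB : ∀ f a, (s.mem f a).magnitude ≤ B
  memNil : ∀ f a, s.fresh ≤ a → s.mem f a = .nil

theorem Rel.tick {B : ℕ} {σ : State} {s : M} (h : Rel B σ s) : Rel B σ.tick s.tick := by
  obtain ⟨h1, h2, h3, h4, h5, h6, h7, h8, h9, h10, h11⟩ := h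
  exact ⟨h1, h2, h3, h4, h5, h6, by simp [State.tick, h7], h8, h9, h10, h11⟩

theorem Rel.put {B : ℕ} {σ : State} {s : M} (h : Rel B σ s) (d : ℕ) (v : Val)
    (hv : v.magnitude ≤ B) : Rel B (σ.put d v).tick (s.set d v) := by
  obtain ⟨h1, h2, h3, h4, h5, h6, h7, h8, h9, h10, h11⟩ := h
  refine ⟨by simp [State.tick, State.put, h1, M.set], h2, h3, h4, h5, h6,
    by simp [State.tick, State.put, h7], by simp [State.tick, State.put, h8, hv], ?_, h10, h11⟩
  intro r
  rw [M.set_reg]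
  split_ifs
  · exact hv
  · exact h9 r

theorem Rel.holds {B : ℕ} {σ : State} {s : M} (h : Rel B σ s) {t : Test} (ht : s.Holds t) :
    t.eval σ = some true := by
  cases t with
  | eq a b => simpa [Test.eval, h.reg, M.Holds] using ht
  | lt a b =>
    simp only [M.Holds] at ht
    revert ht
    simp only [Test.eval, h.reg]
    cases s.reg a <;> cases s.reg b <;> simp [Val.Cmp, Val.Lt]

theorem Rel.fails {B : ℕ} {σ : State} {s : M} (h : Rel B σ s) {t : Test} (ht : s.Fails t) :
    t.eval σ = some false := by
  cases t with
  | eq a b => simpa [Test.eval, h.reg, M.Fails] using ht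
  | lt a b =>
    simp only [M.Fails] at ht
    revert ht
    simp only [Test.eval, h.reg]
    cases s.reg a <;> cases s.reg b <;> simp [Val.Cmp, Val.Lt]

/-- Every run of the abstract machine is a run of the pointer machine. -/
theorem Ex.exec {B : ℕ} {p : Program} {s s' : M} (h : Ex B p s s') :
    ∀ σ, Rel B σ s → ∃ σ', Exec p σ σ' ∧ Rel B σ' s' := by
  induction h with
  | skip s => exact fun σ hσ => ⟨σ, .skip σ, hσ⟩
  | setNil d s => exact fun σ hσ => ⟨_, .instr _ _ _ rfl, hσ.put d .nil (Nat.zero_le _)⟩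
  | setNum d k s h => exact fun σ hσ => ⟨_, .instr _ _ _ rfl, hσ.put d (.num k) h⟩
  | move d r s =>
    intro σ hσ
    refine ⟨_, .instr _ _ _ rfl, ?_⟩
    rw [hσ.reg]
    exact hσ.put d _ (hσ.regB r)
  | load d r f a s h ha =>
    intro σ hσ
    refine ⟨_, .instr _ _ (σ.put d (s.mem f a)) ?_, hσ.put d _ (hσ.memB f a)⟩
    simp [Instr.effect, hσ.reg, h, hσ.heap, ha]
  | store r f v a s h ha =>
    intro σ hσ
    obtain ⟨h1, h2, h3, h4, h5, h6, h7, h8, h9, h10, h11⟩ := hσ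
    have hρ : Instr.effect σ (.store r f v) = some { σ with
        heap := Function.update σ.heap a
          (some (Function.update (fun f => s.mem f a) f (s.reg v))) } := by
      simp [Instr.effect, h1, h, h2, ha]
    refine ⟨_, .instr _ _ _ hρ, ?_⟩
    · refine ⟨h1, ?_, h3, h4, h5, h6, by simp [State.tick, h7], h8, h9, ?_, ?_⟩
      · intro b
        by_cases hb : b = a
        · subst hb
          simp only [State.tick, Function.update_self, M.sto_fresh, ha, if_true, Option.some.injEq]
          funext g
          by_cases hg : g = f
          · subst hg; simp
          · simp [hg]
        · simp only [State.tick, Function.update_of_ne hb, h2, M.sto_fresh, M.sto_mem]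
          split_ifs
          · congr 1
            funext g
            split_ifs with hg
            · subst hg; simp [hb]
            · rfl
          · rfl
      · intro g b
        rw [M.sto_mem]
        split_ifs
        · rw [Function.update_apply]
          split_ifs
          · exact h9 v
          · exact h10 _ _
        · exact h10 _ _
      · intro g b hb
        simp only [M.sto_fresh] at hb
        rw [M.sto_mem]
        split_ifs
        · rw [Function.update_of_ne (by omega)]
          exact h11 _ _ hb
        · exact h11 _ _ hb
  -- The abstract allocation does not touch the columns. That the new record is blank, as on the
  -- pointer machine, is the invariant `memNil`.
  | alloc d s =>
    intro σ hσ
    obtain ⟨h1, h2, h3, h4, h5, h6, h7, h8, h9, h10, h11⟩ := hσ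
    refine ⟨_, .instr _ _ _ rfl, ?_⟩
    refine ⟨by simp [State.tick, h1, h3, M.new], ?_, by simp [State.tick, h3],
      by simp [State.tick, h4], by simp [State.tick, h4, h5], h6, by simp [State.tick, h7],
      h8, ?_, h10, ?_⟩
    · intro b
      by_cases hb : b = s.fresh
      · subst hb
        simp [State.tick, h3, h11]
      · simp only [State.tick, h3, Function.update_of_ne hb, h2, M.new_fresh, M.new_mem]
        have : b < s.fresh ↔ b < s.fresh + 1 := by omega
        simp [this]
    · intro r
      rw [M.new_reg]
      split_ifs
      · exact Nat.zero_le _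
      · exact h9 r
    · intro f a ha
      simp only [M.new_fresh] at ha
      exact h11 f a (by omega)
  | add d r₁ r₂ k l s h₁ h₂ h =>
    intro σ hσ
    refine ⟨_, .instr _ _ (σ.put d (.num (k + l))) ?_, hσ.put d _ h⟩
    simp [Instr.effect, hσ.reg, h₁, h₂]
  -- Truncated subtraction never exceeds its first operand, so no bound on the result has to be
  -- assumed.
  | sub d r₁ r₂ k l s h₁ h₂ =>
    intro σ hσ
    have := hσ.regB r₁
    rw [h₁] at this
    refine ⟨_, .instr _ _ (σ.put d (.num (k - l))) ?_, hσ.put d _ ?_⟩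
    · simp [Instr.effect, hσ.reg, h₁, h₂]
    · simp only [Val.magnitude] at this ⊢; omega
  | reportQuery r a s h =>
    intro σ hσ
    obtain ⟨h1, h2, h3, h4, h5, h6, h7, h8, h9, h10, h11⟩ := hσ
    refine ⟨_, .instr _ _ { σ with out := σ.out ++ [.query a] } ?_,
      ⟨h1, h2, h3, h4, h5, by simp [State.tick, h6], by simp [State.tick, h7], h8, h9, h10, h11⟩⟩
    simp [Instr.effect, h1, h]
  | reportTuple r₁ r₂ c k s hr₁ hr₂ =>
    intro σ hσ
    obtain ⟨h1, h2, h3, h4, h5, h6, h7, h8, h9, h10, h11⟩ := hσ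
    refine ⟨_, .instr _ _ { σ with out := σ.out ++ [.tuple c k] } ?_,
      ⟨h1, h2, h3, h4, h5, by simp [State.tick, h6], by simp [State.tick, h7], h8, h9, h10, h11⟩⟩
    simp [Instr.effect, h1, hr₁, hr₂]
  | seq p q s s' s'' _ _ ih₁ ih₂ =>
    intro σ hσ
    obtain ⟨σ', he, hσ'⟩ := ih₁ σ hσ
    obtain ⟨σ'', he', hσ''⟩ := ih₂ σ' hσ'
    exact ⟨σ'', .seq _ _ _ _ _ he he', hσ''⟩
  | iteTrue t p q s s' ht _ ih =>
    intro σ hσ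
    obtain ⟨σ', he, hσ'⟩ := ih _ hσ.tick
    exact ⟨σ', .iteTrue _ _ _ _ _ (hσ.holds ht) he, hσ'⟩
  | iteFalse t p q s s' ht _ ih =>
    intro σ hσ
    obtain ⟨σ', he, hσ'⟩ := ih _ hσ.tick
    exact ⟨σ', .iteFalse _ _ _ _ _ (hσ.fails ht) he, hσ'⟩
  | loopTrue t p s s' s'' ht _ _ ih₁ ih₂ =>
    intro σ hσ
    obtain ⟨σ', he, hσ'⟩ := ih₁ _ hσ.tick
    obtain ⟨σ'', he', hσ''⟩ := ih₂ σ' hσ'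
    exact ⟨σ'', .loopTrue _ _ _ _ _ (hσ.holds ht) he he', hσ''⟩
  | loopFalse t p s ht =>
    exact fun σ hσ => ⟨_, .loopFalse _ _ _ (hσ.fails ht), hσ.tick⟩

/-! ### Framing -/

/-- The register `i` may be written by the program. -/
def wr : Program → ℕ → Bool
  | .skip, _ => false
  | .instr (.setNil d), i => i == d
  | .instr (.setNum d _), i => i == d
  | .instr (.move d _), i => i == d
  | .instr (.load d _ _), i => i == d
  | .instr (.alloc d), i => i == d
  | .instr (.add d _ _), i => i == d
  | .instr (.sub d _ _), i => i == d
  | .instr _, _ => false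
  | .seq p q, i => wr p i || wr q i
  | .ite _ p q, i => wr p i || wr q i
  | .loop _ p, i => wr p i

/-- The field `f` of some record may be written by the program. -/
def wf : Program → ℕ → Bool
  | .instr (.store _ f _), g => g == f
  | .seq p q, i => wf p i || wf q i
  | .ite _ p q, i => wf p i || wf q i
  | .loop _ p, i => wf p i
  | _, _ => false

/-- The program contains no allocation. -/
def noAlloc : Program → Bool
  | .instr (.alloc _) => false
  | .seq p q => noAlloc p && noAlloc q
  | .ite _ p q => noAlloc p && noAlloc q
  | .loop _ p => noAlloc p
  | _ => true

/-- The program reports nothing. -/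
def silent : Program → Bool
  | .instr (.reportQuery _) => false
  | .instr (.reportTuple _ _) => false
  | .seq p q => silent p && silent q
  | .ite _ p q => silent p && silent q
  | .loop _ p => silent p
  | _ => true

/-- What a program cannot have changed, as far as can be read off its text. -/
structure Frame (p : Program) (s s' : M) : Prop where
  reg : ∀ i, wr p i = false → s'.reg i = s.reg i
  mem : ∀ f, wf p f = false → s'.mem f = s.mem f
  le : s.fresh ≤ s'.fresh
  fresh : noAlloc p = true → s'.fresh = s.fresh
  out : silent p = true → s'.out = s.out

theorem Frame.refl (p : Program) (s : M) : Frame p s s :=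
  ⟨fun _ _ => rfl, fun _ _ => rfl, le_rfl, fun _ => rfl, fun _ => rfl⟩

theorem Frame.trans {p q r : Program} {s s' s'' : M} (h₁ : Frame p s s') (h₂ : Frame q s' s'')
    (hr : ∀ i, wr r i = false → wr p i = false ∧ wr q i = false)
    (hf : ∀ i, wf r i = false → wf p i = false ∧ wf q i = false)
    (ha : noAlloc r = true → noAlloc p = true ∧ noAlloc q = true)
    (hs : silent r = true → silent p = true ∧ silent q = true) : Frame r s s'' :=
  ⟨fun i hi => (h₂.reg i (hr i hi).2).trans (h₁.reg i (hr i hi).1),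
   fun i hi => (h₂.mem i (hf i hi).2).trans (h₁.mem i (hf i hi).1),
   h₁.le.trans h₂.le,
   fun h => (h₂.fresh (ha h).2).trans (h₁.fresh (ha h).1),
   fun h => (h₂.out (hs h).2).trans (h₁.out (hs h).1)⟩

/-- Specifications state only what changes. Everything else is recovered from this lemma by
evaluating `wr`, `wf`, `noAlloc` and `silent` on the concrete program text, mostly by `rfl`. -/
theorem Ex.frame {B : ℕ} {p : Program} {s s' : M} (h : Ex B p s s') : Frame p s s' := by
  induction h with
  | skip s => exact Frame.refl _ _
  | seq p q s s' s'' _ _ ih₁ ih₂ =>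
    exact ih₁.trans ih₂ (by simp [wr]) (by simp [wf]) (by simp [noAlloc]) (by simp [silent])
  | iteTrue t p q s s' ht _ ih =>
    -- The branch starts in `s.tick`, which differs from `s` only in the time, and a frame ignores
    -- time. The trivial frame of `.skip` just makes `Frame.trans` applicable.
    exact (Frame.refl .skip s).trans (s' := s) ⟨ih.reg, ih.mem, ih.le, ih.fresh, ih.out⟩
      (by simp +contextual [wr]) (by simp +contextual [wf]) (by simp +contextual [noAlloc])
      (by simp +contextual [silent])
  | iteFalse t p q s s' ht _ ih =>
    exact (Frame.refl .skip s).trans (s' := s) ⟨ih.reg, ih.mem, ih.le, ih.fresh, ih.out⟩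
      (by simp +contextual [wr]) (by simp +contextual [wf]) (by simp +contextual [noAlloc])
      (by simp +contextual [silent])
  | loopTrue t p s s' s'' ht _ _ ih₁ ih₂ =>
    exact Frame.trans (s' := s') ⟨ih₁.reg, ih₁.mem, ih₁.le, ih₁.fresh, ih₁.out⟩ ih₂
      (by simp [wr]) (by simp [wf]) (by simp [noAlloc]) (by simp [silent])
  | loopFalse t p s ht => exact ⟨fun _ _ => rfl, fun _ _ => rfl, le_rfl, fun _ => rfl, fun _ => rfl⟩
  | _ =>
    refine ⟨?_, ?_, ?_, ?_, ?_⟩ <;> simp +contextual [wr, wf, noAlloc, silent]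

/-! ### Weakest preconditions -/

/-- The program terminates without error from `s`, in a state that satisfies `Q`. -/
def wp (B : ℕ) (p : Program) (s : M) (Q : M → Prop) : Prop := ∃ s', Ex B p s s' ∧ Q s'

infixr:60 " ;; " => Program.seq

def nl (d : ℕ) : Program := .instr (.setNil d)
def nm (d k : ℕ) : Program := .instr (.setNum d k)
def mv (d r : ℕ) : Program := .instr (.move d r)
def ld (d r f : ℕ) : Program := .instr (.load d r f)
def st (r f v : ℕ) : Program := .instr (.store r f v)
def al (d : ℕ) : Program := .instr (.alloc d)
def ad (d r₁ r₂ : ℕ) : Program := .instr (.add d r₁ r₂)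
def sb (d r₁ r₂ : ℕ) : Program := .instr (.sub d r₁ r₂)
def rq (r : ℕ) : Program := .instr (.reportQuery r)
def rt (r₁ r₂ : ℕ) : Program := .instr (.reportTuple r₁ r₂)
def ifEq (a b : ℕ) (p q : Program) : Program := .ite (.eq a b) p q
def ifLt (a b : ℕ) (p q : Program) : Program := .ite (.lt a b) p q

section
variable {B : ℕ} {s : M} {Q R : M → Prop} {p q : Program}

theorem wp.mono (h : wp B p s Q) (hQ : ∀ s', Q s' → R s') : wp B p s R :=
  let ⟨s', he, hq⟩ := h; ⟨s', he, hQ s' hq⟩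

/-- The way specifications are composed: the postcondition of a call comes together with the frame
of the called program. -/
theorem wp.frame (h : wp B p s Q) (hQ : ∀ s', Frame p s s' → Q s' → R s') : wp B p s R :=
  let ⟨s', he, hq⟩ := h; ⟨s', he, hQ s' he.frame hq⟩

theorem wp_skip : wp B .skip s Q ↔ Q s :=
  ⟨fun ⟨s', he, hq⟩ => by cases he; exact hq, fun h => ⟨s, .skip s, h⟩⟩

theorem wp_seq : wp B (p ;; q) s Q ↔ wp B p s fun s' => wp B q s' Q :=
  ⟨fun ⟨s', he, hq⟩ => by cases he with | seq _ _ _ s1 _ h1 h2 => exact ⟨s1, h1, s', h2, hq⟩,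
   fun ⟨s1, h1, s2, h2, hq⟩ => ⟨s2, .seq _ _ _ _ _ h1 h2, hq⟩⟩

theorem wp_nl {d : ℕ} : wp B (nl d) s Q ↔ Q (s.set d .nil) :=
  ⟨fun ⟨s', he, hq⟩ => by cases he; exact hq, fun h => ⟨_, .setNil d s, h⟩⟩

theorem wp_nm {d k : ℕ} : wp B (nm d k) s Q ↔ k ≤ B ∧ Q (s.set d (.num k)) :=
  ⟨fun ⟨s', he, hq⟩ => by cases he with | setNum _ _ _ h => exact ⟨h, hq⟩,
   fun h => ⟨_, .setNum d k s h.1, h.2⟩⟩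

theorem wp_mv {d r : ℕ} : wp B (mv d r) s Q ↔ Q (s.set d (s.reg r)) :=
  ⟨fun ⟨s', he, hq⟩ => by cases he; exact hq, fun h => ⟨_, .move d r s, h⟩⟩

theorem wp_ld {d r f : ℕ} :
    wp B (ld d r f) s Q ↔ ∃ a, s.reg r = .ptr a ∧ a < s.fresh ∧ Q (s.set d (s.mem f a)) :=
  ⟨fun ⟨s', he, hq⟩ => by cases he with | load _ _ _ a _ h ha => exact ⟨a, h, ha, hq⟩,
   fun ⟨a, h, ha, hq⟩ => ⟨_, .load d r f a s h ha, hq⟩⟩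

theorem wp_st {r f v : ℕ} :
    wp B (st r f v) s Q ↔ ∃ a, s.reg r = .ptr a ∧ a < s.fresh ∧ Q (s.sto f a (s.reg v)) :=
  ⟨fun ⟨s', he, hq⟩ => by cases he with | store _ _ _ a _ h ha => exact ⟨a, h, ha, hq⟩,
   fun ⟨a, h, ha, hq⟩ => ⟨_, .store r f v a s h ha, hq⟩⟩

theorem wp_al {d : ℕ} : wp B (al d) s Q ↔ Q (s.new d) :=
  ⟨fun ⟨s', he, hq⟩ => by cases he; exact hq, fun h => ⟨_, .alloc d s, h⟩⟩

theorem wp_ad {d r₁ r₂ : ℕ} : wp B (ad d r₁ r₂) s Q ↔ ∃ k, s.reg r₁ = .num k ∧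
    ∃ l, s.reg r₂ = .num l ∧ k + l ≤ B ∧ Q (s.set d (.num (k + l))) :=
  ⟨fun ⟨s', he, hq⟩ => by
    cases he with | add _ _ _ k l _ h₁ h₂ h => exact ⟨k, h₁, l, h₂, h, hq⟩,
   fun ⟨k, h₁, l, h₂, h, hq⟩ => ⟨_, .add d r₁ r₂ k l s h₁ h₂ h, hq⟩⟩

theorem wp_sb {d r₁ r₂ : ℕ} : wp B (sb d r₁ r₂) s Q ↔ ∃ k, s.reg r₁ = .num k ∧
    ∃ l, s.reg r₂ = .num l ∧ Q (s.set d (.num (k - l))) :=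
  ⟨fun ⟨s', he, hq⟩ => by cases he with | sub _ _ _ k l _ h₁ h₂ => exact ⟨k, h₁, l, h₂, hq⟩,
   fun ⟨k, h₁, l, h₂, hq⟩ => ⟨_, .sub d r₁ r₂ k l s h₁ h₂, hq⟩⟩

theorem wp_rq {r : ℕ} : wp B (rq r) s Q ↔ ∃ a, s.reg r = .ptr a ∧ Q (s.emit (.query a)) :=
  ⟨fun ⟨s', he, hq⟩ => by cases he with | reportQuery _ a _ h => exact ⟨a, h, hq⟩,
   fun ⟨a, h, hq⟩ => ⟨_, .reportQuery r a s h, hq⟩⟩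

theorem wp_rt {r₁ r₂ : ℕ} : wp B (rt r₁ r₂) s Q ↔ ∃ c, s.reg r₁ = .color c ∧
    ∃ k, s.reg r₂ = .num k ∧ Q (s.emit (.tuple c k)) :=
  ⟨fun ⟨s', he, hq⟩ => by cases he with | reportTuple _ _ c k _ h₁ h₂ => exact ⟨c, h₁, k, h₂, hq⟩,
   fun ⟨c, h₁, k, h₂, hq⟩ => ⟨_, .reportTuple r₁ r₂ c k s h₁ h₂, hq⟩⟩

theorem wp_ifEq {a b : ℕ} : wp B (ifEq a b p q) s Q ↔
    (s.reg a = s.reg b → wp B p s.tick Q) ∧ (s.reg a ≠ s.reg b → wp B q s.tick Q) := by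
  constructor
  · rintro ⟨s', he, hq⟩
    cases he with
    | iteTrue _ _ _ _ _ ht h => exact ⟨fun _ => ⟨s', h, hq⟩, fun h' => absurd ht h'⟩
    | iteFalse _ _ _ _ _ ht h => exact ⟨fun h' => absurd h' ht, fun _ => ⟨s', h, hq⟩⟩
  · rintro ⟨h1, h2⟩
    by_cases h : s.reg a = s.reg b
    · obtain ⟨s', he, hq⟩ := h1 h; exact ⟨s', .iteTrue _ _ _ _ _ h he, hq⟩
    · obtain ⟨s', he, hq⟩ := h2 h; exact ⟨s', .iteFalse _ _ _ _ _ h he, hq⟩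

theorem wp_ifLt {a b : ℕ} : wp B (ifLt a b p q) s Q ↔ Val.Cmp (s.reg a) (s.reg b) ∧
    (Val.Lt (s.reg a) (s.reg b) → wp B p s.tick Q) ∧
    (¬ Val.Lt (s.reg a) (s.reg b) → wp B q s.tick Q) := by
  constructor
  · rintro ⟨s', he, hq⟩
    cases he with
    | iteTrue _ _ _ _ _ ht h => exact ⟨ht.1, fun _ => ⟨s', h, hq⟩, fun h' => absurd ht.2 h'⟩
    | iteFalse _ _ _ _ _ ht h => exact ⟨ht.1, fun h' => absurd h' ht.2, fun _ => ⟨s', h, hq⟩⟩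
  · rintro ⟨hc, h1, h2⟩
    by_cases h : Val.Lt (s.reg a) (s.reg b)
    · obtain ⟨s', he, hq⟩ := h1 h; exact ⟨s', .iteTrue _ _ _ _ _ ⟨hc, h⟩ he, hq⟩
    · obtain ⟨s', he, hq⟩ := h2 h; exact ⟨s', .iteFalse _ _ _ _ _ ⟨hc, h⟩ he, hq⟩

end

/-! ### Loops over non-nil registers -/

/-- A loop test can only compare two registers, so the outcome is put into a flag: register 4 equals
register 3 (which is nil) exactly if `r` is not nil. Registers 3 and 4 are reserved for this. -/
def chk (r : ℕ) : Program := nl 3 ;; ifEq r 3 (nm 4 0) (nl 4)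

/-- Repeat `p` as long as register `r` is not nil. -/
def whileNN (r : ℕ) (p : Program) : Program := chk r ;; .loop (.eq 4 3) (p ;; chk r)

section
variable {B : ℕ} {s : M} {Q : M → Prop} {p : Program} {r : ℕ}

theorem Ex.chk (s : M) (h3 : r ≠ 3) : Ex B (chk r) s
    ((s.set 3 .nil).tick.set 4 (open Classical in if s.reg r = .nil then .num 0 else .nil)) := by
  by_cases h : s.reg r = .nil
  · simp only [h, if_true]
    exact .seq _ _ _ _ _ (.setNil _ _) (.iteTrue _ _ _ _ _ (by simp [M.Holds, h3, h])
      (.setNum _ _ _ (Nat.zero_le _)))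
  · simp only [h, if_false]
    exact .seq _ _ _ _ _ (.setNil _ _) (.iteFalse _ _ _ _ _ (by simp [M.Fails, h3, h])
      (.setNil _ _))

theorem M.chk_tick (s : M) (v : Val) : ((s.set 3 .nil).tick.set 4 v).tick = s.ent v := rfl

theorem wp_while_nil (h3 : r ≠ 3) (h : s.reg r = .nil) (hQ : Q (s.ent (.num 0))) :
    wp B (whileNN r p) s Q := by
  refine ⟨_, .seq _ _ _ _ _ (Ex.chk s h3) (.loopFalse _ _ _ ?_), ?_⟩
  · simp [M.Fails, h]
  · simpa only [h, if_true, M.chk_tick] using hQ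

/-- The check at the end of the body is the check at the start of the remaining loop, so one
iteration is the body followed by the same `whileNN`. -/
theorem wp_while_cons (h3 : r ≠ 3) (h : s.reg r ≠ .nil)
    (hQ : wp B p (s.ent .nil) fun s' => wp B (whileNN r p) s' Q) : wp B (whileNN r p) s Q := by
  obtain ⟨s1, h1, s2, h2, hq⟩ := hQ
  cases h2 with
  | seq _ _ _ s3 _ h4 h5 =>
    refine ⟨s2, .seq _ _ _ _ _ (Ex.chk s h3) (.loopTrue _ _ _ s3 _ ?_ (.seq _ _ _ s1 _ ?_ h4) h5),
      hq⟩
    · simp [M.Holds, h]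
    · simpa only [h, if_false, M.chk_tick] using h1

theorem Frame.ent (v : Val) : Frame (whileNN r p) s (s.ent v) := by
  refine ⟨fun i hi => ?_, fun _ _ => rfl, le_rfl, fun _ => rfl, fun _ => rfl⟩
  simp [whileNN, FreqReport.chk, wr, nl, nm, ifEq] at hi
  simp [hi]

theorem Frame.whileNN_body {s' : M} (h : Frame p s s') : Frame (whileNN r p) s s' := by
  refine ⟨fun i hi => h.reg i ?_, fun i hi => h.mem i ?_, h.le, fun hi => h.fresh ?_,
    fun hi => h.out ?_⟩
  · simp [whileNN, FreqReport.chk, wr] at hi; simp [hi]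
  · simp [whileNN, FreqReport.chk, wf] at hi; simp [hi]
  · simp [whileNN, FreqReport.chk, noAlloc] at hi; simp [hi]
  · simp [whileNN, FreqReport.chk, silent] at hi; simp [hi]

theorem Frame.tr {s' s'' : M} (h₁ : Frame p s s') (h₂ : Frame p s' s'') : Frame p s s'' :=
  h₁.trans h₂ (by simp) (by simp) (by simp) (by simp)

/-- The rule for loops: `k` bounds the number of iterations. -/
theorem wp_while (I : ℕ → M → Prop) (k : ℕ) (h3 : r ≠ 3) (h0 : I k s)
    (step : ∀ k s', Frame (whileNN r p) s s' → I k s' → s'.reg r ≠ .nil →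
      wp B p (s'.ent .nil) fun s'' => ∃ k' < k, I k' s'')
    (done : ∀ k s', Frame (whileNN r p) s s' → I k s' → s'.reg r = .nil → Q (s'.ent (.num 0))) :
    wp B (whileNN r p) s Q := by
  suffices H : ∀ k s', Frame (whileNN r p) s s' → I k s' → wp B (whileNN r p) s' Q from
    H k s (Frame.refl _ _) h0
  intro k
  induction k using Nat.strong_induction_on with
  | _ k ih =>
    intro s' hf hI
    by_cases h : s'.reg r = .nil
    · exact wp_while_nil h3 h (done k s' hf hI h)
    · refine wp_while_cons h3 h ((step k s' hf hI h).frame ?_)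
      rintro s'' hf' ⟨k', hk', hI'⟩
      exact ih k' hk' s'' (hf.tr ((Frame.ent .nil).tr hf'.whileNN_body)) hI'

end
attribute [simp] wp_skip wp_seq wp_nl wp_nm wp_mv wp_ld wp_st wp_al wp_ad wp_sb wp_rq wp_rt wp_ifEq
  wp_ifLt

/-- Replaces the postcondition by a variable while `simp` executes straight-line code, so that the
invariant inside it is not rewritten; it is restored afterwards. -/
theorem wp.abs {B : ℕ} {p : Program} {s : M} {Q : M → Prop}
    (h : ∀ R : M → Prop, R = Q → wp B p s R) : wp B p s Q := h Q rfl

section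
variable (d r f g k a b i : ℕ) (p q : Program)
@[simp] theorem wf_skip : wf .skip g = false := rfl
@[simp] theorem wf_nl : wf (nl d) g = false := rfl
@[simp] theorem wf_nm : wf (nm d k) g = false := rfl
@[simp] theorem wf_mv : wf (mv d r) g = false := rfl
@[simp] theorem wf_ld : wf (ld d r f) g = false := rfl
@[simp] theorem wf_st : wf (st r f d) g = (g == f) := rfl
@[simp] theorem wf_al : wf (al d) g = false := rfl
@[simp] theorem wf_ad : wf (ad d a b) g = false := rfl
@[simp] theorem wf_sb : wf (sb d a b) g = false := rfl
@[simp] theorem wf_rq : wf (rq d) g = false := rfl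
@[simp] theorem wf_rt : wf (rt a b) g = false := rfl
@[simp] theorem wf_seq : wf (p ;; q) g = (wf p g || wf q g) := rfl
@[simp] theorem wf_ifEq : wf (ifEq a b p q) g = (wf p g || wf q g) := rfl
@[simp] theorem wf_ifLt : wf (ifLt a b p q) g = (wf p g || wf q g) := rfl
@[simp] theorem wf_whileNN : wf (whileNN r p) g = wf p g := by
  simp [whileNN, chk, wf, nl, ifEq, nm]
end

/-! ### The complete binary tree with `2 ^ h` leaves -/

/-- `k` is the (heap) number of a node of height `e`. -/
def IsNode (h k e : ℕ) : Prop := 2 ^ h ≤ k * 2 ^ e ∧ (k + 1) * 2 ^ e ≤ 2 * 2 ^ h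

/-- The leaves below node `k` of height `e` are those with numbers in `(loOf h k e, hiOf h k e]`. -/
def loOf (h k e : ℕ) : ℕ := k * 2 ^ e - 2 ^ h
def hiOf (h k e : ℕ) : ℕ := (k + 1) * 2 ^ e - 2 ^ h

/-- Leaf number `i` lies below node `k` of height `e`. -/
def Covers (h k e i : ℕ) : Prop := loOf h k e < i ∧ i ≤ hiOf h k e

theorem isNode_root (h : ℕ) : IsNode h 1 h := by simp [IsNode]

theorem IsNode.pos {h k e : ℕ} (hk : IsNode h k e) : 1 ≤ k := by
  rcases Nat.eq_zero_or_pos k with rfl | h0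
  · have := hk.1; have := Nat.two_pow_pos h; omega
  · exact h0

theorem IsNode.lt {h k e : ℕ} (hk : IsNode h k e) : k < 2 * 2 ^ h := by
  have h1 := hk.2
  have h2 := Nat.two_pow_pos e
  nlinarith

theorem IsNode.left {h k e : ℕ} (hk : IsNode h k (e + 1)) : IsNode h (2 * k) e := by
  obtain ⟨h1, h2⟩ := hk
  have h3 := Nat.two_pow_pos e
  rw [pow_succ] at h1 h2
  constructor <;> nlinarith

theorem IsNode.right {h k e : ℕ} (hk : IsNode h k (e + 1)) : IsNode h (2 * k + 1) e := by
  obtain ⟨h1, h2⟩ := hk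
  have h3 := Nat.two_pow_pos e
  rw [pow_succ] at h1 h2
  constructor <;> nlinarith

theorem IsNode.internal {h k e : ℕ} (hk : IsNode h k (e + 1)) : k < 2 ^ h := by
  have := hk.right.lt; omega

theorem IsNode.leaf {h k : ℕ} (hk : IsNode h k 0) : 2 ^ h ≤ k := by
  have := hk.1; omega

theorem isNode_leaf {h i : ℕ} (h1 : 1 ≤ i) (h2 : i ≤ 2 ^ h) : IsNode h (2 ^ h + i - 1) 0 := by
  constructor <;> omega

/-- The numbers of the nodes of height e fill the interval [2^(h-e), 2^(h-e+1)), and these intervals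
are disjoint for different heights. -/
theorem IsNode.unique {h k e e' : ℕ} (hk : IsNode h k e) (hk' : IsNode h k e') : e = e' := by
  wlog hlt : e < e' generalizing e e'
  · rcases Nat.lt_trichotomy e e' with h1 | h1 | h1
    · exact absurd h1 hlt
    · exact h1
    · exact (this hk' hk h1).symm
  have h1 := hk.1
  have h2 := hk'.2
  have h3 : 2 ^ (e + 1) ≤ 2 ^ e' := Nat.pow_le_pow_right (by norm_num) hlt
  have h4 := Nat.two_pow_pos e
  rw [pow_succ] at h3
  nlinarith [Nat.mul_le_mul_left (k + 1) h3]

theorem IsNode.le {h k e : ℕ} (hk : IsNode h k e) : e ≤ h := by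
  by_contra hlt
  have h1 := hk.2
  have h2 := hk.pos
  have h3 : 2 ^ (h + 1) ≤ 2 ^ e := Nat.pow_le_pow_right (by norm_num) (by omega)
  rw [pow_succ] at h3
  have := Nat.two_pow_pos h
  nlinarith

theorem IsNode.parent {h k e : ℕ} (hk : IsNode h k e) (h2 : 2 ≤ k) : IsNode h (k / 2) (e + 1) := by
  have h5 : e < h := by
    rcases hk.le.lt_or_eq with h5 | rfl
    · exact h5
    · have := hk.2; have := Nat.two_pow_pos e; nlinarith
  obtain ⟨h1, h3⟩ := hk
  obtain ⟨c, rfl⟩ : ∃ c, h = e + 1 + c := ⟨h - (e + 1), by omega⟩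
  have he := Nat.two_pow_pos e
  have hc : 2 ^ (e + 1 + c) = 2 ^ e * (2 * 2 ^ c) := by rw [pow_add, pow_succ]; ring
  rw [hc] at h1 h3
  have h1' : 2 * 2 ^ c ≤ k := by
    by_contra hh
    nlinarith
  have h3' : k + 1 ≤ 2 * (2 * 2 ^ c) := by
    by_contra hh
    nlinarith
  constructor
  · rw [hc, pow_succ]
    have : 2 ^ c ≤ k / 2 := by omega
    nlinarith
  · rw [hc, pow_succ]
    have : k / 2 + 1 ≤ 2 * 2 ^ c := by omega
    nlinarith

theorem exists_height {h : ℕ} : ∀ {k : ℕ}, 1 ≤ k → k < 2 * 2 ^ h → ∃ e, IsNode h k e := by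
  intro k
  induction k using Nat.strong_induction_on with
  | _ k ih =>
    intro h1 h2
    rcases Nat.lt_or_ge k 2 with hk | hk
    · obtain rfl : k = 1 := by omega
      exact ⟨h, isNode_root h⟩
    · obtain ⟨e, he⟩ := ih (k / 2) (by omega) (by omega) (by omega)
      rcases e with _ | e
      · have := he.leaf; omega
      · rcases Nat.mod_two_eq_zero_or_one k with h3 | h3
        · have := he.left
          rw [show 2 * (k / 2) = k by omega] at this
          exact ⟨e, this⟩
        · have := he.right
          rw [show 2 * (k / 2) + 1 = k by omega] at this
          exact ⟨e, this⟩

theorem loOf_left (h k e : ℕ) : loOf h (2 * k) e = loOf h k (e + 1) := by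
  simp only [loOf, pow_succ]; congr 1; ring

/-- The leaves of the right child begin where those of the left child end; the two expressions are
literally the same. -/
theorem hiOf_left (h k e : ℕ) : hiOf h (2 * k) e = loOf h (2 * k + 1) e := rfl

theorem hiOf_right (h k e : ℕ) : hiOf h (2 * k + 1) e = hiOf h k (e + 1) := by
  simp only [hiOf, pow_succ]; congr 1; ring

theorem IsNode.hi_eq {h k e : ℕ} (hk : IsNode h k e) : hiOf h k e = loOf h k e + 2 ^ e := by
  have := hk.1
  rw [hiOf, loOf, add_mul, one_mul, Nat.sub_add_comm this]

theorem covers_root {h i : ℕ} (h1 : 1 ≤ i) (h2 : i ≤ 2 ^ h) : Covers h 1 h i := by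
  constructor <;> simp only [loOf, hiOf] <;> omega

theorem Covers.child {h k e i : ℕ} (hc : Covers h k (e + 1) i) :
    Covers h (2 * k) e i ∨ Covers h (2 * k + 1) e i := by
  obtain ⟨h1, h2⟩ := hc
  by_cases h3 : i ≤ hiOf h (2 * k) e
  · exact .inl ⟨by rw [loOf_left]; exact h1, h3⟩
  · exact .inr ⟨by rw [← hiOf_left]; omega, by rw [hiOf_right]; exact h2⟩

/-- Leaves are numbered from 1 while the first leaf is node 2^h, whence the subtraction of 1. -/
theorem IsNode.covers_leaf {h k i : ℕ} (hk : IsNode h k 0) (hc : Covers h k 0 i) :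
    k = 2 ^ h + i - 1 := by
  have h1 := hk.leaf
  obtain ⟨h2, h3⟩ := hc
  simp only [loOf, hiOf, pow_zero, mul_one] at h2 h3
  omega

theorem Covers.left {h k e i : ℕ} (hk : IsNode h k (e + 1)) (hc : Covers h (2 * k) e i) :
    Covers h k (e + 1) i := by
  have h1 := hk.left.hi_eq
  have h2 := hk.hi_eq
  have := pow_succ 2 e
  have h4 := loOf_left h k e
  obtain ⟨h5, h6⟩ := hc
  constructor <;> omega

theorem Covers.right {h k e i : ℕ} (hk : IsNode h k (e + 1)) (hc : Covers h (2 * k + 1) e i) :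
    Covers h k (e + 1) i := by
  have h1 := hk.right.hi_eq
  have h2 := hk.hi_eq
  have := pow_succ 2 e
  have h4 := hiOf_right h k e
  obtain ⟨h5, h6⟩ := hc
  constructor <;> omega

/-! ### Heap-ordered search trees -/

section Heap
variable {K : Type*} [LinearOrder K] {h tb : ℕ} {T ND : ℕ → Val} {κ : ℕ → K} {ix : ℕ → ℕ}
  {S : Set ℕ}

/-- The columns `T` (point stored at a node) and `ND` (node of a point) describe a priority search
tree with the set `S` of points, heap ordered by `κ`, where `ix` is the leaf of a point; at `hole`
the order may be violated (`hole = 0`: nowhere). -/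
structure HeapH (h tb : ℕ) (T ND : ℕ → Val) (κ : ℕ → K) (ix : ℕ → ℕ) (S : Set ℕ) (hole : ℕ) :
    Prop where
  kind : ∀ k e, IsNode h k e → T (tb + k) = .nil ∨
    ∃ p ∈ S, T (tb + k) = .ptr p ∧ ND p = .ptr (tb + k) ∧ Covers h k e (ix p)
  ord : ∀ k, 1 ≤ k → k < 2 ^ h → k ≠ hole → ∀ c, c = 2 * k ∨ c = 2 * k + 1 →
    ∀ q, T (tb + c) = .ptr q → ∃ p, T (tb + k) = .ptr p ∧ κ p ≤ κ q
  bridge : ∀ c, c = 2 * hole ∨ c = 2 * hole + 1 → hole < 2 ^ h → 2 ≤ hole →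
    ∀ q, T (tb + c) = .ptr q → ∃ p, T (tb + hole / 2) = .ptr p ∧ κ p ≤ κ q
  mem : ∀ p ∈ S, ∃ k e, IsNode h k e ∧ T (tb + k) = .ptr p

abbrev Heap (h tb : ℕ) (T ND : ℕ → Val) (κ : ℕ → K) (ix : ℕ → ℕ) (S : Set ℕ) : Prop :=
  HeapH h tb T ND κ ix S 0

theorem HeapH.at {hole : ℕ} (H : HeapH h tb T ND κ ix S hole) {k e p : ℕ} (hk : IsNode h k e)
    (hp : T (tb + k) = .ptr p) : p ∈ S ∧ ND p = .ptr (tb + k) ∧ Covers h k e (ix p) := by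
  rcases H.kind k e hk with h1 | ⟨q, hq, h1, h2, h3⟩
  · rw [hp] at h1; cases h1
  · rw [hp] at h1; cases h1; exact ⟨hq, h2, h3⟩

/-- The back pointer `ND` of a point has a single value, so a point is stored at one node only. -/
theorem HeapH.inj {hole : ℕ} (H : HeapH h tb T ND κ ix S hole) {k e k' e' p : ℕ}
    (hk : IsNode h k e) (hk' : IsNode h k' e') (hp : T (tb + k) = .ptr p)
    (hp' : T (tb + k') = .ptr p) : k = k' := by
  have h1 := (H.at hk hp).2.1
  rw [(H.at hk' hp').2.1, Val.ptr.injEq] at h1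
  omega

theorem heap_empty (hT : ∀ k e, IsNode h k e → T (tb + k) = .nil) : Heap h tb T ND κ ix ∅ := by
  refine ⟨fun k e hk => .inl (hT k e hk), ?_, fun _ _ _ h2 => by omega, fun p hp => hp.elim⟩
  intro k h1 h2 _ c hc q hq
  obtain ⟨e, he⟩ := exists_height (h := h) (k := c) (by omega) (by omega)
  rw [hT c e he] at hq
  cases hq

/-- Follow the heap order upwards. In particular every node on the way is occupied, and an empty
root means an empty heap. -/
theorem HeapH.le_root (H : Heap h tb T ND κ ix S) : ∀ {k e q : ℕ}, IsNode h k e →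
    T (tb + k) = .ptr q → ∃ p, T (tb + 1) = .ptr p ∧ κ p ≤ κ q := by
  intro k
  induction k using Nat.strong_induction_on with
  | _ k ih =>
    intro e q hk hq
    rcases Nat.lt_or_ge k 2 with h2 | h2
    · have := hk.pos
      obtain rfl : k = 1 := by omega
      exact ⟨q, hq, le_rfl⟩
    · have hp := hk.parent h2
      obtain ⟨p, hp1, hp2⟩ := H.ord (k / 2) hp.pos hp.internal (by have := hp.pos; omega) k (by omega)
        q hq
      obtain ⟨r, hr1, hr2⟩ := ih (k / 2) (by omega) hp hp1
      exact ⟨r, hr1, hr2.trans hp2⟩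

/-- Heap order involves only the stored points. Hence the key of a point may be changed while it is
out of the heap, which is how keys are updated. -/
theorem HeapH.congr {κ' : ℕ → K} {hole : ℕ} (H : HeapH h tb T ND κ ix S hole)
    (hκ : ∀ p ∈ S, κ' p = κ p) : HeapH h tb T ND κ' ix S hole := by
  have key : ∀ c, 1 ≤ c → c < 2 * 2 ^ h → ∀ q, T (tb + c) = .ptr q → κ' q = κ q := by
    intro c h1 h2 q hq
    obtain ⟨e, he⟩ := exists_height h1 h2
    exact hκ q (H.at he hq).1
  refine ⟨H.kind, ?_, ?_, H.mem⟩
  · intro k h1 h2 h3 c hc q hq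
    obtain ⟨p, hp, hle⟩ := H.ord k h1 h2 h3 c hc q hq
    exact ⟨p, hp, by rw [key c (by omega) (by omega) q hq, key k h1 (by omega) p hp]; exact hle⟩
  · intro c hc h1 h2 q hq
    obtain ⟨p, hp, hle⟩ := H.bridge c hc h1 h2 q hq
    refine ⟨p, hp, ?_⟩
    rw [key c (by omega) (by omega) q hq, key (hole / 2) (by omega) (by omega) p hp]; exact hle

/-- The point `p` may be put at node `k` as far as the parent of `k` is concerned. -/
def ParentOK (tb : ℕ) (T : ℕ → Val) (κ : ℕ → K) (k p : ℕ) : Prop :=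
  k = 1 ∨ ∃ r, T (tb + k / 2) = .ptr r ∧ κ r ≤ κ p

/-- Storing a carried point at a node, where it takes the place of nothing or of a point with a
larger key. -/
theorem HeapH.place (H : Heap h tb T ND κ ix S) {k e p : ℕ} (hk : IsNode h k e) (hp : p ∉ S)
    (hc : Covers h k e (ix p)) (hpar : ParentOK tb T κ k p)
    (hT : ∀ q, T (tb + k) = .ptr q → κ p ≤ κ q) :
    Heap h tb (Function.update T (tb + k) (.ptr p)) (Function.update ND p (.ptr (tb + k))) κ ix
      (insert p (S \ {q | T (tb + k) = .ptr q})) := by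
  refine ⟨?_, ?_, fun _ _ _ h2 => by omega, ?_⟩
  · intro j d hj
    by_cases hjk : j = k
    · subst hjk
      obtain rfl := hk.unique hj
      exact .inr ⟨p, Set.mem_insert _ _, by simp, by simp, hc⟩
    · rcases H.kind j d hj with h1 | ⟨q, hq, h1, h2, h3⟩
      · left; rw [Function.update_of_ne (by omega)]; exact h1
      · right
        have hqp : q ≠ p := fun hh => hp (hh ▸ hq)
        refine ⟨q, Set.mem_insert_of_mem _ ⟨hq, fun hh => ?_⟩, ?_, ?_, h3⟩
        · exact hjk (H.inj hj hk h1 hh)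
        · rw [Function.update_of_ne (by omega)]; exact h1
        · rw [Function.update_of_ne hqp]; exact h2
  · intro j h1 h2 h3 c hcj q hq
    by_cases hck : c = k
    · subst hck
      rw [Function.update_self, Val.ptr.injEq] at hq
      subst hq
      rcases hpar with hh | ⟨r, hr1, hr2⟩
      · omega
      · rw [show c / 2 = j by omega] at hr1
        exact ⟨r, by rw [Function.update_of_ne (by omega)]; exact hr1, hr2⟩
    · rw [Function.update_of_ne (by omega)] at hq
      obtain ⟨r, hr1, hr2⟩ := H.ord j h1 h2 h3 c hcj q hq
      by_cases hjk : j = k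
      · subst hjk
        exact ⟨p, by simp, (hT r hr1).trans hr2⟩
      · exact ⟨r, by rw [Function.update_of_ne (by omega)]; exact hr1, hr2⟩
  · rintro q (rfl | ⟨hq, hqk⟩)
    · exact ⟨k, e, hk, by simp⟩
    · obtain ⟨j, d, hj, hjq⟩ := H.mem q hq
      refine ⟨j, d, hj, ?_⟩
      rw [Function.update_of_ne]
      · exact hjq
      · intro hh
        obtain rfl : j = k := by omega
        exact hqk hjq

/-- Removing a point makes a hole. -/
theorem HeapH.remove (H : Heap h tb T ND κ ix S) {k e p : ℕ} (hk : IsNode h k e)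
    (hp : T (tb + k) = .ptr p) :
    HeapH h tb (Function.update T (tb + k) .nil) ND κ ix (S \ {p}) k := by
  have hk1 := hk.pos
  refine ⟨?_, ?_, ?_, ?_⟩
  · intro j d hj
    by_cases hjk : j = k
    · subst hjk; simp
    · rw [Function.update_of_ne (by omega)]
      rcases H.kind j d hj with h1 | ⟨q, hq, h1, h2, h3⟩
      · exact .inl h1
      · refine .inr ⟨q, ⟨hq, ?_⟩, h1, h2, h3⟩
        rintro rfl
        exact hjk (H.inj hj hk h1 hp)
  · intro j h1 h2 h3 c hcj q hq
    rw [Function.update_of_ne (by omega)]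
    rw [Function.update_apply] at hq
    split_ifs at hq
    exact H.ord j h1 h2 (by omega) c hcj q hq
  · intro c hc h1 h2 q hq
    rw [Function.update_of_ne (by omega)] at hq ⊢
    obtain ⟨r, hr1, hr2⟩ := H.ord k hk1 h1 (by omega) c hc q hq
    obtain ⟨r', h3, h4⟩ := H.ord (k / 2) (by omega) (by omega) (by omega) k (by omega) r hr1
    exact ⟨r', h3, h4.trans hr2⟩
  · rintro q ⟨hq, hqp⟩
    obtain ⟨j, d, hj, hjq⟩ := H.mem q hq
    refine ⟨j, d, hj, ?_⟩
    rw [Function.update_of_ne]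
    · exact hjq
    · intro hh
      obtain rfl : j = k := by omega
      rw [hp] at hjq
      exact hqp (Val.ptr.inj hjq).symm

/-- A hole without points below it is merely an empty node, so the order holds everywhere again. -/
theorem HeapH.fill {k e : ℕ} (H : HeapH h tb (Function.update T (tb + k) .nil) ND κ ix S k)
    (hk : IsNode h k e) (hch : ∀ c, c = 2 * k ∨ c = 2 * k + 1 → k < 2 ^ h → T (tb + c) = .nil) :
    Heap h tb (Function.update T (tb + k) .nil) ND κ ix S := by
  refine ⟨H.kind, ?_, fun _ _ _ h2 => by omega, H.mem⟩
  intro j h1 h2 h3 c hcj q hq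
  by_cases hjk : j = k
  · subst hjk
    rw [Function.update_of_ne (by omega), hch c hcj h2] at hq
    cases hq
  · exact H.ord j h1 h2 hjk c hcj q hq

/-- The hole moves from a node to one of its children: the smaller of the points at the children
moves up. It may stand below the parent of the old hole by `bridge`, and the new `bridge` holds
because the points below the new hole were ordered after the point that moved up. -/
theorem HeapH.pull {k e c c' q : ℕ}
    (H : HeapH h tb (Function.update T (tb + k) .nil) ND κ ix S k)
    (hk : IsNode h k (e + 1)) (hc : c = 2 * k ∧ c' = 2 * k + 1 ∨ c' = 2 * k ∧ c = 2 * k + 1)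
    (hq : T (tb + c) = .ptr q) (hq' : ∀ r, T (tb + c') = .ptr r → κ q ≤ κ r) :
    HeapH h tb (Function.update (Function.update T (tb + k) (.ptr q)) (tb + c) .nil)
      (Function.update ND q (.ptr (tb + k))) κ ix S c := by
  have hk1 := hk.pos
  have hkh := hk.internal
  have hcn : IsNode h c e := by
    rcases hc with ⟨rfl, _⟩ | ⟨_, rfl⟩
    · exact hk.left
    · exact hk.right
  have hq1 : Function.update T (tb + k) .nil (tb + c) = .ptr q := by
    rw [Function.update_of_ne (by omega)]; exact hq
  have hqS := H.at hcn hq1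
  refine ⟨?_, ?_, ?_, ?_⟩
  · intro j d hj
    by_cases hjc : j = c
    · subst hjc; simp
    by_cases hjk : j = k
    · subst hjk
      obtain rfl := hk.unique hj
      rw [Function.update_of_ne (by omega)]
      refine .inr ⟨q, hqS.1, by simp, by simp, ?_⟩
      rcases hc with ⟨rfl, _⟩ | ⟨_, rfl⟩
      · exact Covers.left hk hqS.2.2
      · exact Covers.right hk hqS.2.2
    · rcases H.kind j d hj with h1 | ⟨r, hr, h1, h2, h3⟩
      · left
        rw [Function.update_of_ne (by omega)] at h1
        rw [Function.update_of_ne (by omega), Function.update_of_ne (by omega)]; exact h1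
      · have hrq : r ≠ q := by
          rintro rfl
          exact hjc (H.inj hj hcn h1 hq1)
        rw [Function.update_of_ne (by omega)] at h1
        refine .inr ⟨r, hr, ?_, ?_, h3⟩
        · rw [Function.update_of_ne (by omega), Function.update_of_ne (by omega)]; exact h1
        · rw [Function.update_of_ne hrq]; exact h2
  · intro j h1 h2 h3 d hdj r hr
    rw [Function.update_of_ne (by omega : tb + j ≠ tb + c)]
    rw [Function.update_apply] at hr
    split_ifs at hr with hdc
    by_cases hjk : j = k
    · subst hjk
      rw [Function.update_of_ne (by omega)] at hr
      obtain rfl : d = c' := by omega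
      exact ⟨q, by simp, hq' r hr⟩
    · rw [Function.update_of_ne (by omega : tb + j ≠ tb + k)]
      by_cases hdk : d = k
      · subst hdk
        rw [Function.update_self, Val.ptr.injEq] at hr
        subst hr
        -- Here `d` is the old hole and `j` its parent: the only place where the order across the
        -- hole is needed.
        obtain ⟨p, hp1, hp2⟩ := H.bridge c (by omega) hkh (by omega) q hq1
        rw [Function.update_of_ne (by omega), show d / 2 = j by omega] at hp1
        exact ⟨p, hp1, hp2⟩
      · rw [Function.update_of_ne (by omega)] at hr
        have := H.ord j h1 h2 hjk d hdj r (by rw [Function.update_of_ne (by omega)]; exact hr)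
        rwa [Function.update_of_ne (by omega)] at this
  · intro d hd h1 h2 r hr
    rw [Function.update_of_ne (by omega), Function.update_of_ne (by omega)] at hr
    rw [show c / 2 = k by omega, Function.update_of_ne (by omega), Function.update_self]
    obtain ⟨p, hp1, hp2⟩ := H.ord c (by omega) h1 (by omega) d hd r
      (by rw [Function.update_of_ne (by omega)]; exact hr)
    rw [hq1, Val.ptr.injEq] at hp1
    subst hp1
    exact ⟨q, rfl, hp2⟩
  · intro r hr
    obtain ⟨j, d, hj, hjr⟩ := H.mem r hr
    have hjk : j ≠ k := by rintro rfl; simp at hjr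
    rw [Function.update_of_ne (by omega)] at hjr
    by_cases hjc : j = c
    · subst hjc
      rw [hq, Val.ptr.injEq] at hjr
      subst hjr
      refine ⟨k, e + 1, hk, ?_⟩
      rw [Function.update_of_ne (by omega), Function.update_self]
    · refine ⟨j, d, hj, ?_⟩
      rw [Function.update_of_ne (by omega), Function.update_of_ne (by omega)]; exact hjr

end Heap

/-! ### Comparison of points by two fields -/

/-- Embeds coordinates, integers and colours into one ordered type, so that all heaps have keys in
`ℝ ×ₗ ℝ`. The embedding is faithful on values of the same kind, the only ones compared. -/
def Val.toReal : Val → ℝ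
  | .num k => k
  | .coord x => x
  | .color c => c
  | _ => 0

theorem Val.Cmp.eq_iff {v w : Val} (h : v.Cmp w) : v = w ↔ v.toReal = w.toReal := by
  cases v <;> cases w <;> simp_all [Val.Cmp, Val.toReal]

theorem Val.Cmp.lt_iff {v w : Val} (h : v.Cmp w) : v.Lt w ↔ v.toReal < w.toReal := by
  cases v <;> cases w <;> simp_all [Val.Cmp, Val.toReal, Val.Lt]

/-- The sorting key of a point: the values in two columns, ordered lexicographically. -/
noncomputable def keyOf (c₁ c₂ : ℕ → Val) (p : ℕ) : ℝ ×ₗ ℝ := toLex ((c₁ p).toReal, (c₂ p).toReal)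

/-- Test whether the point in register `a` has a smaller key than that in register `b`. -/
def ifLess (a b k₁ k₂ : ℕ) (p q : Program) : Program :=
  ld 46 a k₁ ;; ld 47 b k₁ ;; ifEq 46 47 (ld 46 a k₂ ;; ld 47 b k₂) .skip ;; ifLt 46 47 p q

@[simp] theorem wf_ifLess (a b k₁ k₂ f : ℕ) (p q : Program) :
    wf (ifLess a b k₁ k₂ p q) f = (wf p f || wf q f) := by simp [ifLess]

/-- The state after a comparison as far as it matters: registers 46 and 47 are scratch and some time
has passed, whichever component decided. -/
def M.cmp (s : M) (v w : Val) (t : ℕ) : M :=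
  { s with reg := Function.update (Function.update s.reg 46 v) 47 w, time := s.time + t }

section
variable (s : M) (v w : Val) (t i : ℕ)
@[simp] theorem M.cmp_reg :
    (s.cmp v w t).reg i = if i = 47 then w else if i = 46 then v else s.reg i := by
  simp [M.cmp, Function.update_apply]
@[simp] theorem M.cmp_mem : (s.cmp v w t).mem = s.mem := rfl
@[simp] theorem M.cmp_fresh : (s.cmp v w t).fresh = s.fresh := rfl
@[simp] theorem M.cmp_out : (s.cmp v w t).out = s.out := rfl
@[simp] theorem M.cmp_time : (s.cmp v w t).time = s.time + t := rfl
end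

theorem wp_ifLess {B a b k₁ k₂ p q : ℕ} {P P' : Program} {s : M} {Q : M → Prop}
    (ha : s.reg a = .ptr p) (hb : s.reg b = .ptr q) (ha' : a ≠ 46 ∧ a ≠ 47) (hb' : b ≠ 46 ∧ b ≠ 47)
    (hp : p < s.fresh) (hq : q < s.fresh) (c₁ : (s.mem k₁ p).Cmp (s.mem k₁ q))
    (c₂ : (s.mem k₂ p).Cmp (s.mem k₂ q))
    (h₁ : ∀ v w t, t ≤ 6 → keyOf (s.mem k₁) (s.mem k₂) p < keyOf (s.mem k₁) (s.mem k₂) q →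
      wp B P (s.cmp v w t) Q)
    (h₂ : ∀ v w t, t ≤ 6 → keyOf (s.mem k₁) (s.mem k₂) q ≤ keyOf (s.mem k₁) (s.mem k₂) p →
      wp B P' (s.cmp v w t) Q) : wp B (ifLess a b k₁ k₂ P P') s Q := by
  have e1 : (((s.set 46 (s.mem k₁ p)).set 47 (s.mem k₁ q)).tick).tick =
      s.cmp (s.mem k₁ p) (s.mem k₁ q) 4 := rfl
  have e2 : ((((s.set 46 (s.mem k₁ p)).set 47 (s.mem k₁ q)).tick.set 46 (s.mem k₂ p)).set 47
      (s.mem k₂ q)).tick = s.cmp (s.mem k₂ p) (s.mem k₂ q) 6 := by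
    simp only [M.set, M.tick, M.cmp, M.mk.injEq, and_true, true_and]
    funext i
    simp only [Function.update_apply]
    split_ifs <;> rfl
  have h47 : b ≠ 46 := hb'.1
  have hlex : ∀ x y, keyOf (s.mem k₁) (s.mem k₂) x < keyOf (s.mem k₁) (s.mem k₂) y ↔
      (s.mem k₁ x).toReal < (s.mem k₁ y).toReal ∨ ((s.mem k₁ x).toReal = (s.mem k₁ y).toReal ∧
        (s.mem k₂ x).toReal < (s.mem k₂ y).toReal) := fun x y => by
    simp [keyOf, Prod.Lex.toLex_lt_toLex]
  simp only [ifLess, wp_seq, wp_ld, ha, hb, Val.ptr.injEq, exists_eq_left', M.set_fresh, hp, hq,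
    true_and, M.set_reg, M.set_mem, ha', hb', if_false, wp_ifEq, M.tick_reg, M.tick_fresh,
    M.tick_mem, wp_skip, wp_ifLt, if_true, show (46 : ℕ) ≠ 47 by decide]
  rw [e1, e2]
  refine ⟨fun he => ⟨c₂, fun hl => h₁ _ _ _ le_rfl ?_, fun hl => h₂ _ _ _ le_rfl ?_⟩,
    fun he => ⟨c₁, fun hl => h₁ _ _ _ (by norm_num) ?_, fun hl => h₂ _ _ _ (by norm_num) ?_⟩⟩
  · exact (hlex _ _).2 (.inr ⟨c₁.eq_iff.1 he, c₂.lt_iff.1 hl⟩)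
  · rw [← not_lt, hlex]
    rintro (hh | ⟨_, hh⟩)
    · exact absurd (c₁.eq_iff.1 he) hh.ne
    · exact hl (c₂.lt_iff.2 hh)
  · exact (hlex _ _).2 (.inl (c₁.lt_iff.1 hl))
  · rw [← not_lt, hlex]
    rintro (hh | ⟨hh, _⟩)
    · exact hl (c₁.lt_iff.2 hh)
    · exact he (c₁.eq_iff.2 hh)

/-! ### The tree in memory -/

/-- The tree with root in register 8 and node `k` at address `tb + k`: fields 30 (left child),
31 (next node in preorder after the subtree), 33 (last leaf below). -/
structure TreeS (h tb : ℕ) (s : M) : Prop where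
  root : s.reg 8 = .ptr (tb + 1)
  fresh : tb + 2 * 2 ^ h ≤ s.fresh
  child : ∀ k, 1 ≤ k → k < 2 ^ h → s.mem 30 (tb + k) = .ptr (tb + 2 * k)
  leaf : ∀ k, 2 ^ h ≤ k → k < 2 * 2 ^ h → s.mem 30 (tb + k) = .nil
  skip0 : s.mem 31 (tb + 1) = .nil
  skipL : ∀ k, 1 ≤ k → k < 2 ^ h → s.mem 31 (tb + 2 * k) = .ptr (tb + (2 * k + 1))
  skipR : ∀ k, 1 ≤ k → k < 2 ^ h → s.mem 31 (tb + (2 * k + 1)) = s.mem 31 (tb + k)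
  hi : ∀ k e, IsNode h k e → s.mem 33 (tb + k) = .num (hiOf h k e)

theorem TreeS.of {h tb : ℕ} {s s' : M} (H : TreeS h tb s) (h8 : s'.reg 8 = s.reg 8)
    (h30 : s'.mem 30 = s.mem 30) (h31 : s'.mem 31 = s.mem 31) (h33 : s'.mem 33 = s.mem 33)
    (hle : s.fresh ≤ s'.fresh) : TreeS h tb s' := by
  obtain ⟨a1, a2, a3, a4, a5, a6, a7, a8⟩ := H
  refine ⟨?_, a2.trans hle, ?_, ?_, ?_, ?_, ?_, ?_⟩
  · rwa [h8]
  · rwa [h30]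
  · rwa [h30]
  · rwa [h31]
  · rwa [h31]
  · rwa [h31]
  · rwa [h33]

/-- The fields used by a heap: two key fields, the leaf number, and the fields in which a node
refers to its point and a point to its node. -/
structure HP where
  k₁ : ℕ
  k₂ : ℕ
  ix : ℕ
  T : ℕ
  ND : ℕ

/-- Heap operations write the fields `T` and `ND` only. These must not be fields of the tree or
fields that the operations read. -/
structure HP.OK (P : HP) : Prop where
  T30 : P.T ≠ 30
  T31 : P.T ≠ 31
  T33 : P.T ≠ 33
  N30 : P.ND ≠ 30
  N31 : P.ND ≠ 31
  N33 : P.ND ≠ 33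
  Tk₁ : P.T ≠ P.k₁
  Tk₂ : P.T ≠ P.k₂
  Ti : P.T ≠ P.ix
  Nk₁ : P.ND ≠ P.k₁
  Nk₂ : P.ND ≠ P.k₂
  Ni : P.ND ≠ P.ix
  TN : P.T ≠ P.ND

noncomputable abbrev HP.key (P : HP) (s : M) : ℕ → ℝ ×ₗ ℝ := keyOf (s.mem P.k₁) (s.mem P.k₂)

/-- The points `0, …, n - 1` have comparable keys and different leaf numbers. -/
structure Pts (P : HP) (h n : ℕ) (ix : ℕ → ℕ) (s : M) : Prop where
  ixc : ∀ p < n, s.mem P.ix p = .num (ix p)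
  inj : ∀ p < n, ∀ q < n, ix p = ix q → p = q
  rng : ∀ p < n, 1 ≤ ix p ∧ ix p ≤ 2 ^ h
  c₁ : ∀ p < n, ∀ q < n, (s.mem P.k₁ p).Cmp (s.mem P.k₁ q)
  c₂ : ∀ p < n, ∀ q < n, (s.mem P.k₂ p).Cmp (s.mem P.k₂ q)
  fr : n ≤ s.fresh

theorem Pts.of {P : HP} {h n : ℕ} {ix : ℕ → ℕ} {s s' : M} (H : Pts P h n ix s)
    (hi : s'.mem P.ix = s.mem P.ix) (h₁ : s'.mem P.k₁ = s.mem P.k₁)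
    (h₂ : s'.mem P.k₂ = s.mem P.k₂) (hle : s.fresh ≤ s'.fresh) : Pts P h n ix s' := by
  obtain ⟨a1, a2, a3, a4, a5, a6⟩ := H
  exact ⟨by rwa [hi], a2, a3, by rwa [h₁], by rwa [h₂], a6.trans hle⟩

/-- The points of `S` are stored in the heap. -/
structure HeapS (P : HP) (h tb n : ℕ) (ix : ℕ → ℕ) (S : Set ℕ) (s : M) : Prop where
  heap : Heap h tb (s.mem P.T) (s.mem P.ND) (P.key s) ix S
  sub : ∀ p ∈ S, p < n

/-! ### Insertion into and deletion from a priority search tree -/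

/-- Insert the point in register 40. -/
def Ins (P : HP) : Program :=
  mv 41 8 ;; ld 42 40 P.ix ;;
  whileNN 40 (ld 43 41 33 ;;
    ifLt 43 42 (ld 41 41 31)
      (ld 44 41 P.T ;; nl 45 ;;
       ifEq 44 45 (st 41 P.T 40 ;; st 40 P.ND 41 ;; nl 40)
        (ifLess 40 44 P.k₁ P.k₂ (st 41 P.T 40 ;; st 40 P.ND 41 ;; mv 40 44 ;; ld 42 40 P.ix) .skip ;;
         ld 41 41 30)))

@[simp] theorem wf_Ins (P : HP) (f : ℕ) : wf (Ins P) f = (f == P.T || f == P.ND) := by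
  simp only [Ins, wf_seq, wf_mv, wf_ld, wf_st, wf_nl, wf_ifLess, wf_ifEq, wf_ifLt, wf_whileNN,
    wf_skip]
  cases f == P.T <;> cases f == P.ND <;> rfl

/-- Position of a point carried down the tree. -/
def Down (h k e i : ℕ) (μ : ℕ) : Prop :=
  IsNode h k e ∧ (Covers h k e i ∧ μ = 2 * e + 1 ∨
    ∃ j, k = 2 * j ∧ IsNode h j (e + 1) ∧ Covers h (k + 1) e i ∧ μ = 2 * e + 2)

/-- There is no link to a right child. A descent steps to the left child and, if the leaf lies
beyond it, on to the sibling along the preorder link. The measure is 2e + 1 at a node above the leaf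
and 2e + 2 at a left child whose sibling is above the leaf, so it drops in every step and a level
costs at most two. -/
theorem Down.skip {h k e i μ : ℕ} (hd : Down h k e i μ) (hi : hiOf h k e < i) :
    ∃ j, k = 2 * j ∧ 1 ≤ j ∧ j < 2 ^ h ∧ Down h (2 * j + 1) e i (μ - 1) ∧ μ - 1 < μ := by
  obtain ⟨hn, ⟨hc, _⟩ | ⟨j, rfl, hj, hc, rfl⟩⟩ := hd
  · have := hc.2; omega
  · exact ⟨j, rfl, hj.pos, hj.internal, ⟨hj.right, .inl ⟨hc, rfl⟩⟩, by omega⟩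

theorem Down.covers {h k e i μ : ℕ} (hd : Down h k e i μ) (hi : ¬ hiOf h k e < i) :
    Covers h k e i ∧ μ = 2 * e + 1 := by
  obtain ⟨hn, hc | ⟨j, rfl, hj, hc, rfl⟩⟩ := hd
  · exact hc
  · have := hc.1
    rw [← hiOf_left] at this
    omega

theorem Down.child {h k e i : ℕ} (hn : IsNode h k (e + 1)) (hc : Covers h k (e + 1) i) :
    ∃ μ < 2 * (e + 1) + 1, Down h (2 * k) e i μ := by
  rcases hc.child with h1 | h1
  · exact ⟨2 * e + 1, by omega, hn.left, .inl ⟨h1, rfl⟩⟩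
  · exact ⟨2 * e + 2, by omega, hn.left, .inr ⟨k, rfl, hn, h1, rfl⟩⟩

theorem HeapS.of {P : HP} {h tb n : ℕ} {ix : ℕ → ℕ} {S : Set ℕ} {s s' : M}
    (H : HeapS P h tb n ix S s) (hT : s'.mem P.T = s.mem P.T) (hN : s'.mem P.ND = s.mem P.ND)
    (h₁ : s'.mem P.k₁ = s.mem P.k₁) (h₂ : s'.mem P.k₂ = s.mem P.k₂) :
    HeapS P h tb n ix S s' := by
  obtain ⟨a, b⟩ := H
  exact ⟨by rwa [HP.key, hT, hN, h₁, h₂], b⟩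

/-- A point is carried towards its leaf; at each node the point with the smaller key stays and the
other is carried on. The invariant is that the stored set together with the carried point is `insert
p S`, and that the carried point fits below the parent of the current node. -/
theorem Ins_spec {B : ℕ} {P : HP} {h tb n : ℕ} {ix : ℕ → ℕ} {S : Set ℕ} {s : M} {p : ℕ}
    (hP : P.OK) (ht : TreeS h tb s) (hpts : Pts P h n ix s) (H : HeapS P h tb n ix S s)
    (hp : p < n) (hpS : p ∉ S) (h40 : s.reg 40 = .ptr p) :
    wp B (Ins P) s fun s' => HeapS P h tb n ix (insert p S) s' ∧
      s'.time ≤ s.time + 80 * (h + 1) := by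
  have hpf : p < s.fresh := hp.trans_le hpts.fr
  simp only [Ins, wp_seq, wp_mv, wp_ld, M.set_reg, h40, Val.ptr.injEq, exists_eq_left',
    M.set_fresh, M.set_mem, hpf, true_and, hpts.ixc p hp, ht.root, if_false,
    show (40 : ℕ) ≠ 41 by decide]
  refine wp_while (fun μ s' => s'.time + 30 * μ ≤ s.time + 80 * h + 70 ∧
    ((s'.reg 40 = .nil ∧ HeapS P h tb n ix (insert p S) s') ∨
    ∃ c k e S', s'.reg 40 = .ptr c ∧ s'.reg 41 = .ptr (tb + k) ∧ s'.reg 42 = .num (ix c) ∧ c < n ∧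
      c ∉ S' ∧ insert c S' = insert p S ∧ HeapS P h tb n ix S' s' ∧
      ParentOK tb (s'.mem P.T) (P.key s') k c ∧ Down h k e (ix c) μ)) (2 * h + 1) (by decide)
      ?_ ?_ ?_
  · refine ⟨?_, .inr ⟨p, 1, h, S, ?_, ?_, ?_, hp, hpS, rfl, H.of rfl rfl rfl rfl, .inl rfl,
      isNode_root h, .inl ⟨covers_root (hpts.rng p hp).1 (hpts.rng p hp).2, rfl⟩⟩⟩ <;> simp [h40]
    omega
  · rintro μ s' hf ⟨htime, ⟨h1, _⟩ | ⟨c, k, e, S', h40, h41, h42, hc, hcS, hins, HS, hpar, hd⟩⟩ hne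
    · exact absurd h1 hne
    have f30 : s'.mem 30 = s.mem 30 := hf.mem 30 (by simp [hP.T30.symm, hP.N30.symm])
    have f31 : s'.mem 31 = s.mem 31 := hf.mem 31 (by simp [hP.T31.symm, hP.N31.symm])
    have f33 : s'.mem 33 = s.mem 33 := hf.mem 33 (by simp [hP.T33.symm, hP.N33.symm])
    have fi : s'.mem P.ix = s.mem P.ix := hf.mem P.ix (by simp [hP.Ti.symm, hP.Ni.symm])
    have fk1 : s'.mem P.k₁ = s.mem P.k₁ := hf.mem P.k₁ (by simp [hP.Tk₁.symm, hP.Nk₁.symm])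
    have fk2 : s'.mem P.k₂ = s.mem P.k₂ := hf.mem P.k₂ (by simp [hP.Tk₂.symm, hP.Nk₂.symm])
    have ff : s'.fresh = s.fresh := hf.fresh (by rfl)
    have ht' : TreeS h tb s' := ht.of (hf.reg 8 (by rfl)) f30 f31 f33 ff.ge
    have hpts' : Pts P h n ix s' := hpts.of fi fk1 fk2 ff.ge
    have hn := hd.1
    have hkf : tb + k < s'.fresh := by have := hn.lt; have := ht'.fresh; omega
    have hcf : c < s'.fresh := hc.trans_le hpts'.fr
    refine wp.abs fun R hR => ?_
    simp [h41, h42, hkf, ht'.hi k e hn]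
    refine ⟨fun hlt => ?_, fun hlt => ?_⟩
    · obtain ⟨j, rfl, hj1, hj2, hd', hμ⟩ := hd.skip hlt
      simp only [hR]
      refine ⟨μ - 1, hμ, by simp; omega, .inr ⟨c, 2 * j + 1, e, S', by simpa using h40, ?_,
        by simpa using h42, hc, hcS, hins, HS.of rfl rfl rfl rfl, ?_, hd'⟩⟩
      · simpa using ht'.skipL j hj1 hj2
      · rcases hpar with hh | hh
        · omega
        · right
          rw [show 2 * j / 2 = j by omega] at hh
          rw [show (2 * j + 1) / 2 = j by omega]
          exact hh
    · obtain ⟨hcov, rfl⟩ := hd.covers (by omega)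
      have hTf : ∀ q, s'.mem P.T (tb + k) = .ptr q → q < s'.fresh ∧ q < n ∧ q ∈ S' := fun q hq =>
        have := (HS.heap.at hn hq).1
        ⟨(HS.sub q this).trans_le hpts'.fr, HS.sub q this, this⟩
      have hfr := hpts'.ixc
      have plc := HS.heap.place hn hcS hcov (by
        rcases hd.2 with h1 | ⟨j, rfl, _⟩ <;> exact hpar)
      rcases HS.heap.kind k e hn with hnil | ⟨q, hq, hTq, _, hcq⟩
      · simp [hnil, h40, h41, hkf, hcf, hP.TN, hP.TN.symm]
        simp only [hR]
        refine ⟨0, by omega, by simp; omega, .inl ⟨by simp, ?_, ?_⟩⟩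
        · have := plc (by simp [hnil])
          simp only [hnil, reduceCtorEq, Set.ofPred_false, Set.sdiff_empty, hins] at this
          simpa [HP.key, hP.TN, hP.TN.symm, hP.Tk₁.symm, hP.Tk₂.symm, hP.Nk₁.symm, hP.Nk₂.symm,
            fk1, fk2] using this
        · rw [← hins]
          rintro x (rfl | hx)
          · exact hc
          · exact HS.sub x hx
      · obtain ⟨hqf, hqn, -⟩ := hTf q hTq
        have hcq' : c ≠ q := fun hh => hcS (hh ▸ hq)
        -- An occupied leaf cannot be met: its point and the carried point would have the same leaf
        -- number and hence be equal.
        have he : ∃ e', e = e' + 1 := by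
          rcases e with _ | e
          · refine absurd (hpts.inj c hc q hqn ?_) hcq'
            have h1 := hn.covers_leaf hcov
            have h2 := hn.covers_leaf hcq
            have := (hpts.rng c hc).1
            have := (hpts.rng q hqn).1
            have := Nat.two_pow_pos h
            omega
          · exact ⟨e, rfl⟩
        obtain ⟨e, rfl⟩ := he
        have hki := hn.internal
        have hk1 := hn.pos
        simp [hTq]
        refine wp_ifLess (p := c) (q := q) (by simp [h40]) (by simp) (by decide) (by decide)
          (by simpa) (by simpa) (hpts'.c₁ c hc q hqn) (hpts'.c₂ c hc q hqn) ?_ ?_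
        · intro v w t ht6 hlt
          simp [h40, h41, hkf, hcf, hqf, hP.TN, hP.TN.symm, hP.T30.symm, hP.N30.symm,
            ht'.child k hk1 hki]
          simp only [hR]
          obtain ⟨μ, hμ, hdn⟩ := Down.child (i := ix q) hn hcq
          refine ⟨μ, hμ, by simp; omega, .inr ⟨q, 2 * k, e, insert c (S' \ {q}), by simp, by simp,
            ?_, hqn, ?_, ?_, ⟨?_, ?_⟩, ?_, hdn⟩⟩
          · simpa [hP.Ti.symm, hP.Ni.symm] using hpts'.ixc q hqn
          · simp [hcq'.symm]
          · rw [Set.insert_comm, Set.insert_sdiff_singleton, Set.insert_eq_of_mem hq, hins]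
          · have := plc (by
              simp only [hTq, Val.ptr.injEq]; rintro _ rfl; exact hlt.le)
            simp only [hTq, Val.ptr.injEq, Set.ofPred_eq_eq_singleton'] at this
            simpa [HP.key, hP.TN, hP.TN.symm, hP.Tk₁.symm, hP.Tk₂.symm, hP.Nk₁.symm, hP.Nk₂.symm]
              using this
          · rintro x (rfl | hx)
            · exact hc
            · exact HS.sub x hx.1
          · right
            refine ⟨c, ?_, ?_⟩
            · simp [hP.TN]
            · simpa [HP.key, hP.Tk₁.symm, hP.Tk₂.symm, hP.Nk₁.symm, hP.Nk₂.symm] using hlt.le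
        · intro v w t ht6 hle
          simp [h40, h41, hkf, ht'.child k hk1 hki]
          simp only [hR]
          obtain ⟨μ, hμ, hdn⟩ := Down.child (i := ix c) hn hcov
          refine ⟨μ, hμ, by simp; omega, .inr ⟨c, 2 * k, e, S', by simp [h40], by simp,
            by simp [h42], hc, hcS, hins, HS.of rfl rfl rfl rfl, ?_, hdn⟩⟩
          exact .inr ⟨q, by simpa using hTq, hle⟩
  · rintro μ s' hf ⟨htime, ⟨h1, h2⟩ | ⟨c, k, e, S', h40, _⟩⟩ hnil
    · exact ⟨h2.of rfl rfl rfl rfl, by simp; omega⟩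
    · rw [h40] at hnil; cases hnil

/-- Move the point in register 53 from the node in register 51 to its parent in register 50. -/
def PullUp (P : HP) : Program :=
  st 50 P.T 53 ;; ifEq 53 55 (nl 50) (st 53 P.ND 50 ;; mv 50 51)

/-- Remove the point at the node in register 50. -/
def Pull (P : HP) : Program :=
  whileNN 50 (ld 51 50 30 ;; nl 55 ;;
    ifEq 51 55 (st 50 P.T 55 ;; nl 50)
      (ld 52 51 31 ;; ld 53 51 P.T ;; ld 54 52 P.T ;;
       ifEq 54 55 .skip
        (ifEq 53 55 (mv 51 52 ;; mv 53 54)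
          (ifLess 54 53 P.k₁ P.k₂ (mv 51 52 ;; mv 53 54) .skip)) ;;
       PullUp P))

@[simp] theorem wf_Pull (P : HP) (f : ℕ) : wf (Pull P) f = (f == P.T || f == P.ND) := by
  simp only [Pull, PullUp, wf_seq, wf_mv, wf_ld, wf_st, wf_nl, wf_ifLess, wf_ifEq, wf_whileNN,
    wf_skip]
  cases f == P.T <;> cases f == P.ND <;> rfl

/-- The hole left by the removed point sinks by `HeapH.pull`, one level per iteration, until nothing
is below it. -/
theorem Pull_spec {B : ℕ} {P : HP} {h tb n : ℕ} {ix : ℕ → ℕ} {S : Set ℕ} {s : M} {p k e : ℕ}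
    (hP : P.OK) (ht : TreeS h tb s) (hpts : Pts P h n ix s) (H : HeapS P h tb n ix S s)
    (hk : IsNode h k e) (hp : s.mem P.T (tb + k) = .ptr p) (h50 : s.reg 50 = .ptr (tb + k)) :
    wp B (Pull P) s fun s' => HeapS P h tb n ix (S \ {p}) s' ∧
      s'.time ≤ s.time + 40 * (h + 2) := by
  have hSn : ∀ x ∈ S \ {p}, x < n := fun x hx => H.sub x hx.1
  -- The entry at the hole is stale in memory until the next iteration overwrites it, so the
  -- invariant concerns the column with this entry erased.
  refine wp_while (fun μ s' => s'.time + 40 * μ ≤ s.time + 40 * (h + 1) ∧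
    ((s'.reg 50 = .nil ∧ HeapS P h tb n ix (S \ {p}) s') ∨
    ∃ k e, s'.reg 50 = .ptr (tb + k) ∧ IsNode h k e ∧ μ = e + 1 ∧
      HeapH h tb (Function.update (s'.mem P.T) (tb + k) .nil) (s'.mem P.ND) (P.key s') ix
        (S \ {p}) k)) (e + 1) (by decide) ?_ ?_ ?_
  · exact ⟨by have := hk.le; omega, .inr ⟨k, e, h50, hk, rfl, H.heap.remove hk hp⟩⟩
  · rintro μ s' hf ⟨htime, ⟨h1, _⟩ | ⟨k, e, h50, hn, rfl, HH⟩⟩ hne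
    · exact absurd h1 hne
    have f30 : s'.mem 30 = s.mem 30 := hf.mem 30 (by simp [PullUp, hP.T30.symm, hP.N30.symm])
    have f31 : s'.mem 31 = s.mem 31 := hf.mem 31 (by simp [PullUp, hP.T31.symm, hP.N31.symm])
    have f33 : s'.mem 33 = s.mem 33 := hf.mem 33 (by simp [PullUp, hP.T33.symm, hP.N33.symm])
    have fi : s'.mem P.ix = s.mem P.ix := hf.mem P.ix (by simp [PullUp, hP.Ti.symm, hP.Ni.symm])
    have fk1 : s'.mem P.k₁ = s.mem P.k₁ := hf.mem P.k₁ (by simp [PullUp, hP.Tk₁.symm, hP.Nk₁.symm])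
    have fk2 : s'.mem P.k₂ = s.mem P.k₂ := hf.mem P.k₂ (by simp [PullUp, hP.Tk₂.symm, hP.Nk₂.symm])
    have ff : s'.fresh = s.fresh := hf.fresh (by rfl)
    have ht' : TreeS h tb s' := ht.of (hf.reg 8 (by rfl)) f30 f31 f33 ff.ge
    have hpts' : Pts P h n ix s' := hpts.of fi fk1 fk2 ff.ge
    have hkf : tb + k < s'.fresh := by have := hn.lt; have := ht'.fresh; omega
    refine wp.abs fun R hR => ?_
    rcases e with _ | e
    · have hl := ht'.leaf k hn.leaf hn.lt
      simp [h50, hkf, hl]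
      simp only [hR]
      refine ⟨0, by omega, by simp; omega, .inl ⟨by simp, ?_, hSn⟩⟩
      have := HH.fill hn (fun c _ hc => by have := hn.leaf; omega)
      simpa [HP.key, hP.TN.symm, hP.Tk₁.symm, hP.Tk₂.symm] using this
    · have hki := hn.internal
      have hk1 := hn.pos
      have hl := ht'.child k hk1 hki
      have hs := ht'.skipL k hk1 hki
      have hlf : tb + 2 * k < s'.fresh := by have := ht'.fresh; omega
      have hrf : tb + (2 * k + 1) < s'.fresh := by have := ht'.fresh; omega
      have hT : ∀ c d, IsNode h c d → c ≠ k → s'.mem P.T (tb + c) = .nil ∨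
          ∃ q, s'.mem P.T (tb + c) = .ptr q ∧ q < n := by
        intro c d hc hck
        rcases HH.kind c d hc with h1 | ⟨q, hq, h1, _⟩
        · rw [Function.update_of_ne (by omega)] at h1; exact .inl h1
        · rw [Function.update_of_ne (by omega)] at h1; exact .inr ⟨q, h1, hSn q hq⟩
      have pl := fun q => HH.pull (q := q) hn (.inl ⟨rfl, rfl⟩)
      have pr := fun q => HH.pull (q := q) hn (.inr ⟨rfl, rfl⟩)
      have hnp := hpts'.fr
      -- the two ways in which the iteration may end
      have final : ∀ (s2 : M) (c q : ℕ), s2.time ≤ s'.time + 24 → s2.fresh = s'.fresh →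
          s2.reg 50 = .ptr (tb + k) → s2.reg 55 = .nil → s2.reg 53 = .ptr q → q < n →
          s2.reg 51 = .ptr (tb + c) → s2.mem = s'.mem → IsNode h c e → c ≠ k →
          HeapH h tb (Function.update (Function.update (s'.mem P.T) (tb + k) (.ptr q)) (tb + c) .nil)
            (Function.update (s'.mem P.ND) q (.ptr (tb + k))) (P.key s') ix (S \ {p}) c →
          wp B (PullUp P) s2 R := by
        intro s2 c q g1 g2 g3 g4 g5 g6 g7 g8 g9 g10 g11
        simp [PullUp, g2, g3, g4, g5, g7, g8, hkf, g6.trans_le hnp, hP.TN, hP.TN.symm]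
        simp only [hR]
        refine ⟨e + 1, by omega, by simp; omega, .inr ⟨c, e, by simp, g9, rfl, ?_⟩⟩
        simpa [g8, HP.key, hP.TN, hP.TN.symm, hP.Tk₁.symm, hP.Tk₂.symm, hP.Nk₁.symm, hP.Nk₂.symm]
          using g11
      simp [h50, hkf, hl, hs, hlf, hrf]
      rcases hT (2 * k + 1) e hn.right (by omega) with hr0 | ⟨r, hr, hrn⟩
      · rcases hT (2 * k) e hn.left (by omega) with hl0 | ⟨q, hq, hqn⟩
        · simp [PullUp, hl0, hr0, h50, hkf]
          simp only [hR]
          refine ⟨0, by omega, by simp; omega, .inl ⟨by simp, ?_, hSn⟩⟩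
          have := HH.fill hn (fun c hc _ => by rcases hc with rfl | rfl <;> assumption)
          simpa [HP.key, hP.TN.symm, hP.Tk₁.symm, hP.Tk₂.symm] using this
        · simp [hr0, hq]
          exact final _ (2 * k) q (by simp) rfl (by simp [h50]) (by simp) (by simp) hqn (by simp)
            rfl hn.left (by omega) (pl q hq (by simp [hr0]))
      · rcases hT (2 * k) e hn.left (by omega) with hl0 | ⟨q, hq, hqn⟩
        · simp [hl0, hr]
          exact final _ (2 * k + 1) r (by simp) rfl (by simp [h50]) (by simp) (by simp) hrn
            (by simp) rfl hn.right (by omega) (pr r hr (by simp [hl0]))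
        · simp [hq, hr]
          refine wp_ifLess (p := r) (q := q) (by simp) (by simp) (by decide) (by decide)
            (hrn.trans_le hnp) (hqn.trans_le hnp) (hpts'.c₁ r hrn q hqn) (hpts'.c₂ r hrn q hqn) ?_ ?_
          · intro v w t ht6 hlt
            simp
            exact final _ (2 * k + 1) r (by simp; omega) rfl (by simp [h50]) (by simp) (by simp) hrn
              (by simp) rfl hn.right (by omega) (pr r hr (by
                simp only [hq, Val.ptr.injEq]; rintro _ rfl; exact hlt.le))
          · intro v w t ht6 hle
            simp
            exact final _ (2 * k) q (by simp; omega) rfl (by simp [h50]) (by simp) (by simp) hqn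
              (by simp) rfl hn.left (by omega) (pl q hq (by
                simp only [hr, Val.ptr.injEq]; rintro _ rfl; exact hle))
  · rintro μ s' hf ⟨htime, ⟨h1, h2⟩ | ⟨k, e, h50, _⟩⟩ hnil
    · exact ⟨h2.of rfl rfl rfl rfl, by simp; omega⟩
    · rw [h50] at hnil; cases hnil

/-! ### Walks from the root -/

theorem Covers.unique {h k k' e i : ℕ} (hk : IsNode h k e) (hk' : IsNode h k' e)
    (hc : Covers h k e i) (hc' : Covers h k' e i) : k = k' := by
  wlog hlt : k < k' generalizing k k'
  · rcases Nat.lt_trichotomy k k' with h1 | h1 | h1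
    · exact absurd h1 hlt
    · exact h1
    · exact (this hk' hk hc' hc h1).symm
  have h1 := hc.2
  have h2 := hc'.1
  simp only [hiOf, loOf] at h1 h2
  have h3 : (k + 1) * 2 ^ e ≤ k' * 2 ^ e := Nat.mul_le_mul_right _ hlt
  omega

/-- Walk from the root to the leaf with the number in register 31, storing the point in register 33
in field `Mx` of all nodes on the way and the leaf in field `LF` of the point. -/
def Walk (Mx LF : ℕ) : Program :=
  mv 34 8 ;; whileNN 34 (ld 35 34 33 ;;
    ifLt 35 31 (ld 34 34 31) (st 34 Mx 33 ;; st 33 LF 34 ;; ld 34 34 30))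

@[simp] theorem wf_Walk (Mx LF f : ℕ) : wf (Walk Mx LF) f = (f == Mx || f == LF) := by
  simp [Walk]

/-- If the points come in the order of their leaves, the last one written to a node is the last
point below it; this is how sorting produces `MaxCol`. Field `LF` of the point is overwritten on the
way and ends up with the leaf. -/
theorem Walk_spec {B Mx LF h tb c p : ℕ} {s : M} (hf : [30, 31, 33, Mx, LF].Nodup)
    (ht : TreeS h tb s) (h31 : s.reg 31 = .num c) (hc : 1 ≤ c ∧ c ≤ 2 ^ h)
    (h33 : s.reg 33 = .ptr p) (hp : p < s.fresh) :
    wp B (Walk Mx LF) s fun s' => s'.time ≤ s.time + 40 * (h + 1) ∧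
      s'.mem LF p = .ptr (tb + (2 ^ h + c - 1)) ∧ (∀ q ≠ p, s'.mem LF q = s.mem LF q) ∧
      ∀ k e, IsNode h k e → (Covers h k e c → s'.mem Mx (tb + k) = .ptr p) ∧
        (¬ Covers h k e c → s'.mem Mx (tb + k) = s.mem Mx (tb + k)) := by
  simp only [List.nodup_cons, List.mem_cons, List.not_mem_nil, or_false, not_or] at hf
  simp only [Walk, wp_seq, wp_mv, ht.root]
  refine wp_while (fun μ s' => s'.time + 14 * μ ≤ s.time + 28 * h + 25 ∧
    (∀ q ≠ p, s'.mem LF q = s.mem LF q) ∧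
    -- `E` is the height down to which the path has been written: nodes on the path of height at
    -- least `E` are done, all other nodes are as before.
    ∃ E, (∀ k e, IsNode h k e → (Covers h k e c ∧ E ≤ e → s'.mem Mx (tb + k) = .ptr p) ∧
        (¬ Covers h k e c ∨ e < E → s'.mem Mx (tb + k) = s.mem Mx (tb + k))) ∧
      ((s'.reg 34 = .nil ∧ E = 0 ∧ s'.mem LF p = .ptr (tb + (2 ^ h + c - 1))) ∨
      ∃ k e, E = e + 1 ∧ s'.reg 34 = .ptr (tb + k) ∧ Down h k e c μ)) (2 * h + 1) (by decide)
      ?_ ?_ ?_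
  · refine ⟨by simp; omega, by simp, h + 1, fun k e hk => ⟨fun hh => ?_, fun _ => by simp⟩,
      .inr ⟨1, h, rfl, by simp, isNode_root h, .inl ⟨covers_root hc.1 hc.2, rfl⟩⟩⟩
    have := hk.le; omega
  · rintro μ s' hF ⟨htime, hLF, E, hE, ⟨h1, _⟩ | ⟨k, e, rfl, h34, hd⟩⟩ hne
    · exact absurd h1 hne
    have ht' : TreeS h tb s' := ht.of (hF.reg 8 (by rfl)) (hF.mem 30 (by simp; omega))
      (hF.mem 31 (by simp; omega)) (hF.mem 33 (by simp; omega)) (hF.fresh (by rfl)).ge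
    have h31' : s'.reg 31 = .num c := (hF.reg 31 (by rfl)).trans (by simp [h31])
    have h33' : s'.reg 33 = .ptr p := (hF.reg 33 (by rfl)).trans (by simp [h33])
    have hpf : p < s'.fresh := hp.trans_le hF.le
    have hn := hd.1
    have hkf : tb + k < s'.fresh := by have := hn.lt; have := ht'.fresh; omega
    refine wp.abs fun R hR => ?_
    simp [h34, hkf, ht'.hi k e hn, h31']
    refine ⟨fun hlt => ?_, fun hlt => ?_⟩
    · obtain ⟨j, rfl, hj1, hj2, hd', hμ⟩ := hd.skip hlt
      simp only [hR]
      exact ⟨μ - 1, hμ, by simp; omega, hLF, e + 1, hE, .inr ⟨2 * j + 1, e, rfl,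
        by simpa using ht'.skipL j hj1 hj2, hd'⟩⟩
    · obtain ⟨hcov, rfl⟩ := hd.covers (by omega)
      have hE' : ∀ j d, IsNode h j d →
          (Covers h j d c ∧ e ≤ d → Function.update (s'.mem Mx) (tb + k) (.ptr p) (tb + j) = .ptr p) ∧
          (¬ Covers h j d c ∨ d < e →
            Function.update (s'.mem Mx) (tb + k) (.ptr p) (tb + j) = s.mem Mx (tb + j)) := by
        intro j d hj
        by_cases hjk : j = k
        · subst hjk
          obtain rfl := hn.unique hj
          simp [hcov]
        · rw [Function.update_of_ne (by omega)]
          refine ⟨fun hh => (hE j d hj).1 ⟨hh.1, ?_⟩, fun hh => (hE j d hj).2 (hh.imp_right (by omega))⟩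
          by_contra hlt
          obtain rfl : d = e := by omega
          exact hjk (Covers.unique hj hn hh.1 hcov)
      simp [h33', hpf, hkf, h34]
      simp only [hR]
      have hm : ∀ v, (if Mx = LF then v else Function.update (s'.mem Mx) (tb + k) (Val.ptr p)) =
        Function.update (s'.mem Mx) (tb + k) (Val.ptr p) := fun v => if_neg (by omega)
      rcases e with _ | e
      · refine ⟨0, by omega, by simp; omega, ?_, 0, ?_, .inl ⟨?_, rfl, ?_⟩⟩
        · intro q hq
          have := hLF q hq
          simpa [hq, show LF ≠ Mx by omega] using this
        · simpa [show Mx ≠ LF by omega] using hE'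
        · simpa [show 30 ≠ LF by omega, show 30 ≠ Mx by omega] using ht'.leaf k hn.leaf hn.lt
        · simp [hn.covers_leaf hcov]
      · obtain ⟨μ, hμ, hdn⟩ := Down.child (i := c) hn hcov
        refine ⟨μ, hμ, by simp; omega, ?_, e + 1, ?_, .inr ⟨2 * k, e, rfl, ?_, hdn⟩⟩
        · intro q hq
          have := hLF q hq
          simpa [hq, show LF ≠ Mx by omega] using this
        · simpa [show Mx ≠ LF by omega] using hE'
        · simpa [show 30 ≠ LF by omega, show 30 ≠ Mx by omega] using ht'.child k hn.pos hn.internal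
  · rintro μ s' hf ⟨htime, h1, E, hE, ⟨h2, rfl, h3⟩ | ⟨k, e, _, h34, _⟩⟩ hnil
    · exact ⟨by simp; omega, h3, h1, fun k e hk => ⟨fun hh => (hE k e hk).1 ⟨hh, Nat.zero_le _⟩,
        fun hh => (hE k e hk).2 (.inl hh)⟩⟩
    · rw [h34] at hnil; cases hnil

/-- Find the last point, in the order of the leaves, the coordinate `kf` of which is smaller than
(`strict`), or not larger than, the value in register 60. -/
def Loc (kf Mx : ℕ) (strict : Bool) : Program :=
  mv 61 8 ;; nl 62 ;; whileNN 61 (ld 63 61 Mx ;; nl 64 ;; ifEq 63 64 (nl 61) (ld 65 63 kf ;;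
    if strict then ifLt 65 60 (mv 62 63 ;; ld 61 61 31) (ld 61 61 30)
    else ifLt 60 65 (ld 61 61 30) (mv 62 63 ;; ld 61 61 31)))

/-- In field `Mx`, every node refers to the last point below it. -/
def MaxCol (h tb n : ℕ) (pt : ℕ → ℕ) (Mx : ℕ → Val) : Prop :=
  ∀ k e, IsNode h k e → Mx (tb + k) = if loOf h k e < n then .ptr (pt (min (hiOf h k e) n)) else .nil

/-- Since `pred` is antitone, all points below a node satisfy it as soon as the last one does. Then
the subtree is passed over and its last point remembered; otherwise the answer is inside it or just
before it, and the search enters the left child. -/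
theorem Loc_spec {B kf Mx h tb n : ℕ} {strict : Bool} {s : M} {pt : ℕ → ℕ} {pred : ℕ → Prop} {v : Val}
    (ht : TreeS h tb s) (hM : MaxCol h tb n pt (s.mem Mx)) (hn1 : 1 ≤ n) (hnh : n ≤ 2 ^ h)
    (hpt : ∀ r, 1 ≤ r → r ≤ n → pt r < s.fresh) (h60 : s.reg 60 = v)
    (hcmp : ∀ r, 1 ≤ r → r ≤ n → (s.mem kf (pt r)).Cmp v ∧ v.Cmp (s.mem kf (pt r)))
    (hpred : ∀ r, 1 ≤ r → r ≤ n → (pred r ↔ if strict then (s.mem kf (pt r)).Lt v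
      else ¬ v.Lt (s.mem kf (pt r))))
    (hanti : ∀ r r', 1 ≤ r → r ≤ r' → r' ≤ n → pred r' → pred r) :
    wp B (Loc kf Mx strict) s fun s' => s'.time ≤ s.time + 40 * (h + 1) ∧
      ∃ c ≤ n, (c = 0 ∧ s'.reg 62 = .nil ∨ 1 ≤ c ∧ s'.reg 62 = .ptr (pt c)) ∧
        ∀ r, 1 ≤ r → r ≤ n → (pred r ↔ r ≤ c) := by
  simp only [Loc, wp_seq, wp_mv, wp_nl, ht.root]
  -- The last point below the node is known to fail. A right child inherits this from its parent, so
  -- it is never passed over and at most two nodes per level are visited.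
  let NP : ℕ → ℕ → Prop := fun k e => loOf h k e < n → ¬ pred (min (hiOf h k e) n)
  refine wp_while (fun μ s' => s'.time + 14 * μ ≤ s.time + 28 * h + 25 ∧
    ∃ c ≤ n, (c = 0 ∧ s'.reg 62 = .nil ∨ 1 ≤ c ∧ s'.reg 62 = .ptr (pt c)) ∧
      (∀ r, 1 ≤ r → r ≤ c → pred r) ∧
      ((s'.reg 61 = .nil ∧ ∀ r, 1 ≤ r → r ≤ n → pred r → r ≤ c) ∨
      ∃ k e, s'.reg 61 = .ptr (tb + k) ∧ IsNode h k e ∧ c = min (loOf h k e) n ∧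
        ((k = 1 ∨ NP k e) ∧ μ = 2 * e + 1 ∨
          ∃ j, k = 2 * j ∧ IsNode h j (e + 1) ∧ NP j (e + 1) ∧ μ = 2 * e + 2))) (2 * h + 1)
    (by decide) ?_ ?_ ?_
  · refine ⟨by simp; omega, 0, by omega, .inl ⟨rfl, by simp⟩, by omega,
      .inr ⟨1, h, by simp, isNode_root h, by simp [loOf], .inl ⟨.inl rfl, rfl⟩⟩⟩
  · rintro μ s' hF ⟨htime, c, hcn, h62, hall, ⟨h1, _⟩ | ⟨k, e, h61, hn, rfl, hcase⟩⟩ hne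
    · exact absurd h1 hne
    have hmem : s'.mem = s.mem := by
      funext f
      exact hF.mem f (by cases strict <;> simp)
    have h60' : s'.reg 60 = v := (hF.reg 60 (by cases strict <;> rfl)).trans (by simp [h60])
    have ht' : TreeS h tb s' := ht.of ((hF.reg 8 (by cases strict <;> rfl)).trans (by simp))
      (by rw [hmem]) (by rw [hmem]) (by rw [hmem]) hF.le
    have hkf : tb + k < s'.fresh := by have := hn.lt; have := ht'.fresh; omega
    have hM' := hM k e hn
    rw [← hmem] at hM' hcmp hpred
    refine wp.abs fun R hR => ?_
    have hμ : 1 ≤ μ := by rcases hcase with h | ⟨_, _, _, _, h⟩ <;> omega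
    by_cases hlo : loOf h k e < n
    · rw [if_pos hlo] at hM'
      obtain ⟨r, hr⟩ : ∃ r, r = min (hiOf h k e) n := ⟨_, rfl⟩
      have hhi := hn.hi_eq
      have h2e := Nat.two_pow_pos e
      rw [← hr] at hM'
      have hr1 : 1 ≤ r := by omega
      have hrn : r ≤ n := by omega
      have hrf := (hpt r hr1 hrn).trans_le hF.le
      -- the point is not in the range
      have hB : ∀ s2 : M, s2.time ≤ s'.time + 10 → s2.mem = s'.mem → s2.fresh = s'.fresh →
          s2.reg 61 = s'.reg 61 → s2.reg 62 = s'.reg 62 → ¬ pred r → wp B (ld 61 61 30) s2 R := by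
        intro s2 g1 g2 g3 g4 g5 hnp
        simp [g2, g3, g4, h61, hkf]
        simp only [hR]
        rcases e with _ | e
        · refine ⟨0, by omega, by simp; omega, _, hcn, by simpa [g5] using h62, hall, .inl ⟨?_, ?_⟩⟩
          · simpa using ht'.leaf k hn.leaf hn.lt
          · intro r' h1 h2 h3
            by_contra hlt
            exact hnp (hanti r r' hr1 (by simp at hhi; omega) h2 h3)
        · refine ⟨2 * e + 2, ?_, ?_, _, hcn, by simpa [g5] using h62, hall, .inr ⟨2 * k, e, ?_,
            hn.left, by rw [loOf_left], .inr ⟨k, rfl, hn, fun _ => hr ▸ hnp, rfl⟩⟩⟩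
          · rcases hcase with h | ⟨_, _, _, _, h⟩ <;> omega
          · rcases hcase with h | ⟨_, _, _, _, h⟩ <;> simp <;> omega
          · simpa using ht'.child k hn.pos hn.internal
      have hA : ∀ s2 : M, s2.time ≤ s'.time + 10 → s2.mem = s'.mem → s2.fresh = s'.fresh →
          s2.reg 61 = s'.reg 61 → s2.reg 63 = .ptr (pt r) → pred r →
          wp B (mv 62 63 ;; ld 61 61 31) s2 R := by
        intro s2 g1 g2 g3 g4 g5 hp
        simp [g2, g3, g4, h61, hkf]
        simp only [hR]
        have hrr : ∀ r', 1 ≤ r' → r' ≤ r → pred r' := fun r' h1 h2 => hanti r' r h1 h2 hrn hp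
        rcases hcase with ⟨rfl | hNP, rfl⟩ | ⟨j, rfl, hj, hNP, rfl⟩
        -- Even the last of all points satisfies `pred`: the preorder link of the root is nil and
        -- ends the search.
        · refine ⟨0, by omega, by simp; omega, r, hrn, .inr ⟨hr1, by simp [g5]⟩, hrr,
            .inl ⟨by simpa using ht'.skip0, fun r' h1 h2 h3 => ?_⟩⟩
          have := hn.unique (isNode_root h)
          subst this
          have : hiOf e 1 e = 2 ^ e := by simp [hiOf]; omega
          omega
        · exact absurd hp (hr ▸ hNP hlo)
        · have hlo2 := hiOf_left h j e
          refine ⟨2 * e + 1, by omega, by simp; omega, r, hrn, .inr ⟨hr1, by simp [g5]⟩, hrr,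
            .inr ⟨2 * j + 1, e, by simpa using ht'.skipL j hj.pos hj.internal, hj.right,
              by rw [hr, hlo2], .inl ⟨.inr fun _ => ?_, rfl⟩⟩⟩
          rw [hiOf_right]
          rw [loOf_left] at hlo
          exact hNP hlo
      have hpr := hpred r hr1 hrn
      have hc1 := hcmp r hr1 hrn
      generalize (mv 62 63 ;; ld 61 61 31) = PA at hA ⊢
      generalize (ld 61 61 30) = PB at hB ⊢
      cases strict
      · simp at hpr
        simp [h61, hkf, hM', hrf, h60', hc1]
        exact ⟨fun hh => hB _ (by simp) rfl rfl (by simp) (by simp) (by tauto),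
          fun hh => hA _ (by simp) rfl rfl (by simp) (by simp) (by tauto)⟩
      · simp at hpr
        simp [h61, hkf, hM', hrf, h60', hc1]
        exact ⟨fun hh => hA _ (by simp) rfl rfl (by simp) (by simp) (by tauto),
          fun hh => hB _ (by simp) rfl rfl (by simp) (by simp) (by tauto)⟩
    -- No point lies below this node, so all n points precede it and have been accepted.
    · rw [if_neg hlo] at hM'
      simp [h61, hkf, hM']
      simp only [hR]
      refine ⟨0, by omega, by simp; omega, _, hcn, by simpa using h62, hall, .inl ⟨by simp, ?_⟩⟩
      intro r h1 h2 _
      omega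
  · rintro μ s' hf ⟨htime, c, hcn, h62, hall, ⟨h2, h3⟩ | ⟨k, e, h61, _⟩⟩ hnil
    · exact ⟨by simp; omega, c, hcn, by simpa using h62, fun r h1 h2 => ⟨h3 r h1 h2, hall r h1⟩⟩
    · rw [h61] at hnil; cases hnil

/-! ### Loops over the input lists -/

theorem listPtr_lt {base len i : ℕ} (h : i < len) : listPtr base len i = .ptr (base + i) := if_pos h
theorem listPtr_len (base len : ℕ) : listPtr base len len = .nil := if_neg (lt_irrefl _)

/-- The rule for loops over an input list. -/
theorem wp_list {B cur base len : ℕ} {body : Program} {s : M} {Q : M → Prop} (J : ℕ → M → Prop)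
    (h3 : cur ≠ 3) (hs : s.reg cur = listPtr base len 0) (h0 : J 0 s)
    (step : ∀ i < len, ∀ s', Frame (whileNN cur body) s s' → J i s' →
      s'.reg cur = .ptr (base + i) → wp B body (s'.ent .nil) fun s'' =>
        J (i + 1) s'' ∧ s''.reg cur = listPtr base len (i + 1))
    (done : ∀ s', Frame (whileNN cur body) s s' → J len s' → s'.reg cur = .nil →
      Q (s'.ent (.num 0))) :
    wp B (whileNN cur body) s Q := by
  refine wp_while (fun k s' => ∃ i ≤ len, k = len - i ∧ J i s' ∧ s'.reg cur = listPtr base len i)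
    len h3 ⟨0, by omega, by omega, h0, hs⟩ ?_ ?_
  · rintro k s' hF ⟨i, hi, rfl, hJ, hc⟩ hne
    have hlt : i < len := by
      rcases hi.lt_or_eq with h | rfl
      · exact h
      · rw [listPtr_len] at hc; exact absurd hc hne
    refine (step i hlt s' hF hJ (hc.trans (listPtr_lt hlt))).mono ?_
    rintro s'' ⟨h1, h2⟩
    exact ⟨len - (i + 1), by omega, i + 1, by omega, rfl, h1, h2⟩
  · rintro k s' hF ⟨i, hi, rfl, hJ, hc⟩ hnil
    have : i = len := by
      rcases hi.lt_or_eq with h | rfl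
      · rw [listPtr_lt h, hnil] at hc; cases hc
      · rfl
    subst this
    exact done s' hF hJ hnil

/-- The list of the points. -/
structure PtList (n : ℕ) (s : M) : Prop where
  head : s.reg 0 = listPtr 0 n 0
  next : ∀ i < n, s.mem 0 i = listPtr 0 n (i + 1)

def InsAll (P : HP) : Program := mv 30 0 ;; whileNN 30 (mv 40 30 ;; Ins P ;; ld 30 30 0)

@[simp] theorem wf_InsAll (P : HP) (f : ℕ) : wf (InsAll P) f = (f == P.T || f == P.ND) := by
  simp [InsAll]

theorem InsAll_spec {B : ℕ} {P : HP} {h tb n : ℕ} {ix : ℕ → ℕ} {s : M} (hP : P.OK)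
    (hP0 : P.T ≠ 0 ∧ P.ND ≠ 0) (ht : TreeS h tb s)
    (hpts : Pts P h n ix s) (H : HeapS P h tb n ix ∅ s) (hl : PtList n s) :
    wp B (InsAll P) s fun s' => HeapS P h tb n ix {p | p < n} s' ∧
      s'.time ≤ s.time + n * (90 * (h + 1)) + 5 := by
  simp only [InsAll, wp_seq, wp_mv]
  refine wp_list (base := 0) (len := n) (fun i s' => HeapS P h tb n ix {p | p < i} s' ∧
    s'.time ≤ s.time + i * (90 * (h + 1)) + 1) (by decide) (by simp [hl.head]) ?_ ?_ ?_
  · have h0 : {p | p < 0} = (∅ : Set ℕ) := by ext; simp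
    exact ⟨h0 ▸ H.of rfl rfl rfl rfl, by simp⟩
  · rintro i hi s' hF ⟨hH, htime⟩ hcur
    rw [zero_add] at hcur
    have f0 : s'.mem 0 = s.mem 0 := hF.mem 0 (by simp [hP0.1.symm, hP0.2.symm])
    have f30 : s'.mem 30 = s.mem 30 := hF.mem 30 (by simp [hP.T30.symm, hP.N30.symm])
    have f31 : s'.mem 31 = s.mem 31 := hF.mem 31 (by simp [hP.T31.symm, hP.N31.symm])
    have f33 : s'.mem 33 = s.mem 33 := hF.mem 33 (by simp [hP.T33.symm, hP.N33.symm])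
    have fi : s'.mem P.ix = s.mem P.ix := hF.mem P.ix (by simp [hP.Ti.symm, hP.Ni.symm])
    have fk1 : s'.mem P.k₁ = s.mem P.k₁ := hF.mem P.k₁ (by simp [hP.Tk₁.symm, hP.Nk₁.symm])
    have fk2 : s'.mem P.k₂ = s.mem P.k₂ := hF.mem P.k₂ (by simp [hP.Tk₂.symm, hP.Nk₂.symm])
    have ff : s'.fresh = s.fresh := hF.fresh (by rfl)
    refine wp.abs fun R hR => ?_
    simp only [wp_seq, wp_mv, M.ent_reg, hcur]
    refine (Ins_spec (s := (s'.ent .nil).set 40 (.ptr i)) (p := i) hP (ht.of (by simp [hF.reg 8 (by rfl)]) f30 f31 f33 ff.ge)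
      (hpts.of fi fk1 fk2 ff.ge) (hH.of rfl rfl rfl rfl) hi (lt_irrefl i) (by simp)).frame ?_
    rintro s2 hF2 ⟨h1, h2⟩
    have g30 : s2.reg 30 = .ptr i := by rw [hF2.reg 30 (by rfl)]; simp [hcur]
    have g0 : s2.mem 0 = s.mem 0 := by
      rw [hF2.mem 0 (by simp [hP0.1.symm, hP0.2.symm])]; simpa using f0
    have gf : i < s2.fresh := hi.trans_le ((hpts.fr.trans hF.le).trans hF2.le)
    simp [g30, gf, g0, hl.next i hi]
    simp only [hR]
    refine ⟨⟨?_, ?_⟩, by simp⟩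
    · have : {p | p < i + 1} = insert i {p | p < i} := by
        ext x; simp only [Set.mem_ofPred_eq, Set.mem_insert_iff]; omega
      rw [this]
      exact h1.of rfl rfl rfl rfl
    · simp at h2 ⊢
      nlinarith
  · rintro s' hF ⟨hH, htime⟩ hnil
    exact ⟨hH.of rfl rfl rfl rfl, by simp; omega⟩

/-! ### Sorting -/

/-- `rk` numbers the points `0, …, n - 1` from `1` to `n` in the order of `κ`. -/
structure Ranked {K : Type*} [LinearOrder K] (n : ℕ) (κ : ℕ → K) (pt rk : ℕ → ℕ) : Prop where
  pt_lt : ∀ r, 1 ≤ r → r ≤ n → pt r < n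
  rk_pt : ∀ r, 1 ≤ r → r ≤ n → rk (pt r) = r
  rk_pos : ∀ p < n, 1 ≤ rk p
  rk_le : ∀ p < n, rk p ≤ n
  pt_rk : ∀ p < n, pt (rk p) = p
  mono : ∀ p < n, ∀ q < n, rk p < rk q → κ p ≤ κ q

def SortTail (P : HP) (Mx LF : ℕ) : Program :=
  mv 32 33 ;; Walk Mx LF ;; mv 50 8 ;; Pull P ;; ld 33 8 P.T

/-- Remove all points from the heap in order and give them their ranks `R`, their predecessors `Lp`
and successors `Ln`, and the leaves `LF` with their ranks. -/
def PopAll (P : HP) (R Lp Ln Mx LF : ℕ) : Program :=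
  nm 31 0 ;; nl 32 ;; ld 33 8 P.T ;;
  whileNN 33 (ad 31 31 5 ;; st 33 R 31 ;; st 33 Lp 32 ;; nl 36 ;;
    ifEq 32 36 .skip (st 32 Ln 33) ;; SortTail P Mx LF)

def SortBy (P : HP) (R Lp Ln Mx LF : ℕ) : Program := InsAll P ;; PopAll P R Lp Ln Mx LF

/-- The fields used in sorting are different. -/
def SortOK (P : HP) (R Lp Ln Mx LF : ℕ) : Prop :=
  1 ≤ P.k₁ ∧ 1 ≤ P.k₂ ∧ 1 ≤ P.ix ∧ P.k₁ < R ∧ P.k₂ < R ∧ P.ix < R ∧ R < Lp ∧ Lp < Ln ∧ Ln < P.ND ∧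
    P.ND < LF ∧ LF < 30 ∧ 33 < P.T ∧ P.T < Mx

theorem SortOK.hp {P : HP} {R Lp Ln Mx LF : ℕ} (h : SortOK P R Lp Ln Mx LF) : P.OK := by
  unfold SortOK at h
  constructor <;> omega

@[simp] theorem wf_SortTail (P : HP) (Mx LF f : ℕ) :
    wf (SortTail P Mx LF) f = ((f == Mx || f == LF) || (f == P.T || f == P.ND)) := by
  simp [SortTail]

/-- Two leaf numberings are in play. In the heap a point belongs to the leaf `ix`, any injective
numbering; the walk marks the path to the leaf `c`, the rank the point has just received. -/
theorem SortTail_spec {B : ℕ} {P : HP} {R Lp Ln Mx LF h tb n c p : ℕ} {ix : ℕ → ℕ} {S : Set ℕ} {s : M}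
    (hP : SortOK P R Lp Ln Mx LF) (ht : TreeS h tb s) (hpts : Pts P h n ix s)
    (H : HeapS P h tb n ix S s) (h31 : s.reg 31 = .num c) (hc : 1 ≤ c ∧ c ≤ 2 ^ h)
    (h33 : s.reg 33 = .ptr p) (hroot : s.mem P.T (tb + 1) = .ptr p) :
    wp B (SortTail P Mx LF) s fun s' => HeapS P h tb n ix (S \ {p}) s' ∧
      s'.reg 32 = .ptr p ∧ s'.reg 33 = s'.mem P.T (tb + 1) ∧
      s'.time ≤ s.time + 80 * (h + 2) ∧
      s'.mem LF p = .ptr (tb + (2 ^ h + c - 1)) ∧ (∀ q ≠ p, s'.mem LF q = s.mem LF q) ∧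
      ∀ k e, IsNode h k e → (Covers h k e c → s'.mem Mx (tb + k) = .ptr p) ∧
        (¬ Covers h k e c → s'.mem Mx (tb + k) = s.mem Mx (tb + k)) := by
  have hOK := hP.hp
  unfold SortOK at hP
  have hpS := H.heap.at (isNode_root h) hroot
  have hpf : p < s.fresh := (H.sub p hpS.1).trans_le hpts.fr
  simp only [SortTail, wp_seq, wp_mv]
  have hnd : [30, 31, 33, Mx, LF].Nodup := by
    simp only [List.nodup_cons, List.mem_cons, List.not_mem_nil, or_false, not_or, List.nodup_nil,
      not_false_eq_true, and_true]
    omega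
  refine (Walk_spec (s := s.set 32 (s.reg 33)) (c := c) (p := p) hnd (ht.of (by simp) rfl rfl rfl le_rfl)
    (by simpa) hc (by simpa) hpf).frame ?_
  rintro s1 hF1 ⟨w1, w2, w3, w4⟩
  have g8 : s1.reg 8 = .ptr (tb + 1) := by rw [hF1.reg 8 (by rfl)]; simp [ht.root]
  have hm : ∀ f, f ≠ Mx → f ≠ LF → s1.mem f = s.mem f := fun f h1 h2 => by
    rw [hF1.mem f (by simp [h1, h2])]; rfl
  have ht1 : TreeS h tb s1 := ht.of (by rw [g8, ht.root]) (hm _ (by omega) (by omega))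
    (hm _ (by omega) (by omega)) (hm _ (by omega) (by omega)) hF1.le
  have hT1 := hm P.T (by omega) (by omega)
  refine (Pull_spec (s := s1.set 50 (s1.reg 8)) (k := 1) (p := p) hOK (ht1.of (by simp) rfl rfl rfl le_rfl)
    (hpts.of (hm _ (by omega) (by omega)) (hm _ (by omega) (by omega)) (hm _ (by omega) (by omega))
      hF1.le) (H.of hT1 (hm _ (by omega) (by omega)) (hm _ (by omega) (by omega))
      (hm _ (by omega) (by omega))) (isNode_root h) (by simpa [hT1] using hroot)
      (by simp [g8])).frame ?_
  rintro s2 hF2 ⟨p1, p2⟩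
  have g8' : s2.reg 8 = .ptr (tb + 1) := by rw [hF2.reg 8 (by rfl)]; simp [g8]
  have gf : tb + 1 < s2.fresh := by
    have h1 := ht1.fresh
    have h2 := hF2.le
    have := Nat.two_pow_pos h
    simp at h2; omega
  have gM : s2.mem Mx = s1.mem Mx := hF2.mem Mx (by simp; omega)
  have gL : s2.mem LF = s1.mem LF := hF2.mem LF (by simp; omega)
  simp [g8', gf]
  refine ⟨p1.of rfl rfl rfl rfl, ?_, ?_, ?_, ?_, ?_⟩
  · rw [hF2.reg 32 (by rfl)]
    simp [hF1.reg 32 (by rfl), h33]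
  · simp at w1 p2; omega
  · rw [gL]; exact w2
  · rw [gL]; exact w3
  · rw [gM]; exact w4

/-- The c distinct points already removed and one more still in the heap make c + 1 points, so the
next rank is at most n and is a leaf number. -/
theorem card_bound {n c : ℕ} {pt : ℕ → ℕ} (h1 : ∀ r, 1 ≤ r → r ≤ c → pt r < n)
    (h2 : ∀ r r', 1 ≤ r → r ≤ c → 1 ≤ r' → r' ≤ c → pt r = pt r' → r = r') {p : ℕ} (hp : p < n)
    (hpt : ∀ r, 1 ≤ r → r ≤ c → pt r ≠ p) : c < n := by
  have hcard : (insert p ((Finset.Icc 1 c).image pt)).card ≤ (Finset.range n).card := by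
    apply Finset.card_le_card
    intro x hx
    simp only [Finset.mem_insert, Finset.mem_image, Finset.mem_Icc, Finset.mem_range] at hx ⊢
    rcases hx with rfl | ⟨r, hr, rfl⟩
    · exact hp
    · exact h1 r hr.1 hr.2
  rw [Finset.card_insert_of_notMem, Finset.card_image_of_injOn] at hcard
  · simp at hcard; omega
  · intro r hr r' hr' hh
    simp only [Finset.coe_Icc, Set.mem_Icc] at hr hr'
    exact h2 r r' hr.1 hr.2 hr'.1 hr'.2 hh
  · simp only [Finset.mem_image, Finset.mem_Icc, not_exists, not_and]
    exact fun r hr => hpt r hr.1 hr.2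

/-- What sorting leaves in memory. -/
structure SortRes (n h tb R Lp Ln Mx LF : ℕ) (pt rk : ℕ → ℕ) (s : M) : Prop where
  cR : ∀ p < n, s.mem R p = .num (rk p)
  cLp : ∀ p < n, s.mem Lp p = if rk p = 1 then .nil else .ptr (pt (rk p - 1))
  cLn : ∀ p < n, s.mem Ln p = if rk p = n then .nil else .ptr (pt (rk p + 1))
  cLF : ∀ p < n, s.mem LF p = .ptr (tb + (2 ^ h + rk p - 1))
  cMx : MaxCol h tb n pt (s.mem Mx)

/-- The state of sorting when `c` points have been removed from the heap. -/
structure Popped (P : HP) (n h tb R Lp Ln Mx LF : ℕ) (κ : ℕ → ℝ ×ₗ ℝ) (S : Set ℕ) (pt : ℕ → ℕ) (c : ℕ)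
    (s : M) : Prop where
  lt : ∀ r, 1 ≤ r → r ≤ c → pt r < n
  notMem : ∀ r, 1 ≤ r → r ≤ c → pt r ∉ S
  inj : ∀ r r', 1 ≤ r → r ≤ c → 1 ≤ r' → r' ≤ c → pt r = pt r' → r = r'
  all : ∀ p < n, p ∈ S ∨ ∃ r, 1 ≤ r ∧ r ≤ c ∧ pt r = p
  mono : ∀ r r', 1 ≤ r → r < r' → r' ≤ c → κ (pt r) ≤ κ (pt r')
  le : ∀ r, 1 ≤ r → r ≤ c → ∀ p ∈ S, κ (pt r) ≤ κ p
  cR : ∀ r, 1 ≤ r → r ≤ c → s.mem R (pt r) = .num r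
  cLp : ∀ r, 1 ≤ r → r ≤ c → s.mem Lp (pt r) = if r = 1 then .nil else .ptr (pt (r - 1))
  cLn : ∀ r, 1 ≤ r → r ≤ c → s.mem Ln (pt r) = if r = c then .nil else .ptr (pt (r + 1))
  cLnS : ∀ p ∈ S, s.mem Ln p = .nil
  cLF : ∀ r, 1 ≤ r → r ≤ c → s.mem LF (pt r) = .ptr (tb + (2 ^ h + r - 1))
  cMx : MaxCol h tb c pt (s.mem Mx)

/-- A minimum of the heap becomes point number c + 1. Among the ranks and links of the points, only
its own rank and predecessor link and the successor link of the point before it are written. -/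
theorem Popped.next {P : HP} {R Lp Ln Mx LF n h tb c p : ℕ} {κ : ℕ → ℝ ×ₗ ℝ} {S : Set ℕ} {pt : ℕ → ℕ}
    {s s' : M} (H : Popped P n h tb R Lp Ln Mx LF κ S pt c s) (hpS : p ∈ S) (hpn : p < n)
    (hmin : ∀ q ∈ S, κ p ≤ κ q)
    (hR : s'.mem R = Function.update (s.mem R) p (.num (c + 1)))
    (hLp : s'.mem Lp = Function.update (s.mem Lp) p (if c = 0 then .nil else .ptr (pt c)))
    (hLn : s'.mem Ln = if c = 0 then s.mem Ln else Function.update (s.mem Ln) (pt c) (.ptr p))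
    (hLF : s'.mem LF p = .ptr (tb + (2 ^ h + (c + 1) - 1)))
    (hLF' : ∀ q ≠ p, s'.mem LF q = s.mem LF q)
    (hMx : ∀ k e, IsNode h k e → (Covers h k e (c + 1) → s'.mem Mx (tb + k) = .ptr p) ∧
        (¬ Covers h k e (c + 1) → s'.mem Mx (tb + k) = s.mem Mx (tb + k))) :
    Popped P n h tb R Lp Ln Mx LF κ (S \ {p}) (Function.update pt (c + 1) p) (c + 1) s' := by
  have hne : ∀ r, 1 ≤ r → r ≤ c → pt r ≠ p := fun r h1 h2 h3 => H.notMem r h1 h2 (h3 ▸ hpS)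
  have hu : ∀ r, r ≤ c → Function.update pt (c + 1) p r = pt r := fun r hr =>
    Function.update_of_ne (by omega) _ _
  have hself : Function.update pt (c + 1) p (c + 1) = p := by simp
  have split : ∀ r, 1 ≤ r → r ≤ c + 1 → (1 ≤ r ∧ r ≤ c) ∨ r = c + 1 := by omega
  refine ⟨?_, ?_, ?_, ?_, ?_, ?_, ?_, ?_, ?_, ?_, ?_, ?_⟩
  · intro r h1 h2
    rcases split r h1 h2 with ⟨_, h3⟩ | rfl
    · rw [hu r h3]; exact H.lt r h1 h3
    · rwa [hself]
  · intro r h1 h2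
    rcases split r h1 h2 with ⟨_, h3⟩ | rfl
    · rw [hu r h3]; exact fun hh => H.notMem r h1 h3 hh.1
    · rw [hself]; simp
  · intro r r' h1 h2 h1' h2'
    rcases split r h1 h2 with ⟨_, h3⟩ | rfl <;> rcases split r' h1' h2' with ⟨_, h3'⟩ | rfl
    · rw [hu r h3, hu r' h3']; exact H.inj r r' h1 h3 h1' h3'
    · rw [hu r h3, hself]; exact fun hh => absurd hh (hne r h1 h3)
    · rw [hu r' h3', hself]; exact fun hh => absurd hh.symm (hne r' h1' h3')
    · simp
  · intro q hq
    by_cases hqp : q = p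
    · exact .inr ⟨c + 1, by omega, le_rfl, by rw [hself, hqp]⟩
    · rcases H.all q hq with hS | ⟨r, h1, h2, h3⟩
      · exact .inl ⟨hS, hqp⟩
      · exact .inr ⟨r, h1, by omega, by rw [hu r h2, h3]⟩
  · intro r r' h1 hlt h2'
    rw [hu r (by omega)]
    rcases split r' (by omega) h2' with ⟨_, h3'⟩ | rfl
    · rw [hu r' h3']; exact H.mono r r' h1 hlt h3'
    · rw [hself]; exact H.le r h1 (by omega) p hpS
  · intro r h1 h2 q hq
    rcases split r h1 h2 with ⟨_, h3⟩ | rfl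
    · rw [hu r h3]; exact H.le r h1 h3 q hq.1
    · rw [hself]; exact hmin q hq.1
  · intro r h1 h2
    rw [hR]
    rcases split r h1 h2 with ⟨_, h3⟩ | rfl
    · rw [hu r h3, Function.update_of_ne (hne r h1 h3)]; exact H.cR r h1 h3
    · rw [hself, Function.update_self]
  · intro r h1 h2
    rw [hLp]
    rcases split r h1 h2 with ⟨_, h3⟩ | rfl
    · rw [hu r h3, hu (r - 1) (by omega), Function.update_of_ne (hne r h1 h3)]; exact H.cLp r h1 h3
    · rw [hself, Function.update_self]
      simp [hu c le_rfl]
  · intro r h1 h2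
    rw [hLn]
    rcases split r h1 h2 with ⟨_, h3⟩ | rfl
    · rw [hu r h3, if_neg (by omega), if_neg (by omega)]
      by_cases hrc : r = c
      · subst hrc; rw [Function.update_self, hself]
      · rw [Function.update_of_ne (fun hh => hrc (H.inj r c h1 h3 (by omega) le_rfl hh)),
          hu (r + 1) (by omega), H.cLn r h1 h3, if_neg hrc]
    · rw [hself, if_pos rfl]
      split_ifs with hc0
      · exact H.cLnS p hpS
      · rw [Function.update_of_ne (hne c (by omega) le_rfl).symm]
        exact H.cLnS p hpS
  · intro q hq
    rw [hLn]
    split_ifs with hc0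
    · exact H.cLnS q hq.1
    · rw [Function.update_of_ne]
      · exact H.cLnS q hq.1
      · rintro rfl; exact H.notMem c (by omega) le_rfl hq.1
  · intro r h1 h2
    rcases split r h1 h2 with ⟨_, h3⟩ | rfl
    · rw [hu r h3, hLF' _ (hne r h1 h3)]; exact H.cLF r h1 h3
    · rw [hself, hLF]
  -- A node above leaf c + 1 now has the new point as its last one. Any other node has all its
  -- leaves among the first c or all of them beyond c + 1, and nothing changes there.
  · intro k e hk
    have h1 := hk.hi_eq
    have h2 := Nat.two_pow_pos e
    by_cases hcov : Covers h k e (c + 1)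
    · have h3 := hcov.1
      have h4 := hcov.2
      rw [(hMx k e hk).1 hcov, if_pos (by omega), min_eq_right (by omega), hself]
    · rw [(hMx k e hk).2 hcov, H.cMx k e hk]
      by_cases hlo : loOf h k e < c
      · have : hiOf h k e ≤ c := by
          by_contra hh
          exact hcov ⟨by omega, by omega⟩
        rw [if_pos hlo, if_pos (by omega), min_eq_left this, min_eq_left (by omega), hu _ this]
      · have : ¬ loOf h k e < c + 1 := fun hh => hcov ⟨hh, by omega⟩
        rw [if_neg hlo, if_neg this]

/-- Heap sort. The column `Ln` must be nil beforehand because the last point never gets a successor,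
and `Mx` because nodes beyond the last leaf in use are never written. -/
theorem PopAll_spec {B : ℕ} {P : HP} {R Lp Ln Mx LF h tb n : ℕ} {ix : ℕ → ℕ} {s : M}
    (hP : SortOK P R Lp Ln Mx LF) (ht : TreeS h tb s) (hpts : Pts P h n ix s)
    (H : HeapS P h tb n ix {p | p < n} s) (hn : 1 ≤ n) (hnh : n ≤ 2 ^ h) (hB : n ≤ B)
    (h5 : s.reg 5 = .num 1) (hLn : ∀ p < n, s.mem Ln p = .nil)
    (hMx : ∀ k e, IsNode h k e → s.mem Mx (tb + k) = .nil) :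
    wp B (PopAll P R Lp Ln Mx LF) s fun s' => s'.time ≤ s.time + n * (80 * (h + 2) + 15) + 10 ∧
      ∃ pt rk, Ranked n (P.key s) pt rk ∧ SortRes n h tb R Lp Ln Mx LF pt rk s' ∧
        s'.reg 32 = .ptr (pt n) := by
  have hOK := hP.hp
  have hP' := hP
  unfold SortOK at hP
  have hrf : tb + 1 < s.fresh := by
    have := ht.fresh
    have := Nat.two_pow_pos h
    omega
  simp [PopAll, -wp_al, ht.root, hrf]
  refine wp_while (fun μ s' => ∃ c S pt, c ≤ n ∧ μ = n - c ∧ HeapS P h tb n ix S s' ∧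
    Popped P n h tb R Lp Ln Mx LF (P.key s) S pt c s' ∧ s'.reg 31 = .num c ∧
    s'.reg 32 = (if c = 0 then .nil else .ptr (pt c)) ∧ s'.reg 33 = s'.mem P.T (tb + 1) ∧
    s'.time ≤ s.time + c * (80 * (h + 2) + 15) + 3) n (by decide) ?_ ?_ ?_
  · refine ⟨0, {p | p < n}, id, by omega, by omega, H.of rfl rfl rfl rfl, ?_, by simp, by simp,
      by simp, by simp⟩
    refine ⟨by omega, by omega, by omega, fun p hp => .inl hp, by omega, by omega, by omega, by omega,
      by omega, hLn, by omega, fun k e hk => ?_⟩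
    rw [if_neg (by omega)]
    exact hMx k e hk
  · rintro μ s' hF ⟨c, S, pt, hcn, rfl, HS, HP', h31, h32, h33, htime⟩ hne
    have hm : ∀ f, f ≠ R → f ≠ Lp → f ≠ Ln → f ≠ Mx → f ≠ LF → f ≠ P.T → f ≠ P.ND →
        s'.mem f = s.mem f := fun f a1 a2 a3 a4 a5 a6 a7 => by
      rw [hF.mem f (by simp [a1, a2, a3, a4, a5, a6, a7])]; rfl
    have ff : s'.fresh = s.fresh := (hF.fresh (by rfl))
    have ht' : TreeS h tb s' := ht.of ((hF.reg 8 (by rfl)).trans (by simp))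
      (hm _ (by omega) (by omega) (by omega) (by omega) (by omega) (by omega) (by omega))
      (hm _ (by omega) (by omega) (by omega) (by omega) (by omega) (by omega) (by omega))
      (hm _ (by omega) (by omega) (by omega) (by omega) (by omega) (by omega) (by omega)) ff.ge
    have hk1 : s'.mem P.k₁ = s.mem P.k₁ :=
      hm _ (by omega) (by omega) (by omega) (by omega) (by omega) (by omega) (by omega)
    have hk2 : s'.mem P.k₂ = s.mem P.k₂ :=
      hm _ (by omega) (by omega) (by omega) (by omega) (by omega) (by omega) (by omega)
    have hpts' : Pts P h n ix s' := hpts.of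
      (hm _ (by omega) (by omega) (by omega) (by omega) (by omega) (by omega) (by omega))
      hk1 hk2 ff.ge
    have h5' : s'.reg 5 = .num 1 := (hF.reg 5 (by rfl)).trans (by simp [h5])
    obtain ⟨p, hroot⟩ : ∃ p, s'.mem P.T (tb + 1) = .ptr p := by
      rcases HS.heap.kind 1 h (isNode_root h) with h1 | ⟨p, _, h1, _⟩
      · exact absurd (h33.trans h1) hne
      · exact ⟨p, h1⟩
    have hpS := (HS.heap.at (isNode_root h) hroot).1
    have hpn := HS.sub p hpS
    have hlt : c < n := card_bound HP'.lt HP'.inj hpn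
      (fun r h1 h2 h3 => HP'.notMem r h1 h2 (h3 ▸ hpS))
    have hpf : p < s'.fresh := hpn.trans_le hpts'.fr
    rw [hroot] at h33
    have hkey : P.key s' = P.key s := by rw [HP.key, hk1, hk2]
    have hmin : ∀ q ∈ S, P.key s p ≤ P.key s q := by
      intro q hq
      obtain ⟨k, e, hk, hTk⟩ := HS.heap.mem q hq
      obtain ⟨p', hp', hle⟩ := HS.heap.le_root hk hTk
      rw [hroot] at hp'
      cases hp'
      rwa [hkey] at hle
    refine wp.abs fun Q hQ => ?_
    have fin : ∀ s2 : M, s2.time ≤ s'.time + 10 → s2.fresh = s'.fresh → s2.reg 31 = .num (c + 1) →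
        s2.reg 33 = .ptr p → s2.reg 8 = s'.reg 8 → (∀ f, f ≠ R → f ≠ Lp → f ≠ Ln →
          s2.mem f = s'.mem f) → s2.mem R = Function.update (s'.mem R) p (.num (c + 1)) →
        s2.mem Lp = Function.update (s'.mem Lp) p (if c = 0 then .nil else .ptr (pt c)) →
        s2.mem Ln = (if c = 0 then s'.mem Ln else Function.update (s'.mem Ln) (pt c) (.ptr p)) →
        wp B (SortTail P Mx LF) s2 Q := by
      intro s2 g1 g2 g3 g4 g5 g6 g7 g8 g9
      refine (SortTail_spec (c := c + 1) (p := p) hP'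
        (ht'.of g5 (g6 _ (by omega) (by omega) (by omega)) (g6 _ (by omega) (by omega) (by omega))
          (g6 _ (by omega) (by omega) (by omega)) g2.ge)
        (hpts'.of (g6 _ (by omega) (by omega) (by omega)) (g6 _ (by omega) (by omega) (by omega))
          (g6 _ (by omega) (by omega) (by omega)) g2.ge)
        (HS.of (g6 _ (by omega) (by omega) (by omega)) (g6 _ (by omega) (by omega) (by omega))
          (g6 _ (by omega) (by omega) (by omega)) (g6 _ (by omega) (by omega) (by omega)))
        g3 (by omega) g4 (by rw [g6 _ (by omega) (by omega) (by omega)]; exact hroot)).frame ?_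
      rintro s3 hF3 ⟨t1, t2, t3, t4, t5, t6, t7⟩
      simp only [hQ]
      have k1 : s3.mem R = s2.mem R := hF3.mem R (by simp; omega)
      have k2 : s3.mem Lp = s2.mem Lp := hF3.mem Lp (by simp; omega)
      have k3 : s3.mem Ln = s2.mem Ln := hF3.mem Ln (by simp; omega)
      have k4 : s2.mem LF = s'.mem LF := g6 _ (by omega) (by omega) (by omega)
      have k5 : s2.mem Mx = s'.mem Mx := g6 _ (by omega) (by omega) (by omega)
      refine ⟨n - (c + 1), by omega, c + 1, S \ {p}, Function.update pt (c + 1) p, hlt, rfl, t1,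
        HP'.next hpS hpn hmin (k1.trans g7) (k2.trans g8) (k3.trans g9) t5 ?_ ?_, ?_, ?_, t3, ?_⟩
      · rw [← k4]; exact t6
      · rw [← k5]; exact t7
      · rw [hF3.reg 31 (by rfl), g3]
      · simp [t2]
      · nlinarith
    have hpc : ∀ hc : c ≠ 0, pt c < s'.fresh := fun hc =>
      (HP'.lt c (by omega) le_rfl).trans_le hpts'.fr
    have hRLp : R ≠ Lp := by omega
    have hRLn : R ≠ Ln := by omega
    have hLpLn : Lp ≠ Ln := by omega
    generalize SortTail P Mx LF = Tl at fin ⊢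
    simp [h31, h5', h33, hpf, h32, show c < B by omega]
    refine ⟨fun hc0 => fin _ (by simp) rfl (by simp) (by simp [h33]) (by simp) ?_ ?_ ?_ ?_, fun hc0 => ?_⟩
    · intro f a1 a2 a3; simp [a1, a2]
    · simp [hRLp]
    · simp [hRLp.symm, hc0]
    · simp [hRLn.symm, hLpLn.symm, hc0]
    · simp [hc0, hpc hc0, h33]
      refine fin _ (by simp) rfl (by simp) (by simp [h33]) (by simp) ?_ ?_ ?_ ?_
      · intro f a1 a2 a3; simp [a1, a2, a3]
      · simp [hRLp, hRLn]
      · simp [hRLp.symm, hLpLn, hc0]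
      · simp [hRLn.symm, hLpLn.symm, hc0]
  · rintro μ s' hF ⟨c, S, pt, hcn, rfl, HS, HP', h31, h32, h33, htime⟩ hnil
    rw [hnil] at h33
    have hS : S = ∅ := by
      ext q
      simp only [Set.mem_empty_iff_false, iff_false]
      intro hq
      obtain ⟨k, e, hk, hTk⟩ := HS.heap.mem q hq
      obtain ⟨p', hp', -⟩ := HS.heap.le_root hk hTk
      rw [← h33] at hp'
      cases hp'
    subst hS
    have hall : ∀ p < n, ∃ r, 1 ≤ r ∧ r ≤ c ∧ pt r = p := fun p hp => by
      rcases HP'.all p hp with h | h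
      · exact h.elim
      · exact h
    -- The heap is empty, so all n points are among the c removed ones.
    obtain rfl : c = n := by
      by_contra hne
      have : (Finset.range n).card ≤ ((Finset.Icc 1 c).image pt).card := by
        apply Finset.card_le_card
        intro x hx
        obtain ⟨r, h1, h2, h3⟩ := hall x (by simpa using hx)
        exact Finset.mem_image.2 ⟨r, by simp [h1, h2], h3⟩
      have h2 : ((Finset.Icc 1 c).image pt).card ≤ _ := Finset.card_image_le
      simp at this h2
      omega
    choose! rk hrk1 hrk2 hrk3 using hall
    have hrkpt : ∀ r, 1 ≤ r → r ≤ c → rk (pt r) = r := fun r h1 h2 =>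
      HP'.inj _ _ (hrk1 _ (HP'.lt r h1 h2)) (hrk2 _ (HP'.lt r h1 h2)) h1 h2 (hrk3 _ (HP'.lt r h1 h2))
    refine ⟨by simp; omega, pt, rk, ⟨HP'.lt, hrkpt, hrk1, hrk2, hrk3, ?_⟩, ⟨?_, ?_, ?_, ?_, HP'.cMx⟩, ?_⟩
    · intro p hp q hq hlt
      have := HP'.mono (rk p) (rk q) (hrk1 p hp) hlt (hrk2 q hq)
      rwa [hrk3 p hp, hrk3 q hq] at this
    · intro p hp
      have := HP'.cR (rk p) (hrk1 p hp) (hrk2 p hp)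
      rwa [hrk3 p hp] at this
    · intro p hp
      have := HP'.cLp (rk p) (hrk1 p hp) (hrk2 p hp)
      rwa [hrk3 p hp] at this
    · intro p hp
      have := HP'.cLn (rk p) (hrk1 p hp) (hrk2 p hp)
      rwa [hrk3 p hp] at this
    · intro p hp
      have := HP'.cLF (rk p) (hrk1 p hp) (hrk2 p hp)
      rwa [hrk3 p hp] at this
    · simp [h32, show c ≠ 0 by omega]

theorem SortBy_spec {B : ℕ} {P : HP} {R Lp Ln Mx LF h tb n : ℕ} {ix : ℕ → ℕ} {s : M}
    (hP : SortOK P R Lp Ln Mx LF) (ht : TreeS h tb s) (hpts : Pts P h n ix s) (hl : PtList n s)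
    (hT : ∀ k e, IsNode h k e → s.mem P.T (tb + k) = .nil) (hn : 1 ≤ n) (hnh : n ≤ 2 ^ h) (hB : n ≤ B)
    (h5 : s.reg 5 = .num 1) (hLn : ∀ p < n, s.mem Ln p = .nil)
    (hMx : ∀ k e, IsNode h k e → s.mem Mx (tb + k) = .nil) :
    wp B (SortBy P R Lp Ln Mx LF) s fun s' => s'.time ≤ s.time + n * (190 * (h + 2)) + 15 ∧
      ∃ pt rk, Ranked n (P.key s) pt rk ∧ SortRes n h tb R Lp Ln Mx LF pt rk s' ∧
        s'.reg 32 = .ptr (pt n) := by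
  have hP' := hP
  unfold SortOK at hP
  simp only [SortBy, wp_seq]
  refine (InsAll_spec hP'.hp (by omega) ht hpts ⟨heap_empty hT, by simp⟩ hl).frame ?_
  rintro s1 hF ⟨h1, h2⟩
  have hm : ∀ f, f ≠ P.T → f ≠ P.ND → s1.mem f = s.mem f := fun f a1 a2 =>
    hF.mem f (by simp [a1, a2])
  refine (PopAll_spec hP' (ht.of (hF.reg 8 (by rfl)) (hm _ (by omega) (by omega))
    (hm _ (by omega) (by omega)) (hm _ (by omega) (by omega)) hF.le)
    (hpts.of (hm _ (by omega) (by omega)) (hm _ (by omega) (by omega)) (hm _ (by omega) (by omega))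
    hF.le) h1 hn hnh hB ((hF.reg 5 (by rfl)).trans h5) (by rw [hm _ (by omega) (by omega)]; exact hLn)
    (by rw [hm _ (by omega) (by omega)]; exact hMx)).mono ?_
  rintro s2 ⟨h3, pt, rk, h4, h5⟩
  refine ⟨by nlinarith, pt, rk, ?_, h5⟩
  rwa [HP.key, hm _ (by omega) (by omega), hm _ (by omega) (by omega)] at h4

/-! ### Building the tree -/

theorem wp_loop {B : ℕ} {t : Test} {s : M} {Q : M → Prop} {p : Program} (I : ℕ → M → Prop) (k : ℕ)
    (h0 : I k s)
    (step : ∀ k s', Frame (.loop t p) s s' → I k s' →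
      s'.Holds t ∧ wp B p s'.tick (fun s'' => ∃ k' < k, I k' s'') ∨ s'.Fails t ∧ Q s'.tick) :
    wp B (.loop t p) s Q := by
  suffices H : ∀ k s', Frame (.loop t p) s s' → I k s' → wp B (.loop t p) s' Q from
    H k s (Frame.refl _ _) h0
  intro k
  induction k using Nat.strong_induction_on with
  | _ k ih =>
    intro s' hf hI
    rcases step k s' hf hI with ⟨ht, s1, he, k', hk', hI'⟩ | ⟨ht, hQ⟩
    · have hf1 := he.frame
      obtain ⟨s2, he2, hq⟩ := ih k' hk' s1 (hf.tr
        ⟨hf1.reg, hf1.mem, hf1.le, hf1.fresh, hf1.out⟩) hI'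
      exact ⟨s2, .loopTrue _ _ _ _ _ ht he he2, hq⟩
    · exact ⟨_, .loopFalse _ _ _ ht, hQ⟩

/-- Count and number the points. -/
def Count : Program :=
  nm 5 1 ;; nm 6 0 ;; nm 7 0 ;; mv 10 0 ;;
  whileNN 10 (ad 7 7 5 ;; st 10 4 7 ;; ld 10 10 0)

theorem Count_spec {B n : ℕ} {s : M} (hl : PtList n s) (hB : n ≤ B) (hB1 : 1 ≤ B)
    (hfr : n ≤ s.fresh) :
    wp B Count s fun s' => s'.time ≤ s.time + n * 9 + 8 ∧ s'.reg 5 = .num 1 ∧ s'.reg 6 = .num 0 ∧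
      s'.reg 7 = .num n ∧ ∀ p < n, s'.mem 4 p = .num (p + 1) := by
  simp [Count, hB1]
  refine wp_list (base := 0) (len := n) (fun i s' => s'.time ≤ s.time + i * 9 + 4 ∧
    s'.reg 7 = .num i ∧ ∀ p < i, s'.mem 4 p = .num (p + 1)) (by decide) (by simp [hl.head]) (by simp) ?_ ?_
  · rintro i hi s' hF ⟨h1, h2, h3⟩ hcur
    have g5 : s'.reg 5 = .num 1 := (hF.reg 5 (by rfl)).trans (by simp)
    have g6 : s'.reg 6 = .num 0 := (hF.reg 6 (by rfl)).trans (by simp)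
    have g0 : s'.mem 0 = s.mem 0 := hF.mem 0 (by simp)
    have gi : i < s'.fresh := hi.trans_le (hfr.trans hF.le)
    refine wp.abs fun R hR => ?_
    simp [h2, g5, hcur, gi, g6, g0, hl.next i hi, show i < B by omega]
    simp only [hR]
    refine ⟨⟨by simp; omega, by simp, fun p hp => ?_⟩, by simp⟩
    by_cases hh : p = i
    · simp [hh]
    · simp [hh]
      exact h3 p (by omega)
  · rintro s' hF ⟨h1, h2, h3⟩ -
    refine ⟨by simp; omega, ?_, ?_, by simp [h2], h3⟩
    · simp [hF.reg 5 (by rfl)]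
    · simp [hF.reg 6 (by rfl)]

/-- Records for the heights `0, 1, …, h` of the nodes, where `2 ^ h` is at least the number of points:
number of leaves (50), next smaller height (51), and a mark (52) for multiples of `⌊log₂ s⌋`. -/
def Levels : Program :=
  al 11 ;; nm 12 1 ;; nm 13 1 ;; st 11 50 12 ;; st 11 52 5 ;;
  .loop (.lt 12 7) (ad 12 12 12 ;; ad 13 13 13 ;; al 14 ;; st 14 50 12 ;; st 14 51 11 ;; mv 11 14 ;;
    ad 15 13 13 ;; ifLt 2 15 (st 11 52 5 ;; nm 13 1) .skip)

structure LevelS (h lb b : ℕ) (s : M) : Prop where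
  top : s.reg 11 = .ptr (lb + h)
  size : s.reg 12 = .num (2 ^ h)
  c50 : ∀ e ≤ h, s.mem 50 (lb + e) = .num (2 ^ e)
  c51 : ∀ e ≤ h, s.mem 51 (lb + e) = if e = 0 then .nil else .ptr (lb + e - 1)
  c52 : ∀ e ≤ h, s.mem 52 (lb + e) = if b ∣ e then .num 1 else .nil

/-- The number b = ⌊log₂ s⌋ is never computed. Register 13 holds 2^(e mod b); when doubling its next
value would exceed s, the exponent has reached b, the height is marked and the register returns to
1. -/
theorem Levels_spec {B n sp : ℕ} {s : M} (hn : 2 ≤ n) (hsp : 2 ≤ sp) (hspn : sp ≤ n) (hB : 4 * n ≤ B)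
    (h2 : s.reg 2 = .num sp) (h5 : s.reg 5 = .num 1) (h7 : s.reg 7 = .num n)
    (h51 : ∀ a, s.mem 51 a = .nil) (h52 : ∀ a, s.mem 52 a = .nil) :
    wp B Levels s fun s' => ∃ h, n ≤ 2 ^ h ∧ 2 ^ h < 2 * n ∧ LevelS h s.fresh (Nat.log 2 sp) s' ∧
      s'.fresh = s.fresh + h + 1 ∧ s'.time ≤ s.time + 12 * h + 6 := by
  obtain ⟨b, hb⟩ : ∃ b, b = Nat.log 2 sp := ⟨_, rfl⟩
  have hb1 : 2 ^ b ≤ sp := hb ▸ Nat.pow_log_le_self 2 (by omega)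
  have hb2 : sp < 2 ^ (b + 1) := hb ▸ Nat.lt_pow_succ_log_self (by norm_num) sp
  have hb0 : 1 ≤ b := hb ▸ Nat.log_pos (by norm_num) hsp
  rw [← hb]
  simp [Levels, show 1 ≤ B by omega]
  refine wp_loop (fun μ s' => ∃ e, μ = n - 2 ^ e ∧ (e = 0 ∨ 2 ^ e < 2 * n) ∧ LevelS e s.fresh b s' ∧
    s'.reg 13 = .num (2 ^ (e % b)) ∧ s'.fresh = s.fresh + e + 1 ∧ s'.time ≤ s.time + 12 * e + 5 ∧
    (∀ a ≥ s'.fresh, s'.mem 51 a = .nil ∧ s'.mem 52 a = .nil)) (n - 1) ?_ ?_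
  · refine ⟨0, by simp, .inl rfl, ⟨by simp, by simp, ?_, ?_, ?_⟩, by simp, by simp, by simp, ?_⟩
    · intro e he; obtain rfl : e = 0 := by omega
      simp
    · intro e he; obtain rfl : e = 0 := by omega
      simp [h51]
    · intro e he; obtain rfl : e = 0 := by omega
      simp [h5]
    · intro a ha
      simp at ha
      simp [h51, h52, Function.update_apply]
      omega
  · rintro μ s' hF ⟨e, rfl, he, ⟨l1, l2, l3, l4, l5⟩, h13, hfr, ht, hnil⟩
    have g2 : s'.reg 2 = .num sp := (hF.reg 2 (by rfl)).trans (by simp [h2])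
    have g5 : s'.reg 5 = .num 1 := (hF.reg 5 (by rfl)).trans (by simp [h5])
    have g7 : s'.reg 7 = .num n := (hF.reg 7 (by rfl)).trans (by simp [h7])
    by_cases hlt : 2 ^ e < n
    · refine .inl ⟨by simp [M.Holds, l2, g7, hlt], wp.abs fun R hR => ?_⟩
      have hm : e % b < b := Nat.mod_lt _ hb0
      have h13b : 2 ^ (e % b) ≤ sp := (Nat.pow_le_pow_right (by norm_num) hm.le).trans hb1
      have h13c : 2 ^ (e % b + 1) ≤ sp := (Nat.pow_le_pow_right (by norm_num) hm).trans hb1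
      have hp1 := pow_succ 2 (e % b)
      have hp2 := pow_succ 2 e
      have n1 := hnil s'.fresh le_rfl
      -- From 2^b ≤ s < 2^(b+1): the comparison s < 2^(e mod b + 2) holds exactly if e mod b + 1 =
      -- b.
      have hdiv : sp < 2 ^ (e % b) + 2 ^ (e % b) + (2 ^ (e % b) + 2 ^ (e % b)) ↔ b ∣ e + 1 := by
        constructor
        · intro hh
          have : e % b + 1 = b := by
            by_contra hne
            have h3 : 2 ^ (e % b + 2) ≤ sp :=
              (Nat.pow_le_pow_right (by norm_num) (by omega)).trans hb1
            have : 2 ^ (e % b + 2) = 4 * 2 ^ (e % b) := by ring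
            omega
          have h4 := Nat.div_add_mod e b
          exact ⟨e / b + 1, by rw [mul_add, mul_one]; omega⟩
        · intro hh
          have h4 : (e + 1) % b = 0 := Nat.mod_eq_zero_of_dvd hh
          have : e % b + 1 = b := by
            rw [Nat.add_mod] at h4
            rcases hb0.lt_or_eq with h6 | h6
            · rw [Nat.mod_eq_of_lt h6] at h4
              by_contra hne
              rw [Nat.mod_eq_of_lt (by omega)] at h4
              omega
            · omega
          rw [← this] at hb2
          have := pow_succ 2 (e % b + 1)
          omega
      have hmod : (e + 1) % b = if b ∣ e + 1 then 0 else e % b + 1 := by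
        split_ifs with hh
        · exact Nat.mod_eq_zero_of_dvd hh
        · have : e % b + 1 ≠ b := fun hh' => by
            have h4 := Nat.div_add_mod e b
            exact hh ⟨e / b + 1, by rw [mul_add, mul_one]; omega⟩
          rw [← Nat.mod_add_mod, Nat.mod_eq_of_lt (by omega)]
      have fin : ∀ s2 : M, s2.reg 11 = .ptr s'.fresh → s2.reg 12 = .num (2 ^ e + 2 ^ e) →
          s2.mem 50 = Function.update (s'.mem 50) s'.fresh (.num (2 ^ e + 2 ^ e)) →
          s2.mem 51 = Function.update (s'.mem 51) s'.fresh (.ptr (s.fresh + e)) →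
          s2.mem 52 = Function.update (s'.mem 52) s'.fresh (if b ∣ e + 1 then .num 1 else .nil) →
          s2.reg 13 = .num (2 ^ ((e + 1) % b)) →
          s2.fresh = s'.fresh + 1 → s2.time ≤ s'.time + 12 → R s2 := by
        intro s2 q1 q2 q3 q4 q5 q6 q7 q8
        simp only [hR]
        have hlt2 : 2 ^ e < 2 ^ (e + 1) := by have := Nat.two_pow_pos e; omega
        refine ⟨n - 2 ^ (e + 1), Nat.sub_lt_sub_left hlt hlt2, e + 1, rfl, .inr (by omega), ⟨by rw [q1, hfr]; rfl,
          by rw [q2, hp2]; congr 1; ring, ?_, ?_, ?_⟩, q6, by omega, by omega, ?_⟩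
        · intro d hd
          rw [q3, Function.update_apply]
          split_ifs with hh
          · obtain rfl : d = e + 1 := by omega
            rw [hp2]; congr 1; ring
          · exact l3 d (by omega)
        · intro d hd
          rw [q4, Function.update_apply]
          split_ifs with hh
          · omega
          · congr 1; omega
          · rename_i h0; rw [l4 d (by omega), if_pos h0]
          · rename_i h0; rw [l4 d (by omega), if_neg h0]
        · intro d hd
          rw [q5, Function.update_apply]
          by_cases hh : s.fresh + d = s'.fresh
          · obtain rfl : d = e + 1 := by omega
            rw [if_pos hh]
          · rw [if_neg hh]; exact l5 d (by omega)
        · intro a ha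
          rw [q4, q5, Function.update_of_ne (by omega), Function.update_of_ne (by omega)]
          exact hnil a (by omega)
      simp [l2, h13, l1, g2, g5, show 1 ≤ B by omega, show 2 ^ e + 2 ^ e ≤ B by omega,
        show 2 ^ (e % b) + 2 ^ (e % b) ≤ B by omega,
        show 2 ^ (e % b) + 2 ^ (e % b) + (2 ^ (e % b) + 2 ^ (e % b)) ≤ B by omega]
      refine ⟨fun hh => ?_, fun hh => ?_⟩
      · have hd := hdiv.1 hh
        refine fin _ (by simp) (by simp [l2]) (by simp) (by simp) ?_ ?_ rfl (by simp)
        · simp [hd]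
        · simp [hmod, hd]
      · have hd : ¬ b ∣ e + 1 := fun hd => by have := hdiv.2 hd; omega
        refine fin _ (by simp) (by simp [l2]) (by simp) (by simp) ?_ ?_ rfl (by simp)
        · simp [hd, Function.update_eq_self_iff, n1.2]
        · simp [hmod, hd]; omega
    · refine .inr ⟨by simp [M.Fails, l2, g7]; omega, e, by omega, ?_, ⟨l1, l2, l3, l4, l5⟩, hfr,
        by simp; omega⟩
      rcases he with rfl | he
      · simp; omega
      · exact he

/-- Field 32 is the queue of the breadth-first construction, and it remains as the list of nodes by
level. Register 18 receives the record of the height below that of the next node; it is nil when the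
next node is a leaf, which ends the construction. -/
def BfsTail : Program :=
  st 20 35 24 ;; st 21 35 24 ;; st 20 36 6 ;; st 21 36 6 ;; st 17 32 20 ;; st 20 32 21 ;; mv 17 21 ;;
  ld 16 16 32 ;; ld 18 16 34 ;; ld 18 18 51

/-- Attach two new children to the node in register 16. -/
def BfsHead : Program :=
  ld 19 18 50 ;; al 20 ;; al 21 ;; st 16 30 20 ;; st 20 31 21 ;; ld 22 16 31 ;;
    st 21 31 22 ;; ld 22 16 33 ;; st 21 33 22 ;; sb 22 22 19 ;; st 20 33 22

/-- The marked ancestor handed to the children is the node itself if it is the root or of marked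
height, and otherwise its own marked ancestor. -/
def BfsMid : Program :=
  st 20 34 18 ;; st 21 34 18 ;; nl 25 ;; ld 22 16 34 ;; ld 23 22 52 ;; ld 24 16 35 ;;
    ifEq 24 25 (mv 24 16) (ifEq 23 5 (mv 24 16) .skip)

/-- Build the complete binary tree in breadth-first order. Besides the fields of `TreeS` a node has
the next node (32), the record of its height (34), its nearest proper ancestor of marked height (35)
and a counter (36). -/
def Bfs : Program :=
  al 8 ;; st 8 33 12 ;; st 8 34 11 ;; st 8 36 6 ;; mv 16 8 ;; mv 17 8 ;; ld 18 11 51 ;;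
  whileNN 18 (BfsHead ;; BfsMid ;; BfsTail)

theorem BfsHead_spec {B a c l d hh : ℕ} {s : M} (h16 : s.reg 16 = .ptr a) (h18 : s.reg 18 = .ptr l)
    (hl : l < s.fresh) (ha : a < c) (h50 : s.mem 50 l = .num d) (hfr : s.fresh = c)
    (h33 : s.mem 33 a = .num hh) :
    wp B BfsHead s fun s' => s'.mem 30 = Function.update (s.mem 30) a (.ptr c) ∧
      s'.mem 31 = Function.update (Function.update (s.mem 31) c (.ptr (c + 1))) (c + 1)
        (s.mem 31 a) ∧
      s'.mem 33 = Function.update (Function.update (s.mem 33) (c + 1) (.num hh)) c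
        (.num (hh - d)) ∧
      s'.reg 20 = .ptr c ∧ s'.reg 21 = .ptr (c + 1) ∧ s'.fresh = c + 2 ∧ s'.time ≤ s.time + 11 := by
  subst hfr
  have h1 : Function.update (s.mem 31) s.fresh (.ptr (s.fresh + 1)) a = s.mem 31 a :=
    Function.update_of_ne (by omega) _ _
  simp [BfsHead, h16, h18, hl, h50, h33, h1, show a ≤ s.fresh + 1 by omega]

theorem BfsMid_spec {B a c l l' : ℕ} {s : M} (h16 : s.reg 16 = .ptr a) (h18 : s.reg 18 = .ptr l)
    (h20 : s.reg 20 = .ptr c) (h21 : s.reg 21 = .ptr (c + 1)) (hl : l' < s.fresh) (ha : a < c)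
    (hfr : s.fresh = c + 2) (h34 : s.mem 34 a = .ptr l') (h5 : s.reg 5 = .num 1) :
    wp B BfsMid s fun s' => s'.mem 34 = Function.update (Function.update (s.mem 34) c (.ptr l))
        (c + 1) (.ptr l) ∧
      s'.reg 24 = (open Classical in if s.mem 35 a = .nil ∨ s.mem 52 l' = .num 1 then .ptr a else
        s.mem 35 a) ∧ s'.time ≤ s.time + 9 := by
  have h1 : Function.update (Function.update (s.mem 34) c (.ptr l)) (c + 1) (.ptr l) a =
      .ptr l' := by
    rw [Function.update_of_ne (by omega), Function.update_of_ne (by omega), h34]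
  refine wp.abs fun R hR => ?_
  simp [BfsMid, h16, h18, h20, h21, h1, h5, hfr, show a < c + 2 by omega, show l' < c + 2 by omega]
  refine ⟨fun hh => ?_, fun hh => ⟨fun hd => ?_, fun hd => ?_⟩⟩ <;> simp only [hR] <;>
    simp [*]

theorem BfsTail_spec {B a c a' l l' : ℕ} {s : M} {w : Val} (h16 : s.reg 16 = .ptr a)
    (h17 : s.reg 17 = .ptr (c - 1)) (h20 : s.reg 20 = .ptr c) (h21 : s.reg 21 = .ptr (c + 1))
    (ha : a < c) (hfr : s.fresh = c + 2) (h6 : s.reg 6 = .num 0)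
    (hlink : Function.update (Function.update (s.mem 32) (c - 1) (.ptr c)) c (.ptr (c + 1)) a =
      .ptr a') (ha' : a' < c + 2) (h34 : s.mem 34 a' = .ptr l') (hl : l' < c + 2)
    (h51 : s.mem 51 l' = w) :
    wp B BfsTail s fun s' =>
      s'.mem 35 = Function.update (Function.update (s.mem 35) c (s.reg 24)) (c + 1) (s.reg 24) ∧
      s'.mem 36 = Function.update (Function.update (s.mem 36) c (.num 0)) (c + 1) (.num 0) ∧
      s'.mem 32 = Function.update (Function.update (s.mem 32) (c - 1) (.ptr c)) c (.ptr (c + 1)) ∧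
      s'.reg 16 = .ptr a' ∧ s'.reg 17 = .ptr (c + 1) ∧ s'.reg 18 = w ∧
      s'.time ≤ s.time + 10 := by
  simp [BfsTail, h16, h17, h20, h21, hfr, hlink, h34, h51, h6, ha', hl,
    show a < c + 2 by omega, show c - 1 < c + 2 by omega]

/-- The tree with the first `2 * k - 1` nodes. -/
structure BfsInv (h tb lb b k : ℕ) (s : M) : Prop where
  child : ∀ j, 1 ≤ j → j < k → s.mem 30 (tb + j) = .ptr (tb + 2 * j)
  childN : ∀ a, tb + k ≤ a → s.mem 30 a = .nil
  skip0 : s.mem 31 (tb + 1) = .nil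
  skipL : ∀ j, 1 ≤ j → j < k → s.mem 31 (tb + 2 * j) = .ptr (tb + (2 * j + 1))
  skipR : ∀ j, 1 ≤ j → j < k → s.mem 31 (tb + (2 * j + 1)) = s.mem 31 (tb + j)
  hi : ∀ j e, IsNode h j e → j < 2 * k → s.mem 33 (tb + j) = .num (hiOf h j e)
  lvl : ∀ j e, IsNode h j e → j < 2 * k → s.mem 34 (tb + j) = .ptr (lb + e)
  cnt : ∀ j, 1 ≤ j → j < 2 * k → s.mem 36 (tb + j) = .num 0
  bp0 : s.mem 35 (tb + 1) = .nil
  bp : ∀ j e, IsNode h j e → j < k → ∀ c, c = 2 * j ∨ c = 2 * j + 1 → s.mem 35 (tb + c) =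
    open Classical in if s.mem 35 (tb + j) = .nil ∨ b ∣ e then .ptr (tb + j) else s.mem 35 (tb + j)
  link : ∀ j, 1 ≤ j → j + 1 < 2 * k → s.mem 32 (tb + j) = .ptr (tb + (j + 1))
  linkN : ∀ a, tb + 2 * k ≤ a + 1 → s.mem 32 a = .nil

/-- When node k is expanded, exactly 2k - 1 nodes exist, so its children are allocated at offsets 2k
and 2k + 1. The breadth-first address of a node is therefore its heap number, without any address
arithmetic by the program. -/
theorem BfsInv.next {h tb lb b k e : ℕ} {s s' : M} (H : BfsInv h tb lb b k s)
    (hk : IsNode h k (e + 1)) {v : Val}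
    (hv : v = open Classical in if s.mem 35 (tb + k) = .nil ∨ b ∣ (e + 1) then .ptr (tb + k) else
      s.mem 35 (tb + k))
    (h30 : s'.mem 30 = Function.update (s.mem 30) (tb + k) (.ptr (tb + 2 * k)))
    (h31 : s'.mem 31 = Function.update (Function.update (s.mem 31) (tb + 2 * k)
      (.ptr (tb + (2 * k + 1)))) (tb + (2 * k + 1)) (s.mem 31 (tb + k)))
    (h33 : s'.mem 33 = Function.update (Function.update (s.mem 33) (tb + (2 * k + 1))
      (.num (hiOf h k (e + 1)))) (tb + 2 * k) (.num (hiOf h k (e + 1) - 2 ^ e)))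
    (h34 : s'.mem 34 = Function.update (Function.update (s.mem 34) (tb + 2 * k)
      (.ptr (lb + e))) (tb + (2 * k + 1)) (.ptr (lb + e)))
    (h35 : s'.mem 35 = Function.update (Function.update (s.mem 35) (tb + 2 * k) v)
      (tb + (2 * k + 1)) v)
    (h36 : s'.mem 36 = Function.update (Function.update (s.mem 36) (tb + 2 * k) (.num 0))
      (tb + (2 * k + 1)) (.num 0))
    (h32 : s'.mem 32 = Function.update (Function.update (s.mem 32) (tb + 2 * k - 1)
      (.ptr (tb + 2 * k))) (tb + 2 * k) (.ptr (tb + (2 * k + 1)))) :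
    BfsInv h tb lb b (k + 1) s' := by
  have hk1 := hk.pos
  have hl := hk.left
  have hr := hk.right
  have up : ∀ (f : ℕ → Val) (x y z : ℕ) (u w : Val), z ≠ x → z ≠ y →
      Function.update (Function.update f x u) y w z = f z := fun f x y z u w h1 h2 => by
    rw [Function.update_of_ne h2, Function.update_of_ne h1]
  have up1 : ∀ (f : ℕ → Val) (x y : ℕ) (u w : Val), x ≠ y →
      Function.update (Function.update f x u) y w x = u := fun f x y u w h1 => by
    rw [Function.update_of_ne h1, Function.update_self]
  refine ⟨?_, ?_, ?_, ?_, ?_, ?_, ?_, ?_, ?_, ?_, ?_, ?_⟩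
  · intro j h1 h2
    rw [h30]
    by_cases hj : j = k
    · subst hj; rw [Function.update_self]
    · rw [Function.update_of_ne (by omega)]; exact H.child j h1 (by omega)
  · intro a ha
    rw [h30, Function.update_of_ne (by omega)]
    exact H.childN a (by omega)
  · rw [h31, up _ _ _ _ _ _ (by omega) (by omega)]; exact H.skip0
  · intro j h1 h2
    rw [h31]
    by_cases hj : j = k
    · subst hj; rw [up1 _ _ _ _ _ (by omega)]
    · rw [up _ _ _ _ _ _ (by omega) (by omega)]; exact H.skipL j h1 (by omega)
  · intro j h1 h2
    rw [h31, up _ _ _ (tb + j) _ _ (by omega) (by omega)]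
    by_cases hj : j = k
    · subst hj; rw [Function.update_self]
    · rw [up _ _ _ _ _ _ (by omega) (by omega)]; exact H.skipR j h1 (by omega)
  · intro j d hj h2
    rw [h33]
    by_cases hj1 : j = 2 * k
    · subst hj1
      obtain rfl := hl.unique hj
      rw [Function.update_self]
      have h3 := hiOf_right h k e
      have h4 := hr.hi_eq
      have h5 := hiOf_left h k e
      congr 1; omega
    by_cases hj2 : j = 2 * k + 1
    · subst hj2
      obtain rfl := hr.unique hj
      rw [up1 _ _ _ _ _ (by omega), hiOf_right]
    · rw [up _ _ _ _ _ _ (by omega) (by omega)]; exact H.hi j d hj (by omega)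
  · intro j d hj h2
    rw [h34]
    by_cases hj1 : j = 2 * k
    · subst hj1
      obtain rfl := hl.unique hj
      rw [up1 _ _ _ _ _ (by omega)]
    by_cases hj2 : j = 2 * k + 1
    · subst hj2
      obtain rfl := hr.unique hj
      rw [Function.update_self]
    · rw [up _ _ _ _ _ _ (by omega) (by omega)]; exact H.lvl j d hj (by omega)
  · intro j h1 h2
    rw [h36]
    by_cases hj1 : j = 2 * k
    · subst hj1; rw [up1 _ _ _ _ _ (by omega)]
    by_cases hj2 : j = 2 * k + 1
    · subst hj2; rw [Function.update_self]
    · rw [up _ _ _ _ _ _ (by omega) (by omega)]; exact H.cnt j h1 (by omega)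
  · rw [h35, up _ _ _ _ _ _ (by omega) (by omega)]; exact H.bp0
  · intro j d hj h2 c hc
    rw [h35, up _ _ _ (tb + j) _ _ (by have := hj.pos; omega) (by have := hj.pos; omega)]
    by_cases hjk : j = k
    · subst hjk
      obtain rfl := hk.unique hj
      rw [← hv]
      rcases hc with rfl | rfl
      · rw [up1 _ _ _ _ _ (by omega)]
      · rw [Function.update_self]
    · rw [up _ _ _ _ _ _ (by omega) (by omega)]; exact H.bp j d hj (by omega) c hc
  · intro j h1 h2
    rw [h32]
    by_cases hj1 : j = 2 * k
    · subst hj1; rw [Function.update_self]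
    by_cases hj2 : j + 1 = 2 * k
    · rw [show tb + 2 * k - 1 = tb + j by omega, up1 _ _ _ _ _ (by omega), ← hj2]
    · rw [up _ _ _ _ _ _ (by omega) (by omega)]; exact H.link j h1 (by omega)
  · intro a ha
    rw [h32, up _ _ _ _ _ _ (by omega) (by omega)]
    exact H.linkN a (by omega)

theorem Bfs_spec {B h lb b : ℕ} {s : M} (hL : LevelS h lb b s) (hfr : s.fresh = lb + h + 1)
    (h5 : s.reg 5 = .num 1) (h6 : s.reg 6 = .num 0) (hb0 : b ≠ 0)
    (hnil : ∀ f, 30 ≤ f → f ≤ 36 → ∀ a, s.mem f a = .nil) :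
    wp B Bfs s fun s' => TreeS h (lb + h) s' ∧ BfsInv h (lb + h) lb b (2 ^ h) s' ∧
      s'.fresh = lb + h + 2 * 2 ^ h ∧ s'.time ≤ s.time + 40 * 2 ^ h + 20 := by
  obtain ⟨l1, l2, l3, l4, l5⟩ := hL
  have htb : lb + h + 1 = s.fresh := hfr.symm
  -- Heap numbers start at 1, so `tb` is one less than the address of the root: the last of the h +
  -- 1 records of heights.
  obtain ⟨tb, htb'⟩ : ∃ tb, tb = lb + h := ⟨_, rfl⟩
  rw [← htb']
  have hf1 : s.fresh = tb + 1 := by omega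
  simp [Bfs, l1, l2, hf1, h6, show lb + h ≤ tb + 1 by omega]
  refine wp_while (fun μ s' => ∃ k e, μ = 2 ^ h - k ∧ IsNode h k e ∧ k ≤ 2 ^ h ∧ BfsInv h tb lb b k s' ∧
    s'.reg 8 = .ptr (tb + 1) ∧ s'.reg 16 = .ptr (tb + k) ∧ s'.reg 17 = .ptr (tb + 2 * k - 1) ∧
    s'.reg 18 = s.mem 51 (lb + e) ∧ s'.fresh = tb + 2 * k ∧ s'.time ≤ s.time + 40 * k + 8)
    (2 ^ h - 1) (by decide) ?_ ?_ ?_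
  · have h2h := Nat.two_pow_pos h
    refine ⟨1, h, rfl, isNode_root h, h2h, ⟨by omega, ?_, ?_, by omega, by omega, ?_, ?_, ?_, ?_, ?_,
      by omega, ?_⟩, by simp [hf1], by simp [hf1], ?_, by simp, by simp [hf1], by simp⟩
    · simp [hnil 30]
    · simp [hnil 31]
    · intro j e hj h2
      have := hj.pos
      obtain rfl : j = 1 := by omega
      obtain rfl := hj.unique (isNode_root h)
      simp [hf1, l2, hiOf]; omega
    · intro j e hj h2
      have := hj.pos
      obtain rfl : j = 1 := by omega
      obtain rfl := hj.unique (isNode_root h)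
      simp [hf1, l1]
    · intro j h1 h2
      obtain rfl : j = 1 := by omega
      simp [hf1, h6]
    · simp [hnil 35]
    · intro j e hj h2
      have := hj.pos
      omega
    · simp [hnil 32]
    · simp [hf1]
  · rintro μ s' hF ⟨k, e, rfl, hk, hkn, HI, h8, h16, h17, h18, hfr', ht⟩ hne
    have he : e ≠ 0 := by
      rintro rfl
      apply hne
      rw [h18]
      simpa using l4 0 (by omega)
    obtain ⟨e, rfl⟩ := Nat.exists_eq_succ_of_ne_zero he
    rw [Nat.succ_eq_add_one] at hk h18
    have heh := hk.le
    have hlt := hk.internal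
    have hk1 := hk.pos
    have e51 : s'.mem 51 = s.mem 51 := (hF.mem 51 (by simp [BfsHead, BfsMid, BfsTail])).trans (by simp)
    have e50 : s'.mem 50 = s.mem 50 := (hF.mem 50 (by simp [BfsHead, BfsMid, BfsTail])).trans (by simp)
    have e52 : s'.mem 52 = s.mem 52 := (hF.mem 52 (by simp [BfsHead, BfsMid, BfsTail])).trans (by simp)
    have g5 : s'.reg 5 = .num 1 := (hF.reg 5 (by rfl)).trans (by simp [h5])
    have g6 : s'.reg 6 = .num 0 := (hF.reg 6 (by rfl)).trans (by simp [h6])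
    rw [l4 (e + 1) heh, if_neg (by omega), show lb + (e + 1) - 1 = lb + e by omega] at h18
    have hlv := HI.lvl k (e + 1) hk (by omega)
    have hhi := HI.hi k (e + 1) hk (by omega)
    have h50 := l3 e (by omega)
    have h52 := l5 (e + 1) heh
    have h51 := l4 e (by omega)
    -- the next node
    obtain ⟨e', hn'⟩ := exists_height (h := h) (k := k + 1) (by omega) (by omega)
    have he' := hn'.le
    have hlvl' : Function.update (Function.update (s'.mem 34) (tb + 2 * k)
        (.ptr (lb + e))) (tb + 2 * k + 1) (.ptr (lb + e)) (tb + (k + 1)) = .ptr (lb + e') := by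
      -- Only for k = 1 is the next node one that has just been created; otherwise its data are old.
      by_cases hk2 : k = 1
      · subst hk2
        rw [Function.update_of_ne (by omega), show tb + (1 + 1) = tb + 2 * 1 by omega,
          Function.update_self, hn'.unique hk.left]
      · rw [Function.update_of_ne (by omega), Function.update_of_ne (by omega)]
        exact HI.lvl (k + 1) e' hn' (by omega)
    have hlink : Function.update (Function.update (s'.mem 32) (tb + 2 * k - 1)
        (.ptr (tb + 2 * k))) (tb + 2 * k) (.ptr (tb + 2 * k + 1)) (tb + k) = .ptr (tb + (k + 1)) := by
      by_cases hk2 : k = 1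
      · subst hk2
        rw [Function.update_of_ne (by omega), show tb + 2 * 1 - 1 = tb + 1 by omega,
          Function.update_self]
      · rw [Function.update_of_ne (by omega), Function.update_of_ne (by omega)]
        exact HI.link k hk1 (by omega)
    have n34 : Function.update (Function.update (s'.mem 34) (tb + 2 * k)
        (.ptr (lb + e))) (tb + 2 * k + 1) (.ptr (lb + e)) (tb + k) = .ptr (lb + (e + 1)) := by
      rw [Function.update_of_ne (by omega), Function.update_of_ne (by omega), hlv]
    rw [wp_seq]
    refine (BfsHead_spec (a := tb + k) (c := tb + 2 * k) (l := lb + e) (s := s'.ent .nil)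
      (d := 2 ^ e) (hh := hiOf h k (e + 1))
      (by simp [h16]) (by simp [h18]) (by simp; omega) (by omega) (by simp [e50, h50])
      (by simp [hfr']) (by simp [hhi])).frame ?_
    rintro s1 hF1 ⟨p1, p2, p3, p4, p5, p6, p7⟩
    rw [wp_seq]
    refine (BfsMid_spec (a := tb + k) (c := tb + 2 * k) (l := lb + e) (l' := lb + (e + 1))
      ((hF1.reg 16 (by rfl)).trans (by simp [h16])) ((hF1.reg 18 (by rfl)).trans (by simp [h18]))
      p4 p5 (by omega) (by omega) p6 (by rw [hF1.mem 34 (by simp [BfsHead])]; simp [hlv])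
      ((hF1.reg 5 (by rfl)).trans (by simp [g5]))).frame ?_
    rintro s2 hF2 ⟨q1, q2, q3⟩
    have m32 : s2.mem 32 = s'.mem 32 := by
      rw [hF2.mem 32 (by simp [BfsMid]), hF1.mem 32 (by simp [BfsHead]), M.ent_mem]
    have m34 : s1.mem 34 = s'.mem 34 := by
      rw [hF1.mem 34 (by simp [BfsHead]), M.ent_mem]
    have m35 : s1.mem 35 = s'.mem 35 := by
      rw [hF1.mem 35 (by simp [BfsHead]), M.ent_mem]
    have m35' : s2.mem 35 = s'.mem 35 := by
      rw [hF2.mem 35 (by simp [BfsMid]), m35]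
    have m36 : s2.mem 36 = s'.mem 36 := by
      rw [hF2.mem 36 (by simp [BfsMid]), hF1.mem 36 (by simp [BfsHead]), M.ent_mem]
    have m51 : s2.mem 51 = s.mem 51 := by
      rw [hF2.mem 51 (by simp [BfsMid]), hF1.mem 51 (by simp [BfsHead]), M.ent_mem, e51]
    have m52 : s1.mem 52 = s.mem 52 := by
      rw [hF1.mem 52 (by simp [BfsHead]), M.ent_mem, e52]
    have f2 := hF2.fresh (by rfl)
    refine (BfsTail_spec (a := tb + k) (c := tb + 2 * k) (a' := tb + (k + 1)) (l' := lb + e')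
      (w := s.mem 51 (lb + e')) (l := 0)
      (by rw [hF2.reg 16 (by rfl), hF1.reg 16 (by rfl)]; simp [h16])
      (by rw [hF2.reg 17 (by rfl), hF1.reg 17 (by rfl)]; simp [h17])
      (by rw [hF2.reg 20 (by rfl), p4]) (by rw [hF2.reg 21 (by rfl), p5]) (by omega)
      (by omega) (by rw [hF2.reg 6 (by rfl), hF1.reg 6 (by rfl)]; simp [g6])
      (by rw [m32]; exact hlink) (by omega) (by rw [q1, m34]; exact hlvl') (by omega)
      (by rw [m51])).frame ?_
    rintro s3 hF3 ⟨r1, r2, r3, r4, r5, r6, r7⟩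
    have f3 := hF3.fresh (by rfl)
    have t0 : (s'.ent .nil).time = s'.time + 4 := rfl
    refine ⟨2 ^ h - (k + 1), by omega, k + 1, e', rfl, hn', hlt,
      HI.next hk (v := s2.reg 24) ?_ ?_ ?_ ?_ ?_ ?_ ?_ ?_, ?_, r4, ?_, r6, by omega, by omega⟩
    · rw [q2, m35, m52, h52]
      congr 1
      by_cases hbe : b ∣ e + 1 <;> simp [hbe]
    · rw [hF3.mem 30 (by simp [BfsTail]), hF2.mem 30 (by simp [BfsMid]), p1]; rfl
    · rw [hF3.mem 31 (by simp [BfsTail]), hF2.mem 31 (by simp [BfsMid]), p2]; rfl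
    · rw [hF3.mem 33 (by simp [BfsTail]), hF2.mem 33 (by simp [BfsMid]), p3]; rfl
    · rw [hF3.mem 34 (by simp [BfsTail]), q1, m34]; rfl
    · rw [r1, m35']; rfl
    · rw [r2, m36]; rfl
    · rw [r3, m32]; rfl
    · rw [hF3.reg 8 (by rfl), hF2.reg 8 (by rfl), hF1.reg 8 (by rfl)]; simp [h8]
    · rw [r5]; congr 1
  · rintro μ s' hF ⟨k, e, rfl, hk, hkn, HI, h8, h16, h17, h18, hfr', ht⟩ hnil
    have he : e = 0 := by
      by_contra he
      rw [hnil, l4 e hk.le, if_neg he] at h18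
      cases h18
    subst he
    obtain rfl : k = 2 ^ h := by have := hk.leaf; omega
    have h2h := Nat.two_pow_pos h
    refine ⟨⟨by simp [h8], by simp; omega, HI.child, fun k h1 _ => HI.childN _ (by omega), HI.skip0,
      HI.skipL, HI.skipR, fun k e hk => HI.hi k e hk (by have := hk.lt; omega)⟩,
      ⟨HI.child, HI.childN, HI.skip0, HI.skipL, HI.skipR, HI.hi, HI.lvl, HI.cnt, HI.bp0, HI.bp,
        HI.link, HI.linkN⟩, hfr', by simp; omega⟩

/-! ### Counting deleted points -/

/-- Height of the next marked proper ancestor of a node of height `e`. -/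
def bigH (h b e : ℕ) : ℕ := min h ((e / b + 1) * b)

theorem bigH_le (h b e : ℕ) : bigH h b e ≤ h := min_le_left _ _

theorem lt_bigH {h b e : ℕ} (hb : b ≠ 0) (he : e < h) : e < bigH h b e := by
  have := Nat.lt_div_mul_add (a := e) (Nat.pos_of_ne_zero hb)
  rw [bigH, add_mul, one_mul]
  exact lt_min he this

theorem bigH_mul {h b t : ℕ} (hb : b ≠ 0) : bigH h b (t * b) = min h ((t + 1) * b) := by
  rw [bigH, Nat.mul_div_cancel _ (Nat.pos_of_ne_zero hb)]

/-- The next multiple of b above a smaller height cannot jump over the multiple e. -/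
theorem bigH_le_of_lt {h b e e' : ℕ} (hb : b ≠ 0) (hbe : b ∣ e) (h1 : e' < e) : bigH h b e' ≤ e := by
  obtain ⟨t, rfl⟩ := hbe
  have h2 : e' / b < t := (Nat.div_lt_iff_lt_mul (Nat.pos_of_ne_zero hb)).2 (by rwa [mul_comm])
  refine (min_le_right _ _).trans ?_
  rw [mul_comm b t]
  exact Nat.mul_le_mul_right _ h2

theorem bigH_succ {h b e : ℕ} (hbe : ¬ b ∣ e + 1) : bigH h b (e + 1) = bigH h b e := by
  rw [bigH, bigH, Nat.succ_div_of_not_dvd hbe]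

theorem bigH_succ_of_dvd {h b e : ℕ} (hb : b ≠ 0) (hbe : b ∣ e + 1) (he : e < h) :
    bigH h b e = e + 1 := by
  have h1 := Nat.succ_div_of_dvd hbe
  have h2 := Nat.div_mul_cancel hbe
  rw [h1] at h2
  rw [bigH, h2]
  exact min_eq_right he

/-- The next marked proper ancestor of the node `k` of height `e`. -/
def bigN (h b k e : ℕ) : ℕ := k / 2 ^ (bigH h b e - e)

theorem IsNode.lt_of_two_le {h k e : ℕ} (hk : IsNode h k e) (h2 : 2 ≤ k) : e < h :=
  (hk.parent h2).le

theorem IsNode.two_le {h k e : ℕ} (hk : IsNode h k e) (he : e < h) : 2 ≤ k := by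
  by_contra hh
  have := hk.pos
  obtain rfl : k = 1 := by omega
  have := hk.unique (isNode_root h)
  omega

theorem IsNode.div {h k e : ℕ} (hk : IsNode h k e) {d : ℕ} (hd : e + d ≤ h) :
    IsNode h (k / 2 ^ d) (e + d) := by
  induction d with
  | zero => simpa using hk
  | succ d ih =>
    have h1 := ih (by omega)
    have := h1.parent (h1.two_le (by omega))
    rwa [Nat.div_div_eq_div_mul, ← pow_succ] at this

theorem loOf_mono (h e : ℕ) {k k' : ℕ} (hk : k ≤ k') : loOf h k e ≤ loOf h k' e :=
  Nat.sub_le_sub_right (Nat.mul_le_mul_right _ hk) _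

theorem loOf_div (h k e d : ℕ) : loOf h (k / 2 ^ d) (e + d) ≤ loOf h k e := by
  refine Nat.sub_le_sub_right ?_ _
  rw [pow_add, mul_comm (2 ^ e), ← mul_assoc]
  exact Nat.mul_le_mul_right _ (Nat.div_mul_le_self _ _)

theorem hiOf_div (h k e d : ℕ) : hiOf h k e ≤ hiOf h (k / 2 ^ d) (e + d) := by
  refine Nat.sub_le_sub_right ?_ _
  rw [pow_add, mul_comm (2 ^ e), ← mul_assoc]
  refine Nat.mul_le_mul_right _ ?_
  have := Nat.lt_div_mul_add (a := k) (Nat.two_pow_pos d)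
  rw [add_mul, one_mul]
  exact this

theorem Covers.div {h k e i : ℕ} (hc : Covers h k e i) (d : ℕ) :
    Covers h (k / 2 ^ d) (e + d) i :=
  ⟨(loOf_div h k e d).trans_lt hc.1, hc.2.trans (hiOf_div h k e d)⟩

theorem IsNode.big {h b k e : ℕ} (hb : b ≠ 0) (hk : IsNode h k e) (he : e < h) :
    IsNode h (bigN h b k e) (bigH h b e) := by
  have h1 := lt_bigH hb he
  have h2 := bigH_le h b e
  have := hk.div (d := bigH h b e - e) (by omega)
  rwa [Nat.add_sub_cancel' h1.le] at this

theorem Covers.big {h b k e i : ℕ} (hb : b ≠ 0) (he : e < h) (hc : Covers h k e i) :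
    Covers h (bigN h b k e) (bigH h b e) i := by
  have := hc.div (bigH h b e - e)
  rwa [Nat.add_sub_cancel' (lt_bigH hb he).le] at this

theorem loOf_big {h b e : ℕ} (hb : b ≠ 0) (he : e < h) (k : ℕ) :
    loOf h (bigN h b k e) (bigH h b e) ≤ loOf h k e := by
  have := loOf_div h k e (bigH h b e - e)
  rwa [Nat.add_sub_cancel' (lt_bigH hb he).le] at this

/-- Going right from `k`, the marked ancestor is that of `k` exactly as long as the nodes are below it. -/
theorem bigN_eq_iff {h b k e u e' : ℕ} (hb : b ≠ 0) (hbe : b ∣ e) (hk : IsNode h k e) (he : e < h)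
    (hku : k < u) (hu : IsNode h u e') :
    bigN h b u e' = bigN h b k e ↔
      u / 2 ^ (bigH h b e - e) = k / 2 ^ (bigH h b e - e) := by
  have h1 := lt_bigH hb he
  have h2 := bigH_le h b e
  have hlow : ∀ {k e}, IsNode h k e → 2 ^ (h - e) ≤ k := fun {k e} hk => by
    have := hk.1
    have h3 : 2 ^ h = 2 ^ (h - e) * 2 ^ e := by rw [← pow_add, Nat.sub_add_cancel hk.le]
    rw [h3] at this
    exact Nat.le_of_mul_le_mul_right this (Nat.two_pow_pos e)
  have hup : ∀ {k e}, IsNode h k e → k < 2 ^ (h - e + 1) := fun {k e} hk => by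
    have := hk.2
    have h3 : 2 * 2 ^ h = 2 ^ (h - e + 1) * 2 ^ e := by
      rw [← pow_add, show h - e + 1 + e = h + 1 by have := hk.le; omega, pow_succ, mul_comm]
    rw [h3] at this
    exact Nat.lt_of_succ_le (Nat.le_of_mul_le_mul_right this (Nat.two_pow_pos e))
  -- Heights do not increase along the numbering of the nodes.
  have hee : e' ≤ e := by
    by_contra hh
    have a1 := hlow hk
    have a2 := hup hu
    have a3 : 2 ^ (h - e' + 1) ≤ 2 ^ (h - e) :=
      Nat.pow_le_pow_right (by norm_num) (by have := hu.le; omega)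
    omega
  -- For a lower node both sides are false: its marked ancestor has height at most e, below that of
  -- the marked ancestor of `k`, and so a larger number; likewise its own number is too large for
  -- the quotient.
  rcases hee.lt_or_eq with hlt | rfl
  · have b1 := hu.big hb (by omega)
    have b2 := hk.big hb he
    have b3 := hlow b1
    have b4 := hup b2
    have b5 := bigH_le_of_lt (h := h) hb hbe hlt
    have b6 : 2 ^ (h - bigH h b e + 1) ≤ 2 ^ (h - bigH h b e') :=
      Nat.pow_le_pow_right (by norm_num) (by omega)
    have c1 := hlow hu
    have c2 : 2 ^ (h - bigH h b e + 1) ≤ u / 2 ^ (bigH h b e - e) := by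
      rw [Nat.le_div_iff_mul_le (Nat.two_pow_pos _), ← pow_add]
      exact (Nat.pow_le_pow_right (by norm_num) (by omega)).trans c1
    have b7 : k / 2 ^ (bigH h b e - e) = bigN h b k e := rfl
    constructor <;> intro hh <;> omega
  · rfl

/-- Equal marked ancestors force equal `bigH`. A smaller height is then impossible because `e`
itself is marked, and a larger one because `u` comes after `k`. -/
theorem bigN_height {h b k e u e' : ℕ} (hb : b ≠ 0) (hbe : b ∣ e) (hk : IsNode h k e) (he : e < h)
    (hku : k < u) (hu : IsNode h u e') (hbig : bigN h b u e' = bigN h b k e) : e' = e := by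
  have hue2 : e' < h := hu.lt_of_two_le (by have := hk.pos; omega)
  have b1 := hu.big hb hue2
  rw [hbig] at b1
  have b2 := b1.unique (hk.big hb he)
  have b3 := lt_bigH hb he
  by_contra hne
  rcases Nat.lt_or_gt_of_ne hne with h4 | h4
  · have := bigH_le_of_lt (h := h) hb hbe h4
    omega
  · have c1 := hk.1
    have c2 := hu.2
    have c3 : 2 ^ (e + 1) ≤ 2 ^ e' := Nat.pow_le_pow_right (by norm_num) h4
    rw [pow_succ] at c3
    have c5 := Nat.two_pow_pos e
    nlinarith [Nat.mul_le_mul_left (u + 1) c3]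

/-! ### Counters of deleted leaves -/

/-- The number of elements of `D` in `(a, b]`. -/
def cntI (D : Finset ℕ) (a b : ℕ) : ℕ := (D.filter fun x => a < x ∧ x ≤ b).card

theorem cntI_add (D : Finset ℕ) {a b c : ℕ} (h1 : a ≤ b) (h2 : b ≤ c) :
    cntI D a b + cntI D b c = cntI D a c := by
  rw [cntI, cntI, cntI, ← Finset.card_union_of_disjoint]
  · congr 1
    ext x
    simp only [Finset.mem_union, Finset.mem_filter]
    constructor
    · rintro (⟨h, h3, h4⟩ | ⟨h, h3, h4⟩) <;> exact ⟨h, by omega, by omega⟩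
    · rintro ⟨h, h3, h4⟩
      by_cases h5 : x ≤ b
      · exact .inl ⟨h, h3, h5⟩
      · exact .inr ⟨h, by omega, h4⟩
  · rw [Finset.disjoint_left]
    simp only [Finset.mem_filter]
    rintro x ⟨_, h3, h4⟩ ⟨_, h5, h6⟩
    omega

theorem cntI_self (D : Finset ℕ) (a : ℕ) : cntI D a a = 0 := by
  rw [cntI, Finset.card_eq_zero, Finset.filter_eq_empty_iff]
  intro x _; omega

theorem cntI_le (D : Finset ℕ) (a b : ℕ) : cntI D a b ≤ D.card := Finset.card_filter_le _ _

theorem cntI_insert {D : Finset ℕ} {i : ℕ} (hi : i ∉ D) (a b : ℕ) :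
    cntI (insert i D) a b = cntI D a b + if a < i ∧ i ≤ b then 1 else 0 := by
  rw [cntI, cntI, Finset.filter_insert]
  split_ifs with h
  · rw [Finset.card_insert_of_notMem (fun h' => hi (Finset.mem_filter.1 h').1)]
  · rw [add_zero]

/-- The counters count the deleted leaves to the left of a node, below its marked ancestor. -/
structure CntOK (h b : ℕ) (D : Finset ℕ) (c : ℕ → ℕ) : Prop where
  root : c 1 = 0
  cnt : ∀ k e, IsNode h k e → e < h → b ∣ e →
    c k = cntI D (loOf h (bigN h b k e) (bigH h b e)) (loOf h k e)

/-- The fields 35 (marked ancestor), 32 (next node in breadth-first order) and 36 (counter). -/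
structure CntS (h tb b : ℕ) (c : ℕ → ℕ) (s : M) : Prop where
  bp : ∀ k e, IsNode h k e → e < h → s.mem 35 (tb + k) = .ptr (tb + bigN h b k e)
  bp0 : s.mem 35 (tb + 1) = .nil
  link : ∀ k, 1 ≤ k → k < 2 * 2 ^ h →
    s.mem 32 (tb + k) = if k + 1 < 2 * 2 ^ h then .ptr (tb + (k + 1)) else .nil
  cnt : ∀ k, 1 ≤ k → k < 2 * 2 ^ h → s.mem 36 (tb + k) = .num (c k)
  fresh : tb + 2 * 2 ^ h ≤ s.fresh

theorem CntS.of {h tb b : ℕ} {c : ℕ → ℕ} {s s' : M} (H : CntS h tb b c s)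
    (h35 : s'.mem 35 = s.mem 35) (h32 : s'.mem 32 = s.mem 32) (h36 : s'.mem 36 = s.mem 36)
    (hle : s.fresh ≤ s'.fresh) : CntS h tb b c s' := by
  obtain ⟨h1, h2, h3, h4, h5⟩ := H
  refine ⟨?_, ?_, ?_, ?_, h5.trans hle⟩
  · rwa [h35]
  · rwa [h35]
  · rwa [h32]
  · rwa [h36]

/-- Unfolds the recurrence by which field 35 was built: a parent of unmarked height hands on its own
marked ancestor, having the same `bigH`, and a parent of marked height is itself that ancestor. The
root ends the chain whatever its height, as does the minimum in `bigH`. -/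
theorem BfsInv.cntS {h tb lb b : ℕ} {s : M} (H : BfsInv h tb lb b (2 ^ h) s) (hb : b ≠ 0)
    (hfr : tb + 2 * 2 ^ h ≤ s.fresh) : CntS h tb b (fun _ => 0) s := by
  refine ⟨?_, H.bp0, ?_, H.cnt, hfr⟩
  · intro k
    induction k using Nat.strong_induction_on with
    | _ k ih =>
      intro e hk he
      have h2 := hk.two_le he
      have hp := hk.parent h2
      have hp1 := hp.pos
      rw [H.bp (k / 2) (e + 1) hp hp.internal k (by omega)]
      rcases Nat.lt_or_ge (e + 1) h with h3 | h3
      · rw [ih (k / 2) (by omega) (e + 1) hp h3]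
        by_cases hbe : b ∣ e + 1
        · simp [hbe, bigN, bigH_succ_of_dvd hb hbe he]
        · have h4 := lt_bigH hb h3
          rw [bigH_succ hbe] at h4
          simp only [hbe, or_false, reduceCtorEq, if_false, bigN, bigH_succ hbe]
          rw [Nat.div_div_eq_div_mul, ← pow_succ',
            show bigH h b e - (e + 1) + 1 = bigH h b e - e by omega]
      · have h5 : k / 2 = 1 := by
          by_contra hh
          have := hp.lt_of_two_le (by omega)
          omega
        have h6 := lt_bigH hb he
        have h7 := bigH_le h b e
        rw [h5, H.bp0, if_pos (.inl rfl), bigN, show bigH h b e - e = 1 by omega, pow_one, h5]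
  · intro k h1 h2
    split_ifs with h3
    · exact H.link k h1 h3
    · exact H.linkN _ (by omega)

theorem cntOK_empty (h b : ℕ) : CntOK h b ∅ fun _ => 0 := ⟨rfl, fun _ _ _ _ _ => by simp [cntI]⟩

/-- Rank of the point in register 80 among the points that have not been deleted; result in 81. -/
def Rank : Program :=
  ld 81 80 6 ;; ld 82 80 20 ;; whileNN 82 (ld 83 82 36 ;; sb 81 81 83 ;; ld 82 82 35)

/-- On the climb from leaf i through its marked ancestors, the intervals covered by the counters
abut: each runs from the left end of the next node to the left end of the current one. Together they
make up (0, i - 1]. -/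
theorem Rank_spec {B h tb b i p : ℕ} {D : Finset ℕ} {c : ℕ → ℕ} {s : M} (hb : b ≠ 0)
    (H : CntS h tb b c s) (hD : CntOK h b D c) (h80 : s.reg 80 = .ptr p) (hp : p < s.fresh)
    (h6 : s.mem 6 p = .num i) (h20 : s.mem 20 p = .ptr (tb + (2 ^ h + i - 1))) (hi : 1 ≤ i)
    (hih : i ≤ 2 ^ h) :
    wp B Rank s fun s' => s'.reg 81 = .num (i - cntI D 0 (i - 1)) ∧
      s'.time ≤ s.time + 7 * (h / b) + 20 := by
  simp [Rank, h80, hp, h6, h20]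
  -- After t steps the height is min(h, tb); so at most h / b + 2 nodes are met, the root included.
  refine wp_while (fun μ s' => ∃ t, μ + t = h / b + 2 ∧ s'.time ≤ s.time + 2 + 7 * t ∧
    ((∃ k, t ≤ h / b + 1 ∧ IsNode h k (min h (t * b)) ∧ Covers h k (min h (t * b)) i ∧
      s'.reg 82 = .ptr (tb + k) ∧
      s'.reg 81 = .num (i - cntI D (loOf h k (min h (t * b))) (i - 1))) ∨
     (s'.reg 82 = .nil ∧ s'.reg 81 = .num (i - cntI D 0 (i - 1))))) (h / b + 2) (by decide) ?_ ?_ ?_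
  · refine ⟨0, rfl, by simp, .inl ⟨2 ^ h + i - 1, Nat.zero_le _, ?_, ?_, by simp, ?_⟩⟩
    · simpa using isNode_leaf hi hih
    · simp [Covers, loOf, hiOf]; omega
    · simp [loOf, show 2 ^ h + i - 1 - 2 ^ h = i - 1 by omega, cntI_self]
  · rintro μ s' hF ⟨t, hμ, ht, ⟨k, htb, hk, hc, h82, h81⟩ | ⟨h82, -⟩⟩ hne
    · have m36 := hF.mem 36 (by simp)
      have m35 := hF.mem 35 (by simp)
      have fr := hF.fresh (by rfl)
      have H' := H.of (s' := s') (m35.trans (by simp)) ((hF.mem 32 (by simp)).trans (by simp))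
        (m36.trans (by simp)) (by rw [fr]; simp)
      have hlt := hk.lt
      have hcnt := H'.cnt k hk.pos hlt
      have hfr := H'.fresh
      -- Iterated truncated subtraction is still subtraction of the sum, so no lower bound on
      -- register 81 has to be carried along.
      have tm : ∀ a b c : ℕ, a - b - c = a - (b + c) := fun a b c => by omega
      refine wp.abs fun R hR => ?_
      simp [h82, hcnt, h81, show tb + k < s'.fresh by omega]
      simp only [hR]
      refine ⟨μ - 1, by omega, t + 1, by omega, by simp; omega, ?_⟩
      obtain ⟨e, he⟩ : ∃ e, e = min h (t * b) := ⟨_, rfl⟩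
      rw [← he] at hk hc ⊢
      have h1 := hc.1
      rcases (show e ≤ h by rw [he]; exact min_le_left _ _).lt_or_eq with hlt | heq
      · have he' : e = t * b := by
          rcases min_choice h (t * b) with h2 | h2 <;> omega
        have hbe : b ∣ e := ⟨t, by rw [he', mul_comm]⟩
        have hH : bigH h b e = min h ((t + 1) * b) := by rw [he', bigH_mul hb]
        have hn := hk.big hb hlt
        have hcc := hc.big hb hlt
        have hlo := loOf_big hb hlt k
        rw [hH] at hn hcc
        have ht1 : t ≤ h / b := (Nat.le_div_iff_mul_le (Nat.pos_of_ne_zero hb)).2 (by omega)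
        refine .inl ⟨bigN h b k e, by omega, hn, hcc, by simp [H'.bp k e hk hlt], ?_⟩
        simp only [M.set_reg]
        simp only [reduceIte, show (81 : ℕ) ≠ 82 by decide, tm]
        rw [hD.cnt k e hk hlt hbe, ← hH, add_comm, cntI_add D hlo (by omega)]
      · rw [heq] at hk h1 ⊢
        have hk1 : k = 1 := by
          by_contra hh
          have := hk.lt_of_two_le (by have := hk.pos; omega)
          omega
        subst hk1
        refine .inr ⟨by simp [H'.bp0], ?_⟩
        simp [hD.root, loOf]
    · exact absurd h82 hne
  · rintro μ s' hF ⟨t, hμ, ht, ⟨k, -, -, -, h82, -⟩ | ⟨h82, h81⟩⟩ hnil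
    · rw [h82] at hnil; cases hnil
    · exact ⟨by simp [h81], by simp; omega⟩

/-- At the end of the level list the integer 0 stands in for the marked ancestor. It differs from
every pointer and so stops the loop in `Bump`. -/
def NextBp : Program := nl 88 ;; ifEq 85 88 (nm 87 0) (ld 87 85 35)

/-- Increment the counters of the right siblings of the node in register 82, where 84 is their common
marked ancestor. -/
def Bump : Program :=
  ld 85 82 32 ;; NextBp ;;
  .loop (.eq 87 84) (ld 86 85 36 ;; ad 86 86 5 ;; st 85 36 86 ;; ld 85 85 32 ;; NextBp)

/-- The nodes of height e below one marked ancestor are consecutive in the level list. Hence the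
nodes to be incremented are those after `k` until the marked ancestor changes. -/
theorem Bump_spec {B h tb b k e : ℕ} {c : ℕ → ℕ} {s : M} (hb : b ≠ 0) (H : CntS h tb b c s)
    (hk : IsNode h k e) (he : e < h) (hbe : b ∣ e)
    (hB : ∀ j, IsNode h j e → bigN h b j e = bigN h b k e → c j + 1 ≤ B)
    (h82 : s.reg 82 = .ptr (tb + k)) (h84 : s.reg 84 = .ptr (tb + bigN h b k e))
    (h5 : s.reg 5 = .num 1) :
    wp B Bump s fun s' => (∃ c', CntS h tb b c' s' ∧ ∀ j e', IsNode h j e' → c' j =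
        c j + if e' = e ∧ k < j ∧ bigN h b j e = bigN h b k e then 1 else 0) ∧
      s'.time ≤ s.time + 8 * 2 ^ b + 5 := by
  have hfr := H.fresh
  have hlt := hk.lt
  have hk1 := hk.pos
  -- The number of nodes of height e below their common marked ancestor; it bounds the number of
  -- increments.
  have h2d : 2 ^ (bigH h b e - e) ≤ 2 ^ b := by
    refine Nat.pow_le_pow_right (by norm_num) ?_
    obtain ⟨t, rfl⟩ := hbe
    rw [mul_comm b t, bigH_mul hb]
    have := min_le_right h ((t + 1) * b)
    rw [add_mul, one_mul] at this ⊢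
    omega
  set V : ℕ → M → Val := fun u s' => if u < 2 * 2 ^ h then s'.mem 35 (tb + u) else .num 0 with hV
  -- the common start and end of a step
  have next : ∀ (s1 : M) (u : ℕ) (Q : M → Prop), k ≤ u → u < 2 * 2 ^ h →
      s1.mem 35 = s.mem 35 → s.fresh ≤ s1.fresh →
      s1.reg 85 = (if u + 1 < 2 * 2 ^ h then .ptr (tb + (u + 1)) else .nil) →
      -- Here `v` only names the value that is loaded; the second alternative disposes of all
      -- others.
      (∀ v, Q (((s1.set 88 .nil).tick).set 87 v) ∨ v ≠ if u + 1 < 2 * 2 ^ h then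
        s.mem 35 (tb + (u + 1)) else .num 0) → wp B NextBp s1 Q := by
    intro s1 u Q hu hu2 h35 hfr1 h85 hQ
    have hQ := (hQ _).resolve_right (not_not.2 rfl)
    by_cases hh : u + 1 < 2 * 2 ^ h
    · rw [if_pos hh] at h85 hQ
      refine wp.abs fun R hR => ?_
      simp [NextBp, h85, h35, show tb + (u + 1) < s1.fresh by omega]
      rw [hR]; exact hQ
    · rw [if_neg hh] at h85 hQ
      refine wp.abs fun R hR => ?_
      simp [NextBp, h85]
      rw [hR]; exact hQ
  have hlink := H.link k hk1 hlt
  rw [Bump, wp_seq, wp_ld]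
  refine ⟨_, h82, by omega, ?_⟩
  rw [wp_seq]
  refine next _ k _ le_rfl hlt rfl le_rfl (by simp [hlink]) fun v => ?_
  rw [or_iff_not_imp_right, not_not]
  rintro rfl
  refine wp_loop (fun μ s' => ∃ u, μ = 2 * 2 ^ h - u ∧ k < u ∧ u ≤ 2 * 2 ^ h ∧
    (∀ j, k < j → j < u → j / 2 ^ (bigH h b e - e) = k / 2 ^ (bigH h b e - e)) ∧
    CntS h tb b (fun j => c j + if k < j ∧ j < u then 1 else 0) s' ∧
    s'.reg 85 = (if u < 2 * 2 ^ h then .ptr (tb + u) else .nil) ∧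
    s'.reg 87 = (if u < 2 * 2 ^ h then s.mem 35 (tb + u) else .num 0) ∧
    s'.time ≤ s.time + 4 + 8 * (u - (k + 1))) (2 * 2 ^ h - (k + 1)) ?_ ?_
  · refine ⟨k + 1, rfl, by omega, by omega, fun j h1 h2 => by omega, ?_, by simp [hlink], by simp,
      by simp⟩
    have : (fun j => c j + if k < j ∧ j < k + 1 then 1 else 0) = c := by
      funext j
      rw [if_neg (by omega), add_zero]
    rw [this]
    exact H.of (by simp) (by simp) (by simp) (by simp)
  · rintro μ s' hF ⟨u, rfl, hku, hu2, hq, H', h85, h87, ht⟩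
    have g84 : s'.reg 84 = .ptr (tb + bigN h b k e) := (hF.reg 84 (by rfl)).trans (by simp [h84])
    have g5 : s'.reg 5 = .num 1 := (hF.reg 5 (by rfl)).trans (by simp [h5])
    have fr := hF.fresh (by rfl)
    simp only [M.set_fresh, M.tick_fresh] at fr
    by_cases hcase : u < 2 * 2 ^ h ∧ u / 2 ^ (bigH h b e - e) = k / 2 ^ (bigH h b e - e)
    · obtain ⟨hu, hd⟩ := hcase
      rw [if_pos hu] at h85 h87
      obtain ⟨e', hue⟩ := exists_height (h := h) (k := u) (by omega) hu
      have hbig := (bigN_eq_iff hb hbe hk he hku hue).2 hd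
      have hue2 : e' < h := hue.lt_of_two_le (by omega)
      have hbp := H.bp u e' hue hue2
      have hee : e' = e := bigN_height hb hbe hk he hku hue hbig
      subst hee
      refine .inl ⟨by simp [M.Holds, h87, g84, hbp, hbig], wp.abs fun R hR => ?_⟩
      have hcnt := H'.cnt u (by omega) hu
      simp only [lt_irrefl, and_false, if_false, add_zero] at hcnt
      have hBu := hB u hue hbig
      have hlk := H'.link u (by omega) hu
      have hfu : tb + u < s'.fresh := by omega
      have hBu' : c u < B := hBu
      simp only [wp_seq, wp_ld, wp_ad, wp_st, M.tick_reg, h85, M.tick_fresh, hfu, true_and,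
        Val.ptr.injEq, exists_eq_left', M.set_reg, M.set_fresh, M.set_mem, M.tick_mem, if_true,
        if_false, hcnt, Val.num.injEq, g5, hBu, M.sto_reg, M.sto_fresh, M.sto_mem, reduceIte, hlk,
        Nat.reduceEqDiff, show (86 : ℕ) ≠ 85 by decide, show (85 : ℕ) ≠ 86 by decide, show (5 : ℕ) ≠ 86 by decide, show (32 : ℕ) ≠ 36 by decide]
      refine next _ u _ hku.le hu ?_ ?_ ?_ fun v => ?_
      · have := hF.mem 35 (by rfl)
        simpa using this
      · simp [fr]
      · simp
      rw [or_iff_not_imp_right, not_not]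
      rintro rfl
      simp only [hR]
      refine ⟨2 * 2 ^ h - (u + 1), by omega, u + 1, rfl, by omega, by omega, ?_, ?_, by simp, by simp,
        by simp; omega⟩
      · intro j h1 h2
        rcases (show j ≤ u by omega).lt_or_eq with h3 | rfl
        · exact hq j h1 h3
        · exact hd
      · refine ⟨fun k' e hk' he' => ?_, ?_, ?_, ?_, ?_⟩
        · simpa using H'.bp k' e hk' he'
        · simpa using H'.bp0
        · simpa using H'.link
        · intro j h1 h2
          by_cases hj : j = u
          · subst hj
            simp [hku]
          · have := H'.cnt j h1 h2
            simp [hj, this, show (j ≤ u ↔ j < u) by omega]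
        · simpa using H'.fresh
    · have hfail : s'.reg 87 ≠ s'.reg 84 := by
        rw [h87, g84]
        split_ifs with hu
        · obtain ⟨e', hue⟩ := exists_height (h := h) (k := u) (by omega) hu
          rw [H.bp u e' hue (hue.lt_of_two_le (by omega))]
          intro hh
          simp only [Val.ptr.injEq, Nat.add_left_cancel_iff] at hh
          exact hcase ⟨hu, (bigN_eq_iff hb hbe hk he hku hue).1 hh⟩
        · simp
      refine .inr ⟨hfail, ⟨_, H'.of rfl rfl rfl le_rfl, fun j e' hj => ?_⟩, ?_⟩
      · congr 1
        have : (k < j ∧ j < u) ↔ (e' = e ∧ k < j ∧ bigN h b j e = bigN h b k e) := by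
          constructor
          · rintro ⟨h1, h2⟩
            have h3 := hq j h1 h2
            refine ⟨?_, h1, h3⟩
            exact bigN_height hb hbe hk he h1 hj ((bigN_eq_iff hb hbe hk he h1 hj).2 h3)
          · rintro ⟨rfl, h1, h2⟩
            refine ⟨h1, ?_⟩
            -- A later node with the right quotient would, since division is monotone, force the
            -- node at which the loop stopped to have it as well.
            by_contra hh
            have h3 := hj.lt
            refine hcase ⟨by omega, le_antisymm ?_ (Nat.div_le_div_right hku.le)⟩
            refine (Nat.div_le_div_right (show u ≤ j by omega)).trans h2.le
        simp only [this]
      -- The last incremented node has the same quotient by 2^(bigH - e) as `k`, so it is less than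
      -- that power away.
      · have h1 : u - 1 < k + 2 ^ (bigH h b e - e) := by
          rcases (show k + 1 ≤ u from hku).lt_or_eq with h2 | h2
          · have h3 := hq (u - 1) (by omega) (by omega)
            have h4 := Nat.lt_div_mul_add (a := u - 1) (Nat.two_pow_pos (bigH h b e - e))
            have h5 := Nat.div_mul_le_self k (2 ^ (bigH h b e - e))
            rw [h3] at h4
            omega
          · have := Nat.two_pow_pos (bigH h b e - e); omega
        simp; omega

/-- Delete the point in register 80 from the counters. -/
def Update : Program :=
  ld 82 80 20 ;; ld 84 82 35 ;; whileNN 84 (Bump ;; mv 82 84 ;; ld 84 84 35)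

/-- Connects the two descriptions of a deletion: the nodes that `Bump` increments at height e are
exactly those whose counting interval contains the deleted leaf. -/
theorem bump_iff {h b k k' e i : ℕ} (hb : b ≠ 0) (hk : IsNode h k e) (hk' : IsNode h k' e)
    (he : e < h) (hc : Covers h k e i) :
    (k < k' ∧ bigN h b k' e = bigN h b k e) ↔
      loOf h (bigN h b k' e) (bigH h b e) < i ∧ i ≤ loOf h k' e := by
  have hcb := hc.big hb he
  constructor
  · rintro ⟨h1, h2⟩
    rw [h2]
    exact ⟨hcb.1, hc.2.trans (loOf_mono h e h1)⟩
  · rintro ⟨h1, h2⟩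
    constructor
    · by_contra hh
      exact absurd (h2.trans (loOf_mono h e (not_lt.1 hh))) (not_le.2 hc.1)
    · refine Covers.unique (hk'.big hb he) (hk.big hb he) ⟨h1, ?_⟩ hcb
      have := hiOf_div h k' e (bigH h b e - e)
      rw [Nat.add_sub_cancel' (lt_bigH hb he).le] at this
      have h3 := hk'.hi_eq
      have h4 := Nat.two_pow_pos e
      refine (h2.trans ?_).trans this
      omega

/-- The deleted leaf climbs through its marked ancestors. At each stage the counters of heights
below the current one already count it, and the others do not yet. -/
theorem Update_spec {B h tb b i p : ℕ} {D : Finset ℕ} {c : ℕ → ℕ} {s : M} (hb : b ≠ 0)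
    (H : CntS h tb b c s) (hD : CntOK h b D c) (h80 : s.reg 80 = .ptr p) (hp : p < s.fresh)
    (h20 : s.mem 20 p = .ptr (tb + (2 ^ h + i - 1))) (hi : 1 ≤ i) (hih : i ≤ 2 ^ h) (hiD : i ∉ D)
    (hDB : D.card + 1 ≤ B) (h5 : s.reg 5 = .num 1) (hh : 1 ≤ h) :
    wp B Update s fun s' => (∃ c', CntS h tb b c' s' ∧ CntOK h b (insert i D) c') ∧
      s'.time ≤ s.time + (h / b + 1) * (8 * 2 ^ b + 11) + 6 := by
  have hleaf := isNode_leaf hi hih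
  have hlt := hleaf.lt
  have hfr := H.fresh
  have hbp := H.bp _ _ hleaf (by omega)
  have hcl : Covers h (2 ^ h + i - 1) 0 i := by simp [Covers, loOf, hiOf]; omega
  simp [Update, h80, hp, h20, show tb + (2 ^ h + i - 1) < s.fresh by omega, hbp]
  refine wp_while (fun μ s' => ∃ t, μ + t = h / b + 1 ∧
    s'.time ≤ s.time + 2 + t * (8 * 2 ^ b + 11) ∧
    ∃ k, IsNode h k (min h (t * b)) ∧ Covers h k (min h (t * b)) i ∧
      s'.reg 82 = .ptr (tb + k) ∧ s'.reg 84 = (if min h (t * b) = h then .nil else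
        .ptr (tb + bigN h b k (min h (t * b)))) ∧
      ∃ c', CntS h tb b c' s' ∧ c' 1 = 0 ∧ ∀ j e, IsNode h j e → e < h → b ∣ e → c' j = c j +
        if e < min h (t * b) ∧ loOf h (bigN h b j e) (bigH h b e) < i ∧ i ≤ loOf h j e then 1 else 0)
    (h / b + 1) (by decide) ?_ ?_ ?_
  · refine ⟨0, rfl, by simp, 2 ^ h + i - 1, by simpa using hleaf, by simpa using hcl, by simp, ?_,
      c, H.of rfl rfl rfl le_rfl, hD.root, fun j e _ _ _ => by simp⟩
    simp; omega
  · rintro μ s' hF ⟨t, hμ, ht, k, hk, hc, h82, h84, c', H', hc1, hc'⟩ hne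
    have g5 : s'.reg 5 = .num 1 := (hF.reg 5 (by rfl)).trans (by simp [h5])
    obtain ⟨e, he⟩ : ∃ e, e = min h (t * b) := ⟨_, rfl⟩
    rw [← he] at hk hc h84 hc'
    have hlt : e < h := by
      rcases (show e ≤ h by rw [he]; exact min_le_left _ _).lt_or_eq with h1 | h1
      · exact h1
      · rw [if_pos h1] at h84; exact absurd h84 hne
    rw [if_neg (by omega)] at h84
    have he' : e = t * b := by
      rcases min_choice h (t * b) with h2 | h2 <;> omega
    have hbe : b ∣ e := ⟨t, by rw [he', mul_comm]⟩
    have hH : bigH h b e = min h ((t + 1) * b) := by rw [he', bigH_mul hb]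
    have ht1 : t ≤ h / b := (Nat.le_div_iff_mul_le (Nat.pos_of_ne_zero hb)).2 (by omega)
    have hn := hk.big hb hlt
    have hcc := hc.big hb hlt
    rw [wp_seq]
    refine (Bump_spec (c := c') (s := s'.ent .nil) hb (H'.of rfl rfl rfl le_rfl) hk hlt hbe ?_
      (by simp [h82]) (by simp [h84]) (by simp [g5])).frame ?_
    -- Counters of the current height are still the old ones, so they are at most the number of
    -- deleted points and may be incremented without exceeding `B`.
    · intro j hj _
      have h1 := hc' j e hj hlt hbe
      rw [if_neg (by omega), add_zero, hD.cnt j e hj hlt hbe] at h1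
      have := cntI_le D (loOf h (bigN h b j e) (bigH h b e)) (loOf h j e)
      omega
    rintro s1 hF1 ⟨⟨c2, H2, hc2⟩, ht2⟩
    have q84 : s1.reg 84 = .ptr (tb + bigN h b k e) := (hF1.reg 84 (by rfl)).trans (by simp [h84])
    have hfr1 := H2.fresh
    have hlt1 := hn.lt
    refine wp.abs fun R hR => ?_
    simp [q84, show tb + bigN h b k e < s1.fresh by omega]
    simp only [hR]
    have t0 : (s'.ent .nil).time = s'.time + 4 := rfl
    refine ⟨μ - 1, by omega, t + 1, by omega, by simp; rw [add_mul]; omega, bigN h b k e, ?_, ?_, by simp, ?_,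
      c2, H2.of rfl rfl rfl le_rfl, ?_, ?_⟩
    · rwa [← hH]
    · rwa [← hH]
    · rw [← hH]
      split_ifs with h1
      · have : bigN h b k e = 1 := by
          rw [h1] at hn
          by_contra hh
          have := hn.lt_of_two_le (by have := hn.pos; omega)
          omega
        simp [this, H2.bp0]
      · have := bigH_le h b e
        simp [H2.bp _ _ hn (by omega)]
    · rw [hc2 1 h (isNode_root h), if_neg (by omega), hc1]
    · intro j d hj hd hbd
      rw [← hH, hc2 j d hj, hc' j d hj hd hbd, add_assoc]
      congr 1
      have h3 := lt_bigH hb hlt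
      rcases Nat.lt_trichotomy d e with h4 | h4 | h4
      · rw [if_neg (show ¬ (d = e ∧ _) by omega), add_zero]
        simp [h4, h4.trans h3]
      · subst h4
        simp only [lt_irrefl, false_and, if_false, true_and, h3, zero_add]
        simp only [bump_iff hb hk hj hd hc]
      · have h5 : ¬ d < bigH h b e := by
          have := bigH_le_of_lt (h := h) hb hbd h4
          omega
        rw [if_neg (by omega), if_neg (by omega), if_neg (by omega)]
  · rintro μ s' hF ⟨t, hμ, ht, k, hk, hc, h82, h84, c', H', hc1, hc'⟩ hnil
    have hm : min h (t * b) = h := by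
      by_contra h1
      rw [h84, if_neg h1] at hnil
      cases hnil
    rw [hm] at hc'
    refine ⟨⟨c', H'.of rfl rfl rfl le_rfl, hc1, fun j e hj he hbe => ?_⟩, ?_⟩
    · rw [hc' j e hj he hbe, hD.cnt j e hj he hbe, cntI_insert hiD]
      simp only [he, true_and]
    · have := Nat.mul_le_mul_right (8 * 2 ^ b + 11) (show t ≤ h / b + 1 by omega)
      simp; omega

/-! ### Reporting from a priority search tree -/

section
variable (T : ℕ → Val) (tb : ℕ)

def top (k : ℕ) : List ℕ := match T (tb + k) with
  | .ptr p => [p]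
  | _ => []

/-- The points stored below a node, in preorder. -/
def sub : ℕ → ℕ → List ℕ
  | 0, k => top T tb k
  | e + 1, k => top T tb k ++ (sub e (2 * k) ++ sub e (2 * k + 1))

end

theorem mem_top {T : ℕ → Val} {tb k p : ℕ} : p ∈ top T tb k ↔ T (tb + k) = .ptr p := by
  unfold top
  split <;> simp_all [eq_comm]

theorem exists_node_of_mem_sub {T : ℕ → Val} {tb h p : ℕ} : ∀ {e k}, IsNode h k e → p ∈ sub T tb e k →
    ∃ k' e', IsNode h k' e' ∧ e' ≤ e ∧ k' / 2 ^ (e - e') = k ∧ T (tb + k') = .ptr p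
  | 0, k, hk, hp => ⟨k, 0, hk, le_rfl, by simp, mem_top.1 hp⟩
  | e + 1, k, hk, hp => by
    have aux : ∀ c, c / 2 = k → IsNode h c e → p ∈ sub T tb e c → ∃ k' e', IsNode h k' e' ∧
        e' ≤ e + 1 ∧ k' / 2 ^ (e + 1 - e') = k ∧ T (tb + k') = .ptr p := fun c hc hn hp => by
      obtain ⟨k', e', h1, h2, h3, h4⟩ := exists_node_of_mem_sub hn hp
      refine ⟨k', e', h1, by omega, ?_, h4⟩
      rw [show e + 1 - e' = e - e' + 1 by omega, pow_succ, ← Nat.div_div_eq_div_mul, h3, hc]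
    rw [sub, List.mem_append, List.mem_append] at hp
    rcases hp with hp | hp | hp
    · exact ⟨k, e + 1, hk, le_rfl, by simp, mem_top.1 hp⟩
    · exact aux _ (by omega) hk.left hp
    · exact aux _ (by omega) hk.right hp

theorem mem_sub_of_node {T : ℕ → Val} {tb h k e p : ℕ} (hk : IsNode h k e)
    (hp : T (tb + k) = .ptr p) : ∀ d, e + d ≤ h → p ∈ sub T tb (e + d) (k / 2 ^ d)
  | 0, _ => by
    rw [pow_zero, Nat.div_one, add_zero]
    cases e with
    | zero => exact mem_top.2 hp
    | succ e => exact List.mem_append_left _ (mem_top.2 hp)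
  | d + 1, hd => by
    have ih := mem_sub_of_node hk hp d (by omega)
    have h2 : k / 2 ^ (d + 1) = k / 2 ^ d / 2 := by rw [pow_succ, Nat.div_div_eq_div_mul]
    rw [← add_assoc, sub, h2]
    refine List.mem_append_right _ ?_
    rcases Nat.mod_two_eq_zero_or_one (k / 2 ^ d) with h1 | h1
    · refine List.mem_append_left _ ?_
      rwa [show 2 * (k / 2 ^ d / 2) = k / 2 ^ d by omega]
    · refine List.mem_append_right _ ?_
      rwa [show 2 * (k / 2 ^ d / 2) + 1 = k / 2 ^ d by omega]

section
variable {K : Type*} [LinearOrder K] {h tb : ℕ} {T ND : ℕ → Val} {κ : ℕ → K} {ix : ℕ → ℕ}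
  {S : Set ℕ}

theorem HeapH.mem_sub_root (H : Heap h tb T ND κ ix S) {p : ℕ} : p ∈ sub T tb h 1 ↔ p ∈ S := by
  constructor
  · intro hp
    obtain ⟨k, e, hk, -, -, hT⟩ := exists_node_of_mem_sub (isNode_root h) hp
    exact (H.at hk hT).1
  · intro hp
    obtain ⟨k, e, hk, hT⟩ := H.mem p hp
    have h1 := mem_sub_of_node hk hT (h - e) (by have := hk.le; omega)
    have h2 := hk.div (d := h - e) (by have := hk.le; omega)
    rw [show e + (h - e) = h by have := hk.le; omega] at h1 h2
    have : k / 2 ^ (h - e) = 1 := by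
      by_contra hh
      have := h2.lt_of_two_le (by have := h2.pos; omega)
      omega
    rwa [this] at h1

theorem HeapH.sub_covers (H : Heap h tb T ND κ ix S) {k e p : ℕ} (hk : IsNode h k e)
    (hp : p ∈ sub T tb e k) : p ∈ S ∧ Covers h k e (ix p) := by
  obtain ⟨k', e', h1, h2, h3, h4⟩ := exists_node_of_mem_sub hk hp
  obtain ⟨h5, -, h6⟩ := H.at h1 h4
  have := h6.div (e - e')
  rw [h3, Nat.add_sub_cancel' h2] at this
  exact ⟨h5, this⟩

/-- Points in different children have leaves on different sides, and the point of the node itself is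
stored nowhere else. -/
theorem HeapH.sub_nodup (H : Heap h tb T ND κ ix S) : ∀ {e k : ℕ}, IsNode h k e →
    (sub T tb e k).Nodup := by
  have ht : ∀ k, (top T tb k).Nodup := fun k => by unfold top; split <;> simp
  intro e
  induction e with
  | zero => exact fun _ => ht _
  | succ e ih =>
    intro k hk
    rw [sub, List.nodup_append, List.nodup_append]
    refine ⟨ht _, ⟨ih hk.left, ih hk.right, fun a ha b hb hab => ?_⟩, fun a ha b hb hab => ?_⟩
    · subst hab
      have h1 := (H.sub_covers hk.left ha).2
      have h2 := (H.sub_covers hk.right hb).2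
      have := h1.unique hk.left hk.right h2
      omega
    · subst hab
      rw [mem_top] at ha
      have : ∃ c, IsNode h c e ∧ a ∈ sub T tb e c := by
        rcases List.mem_append.1 hb with h1 | h1
        · exact ⟨_, hk.left, h1⟩
        · exact ⟨_, hk.right, h1⟩
      obtain ⟨c, hc, h1⟩ := this
      obtain ⟨k', e', h2, h3, -, h4⟩ := exists_node_of_mem_sub hc h1
      have := H.inj hk h2 ha h4
      subst this
      have := hk.unique h2
      omega

theorem HeapH.sub_ord (H : Heap h tb T ND κ ix S) : ∀ {e k : ℕ}, IsNode h k e → ∀ p ∈ sub T tb e k,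
    ∃ q, T (tb + k) = .ptr q ∧ κ q ≤ κ p := by
  intro e
  induction e with
  | zero => exact fun hk p hp => ⟨p, mem_top.1 hp, le_rfl⟩
  | succ e ih =>
    intro k hk p hp
    rw [sub, List.mem_append, List.mem_append] at hp
    have aux : ∀ c, c = 2 * k ∨ c = 2 * k + 1 → IsNode h c e → p ∈ sub T tb e c →
        ∃ q, T (tb + k) = .ptr q ∧ κ q ≤ κ p := fun c hc hn hp => by
      obtain ⟨q, h1, h2⟩ := ih hn p hp
      obtain ⟨r, h3, h4⟩ := H.ord k hk.pos hk.internal (by have := hk.pos; omega) c hc q h1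
      exact ⟨r, h3, h4.trans h2⟩
    rcases hp with hp | hp | hp
    · exact ⟨p, mem_top.1 hp, le_rfl⟩
    · exact aux _ (.inl rfl) hk.left hp
    · exact aux _ (.inr rfl) hk.right hp

end

/-- A subtree is discarded if it lies at or before `lo`, has no point at its root, or has a root key
above `thr`, which by heap order excludes all keys below. Register 97 then stays nil; otherwise it
receives the first child. -/
def DfsAct (T K : ℕ) (act : Program) : Program :=
  ld 96 95 33 ;; nl 97 ;; ifLt 92 96 (ld 98 95 T ;; ifEq 98 97 .skip (ld 99 98 K ;;
    ifLt 94 99 .skip (ld 100 98 5 ;; ifLt 92 100 (ifLt 93 100 .skip act) .skip ;; ld 97 95 30)))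
    .skip

/-- With nothing left below the node, the traversal goes on after its subtree, unless the subtree
reaches `hi`: then everything later in preorder lies beyond the query. -/
def DfsNext : Program :=
  nl 100 ;; ifEq 97 100 (ifLt 96 93 (ld 95 95 31) (nl 95)) (mv 95 97)

/-- Perform `act` for all points (register 98) in the priority search tree with roots in column `T`
whose number in field 5 is in `(lo, hi]` and whose number in field `K` is at most `thr`, where `lo`,
`hi` and `thr` are in registers 92 to 94. -/
def Dfs (T K : ℕ) (act : Program) : Program :=
  mv 95 8 ;; whileNN 95 (DfsAct T K act ;; DfsNext)

@[simp] theorem wf_Dfs (T K : ℕ) (act : Program) (f : ℕ) : wf (Dfs T K act) f = wf act f := by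
  simp [Dfs, DfsAct, DfsNext]

/-- The state has changed only in what the traversal and `act` may change. -/
structure Same (act : Program) (s s' : M) : Prop where
  reg : ∀ i, i ≠ 3 → i ≠ 4 → i < 95 ∨ 100 < i → wr act i = false → s'.reg i = s.reg i
  mem : ∀ f, wf act f = false → s'.mem f = s.mem f
  fresh : s'.fresh = s.fresh

/-- What a traversal needs. -/
structure DfsHyp {κT : Type*} [LinearOrder κT] (B T K : ℕ) (act : Program) (h tb : ℕ) (κ : ℕ → κT)
    (ND : ℕ → Val) (ix kv : ℕ → ℕ) (S : Set ℕ) (lo hi thr : ℕ) (s₀ : M)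
    (J : List ℕ → (ℕ → ℕ → Val) → List Event → Prop) (ta : ℕ) : Prop where
  tree : TreeS h tb s₀
  heap : Heap h tb (s₀.mem T) ND κ ix S
  key : ∀ p ∈ S, ∀ q ∈ S, κ p ≤ κ q → kv p ≤ kv q
  kvc : ∀ p ∈ S, s₀.mem K p = .num (kv p)
  ixc : ∀ p ∈ S, s₀.mem 5 p = .num (ix p)
  lt : ∀ p ∈ S, p < s₀.fresh
  r92 : s₀.reg 92 = .num lo
  r93 : s₀.reg 93 = .num hi
  r94 : s₀.reg 94 = .num thr
  keepM : ∀ f, f = T ∨ f = K ∨ f = 5 ∨ f = 30 ∨ f = 31 ∨ f = 33 → wf act f = false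
  keepR : ∀ i, 92 ≤ i → i ≤ 100 → wr act i = false
  alloc : noAlloc act = true
  act : ∀ l p s', Same act s₀ s' → J l s'.mem s'.out → s'.reg 98 = .ptr p → p ∈ S → lo < ix p →
    ix p ≤ hi → kv p ≤ thr →
    wp B act s' fun s'' => J (l ++ [p]) s''.mem s''.out ∧ s''.time ≤ s'.time + ta

/-- Whether the position `x` is strictly between leaves of a node. -/
def cut (h k e x : ℕ) : ℕ := if loOf h k e < x ∧ x < hiOf h k e then 1 else 0

/-- A position strictly inside the leaf interval of a node is strictly inside that of at most one
child. So each query bound cuts at most one node per level, which pays for visits that report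
nothing. -/
theorem cut_children (h k e x : ℕ) :
    cut h (2 * k) e x + cut h (2 * k + 1) e x ≤ cut h k (e + 1) x := by
  have h1 := loOf_left h k e
  have h2 := hiOf_left h k e
  have h3 := hiOf_right h k e
  have h4 : loOf h (2 * k) e ≤ loOf h (2 * k + 1) e := loOf_mono h e (by omega)
  have h5 : loOf h (2 * k + 1) e ≤ hiOf h (2 * k + 1) e := loOf_mono h e (Nat.le_succ _)
  unfold cut
  split_ifs <;> omega

def pr (ix kv : ℕ → ℕ) (lo hi thr : ℕ) (p : ℕ) : Bool :=
  decide (lo < ix p ∧ ix p ≤ hi ∧ kv p ≤ thr)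

section
variable {κT : Type*} [LinearOrder κT] {B T K : ℕ} {act : Program} {h tb : ℕ} {κ : ℕ → κT}
    {ND : ℕ → Val} {ix kv : ℕ → ℕ} {S : Set ℕ} {lo hi thr : ℕ} {s₀ : M}
    {J : List ℕ → (ℕ → ℕ → Val) → List Event → Prop} {ta : ℕ}

theorem DfsHyp.same (H : DfsHyp B T K act h tb κ ND ix kv S lo hi thr s₀ J ta) {s : M}
    (hs : Same act s₀ s) : s.mem T = s₀.mem T ∧ s.mem K = s₀.mem K ∧ s.mem 5 = s₀.mem 5 ∧
      s.mem 30 = s₀.mem 30 ∧ s.mem 31 = s₀.mem 31 ∧ s.mem 33 = s₀.mem 33 ∧ s.reg 92 = .num lo ∧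
      s.reg 93 = .num hi ∧ s.reg 94 = .num thr := by
  have := fun f hf => hs.mem f (H.keepM f hf)
  refine ⟨this _ (by tauto), this _ (by tauto), this _ (by tauto), this _ (by tauto),
    this _ (by tauto), this _ (by tauto), ?_, ?_, ?_⟩
  · rw [hs.reg 92 (by decide) (by decide) (by decide) (H.keepR 92 (by decide) (by decide)), H.r92]
  · rw [hs.reg 93 (by decide) (by decide) (by decide) (H.keepR 93 (by decide) (by decide)), H.r93]
  · rw [hs.reg 94 (by decide) (by decide) (by decide) (H.keepR 94 (by decide) (by decide)), H.r94]

/-- One node of the traversal: either nothing below it is to be reported, or its own point is handled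
and its first child comes next. -/
theorem DfsHyp.node (H : DfsHyp B T K act h tb κ ND ix kv S lo hi thr s₀ J ta) {s : M} {k e : ℕ}
    {l : List ℕ} (hs : Same act s₀ s) (hk : IsNode h k e) (hlo : loOf h k e < hi)
    (h95 : s.reg 95 = .ptr (tb + k)) (hJ : J l s.mem s.out) :
    wp B (DfsAct T K act) s fun s' => Same act s₀ s' ∧ s'.reg 96 = .num (hiOf h k e) ∧
      s'.reg 95 = .ptr (tb + k) ∧
      ((s'.reg 97 = .nil ∧ (sub (s₀.mem T) tb e k).filter (pr ix kv lo hi thr) = [] ∧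
        J l s'.mem s'.out ∧ s'.time ≤ s.time + 13) ∨
       (s'.reg 97 = s₀.mem 30 (tb + k) ∧
        J (l ++ (top (s₀.mem T) tb k).filter (pr ix kv lo hi thr)) s'.mem s'.out ∧
        1 ≤ ((top (s₀.mem T) tb k).filter (pr ix kv lo hi thr)).length +
          (cut h k e lo + cut h k e hi) ∧
        s'.time ≤ s.time + 13 +
          ta * ((top (s₀.mem T) tb k).filter (pr ix kv lo hi thr)).length)) := by
  obtain ⟨mT, mK, m5, m30, m31, m33, r92, r93, r94⟩ := H.same hs
  have hfr := H.tree.fresh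
  have hlt := hk.lt
  have ff := hs.fresh
  have hkf : tb + k < s.fresh := by omega
  have h33 := H.tree.hi k e hk
  have hempty : (∀ p ∈ sub (s₀.mem T) tb e k, pr ix kv lo hi thr p = false) →
      (sub (s₀.mem T) tb e k).filter (pr ix kv lo hi thr) = [] := fun hh => by
    rw [List.filter_eq_nil_iff]
    intro p hp; simp [hh p hp]
  have same : ∀ s2 : M, (∀ i, i ≠ 3 → i ≠ 4 → i < 95 ∨ 100 < i → wr act i = false →
      s2.reg i = s.reg i) → s2.mem = s.mem → s2.fresh = s.fresh → Same act s₀ s2 :=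
    fun s2 h1 h2 h3 => ⟨fun i a b c d => (h1 i a b c d).trans (hs.reg i a b c d),
      fun f hf => by rw [h2]; exact hs.mem f hf, h3.trans ff⟩
  refine wp.abs fun R hR => ?_
  rcases H.heap.kind k e hk with hnil | ⟨p, hp, hT, hN, hc⟩
  · simp [DfsAct, h95, hkf, r92, m33, h33, mT, hnil]
    refine ⟨fun h1 => ?_, fun h1 => ?_⟩ <;> simp only [hR]
    all_goals
      refine ⟨same _ (fun i _ _ _ _ => ?_) rfl rfl, by simp, by simp [h95], .inl ⟨by simp,
        hempty fun p hp => ?_, hJ, by simp⟩⟩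
      · simp only [M.set_reg, M.tick_reg]
        repeat' rw [if_neg (by omega)]
      · obtain ⟨q, hq, -⟩ := H.heap.sub_ord hk p hp
        rw [hnil] at hq; cases hq
  · have hpf : p < s.fresh := by have := H.lt p hp; omega
    have e5 := H.ixc p hp
    have eK := H.kvc p hp
    have htop : top (s₀.mem T) tb k = [p] := by unfold top; rw [hT]
    rw [htop] at hR
    simp [DfsAct, h95, hkf, r92, m33, h33, mT, hT, hpf, r94, mK, eK, m5, e5, r93]
    refine ⟨fun h1 => ⟨fun h2 => ?_, fun h2 => ⟨fun h3 => ⟨fun h4 => ?_, fun h4 => ?_⟩,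
      fun h3 => ?_⟩⟩, fun h1 => ?_⟩
    · simp only [hR]
      refine ⟨same _ (fun i _ _ _ _ => ?_) rfl rfl, by simp, by simp [h95], .inl ⟨by simp,
        hempty fun q hq => ?_, hJ, by simp⟩⟩
      · simp only [M.set_reg, M.tick_reg]
        repeat' rw [if_neg (by omega)]
      · obtain ⟨r, hr, hle⟩ := H.heap.sub_ord hk q hq
        rw [hT] at hr
        cases hr
        have := H.key p hp q (H.heap.sub_covers hk hq).1 hle
        simp [pr]; omega
    · simp only [hR]
      refine ⟨same _ (fun i _ _ _ _ => ?_) rfl rfl, by simp, by simp [h95], .inr ⟨by simp [m30],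
        ?_, ?_, ?_⟩⟩
      · simp only [M.set_reg, M.tick_reg]
        repeat' rw [if_neg (by omega)]
      · simpa [pr, h4] using hJ
      -- The point of this node is beyond `hi`, so `hi` is strictly inside the interval of the node:
      -- the visit is charged to this cut.
      · have := hc.2
        simp [cut, hlo, show hi < hiOf h k e by omega]
        omega
      · simp; omega
    · have hpr : pr ix kv lo hi thr p = true := by simp [pr]; omega
      simp only [List.filter_cons, hpr, if_true, List.filter_nil, List.length_singleton] at hR
      refine wp.frame (H.act l p _ (same _ (fun i _ _ _ _ => ?_) rfl rfl) hJ (by simp) hp h3 h4 h2) ?_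
      · simp only [M.set_reg, M.tick_reg]
        repeat' rw [if_neg (by omega)]
      rintro s2 hF ⟨hJ2, ht2⟩
      have f2 := hF.fresh H.alloc
      simp only [M.set_fresh, M.tick_fresh] at f2
      have q95 : s2.reg 95 = .ptr (tb + k) :=
        (hF.reg 95 (H.keepR 95 (by decide) (by decide))).trans (by simp [h95])
      have q96 : s2.reg 96 = .num (hiOf h k e) :=
        (hF.reg 96 (H.keepR 96 (by decide) (by decide))).trans (by simp)
      refine ⟨tb + k, q95, by omega, ?_⟩
      simp only [hR]
      refine ⟨⟨fun i a b c d => ?_, fun f hf => ?_, by simp [f2, ff]⟩, by simp [q96], by simp [q95],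
        .inr ⟨?_, hJ2, by omega, ?_⟩⟩
      · simp only [M.set_reg, if_neg (show i ≠ 97 by omega)]
        rw [hF.reg i d]
        simp only [M.set_reg, M.tick_reg]
        repeat' rw [if_neg (by omega)]
        exact hs.reg i a b c d
      · simp only [M.set_mem]
        rw [hF.mem f hf]
        exact hs.mem f hf
      · simp only [M.set_reg, if_true]
        rw [hF.mem 30 (H.keepM 30 (by tauto))]
        simp [m30]
      · simp only [M.set_time, M.tick_time] at ht2 ⊢
        omega
    · simp only [hR]
      refine ⟨same _ (fun i _ _ _ _ => ?_) rfl rfl, by simp, by simp [h95], .inr ⟨by simp [m30],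
        ?_, ?_, ?_⟩⟩
      · simp only [M.set_reg, M.tick_reg]
        repeat' rw [if_neg (by omega)]
      · simpa [pr, h3] using hJ
      · have := hc.1
        simp [cut, h1, show loOf h k e < lo by omega]
        omega
      · simp; omega
    · simp only [hR]
      refine ⟨same _ (fun i _ _ _ _ => ?_) rfl rfl, by simp, by simp [h95], .inl ⟨by simp,
        hempty fun q hq => ?_, hJ, by simp⟩⟩
      · simp only [M.set_reg, M.tick_reg]
        repeat' rw [if_neg (by omega)]
      · have := (H.heap.sub_covers hk hq).2.2
        simp [pr]; omega

theorem dfsNext_wp {s : M} {Q : M → Prop} {k x : ℕ} (h95 : s.reg 95 = .ptr (tb + k))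
    (hk : tb + k < s.fresh) (h96 : s.reg 96 = .num x) (h93 : s.reg 93 = .num hi)
    (hQ : ∀ s', (∀ i, i ≠ 95 → i ≠ 100 → s'.reg i = s.reg i) → s'.mem = s.mem → s'.fresh = s.fresh →
      s'.out = s.out → s'.time ≤ s.time + 4 → (s.reg 97 ≠ .nil → s'.reg 95 = s.reg 97) →
      (s.reg 97 = .nil → s'.reg 95 = if x < hi then s.mem 31 (tb + k) else .nil) → Q s') :
    wp B DfsNext s Q := by
  refine wp.abs fun R hR => ?_
  simp [DfsNext, h95, hk, h96, h93]
  refine ⟨fun h1 => ⟨fun h2 => ?_, fun h2 => ?_⟩, fun h1 => ?_⟩ <;> rw [hR]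
  · refine hQ _ (fun i h3 h4 => by simp [h3, h4]) rfl rfl rfl (by simp) (fun h => absurd h1 h) ?_
    simp [h2]
  · refine hQ _ (fun i h3 h4 => by simp [h3, h4]) rfl rfl rfl (by simp) (fun h => absurd h1 h) ?_
    simp [not_lt.2 h2]
  · exact hQ _ (fun i h3 h4 => by simp [h3, h4]) rfl rfl rfl (by simp) (fun _ => by simp)
      (fun h => absurd h h1)

theorem DfsHyp.body (H : DfsHyp B T K act h tb κ ND ix kv S lo hi thr s₀ J ta) {s : M} {k e : ℕ}
    {l : List ℕ} (hs : Same act s₀ s) (hk : IsNode h k e) (hlo : loOf h k e < hi)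
    (h95 : s.reg 95 = .ptr (tb + k)) (hJ : J l s.mem s.out) :
    wp B (DfsAct T K act ;; DfsNext) (s.ent .nil) fun s' => Same act s₀ s' ∧
      ((s'.reg 95 = (if hiOf h k e < hi then s₀.mem 31 (tb + k) else .nil) ∧
        (sub (s₀.mem T) tb e k).filter (pr ix kv lo hi thr) = [] ∧
        J l s'.mem s'.out ∧ s'.time ≤ s.time + 21) ∨
       (s'.reg 95 = (if 2 ^ h ≤ k then if hiOf h k e < hi then s₀.mem 31 (tb + k) else .nil
          else .ptr (tb + 2 * k)) ∧
        J (l ++ (top (s₀.mem T) tb k).filter (pr ix kv lo hi thr)) s'.mem s'.out ∧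
        1 ≤ ((top (s₀.mem T) tb k).filter (pr ix kv lo hi thr)).length +
          (cut h k e lo + cut h k e hi) ∧
        s'.time ≤ s.time + 21 +
          ta * ((top (s₀.mem T) tb k).filter (pr ix kv lo hi thr)).length)) := by
  have hfr := H.tree.fresh
  have hlt := hk.lt
  rw [wp_seq]
  refine (H.node (s := s.ent .nil) ⟨fun i a b c d => ?_, hs.mem, hs.fresh⟩ hk hlo (by simp [h95])
    hJ).mono ?_
  · simp only [M.ent_reg, if_neg a, if_neg b]
    exact hs.reg i a b c d
  rintro s1 ⟨hs1, h96, h95', h⟩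
  have f1 := hs1.fresh
  refine dfsNext_wp h95' (by omega) h96 (H.same hs1).2.2.2.2.2.2.2.1 fun s2 hr hm hf ho ht hc hn => ?_
  refine ⟨⟨fun i a b c d => (hr i (by omega) (by omega)).trans (hs1.reg i a b c d),
    fun f hf => by rw [hm]; exact hs1.mem f hf, hf.trans f1⟩, ?_⟩
  rw [(H.same hs1).2.2.2.2.1] at hn
  rw [hm, ho]
  simp only [M.ent_time] at h
  rcases h with ⟨h97, h1, h2, h3⟩ | ⟨h97, h2, h3, h4⟩
  · exact .inl ⟨hn h97, h1, h2, by omega⟩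
  · refine .inr ⟨?_, h2, h3, by omega⟩
    rcases Nat.lt_or_ge k (2 ^ h) with h5 | h5
    · rw [H.tree.child k hk.pos h5] at h97
      rw [if_neg (by omega), ← h97]
      exact hc (by rw [h97]; simp)
    · rw [H.tree.leaf k h5 hlt] at h97
      rw [if_pos h5]
      exact hn h97

/-- The traversal of a subtree. -/
theorem DfsHyp.subtree (H : DfsHyp B T K act h tb κ ND ix kv S lo hi thr s₀ J ta) {Q : M → Prop} :
    ∀ {e k l} {s : M}, IsNode h k e → Same act s₀ s → loOf h k e < hi → s.reg 95 = .ptr (tb + k) →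
    J l s.mem s.out →
    (∀ s', Same act s₀ s' →
      s'.reg 95 = (if hiOf h k e < hi then s₀.mem 31 (tb + k) else .nil) →
      J (l ++ (sub (s₀.mem T) tb e k).filter (pr ix kv lo hi thr)) s'.mem s'.out →
      s'.time ≤ s.time + (ta + 42) * ((sub (s₀.mem T) tb e k).filter (pr ix kv lo hi thr)).length +
        21 * (1 + 2 * e * (cut h k e lo + cut h k e hi)) →
      wp B (whileNN 95 (DfsAct T K act ;; DfsNext)) s' Q) →
    wp B (whileNN 95 (DfsAct T K act ;; DfsNext)) s Q := by
  -- The traversal is one flat loop, so the induction over subtrees is in continuation form: `hQ`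
  -- takes over in the state in which the subtree is left.
  intro e
  induction e with
  | zero =>
    intro k l s hk hs hlo h95 hJ hQ
    refine wp_while_cons (by decide) (by simp [h95]) ((H.body hs hk hlo h95 hJ).mono ?_)
    rintro s' ⟨hs', ⟨h1, h2, h3, h4⟩ | ⟨h1, h2, h3, h4⟩⟩
    · refine hQ s' hs' h1 (by rwa [h2, List.append_nil]) (by omega)
    · rw [if_pos hk.leaf] at h1
      refine hQ s' hs' h1 h2 ?_
      rw [add_mul]
      simp only [sub]
      omega
  | succ e ih =>
    intro k l s hk hs hlo h95 hJ hQ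
    refine wp_while_cons (by decide) (by simp [h95]) ((H.body hs hk hlo h95 hJ).mono ?_)
    rintro s1 ⟨hs1, ⟨h1, h2, h3, h4⟩ | ⟨h1, h2, h3, h4⟩⟩
    · refine hQ s1 hs1 h1 (by rwa [h2, List.append_nil]) (by omega)
    rw [if_neg (not_le.2 hk.internal)] at h1
    refine ih hk.left hs1 (by rwa [loOf_left]) h1 h2 fun s2 hs2 g1 g2 g3 => ?_
    -- Accounting: an expanded node leads to at most two further visits, of 21 steps each in
    -- addition to the action. These 42 steps are charged to the reported point of the node or to a
    -- cut of the node, one of which exists.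
    have cl := cut_children h k e lo
    have ch := cut_children h k e hi
    have hlen : ((sub (s₀.mem T) tb (e + 1) k).filter (pr ix kv lo hi thr)).length =
        ((top (s₀.mem T) tb k).filter (pr ix kv lo hi thr)).length +
        (((sub (s₀.mem T) tb e (2 * k)).filter (pr ix kv lo hi thr)).length +
        ((sub (s₀.mem T) tb e (2 * k + 1)).filter (pr ix kv lo hi thr)).length) := by
      simp only [sub, List.filter_append, List.length_append]
    have hf : l ++ (sub (s₀.mem T) tb (e + 1) k).filter (pr ix kv lo hi thr) =
        l ++ (top (s₀.mem T) tb k).filter (pr ix kv lo hi thr) ++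
        (sub (s₀.mem T) tb e (2 * k)).filter (pr ix kv lo hi thr) ++
        (sub (s₀.mem T) tb e (2 * k + 1)).filter (pr ix kv lo hi thr) := by
      simp only [sub, List.filter_append, List.append_assoc]
    rw [hf, hlen] at hQ
    generalize cut h (2 * k) e lo = a1 at *
    generalize ha2 : cut h (2 * k + 1) e lo = a2 at *
    generalize cut h k (e + 1) lo = a3 at *
    generalize cut h (2 * k) e hi = b1 at *
    generalize hb2 : cut h (2 * k + 1) e hi = b2 at *
    generalize cut h k (e + 1) hi = b3 at *
    generalize hr1 : ((top (s₀.mem T) tb k).filter (pr ix kv lo hi thr)).length = r1 at *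
    generalize hr2 : ((sub (s₀.mem T) tb e (2 * k)).filter (pr ix kv lo hi thr)).length = r2 at *
    generalize hr3 : ((sub (s₀.mem T) tb e (2 * k + 1)).filter (pr ix kv lo hi thr)).length = r3 at *
    have hm : e * (a1 + b1) + e * (a2 + b2) ≤ e * (a3 + b3) := by
      rw [← mul_add]; exact Nat.mul_le_mul_left _ (by omega)
    have hm2 : 2 * (e + 1) * (a3 + b3) = 2 * (e * (a3 + b3)) + 2 * (a3 + b3) := by ring
    have hm3 : 2 * e * (a1 + b1) = 2 * (e * (a1 + b1)) := by ring
    have hm4 : 2 * e * (a2 + b2) = 2 * (e * (a2 + b2)) := by ring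
    rw [hm2] at hQ
    rw [hm3] at g3
    have ha : ∀ r, (ta + 42) * r = ta * r + 42 * r := fun r => add_mul _ _ _
    have hb : ta * (r1 + (r2 + r3)) = ta * r1 + ta * r2 + ta * r3 := by ring
    by_cases hmid : hiOf h (2 * k) e < hi
    · rw [if_pos hmid, H.tree.skipL k hk.pos hk.internal] at g1
      refine ih hk.right hs2 hmid g1 g2 fun s3 hs3 f1 f2 f3 => hQ s3 hs3 ?_ f2 ?_
      · rw [f1, hiOf_right, H.tree.skipR k hk.pos hk.internal]
      · simp only [hr3, ha2, hb2, hm4, ha] at f3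
        simp only [ha] at g3 ⊢
        omega
    · rw [if_neg hmid] at g1
      -- The right child is never visited here, and rightly so: all its leaves are beyond `hi`.
      have h0 : (sub (s₀.mem T) tb e (2 * k + 1)).filter (pr ix kv lo hi thr) = [] := by
        rw [List.filter_eq_nil_iff]
        intro p hp
        have h5 := (H.heap.sub_covers hk.right hp).2.1
        have h6 := hiOf_left h k e
        simp [pr]; omega
      refine hQ s2 hs2 ?_ (by rwa [h0, List.append_nil]) ?_
      · have := hiOf_right h k e
        have h5 : hiOf h (2 * k) e ≤ hiOf h (2 * k + 1) e := loOf_mono h e (by omega)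
        rw [g1, if_neg (by omega)]
      · simp only [ha] at g3 ⊢
        omega

/-- The traversal acts on exactly the points to be reported. -/
theorem DfsHyp.spec (H : DfsHyp B T K act h tb κ ND ix kv S lo hi thr s₀ J ta) (hlo : lo < hi)
    (hJ : J [] s₀.mem s₀.out) :
    wp B (Dfs T K act) s₀ fun s' => ∃ l : List ℕ, l.Nodup ∧
      (∀ p, p ∈ l ↔ p ∈ S ∧ lo < ix p ∧ ix p ≤ hi ∧ kv p ≤ thr) ∧ J l s'.mem s'.out ∧
      s'.time ≤ s₀.time + (ta + 42) * l.length + 84 * h + 26 := by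
  rw [Dfs, wp_seq, wp_mv]
  have hroot : hiOf h 1 h = 2 ^ h := by simp [hiOf]; omega
  refine H.subtree (s := s₀.set 95 (s₀.reg 8)) (isNode_root h) ⟨fun i a b c d => ?_, fun _ _ => rfl, rfl⟩
    (by simp [loOf]; omega) (by simp [H.tree.root]) hJ fun s' hs' h95 hJ' ht => ?_
  · simp only [M.set_reg]; rw [if_neg (by omega)]
  rw [H.tree.skip0, ite_self] at h95
  refine wp_while_nil (by decide) h95 ⟨_, (H.heap.sub_nodup (isNode_root h)).filter _, fun p => ?_,
    hJ', ?_⟩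
  · rw [List.mem_filter, H.heap.mem_sub_root]
    simp [pr]
  · have c1 : ∀ x, cut h 1 h x ≤ 1 := fun x => by unfold cut; split_ifs <;> simp
    have c2 := c1 lo
    have c3 := c1 hi
    have c4 : 2 * h * (cut h 1 h lo + cut h 1 h hi) ≤ 2 * h * 2 := Nat.mul_le_mul_left _ (by omega)
    simp only [M.set_time] at ht
    simp only [M.ent_time]
    omega

end

/-! ### First and last points of the colours in a query -/

/-- The points `0, …, n - 1` have colours `cl`, ranks `r` by first coordinate, and ranks `c` by colour
and first coordinate (or both ranks are reversed). -/
structure Scene (n : ℕ) (cl r c : ℕ → ℕ) : Prop where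
  r_inj : ∀ p < n, ∀ q < n, r p = r q → p = q
  r_pos : ∀ p < n, 1 ≤ r p
  r_le : ∀ p < n, r p ≤ n
  c_inj : ∀ p < n, ∀ q < n, c p = c q → p = q
  c_pos : ∀ p < n, 1 ≤ c p
  c_le : ∀ p < n, c p ≤ n
  conv : ∀ p < n, ∀ q < n, ∀ s < n, c p < c q → c q < c s → cl p = cl s → cl q = cl p
  mono : ∀ p < n, ∀ q < n, cl p = cl q → (c p < c q ↔ r p < r q)

/-- The reversed ranks. -/
def rev (n : ℕ) (r : ℕ → ℕ) (p : ℕ) : ℕ := n + 1 - r p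

/-- Reversing both orders preserves contiguity of colours and compatibility. Last points of colours
are first points of the mirrored scene, so one development serves both search trees. -/
theorem Scene.mirror {n : ℕ} {cl r c : ℕ → ℕ} (H : Scene n cl r c) :
    Scene n cl (rev n r) (rev n c) := by
  have hr := H.r_le
  have hr' := H.r_pos
  have hc := H.c_le
  have hc' := H.c_pos
  have e1 : ∀ p < n, ∀ q < n, (rev n r p < rev n r q ↔ r q < r p) := fun p hp q hq => by
    have := hr p hp; have := hr q hq; unfold rev; omega
  have e2 : ∀ p < n, ∀ q < n, (rev n c p < rev n c q ↔ c q < c p) := fun p hp q hq => by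
    have := hc p hp; have := hc q hq; unfold rev; omega
  refine ⟨fun p hp q hq h => H.r_inj p hp q hq ?_, fun p hp => ?_, fun p hp => ?_,
    fun p hp q hq h => H.c_inj p hp q hq ?_, fun p hp => ?_, fun p hp => ?_,
    fun p hp q hq s hs h1 h2 h3 => ?_, fun p hp q hq h => ?_⟩
  · have := hr p hp; have := hr q hq; unfold rev at h; omega
  · have := hr p hp; unfold rev; omega
  · have := hr' p hp; unfold rev; omega
  · have := hc p hp; have := hc q hq; unfold rev at h; omega
  · have := hc p hp; unfold rev; omega
  · have := hc' p hp; unfold rev; omega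
  · rw [e2 _ hp _ hq] at h1
    rw [e2 _ hq _ hs] at h2
    rw [H.conv s hs q hq p hp h2 h1 h3.symm, h3]
  · rw [e1 p hp q hq, e2 p hp q hq]
    exact H.mono q hq p hp h.symm

/-- The last element of `A` before `p` in the order `c`. -/
def Prev (c : ℕ → ℕ) (A : Set ℕ) (p : ℕ) (v : Val) : Prop :=
  (v = .nil ∧ ∀ q ∈ A, ¬ c q < c p) ∨
    ∃ q ∈ A, v = .ptr q ∧ c q < c p ∧ ∀ s ∈ A, c s < c p → c s ≤ c q

/-- `k` is the largest rank of an element of `A` with smaller rank and the same colour as `p`; it is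
`0` if there is none. -/
def FKey (cl r : ℕ → ℕ) (A : Set ℕ) (p k : ℕ) : Prop :=
  (∀ q ∈ A, cl q = cl p → r q < r p → r q ≤ k) ∧
    (k = 0 ∨ ∃ q ∈ A, cl q = cl p ∧ r q < r p ∧ r q = k)

section
variable {n : ℕ} {cl r c : ℕ → ℕ} {A : Set ℕ}

/-- By contiguity, if any earlier point of the same colour survives, then the immediate predecessor
in the list has that colour. So the key is read off one neighbour: its rank if the colours agree,
and 0 otherwise. -/
theorem Prev.fkey (H : Scene n cl r c) (hA : ∀ p ∈ A, p < n) {p : ℕ} (hp : p ∈ A) {v : Val}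
    (hv : Prev c A p v) : (v = .nil ∧ FKey cl r A p 0) ∨
      ∃ q ∈ A, v = .ptr q ∧ FKey cl r A p (if cl q = cl p then r q else 0) := by
  rcases hv with ⟨rfl, h⟩ | ⟨q, hq, rfl, hlt, h⟩
  · exact .inl ⟨rfl, fun q hq h1 h2 => absurd ((H.mono q (hA q hq) p (hA p hp) h1).2 h2) (h q hq),
      .inl rfl⟩
  · refine .inr ⟨q, hq, rfl, fun s hs h1 h2 => ?_, ?_⟩
    · have h3 := (H.mono s (hA s hs) p (hA p hp) h1).2 h2
      have h4 := h s hs h3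
      rcases h4.lt_or_eq with h5 | h5
      · have h6 := H.conv s (hA s hs) q (hA q hq) p (hA p hp) h5 hlt h1
        rw [if_pos (h6.trans h1)]
        exact ((H.mono s (hA s hs) q (hA q hq) h6.symm).1 h5).le
      · obtain rfl := H.c_inj s (hA s hs) q (hA q hq) h5
        rw [if_pos h1]
    · split_ifs with h1
      · exact .inr ⟨q, hq, h1, (H.mono q (hA q hq) p (hA p hp) h1).1 hlt, rfl⟩
      · exact .inl rfl

theorem Prev.of_ne {p q : ℕ} {v : Val} (h : Prev c A q v) (hv : v ≠ .ptr p) :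
    Prev c (A \ {p}) q v := by
  rcases h with ⟨rfl, h⟩ | ⟨s, hs, rfl, hlt, h⟩
  · exact .inl ⟨rfl, fun s hs => h s hs.1⟩
  · exact .inr ⟨s, ⟨hs, fun hh => hv (by rw [Set.mem_singleton_iff.1 hh])⟩, rfl, hlt,
      fun t ht => h t ht.1⟩

theorem Prev.skip (H : Scene n cl r c) (hA : ∀ p ∈ A, p < n) {p q : ℕ} {w : Val}
    (h : Prev c A q (.ptr p)) (hw : Prev c A p w) : Prev c (A \ {p}) q w := by
  rcases h with ⟨h1, _⟩ | ⟨p', hp, he, hlt, h⟩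
  · cases h1
  cases he
  have hne : ∀ s ∈ A \ {p}, c s < c q → c s < c p := fun s hs h1 =>
    (h s hs.1 h1).lt_of_ne fun hh => hs.2 (H.c_inj s (hA s hs.1) p (hA p hp) hh)
  rcases hw with ⟨rfl, h1⟩ | ⟨s, hs, rfl, h1, h2⟩
  · exact .inl ⟨rfl, fun s hs h2 => h1 s hs.1 (hne s hs h2)⟩
  · exact .inr ⟨s, ⟨hs, fun hh => by rw [Set.mem_singleton_iff.1 hh] at h1; omega⟩, rfl,
      h1.trans hlt, fun t ht h3 => h2 t ht.1 (hne t ht h3)⟩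

/-- The two link fields are inverse to each other. Thus the only point whose predecessor is the
deleted `p` is the one found by the other link of `p`. -/
theorem Prev.iff_mirror (H : Scene n cl r c) (hA : ∀ p ∈ A, p < n) {p q : ℕ} (hp : p ∈ A)
    (hq : q ∈ A) {v w : Val} (hv : Prev c A q v) (hw : Prev (rev n c) A p w) :
    v = .ptr p ↔ w = .ptr q := by
  have e : ∀ a ∈ A, ∀ b ∈ A, (rev n c a < rev n c b ↔ c b < c a) := fun a ha b hb => by
    have := H.c_le a (hA a ha); have := H.c_le b (hA b hb); unfold rev; omega
  have e' : ∀ a ∈ A, ∀ b ∈ A, (rev n c a ≤ rev n c b ↔ c b ≤ c a) := fun a ha b hb => by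
    have := H.c_le a (hA a ha); have := H.c_le b (hA b hb); unfold rev; omega
  constructor
  · rintro rfl
    rcases hv with ⟨h1, _⟩ | ⟨p', -, he, hlt, h⟩
    · cases h1
    cases he
    rcases hw with ⟨-, h1⟩ | ⟨s, hs, rfl, h1, h2⟩
    · exact absurd ((e q hq p hp).2 hlt) (h1 q hq)
    · rw [e s hs p hp] at h1
      have h3 := h2 q hq ((e q hq p hp).2 hlt)
      rw [e' q hq s hs] at h3
      rcases h3.lt_or_eq with h4 | h4
      · have := h s hs h4; omega
      · rw [H.c_inj s (hA s hs) q (hA q hq) h4]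
  · rintro rfl
    rcases hw with ⟨h1, _⟩ | ⟨p', -, he, hlt, h⟩
    · cases h1
    cases he
    rw [e q hq p hp] at hlt
    rcases hv with ⟨-, h1⟩ | ⟨s, hs, rfl, h1, h2⟩
    · exact absurd hlt (h1 p hp)
    · have h3 := h2 p hp hlt
      rcases h3.lt_or_eq with h4 | h4
      · have h5 := h s hs ((e s hs p hp).2 h4)
        rw [e' s hs q hq] at h5
        omega
      · rw [H.c_inj p (hA p hp) s (hA s hs) h4]

/-- Keys of points other than the successor of the deleted point do not change. -/
theorem FKey.delete (H : Scene n cl r c) (hA : ∀ p ∈ A, p < n) {p q k : ℕ} (hp : p ∈ A) (hq : q ∈ A)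
    {v : Val} (hv : Prev c A q v) (hvp : v ≠ .ptr p) (h : FKey cl r A q k) :
    FKey cl r (A \ {p}) q k := by
  refine ⟨fun s hs => h.1 s hs.1, ?_⟩
  rcases h.2 with rfl | ⟨s, hs, h1, h2, rfl⟩
  · exact .inl rfl
  by_cases hsp : s = p
  · subst hsp
    exfalso
    have h3 := (H.mono s (hA s hs) q (hA q hq) h1).2 h2
    rcases hv with ⟨-, h4⟩ | ⟨t, ht, rfl, h4, h5⟩
    · exact h4 s hs h3
    · rcases (h5 s hs h3).lt_or_eq with h6 | h6
      · have h7 := H.conv s (hA s hs) t (hA t ht) q (hA q hq) h6 h4 h1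
        have h8 := (H.mono s (hA s hs) t (hA t ht) h7.symm).1 h6
        have h9 := (H.mono t (hA t ht) q (hA q hq) (h7.trans h1)).1 h4
        have := h.1 t ht (h7.trans h1) h9
        omega
      · exact hvp (by rw [H.c_inj s (hA s hs) t (hA t ht) h6])
  · exact .inr ⟨s, ⟨hs, hsp⟩, h1, h2, rfl⟩

/-- Of two points of one colour with ranks above `lo`, the later has a key at least the rank of the
earlier, which exceeds `lo`. So a search meets each colour at most once. -/
theorem FKey.unique (H : Scene n cl r c) (hA : ∀ p ∈ A, p < n) {p q k k' lo : ℕ} (hp : p ∈ A)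
    (hq : q ∈ A) (h : FKey cl r A p k) (h' : FKey cl r A q k') (hpl : lo < r p) (hql : lo < r q)
    (hk : k ≤ lo) (hk' : k' ≤ lo) (hcl : cl p = cl q) : p = q := by
  refine H.r_inj p (hA p hp) q (hA q hq) ?_
  rcases Nat.lt_trichotomy (r p) (r q) with h1 | h1 | h1
  · have := h'.1 p hp hcl h1; omega
  · exact h1
  · have := h.1 q hq hcl.symm h1; omega

/-- Take the smallest rank above `lo` in this colour: no point of the colour lies between `lo` and
it, so its key is at most `lo`. -/
theorem exists_first (r : ℕ → ℕ) (kf : ℕ → ℕ) (hkf : ∀ p ∈ A, FKey cl r A p (kf p)) {q lo : ℕ}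
    (hq : q ∈ A) (hlo : lo < r q) :
    ∃ p ∈ A, cl p = cl q ∧ lo < r p ∧ r p ≤ r q ∧ kf p ≤ lo := by
  classical
  have hex : ∃ x, ∃ p ∈ A, r p = x ∧ cl p = cl q ∧ lo < r p := ⟨r q, q, hq, rfl, rfl, hlo⟩
  obtain ⟨p, hp, h1, h2, h3⟩ := Nat.find_spec hex
  have hmin : ∀ s ∈ A, cl s = cl q → lo < r s → r p ≤ r s := fun s hs h4 h5 => by
    rw [h1]; exact Nat.find_min' hex ⟨s, hs, rfl, h4, h5⟩
  refine ⟨p, hp, h2, h3, hmin q hq rfl hlo, ?_⟩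
  rcases (hkf p hp).2 with h4 | ⟨s, hs, h4, h5, h6⟩
  · omega
  · by_contra hh
    have := hmin s hs (h4.trans h2) (by omega)
    omega

/-- The points of one colour in a query, from the first to the last. -/
theorem first_last_iff (H : Scene n cl r c) (hA : ∀ p ∈ A, p < n) {f l q kf kl lo hi : ℕ}
    (hf : f ∈ A) (hl : l ∈ A) (hq : q ∈ A) (hcl : cl f = cl l) (hF : FKey cl r A f kf)
    (hL : FKey cl (rev n r) A l kl) (hflo : lo < r f) (hkf : kf ≤ lo)
    (hlhi : r l ≤ hi) (hkl : kl ≤ n - hi) (hhn : hi ≤ n) :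
    (cl q = cl f ∧ lo < r q ∧ r q ≤ hi) ↔ c f ≤ c q ∧ c q ≤ c l := by
  have bl := H.r_le l (hA l hl)
  have bq := H.r_le q (hA q hq)
  constructor
  · rintro ⟨h1, h2, h3⟩
    constructor
    · by_contra hh
      have h4 := (H.mono q (hA q hq) f (hA f hf) h1).1 (by omega)
      have := hF.1 q hq h1 h4
      omega
    · by_contra hh
      have h4 := (H.mono l (hA l hl) q (hA q hq) (hcl.symm.trans h1.symm)).1 (by omega)
      have := hL.1 q hq (h1.trans hcl) (by unfold rev; omega)
      unfold rev at this
      omega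
  · rintro ⟨h1, h2⟩
    have hc : cl q = cl f := by
      rcases h1.lt_or_eq with h3 | h3
      · rcases h2.lt_or_eq with h4 | h4
        · exact H.conv f (hA f hf) q (hA q hq) l (hA l hl) h3 h4 hcl
        · rw [H.c_inj q (hA q hq) l (hA l hl) h4, hcl]
      · rw [H.c_inj f (hA f hf) q (hA q hq) h3]
    have h3 := H.mono q (hA q hq) f (hA f hf) hc
    have h4 := H.mono l (hA l hl) q (hA q hq) (hcl.symm.trans hc.symm)
    exact ⟨hc, by omega, by omega⟩

open Classical in
/-- The colour ranks of the points that are not in `A`. -/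
noncomputable def dead (n : ℕ) (c : ℕ → ℕ) (A : Set ℕ) : Finset ℕ :=
  ((Finset.range n).filter (· ∉ A)).image c

theorem mem_dead {x : ℕ} : x ∈ dead n c A ↔ ∃ p < n, p ∉ A ∧ c p = x := by
  simp [dead, and_assoc]

theorem dead_delete {p : ℕ} (hp : p < n) (hpA : p ∈ A) :
    dead n c (A \ {p}) = insert (c p) (dead n c A) := by
  ext x
  rw [Finset.mem_insert, mem_dead, mem_dead]
  constructor
  · rintro ⟨q, h1, h2, rfl⟩
    by_cases hq : q = p
    · exact .inl (by rw [hq])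
    · exact .inr ⟨q, h1, fun hh => h2 ⟨hh, hq⟩, rfl⟩
  · rintro (rfl | ⟨q, h1, h2, rfl⟩)
    · exact ⟨p, hp, fun hh => hh.2 rfl, rfl⟩
    · exact ⟨q, h1, fun hh => h2 hh.1, rfl⟩

theorem notMem_dead (H : Scene n cl r c) (hA : ∀ p ∈ A, p < n) {p : ℕ} (hp : p ∈ A) :
    c p ∉ dead n c A := by
  rw [mem_dead]
  rintro ⟨q, h1, h2, h3⟩
  exact h2 (by rwa [H.c_inj q h1 p (hA p hp) h3])

theorem dead_card_lt {p : ℕ} (hA : ∀ p ∈ A, p < n) (hp : p ∈ A) : (dead n c A).card + 1 ≤ n := by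
  classical
  have h1 : dead n c A ⊆ ((Finset.range n).erase p).image c := by
    intro x hx
    obtain ⟨q, h1, h2, rfl⟩ := mem_dead.1 hx
    exact Finset.mem_image_of_mem c (Finset.mem_erase.2 ⟨fun h => h2 (h ▸ hp),
      Finset.mem_range.2 h1⟩)
  have h2 := (Finset.card_le_card h1).trans Finset.card_image_le
  have h3 := hA p hp
  rw [Finset.card_erase_of_mem (Finset.mem_range.2 h3), Finset.card_range] at h2
  omega

theorem cntI_le_sub (D : Finset ℕ) (a b : ℕ) : cntI D a b ≤ b - a := by
  rw [cntI, ← Nat.card_Ioc]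
  refine Finset.card_le_card fun x hx => ?_
  rw [Finset.mem_filter] at hx
  exact Finset.mem_Ioc.2 hx.2

/-- The difference of the ranks of two points is the number of points between them. -/
theorem card_between (H : Scene n cl r c) (hA : ∀ p ∈ A, p < n)
    (hsurj : ∀ x, 1 ≤ x → x ≤ n → ∃ p < n, c p = x) {f l : ℕ} (hf : f ∈ A) (hl : l ∈ A)
    (hfl : c f ≤ c l) :
    Set.ncard {q | q ∈ A ∧ c f ≤ c q ∧ c q ≤ c l} =
      c l - cntI (dead n c A) 0 (c l - 1) + 1 - (c f - cntI (dead n c A) 0 (c f - 1)) := by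
  have f1 := H.c_pos f (hA f hf)
  have l1 := H.c_le l (hA l hl)
  have hD := notMem_dead H hA hl
  generalize hDe : dead n c A = D at *
  have b1 := cntI_le_sub D 0 (c f - 1)
  have b2 := cntI_le_sub D (c f - 1) (c l - 1)
  rw [← cntI_add D (Nat.zero_le (c f - 1)) (show c f - 1 ≤ c l - 1 by omega)]
  have h1 : {q | q ∈ A ∧ c f ≤ c q ∧ c q ≤ c l}.ncard =
      ((Finset.Icc (c f) (c l)).filter (· ∉ D)).card := by
    rw [← Set.ncard_coe_finset]
    refine Set.ncard_congr (fun q _ => c q) ?_ ?_ ?_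
    · rintro q ⟨h2, h3, h4⟩
      have := notMem_dead H hA h2
      rw [hDe] at this
      simpa using ⟨⟨h3, h4⟩, this⟩
    · rintro p q ⟨h2, -⟩ ⟨h3, -⟩ h4
      exact H.c_inj p (hA p h2) q (hA q h3) h4
    · intro x hx
      simp only [Finset.coe_filter, Finset.mem_Icc, Set.mem_ofPred_eq] at hx
      obtain ⟨p, hp, rfl⟩ := hsurj x (by omega) (by omega)
      refine ⟨p, ⟨?_, hx.1⟩, rfl⟩
      by_contra hh
      exact hx.2 (hDe ▸ mem_dead.2 ⟨p, hp, hh, rfl⟩)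
  -- The interval of ranks splits into surviving and deleted ones. As `l` survives, the deleted ones
  -- are counted up to c l - 1.
  have h2 : ((Finset.Icc (c f) (c l)).filter (· ∉ D)).card + cntI D (c f - 1) (c l - 1) =
      c l + 1 - c f := by
    rw [← Nat.card_Icc, ← Finset.card_filter_add_card_filter_not (s := Finset.Icc (c f) (c l))
      (p := (· ∈ D)), add_comm, cntI]
    congr 2
    ext x
    simp only [Finset.mem_filter, Finset.mem_Icc]
    constructor
    · rintro ⟨h3, h4, h5⟩
      exact ⟨by omega, h3⟩
    · rintro ⟨⟨h3, h4⟩, h5⟩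
      refine ⟨h5, by omega, ?_⟩
      have : x ≠ c l := fun hh => hD (hh ▸ h5)
      omega
  rw [h1]
  omega

end

/-! ### Deleting a point -/

/-- A priority search tree on the ranks in field 5 with keys in field `ky`. -/
abbrev hpOf (ky T ND : ℕ) : HP := ⟨ky, 5, 5, T, ND⟩

/-- Compute the key of the point in register 101 from the link `ln`. -/
def SetKey (ln ky : ℕ) (cv : Program) : Program :=
  ld 102 101 ln ;; nl 103 ;; mv 104 6 ;; ifEq 102 103 .skip (ld 105 101 3 ;; ld 106 102 3 ;;
    ifEq 105 106 (ld 104 102 5 ;; cv) .skip) ;; st 101 ky 104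

@[simp] theorem wf_SetKey (ln ky : ℕ) (cv : Program) (f : ℕ) :
    wf (SetKey ln ky cv) f = (wf cv f || f == ky) := by simp [SetKey]

/-- `cv` turns the rank `rx` in register 104 into the rank `r`. -/
structure Conv (B n : ℕ) (rx r : ℕ → ℕ) (cv : Program) : Prop where
  run : ∀ (s : M) (q : ℕ), q < n → s.reg 5 = .num 1 → s.reg 7 = .num n → s.reg 104 = .num (rx q) →
    wp B cv s fun s' => s'.reg 104 = .num (r q) ∧ s'.time ≤ s.time + 2
  reg : ∀ i, i ≠ 104 → i ≠ 105 → wr cv i = false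
  mem : ∀ f, wf cv f = false
  alloc : noAlloc cv = true
  silent : silent cv = true

theorem SetKey_spec {B n ln ky p : ℕ} {cl rx r c : ℕ → ℕ} {A : Set ℕ} {cv : Program} {s : M}
    (H : Scene n cl r c) (hcv : Conv B n rx r cv) (hA : ∀ p ∈ A, p < n) (hp : p ∈ A)
    (hfr : n ≤ s.fresh) (h101 : s.reg 101 = .ptr p) (h5 : s.reg 5 = .num 1) (h6 : s.reg 6 = .num 0)
    (h7 : s.reg 7 = .num n) (m3 : ∀ p < n, s.mem 3 p = .color (cl p))
    (m5 : ∀ p < n, s.mem 5 p = .num (rx p)) (hln : Prev c A p (s.mem ln p)) :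
    wp B (SetKey ln ky cv) s fun s' => s'.time ≤ s.time + 12 ∧
      ∃ k, s'.mem ky = Function.update (s.mem ky) p (.num k) ∧ FKey cl r A p k := by
  have hpn := hA p hp
  have hpf := hpn.trans_le hfr
  refine wp.abs fun R hR => ?_
  rcases hln.fkey H hA hp with ⟨hv, hk⟩ | ⟨q, hq, hv, hk⟩
  · simp [SetKey, h101, hpf, hv, h6]
    simp only [hR]
    exact ⟨by simp, 0, by simp, hk⟩
  · have hqn := hA q hq
    have hqf := hqn.trans_le hfr
    simp [SetKey, h101, hpf, hv, h6, m3 p hpn, hqf, m3 q hqn, m5 q hqn]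
    refine ⟨fun hc => ?_, fun hc => ?_⟩
    · rw [if_pos hc.symm] at hk
      refine wp.frame (hcv.run _ q hqn (by simp [h5]) (by simp [h7]) (by simp)) ?_
      rintro s' hF ⟨h1, h2⟩
      have g101 : s'.reg 101 = .ptr p :=
        (hF.reg 101 (hcv.reg 101 (by decide) (by decide))).trans (by simp [h101])
      have gf := hF.fresh hcv.alloc
      have gm := hF.mem ky (hcv.mem ky)
      refine ⟨p, g101, by rw [gf]; simpa using hpf, ?_⟩
      simp only [hR]
      exact ⟨by simp at h2 ⊢; omega, r q, by simp [h1, gm], hk⟩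
    · rw [if_neg (fun h => hc h.symm)] at hk
      rw [hR]
      exact ⟨by simp, 0, by simp, hk⟩

/-- The part of the data structure that belongs to one of the two search trees: `ln` is the list of
the points by `c`, and `ky` the key of the points. -/
structure Half (n h tb : ℕ) (cl rx r c : ℕ → ℕ) (ln ky T ND : ℕ) (A : Set ℕ) (s : M) : Prop where
  link : ∀ p ∈ A, Prev c A p (s.mem ln p)
  key : ∀ p ∈ A, ∃ k, s.mem ky p = .num k ∧ FKey cl r A p k
  keyn : ∀ p < n, ∃ k, s.mem ky p = .num k
  heap : HeapS (hpOf ky T ND) h tb n rx A s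

theorem Half.of {n h tb : ℕ} {cl rx r c : ℕ → ℕ} {ln ky T ND : ℕ} {A : Set ℕ} {s s' : M}
    (H : Half n h tb cl rx r c ln ky T ND A s) (h1 : s'.mem ln = s.mem ln)
    (h2 : s'.mem ky = s.mem ky) (h3 : s'.mem T = s.mem T) (h4 : s'.mem ND = s.mem ND)
    (h5 : s'.mem 5 = s.mem 5) : Half n h tb cl rx r c ln ky T ND A s' :=
  ⟨by rw [h1]; exact H.link, by rw [h2]; exact H.key, by rw [h2]; exact H.keyn,
    H.heap.of h3 h4 h2 h5⟩

/-- The data that never change after the preprocessing. -/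
structure Fix (n h tb : ℕ) (cl rx rc : ℕ → ℕ) (s : M) : Prop where
  tree : TreeS h tb s
  scene : Scene n cl rx rc
  nh : n ≤ 2 ^ h
  fr : n ≤ s.fresh
  r5 : s.reg 5 = .num 1
  r6 : s.reg 6 = .num 0
  r7 : s.reg 7 = .num n
  m3 : ∀ p < n, s.mem 3 p = .color (cl p)
  m5 : ∀ p < n, s.mem 5 p = .num (rx p)
  m6 : ∀ p < n, s.mem 6 p = .num (rc p)
  m20 : ∀ p < n, s.mem 20 p = .ptr (tb + (2 ^ h + rc p - 1))

theorem Fix.of {n h tb : ℕ} {cl rx rc : ℕ → ℕ} {s s' : M} (H : Fix n h tb cl rx rc s)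
    (hr : ∀ i, i = 5 ∨ i = 6 ∨ i = 7 ∨ i = 8 → s'.reg i = s.reg i)
    (hm : ∀ f, f = 3 ∨ f = 5 ∨ f = 6 ∨ f = 20 ∨ f = 30 ∨ f = 31 ∨ f = 33 → s'.mem f = s.mem f)
    (hf : s.fresh ≤ s'.fresh) : Fix n h tb cl rx rc s' := by
  refine ⟨H.tree.of (hr 8 (by tauto)) (hm 30 (by tauto)) (hm 31 (by tauto)) (hm 33 (by tauto)) hf,
    H.scene, H.nh, H.fr.trans hf, ?_, ?_, ?_, ?_, ?_, ?_, ?_⟩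
  · rw [hr 5 (by tauto)]; exact H.r5
  · rw [hr 6 (by tauto)]; exact H.r6
  · rw [hr 7 (by tauto)]; exact H.r7
  · rw [hm 3 (by tauto)]; exact H.m3
  · rw [hm 5 (by tauto)]; exact H.m5
  · rw [hm 6 (by tauto)]; exact H.m6
  · rw [hm 20 (by tauto)]; exact H.m20

/-- Comparability is required of all points, also of those already deleted; therefore `keyn` in
`Half` is not restricted to survivors. -/
theorem Fix.pts {n h tb ky T ND : ℕ} {cl rx rc : ℕ → ℕ} {s : M} (H : Fix n h tb cl rx rc s)
    (hk : ∀ p < n, ∃ k, s.mem ky p = .num k) : Pts (hpOf ky T ND) h n rx s := by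
  refine ⟨H.m5, H.scene.r_inj, fun p hp => ⟨H.scene.r_pos p hp, (H.scene.r_le p hp).trans H.nh⟩,
    fun p hp q hq => ?_, fun p hp q hq => ?_, H.fr⟩
  · obtain ⟨k, h1⟩ := hk p hp
    obtain ⟨l, h2⟩ := hk q hq
    simp only [h1, h2, Val.cmp_num]
  · simp only [H.m5 p hp, H.m5 q hq, Val.cmp_num]

/-- The fields are different. -/
def Flds (ln ky T ND : ℕ) : Prop := 6 < ln ∧ ln < ky ∧ ky < 20 ∧ ky < ND ∧ ND ≠ 20 ∧ ND < 30 ∧ 33 < T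

theorem Flds.ok {ln ky T ND : ℕ} (h : Flds ln ky T ND) : (hpOf ky T ND).OK := by
  unfold Flds at h
  constructor <;> simp only <;> omega

/-- Recompute the key of the point in register 101, if there is one. -/
def Rekey (ln ky T ND : ℕ) (cv : Program) : Program :=
  nl 107 ;; ifEq 101 107 .skip (ld 50 101 ND ;; Pull (hpOf ky T ND) ;; SetKey ln ky cv ;; mv 40 101 ;;
    Ins (hpOf ky T ND))

@[simp] theorem wf_Rekey (ln ky T ND : ℕ) (cv : Program) (f : ℕ) :
    wf (Rekey ln ky T ND cv) f = ((f == T || f == ND) || ((wf cv f || f == ky) ||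
      (f == T || f == ND))) := by simp [Rekey]

/-- The point is taken out of the heap, gets its new key and is inserted again, so heap order is
never stated for a half-changed key. -/
theorem Rekey_spec {B n h tb ln ky T ND : ℕ} {cl rx rc r c : ℕ → ℕ} {A : Set ℕ} {cv : Program} {s : M}
    (hO : Flds ln ky T ND) (F : Fix n h tb cl rx rc s)
    (H : Scene n cl r c) (hcv : Conv B n rx r cv)
    (hln : ∀ p ∈ A, Prev c A p (s.mem ln p)) (hkn : ∀ p < n, ∃ k, s.mem ky p = .num k)
    (hkey : ∀ p ∈ A, s.reg 101 ≠ .ptr p → ∃ k, s.mem ky p = .num k ∧ FKey cl r A p k)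
    (hh : HeapS (hpOf ky T ND) h tb n rx A s)
    (h101 : s.reg 101 = .nil ∨ ∃ p ∈ A, s.reg 101 = .ptr p) :
    wp B (Rekey ln ky T ND cv) s fun s' => Half n h tb cl rx r c ln ky T ND A s' ∧
      s'.time ≤ s.time + 120 * (h + 2) + 20 := by
  have hO' := hO
  unfold Flds at hO
  have hA := hh.sub
  rcases h101 with h101 | ⟨p, hp, h101⟩
  · refine wp.abs fun R hR => ?_
    simp [Rekey, h101]
    simp only [hR]
    refine ⟨⟨hln, fun p hp => ?_, hkn, hh.of rfl rfl rfl rfl⟩, by simp; omega⟩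
    exact hkey p hp (by simp [h101])
  have hpn := hA p hp
  obtain ⟨k, e, hk, hT⟩ := hh.heap.mem p hp
  have hND : s.mem ND p = .ptr (tb + k) := (hh.heap.at hk hT).2.1
  simp only [Rekey, wp_seq, wp_nl, wp_ifEq, M.set_reg, h101, if_true, if_false,
    show (101 : ℕ) ≠ 107 by decide, show (101 : ℕ) ≠ 50 by decide, reduceCtorEq, false_implies, ne_eq, not_false_eq_true, true_implies,
    true_and, wp_ld, M.tick_reg, Val.ptr.injEq, exists_eq_left', M.tick_fresh, M.set_fresh,
    M.tick_mem, M.set_mem, hND, hpn.trans_le F.fr]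
  have F0 : Fix n h tb cl rx rc (((s.set 107 .nil).tick).set 50 (.ptr (tb + k))) :=
    F.of (fun i hi => by simp only [M.set_reg, M.tick_reg]; repeat' rw [if_neg (by omega)])
      (fun _ _ => rfl) le_rfl
  refine wp.frame (Pull_spec hO'.ok F0.tree (F0.pts hkn) (hh.of rfl rfl rfl rfl) hk hT (by simp)) ?_
  rintro s1 hF1 ⟨h1, t1⟩
  have m1 : ∀ f, f ≠ T → f ≠ ND → s1.mem f = s.mem f := fun f a b =>
    (hF1.mem f (by simp [a, b])).trans rfl
  have g1 : s1.reg 101 = .ptr p := (hF1.reg 101 (by rfl)).trans (by simp [h101])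
  have F1 : Fix n h tb cl rx rc s1 := F0.of
    (fun i hi => hF1.reg i (by rcases hi with rfl | rfl | rfl | rfl <;> rfl))
    (fun f hf => m1 f (by omega) (by omega)) hF1.le
  refine wp.frame (SetKey_spec H hcv hA hp F1.fr g1 F1.r5 F1.r6 F1.r7 F1.m3 F1.m5
    (by rw [m1 ln (by omega) (by omega)]; exact hln p hp)) ?_
  rintro s2 hF2 ⟨t2, k', hk', hfk⟩
  rw [m1 ky (by omega) (by omega)] at hk'
  have m2 : ∀ f, f ≠ ky → s2.mem f = s1.mem f := fun f a => hF2.mem f (by simp [hcv.mem, a])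
  have r2 : ∀ i, i < 100 → s2.reg i = s1.reg i := fun i hi => hF2.reg i (by
    have := hcv.reg i (by omega) (by omega)
    simp [SetKey, wr, nl, mv, ld, ifEq, st, this]
    omega)
  have r2' : s2.reg 101 = s1.reg 101 := hF2.reg 101 (by
    have := hcv.reg 101 (by omega) (by omega)
    simp [SetKey, wr, nl, mv, ld, ifEq, st, this])
  rw [wp_mv]
  have F2 : Fix n h tb cl rx rc (s2.set 40 (s2.reg 101)) := F1.of
    (fun i hi => by
      rw [M.set_reg, if_neg (by omega)]
      exact r2 i (by omega))
    (fun f hf => m2 f (by omega)) hF2.le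
  have keyn2 : ∀ q < n, ∃ k, s2.mem ky q = .num k := fun q hq => by
    rw [hk', Function.update_apply]
    split_ifs
    · exact ⟨_, rfl⟩
    · exact hkn q hq
  have h2 : HeapS (hpOf ky T ND) h tb n rx (A \ {p}) (s2.set 40 (s2.reg 101)) := by
    refine ⟨?_, h1.sub⟩
    have := h1.heap
    simp only [HP.key, M.set_mem] at this ⊢
    rw [m2 T (by omega), m2 ND (by omega), m2 5 (by omega)]
    -- The only changed key belongs to the point outside the heap.
    refine this.congr fun q hq => ?_
    simp only [keyOf, hk', m1 ky (by omega) (by omega)]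
    rw [Function.update_of_ne (by rintro rfl; exact hq.2 rfl)]
  refine wp.frame (Ins_spec (p := p) hO'.ok F2.tree (F2.pts keyn2) h2 hpn (fun hh => hh.2 rfl)
    (by rw [M.set_reg, if_pos rfl, r2', g1])) ?_
  rintro s3 hF3 ⟨h3, t3⟩
  have m3 : ∀ f, f ≠ T → f ≠ ND → s3.mem f = s2.mem f := fun f a b =>
    (hF3.mem f (by simp [a, b])).trans rfl
  rw [Set.insert_sdiff_singleton, Set.insert_eq_of_mem hp] at h3
  refine ⟨⟨fun q hq => ?_, fun q hq => ?_, fun q hq => ?_, h3⟩, ?_⟩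
  · rw [m3 ln (by omega) (by omega), m2 ln (by omega), m1 ln (by omega) (by omega)]
    exact hln q hq
  · rw [m3 ky (by omega) (by omega), hk']
    by_cases hqp : q = p
    · subst hqp
      exact ⟨k', by simp, hfk⟩
    · rw [Function.update_of_ne hqp]
      exact hkey q hq (by rw [h101]; intro hh; cases hh; exact hqp rfl)
  · rw [m3 ky (by omega) (by omega)]
    exact keyn2 q hq
  · simp only [M.set_time, M.tick_time] at t1 t3
    omega

/-- Remove the point in register 90 from a tree, where register `rs` has the point whose link led to
it. -/
def Drop (ln ky T ND rs : ℕ) (cv : Program) : Program :=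
  ld 50 90 ND ;; Pull (hpOf ky T ND) ;; mv 101 rs ;; Rekey ln ky T ND cv

@[simp] theorem wf_Drop (ln ky T ND rs : ℕ) (cv : Program) (f : ℕ) :
    wf (Drop ln ky T ND rs cv) f = ((f == T || f == ND) || ((f == T || f == ND) ||
      ((wf cv f || f == ky) || (f == T || f == ND)))) := by simp [Drop]

/-- Here `s₀` is the state before unlinking and `v` the neighbour of `p` on the other side, the one
point whose link in `ln` pointed to `p`. By `FKey.delete` it is also the only point whose key may
change. -/
theorem Drop_spec {B n h tb ln ky T ND rs p : ℕ} {cl rx rc r c : ℕ → ℕ} {A : Set ℕ} {cv : Program}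
    {s s₀ : M} {v : Val}
    (hO : Flds ln ky T ND) (F : Fix n h tb cl rx rc s) (hrs : rs = 108 ∨ rs = 109)
    (H : Scene n cl r c) (hcv : Conv B n rx r cv) (H₀ : Half n h tb cl rx r c ln ky T ND A s₀)
    (hp : p ∈ A) (hv : Prev (rev n c) A p v)
    (hln : ∀ q, v = .ptr q → s.mem ln q = s₀.mem ln p)
    (hln' : ∀ q, v ≠ .ptr q → s.mem ln q = s₀.mem ln q)
    (hky : s.mem ky = s₀.mem ky) (hT : s.mem T = s₀.mem T) (hND : s.mem ND = s₀.mem ND)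
    (hm5 : s.mem 5 = s₀.mem 5) (h90 : s.reg 90 = .ptr p) (hrsv : s.reg rs = v) :
    wp B (Drop ln ky T ND rs cv) s fun s' => Half n h tb cl rx r c ln ky T ND (A \ {p}) s' ∧
      s'.time ≤ s.time + 160 * (h + 2) + 22 := by
  have hO' := hO
  unfold Flds at hO
  have hh : HeapS (hpOf ky T ND) h tb n rx A s := H₀.heap.of hT hND hky hm5
  have hA := hh.sub
  have hpn := hA p hp
  obtain ⟨k, e, hk, hkT⟩ := hh.heap.mem p hp
  have hkN : s.mem ND p = .ptr (tb + k) := (hh.heap.at hk hkT).2.1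
  have hkn : ∀ p < n, ∃ k, s.mem ky p = .num k := by rw [hky]; exact H₀.keyn
  have F0 : Fix n h tb cl rx rc (s.set 50 (.ptr (tb + k))) :=
    F.of (fun i hi => by rw [M.set_reg, if_neg (by omega)]) (fun _ _ => rfl) le_rfl
  rw [Drop, wp_seq, wp_ld]
  refine ⟨p, h90, hpn.trans_le F.fr, ?_⟩
  rw [hkN, wp_seq]
  refine wp.frame (Pull_spec hO'.ok F0.tree (F0.pts hkn) (hh.of rfl rfl rfl rfl) hk hkT (by simp)) ?_
  rintro s1 hF1 ⟨h1, t1⟩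
  have m1 : ∀ f, f ≠ T → f ≠ ND → s1.mem f = s.mem f := fun f a b =>
    (hF1.mem f (by simp [a, b])).trans rfl
  have g1 : s1.reg rs = v := by
    rcases hrs with rfl | rfl
    · exact (hF1.reg 108 (by rfl)).trans (by simp [hrsv])
    · exact (hF1.reg 109 (by rfl)).trans (by simp [hrsv])
  rw [wp_seq, wp_mv]
  have F1 : Fix n h tb cl rx rc (s1.set 101 (s1.reg rs)) := F0.of
    (fun i hi => by
      rw [M.set_reg, if_neg (by omega)]
      exact hF1.reg i (by rcases hi with rfl | rfl | rfl | rfl <;> rfl))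
    (fun f hf => m1 f (by omega) (by omega)) hF1.le
  have hlink := H₀.link
  have hiff : ∀ q ∈ A, s₀.mem ln q = .ptr p ↔ v = .ptr q := fun q hq =>
    (hlink q hq).iff_mirror H hA hp hq hv
  refine (Rekey_spec (A := A \ {p}) hO' F1 H hcv ?_ ?_ ?_ (h1.of rfl rfl rfl rfl) ?_).mono ?_
  · intro q hq
    rw [M.set_mem, m1 ln (by omega) (by omega)]
    by_cases h2 : v = .ptr q
    · have h3 := hlink q hq.1
      rw [(hiff q hq.1).2 h2] at h3
      rw [hln q h2]
      exact h3.skip H hA (hlink p hp)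
    · rw [hln' q h2]
      exact (hlink q hq.1).of_ne fun h3 => h2 ((hiff q hq.1).1 h3)
  · intro q hq
    rw [M.set_mem, m1 ky (by omega) (by omega)]
    exact hkn q hq
  · intro q hq hne
    rw [M.set_reg, if_pos rfl, g1] at hne
    obtain ⟨k, h2, h3⟩ := H₀.key q hq.1
    refine ⟨k, ?_, h3.delete H hA hp hq.1 (hlink q hq.1) fun h4 => hne ((hiff q hq.1).1 h4)⟩
    rw [M.set_mem, m1 ky (by omega) (by omega), hky, h2]
  · rw [M.set_reg, if_pos rfl, g1]
    rcases hv with ⟨rfl, -⟩ | ⟨q, hq, rfl, h2, -⟩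
    · exact .inl rfl
    · refine .inr ⟨q, ⟨hq, fun h3 => ?_⟩, rfl⟩
      rw [Set.mem_singleton_iff.1 h3] at h2
      omega
  · rintro s2 ⟨h2, t2⟩
    refine ⟨h2, ?_⟩
    simp only [M.set_time] at t1 t2
    omega

@[simp] theorem wf_Update (f : ℕ) : wf Update f = (f == 36) := by
  simp [Update, Bump, NextBp, wf]

theorem Prev.congr {c c' : ℕ → ℕ} {A : Set ℕ} {p : ℕ} {v : Val} (hp : p ∈ A)
    (h : ∀ q ∈ A, c q = c' q) (H : Prev c A p v) : Prev c' A p v := by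
  rcases H with ⟨rfl, h1⟩ | ⟨q, hq, rfl, h1, h2⟩
  · exact .inl ⟨rfl, fun q hq => by rw [← h q hq, ← h p hp]; exact h1 q hq⟩
  · refine .inr ⟨q, hq, rfl, by rwa [← h q hq, ← h p hp], fun s hs => ?_⟩
    rw [← h q hq, ← h p hp, ← h s hs]; exact h2 s hs

/-- The tree of last points works with the rank n + 1 - r, but only r is stored. -/
def ConvR : Program := ad 105 7 5 ;; sb 104 105 104

theorem conv_skip {B n : ℕ} {rx : ℕ → ℕ} : Conv B n rx rx .skip :=
  ⟨fun s q _ _ _ h => by simp [h], fun _ _ _ => rfl, fun _ => rfl, rfl, rfl⟩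

theorem convR {B n : ℕ} {rx : ℕ → ℕ} (hB : n + 1 ≤ B) : Conv B n rx (rev n rx) ConvR := by
  refine ⟨fun s q hq h5 h7 h => ?_, fun i h1 h2 => ?_, fun f => by simp [ConvR], rfl, rfl⟩
  · simp [ConvR, h5, h7, h, show n < B by omega, rev]
  · simp [ConvR, wr, ad, sb]; omega

/-- The data structure when the points in `A` have not been deleted. -/
structure Alive (n h tb b : ℕ) (cl rx rc : ℕ → ℕ) (A : Set ℕ) (s : M) : Prop where
  left : Half n h tb cl rx rx rc 10 14 43 24 A s
  right : Half n h tb cl rx (rev n rx) (rev n rc) 11 15 44 25 A s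
  cnt : ∃ c, CntS h tb b c s ∧ CntOK h b (dead n rc A) c

theorem Alive.of {n h tb b : ℕ} {cl rx rc : ℕ → ℕ} {A : Set ℕ} {s s' : M}
    (H : Alive n h tb b cl rx rc A s) (hm : ∀ f ∈ [5, 10, 11, 14, 15, 24, 25, 32, 35, 36, 43, 44],
      s'.mem f = s.mem f) (hf : s.fresh ≤ s'.fresh) : Alive n h tb b cl rx rc A s' := by
  refine ⟨H.left.of ?_ ?_ ?_ ?_ ?_, H.right.of ?_ ?_ ?_ ?_ ?_, ?_⟩
  any_goals exact hm _ (by simp)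
  obtain ⟨c, h1, h2⟩ := H.cnt
  exact ⟨c, h1.of (hm _ (by simp)) (hm _ (by simp)) (hm _ (by simp)) hf, h2⟩

def Unlink : Program :=
  ld 108 90 10 ;; ld 109 90 11 ;; nl 110 ;; ifEq 108 110 .skip (st 108 11 109) ;;
    ifEq 109 110 .skip (st 109 10 108)

/-- Delete the point in register 90. -/
def Delete : Program :=
  mv 80 90 ;; Update ;; Unlink ;; Drop 10 14 43 24 109 .skip ;; Drop 11 15 44 25 108 ConvR

theorem Unlink_spec {B p : ℕ} {s : M} {v w : Val} (h90 : s.reg 90 = .ptr p) (hp : p < s.fresh)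
    (hv : s.mem 10 p = v) (hw : s.mem 11 p = w) (hvf : ∀ q, v = .ptr q → q < s.fresh ∧ q ≠ p)
    (hwf : ∀ q, w = .ptr q → q < s.fresh ∧ q ≠ p) (hv' : v = .nil ∨ ∃ q, v = .ptr q)
    (hw' : w = .nil ∨ ∃ q, w = .ptr q) :
    wp B Unlink s fun s' => s'.reg 108 = v ∧ s'.reg 109 = w ∧ s'.time ≤ s.time + 7 ∧
      (∀ q, w = .ptr q → s'.mem 10 q = v) ∧ (∀ q, w ≠ .ptr q → s'.mem 10 q = s.mem 10 q) ∧
      (∀ q, v = .ptr q → s'.mem 11 q = w) ∧ (∀ q, v ≠ .ptr q → s'.mem 11 q = s.mem 11 q) := by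
  refine wp.abs fun R hR => ?_
  rcases hv' with rfl | ⟨a, rfl⟩ <;> rcases hw' with rfl | ⟨c, rfl⟩
  · simp [Unlink, h90, hp, hv, hw]
    simp only [hR]
    simp
  · have hc := hwf c rfl
    simp [Unlink, h90, hp, hv, hw, hc]
    simp only [hR]
    simp
    exact fun q hq => Function.update_of_ne (Ne.symm hq) _ _
  · have ha := hvf a rfl
    simp [Unlink, h90, hp, hv, hw, ha]
    simp only [hR]
    simp
    exact fun q hq => Function.update_of_ne (Ne.symm hq) _ _
  · have hc := hwf c rfl
    have ha := hvf a rfl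
    simp [Unlink, h90, hp, hv, hw, ha, hc]
    simp only [hR]
    simp
    exact ⟨fun q hq => Function.update_of_ne (Ne.symm hq) _ _,
      fun q hq => Function.update_of_ne (Ne.symm hq) _ _⟩

theorem Delete_spec {B n h tb b p : ℕ} {cl rx rc : ℕ → ℕ} {A : Set ℕ} {s : M} (hb : b ≠ 0)
    (hh : 1 ≤ h) (hB : n + 1 ≤ B) (F : Fix n h tb cl rx rc s) (H : Alive n h tb b cl rx rc A s)
    (hp : p ∈ A) (h90 : s.reg 90 = .ptr p) :
    wp B Delete s fun s' => Alive n h tb b cl rx rc (A \ {p}) s' ∧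
      s'.time ≤ s.time + (h / b + 1) * (8 * 2 ^ b + 11) + 320 * (h + 2) + 60 := by
  have hA := H.left.heap.sub
  have hpn := hA p hp
  have hpf := hpn.trans_le F.fr
  obtain ⟨c, hc, hcD⟩ := H.cnt
  have hsc := F.scene
  have hpr := H.left.link p hp
  have hnx := H.right.link p hp
  have vk : ∀ {r v}, Prev r A p v → v = .nil ∨ ∃ q, v = .ptr q := fun hv => by
    rcases hv with ⟨h1, -⟩ | ⟨q, -, h1, -⟩
    · exact .inl h1
    · exact .inr ⟨q, h1⟩
  have vlt : ∀ {r v}, Prev r A p v → ∀ q, v = .ptr q → q < n ∧ q ≠ p := fun hv q hq => by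
    rcases hv with ⟨h1, -⟩ | ⟨q', h2, h1, h3, -⟩
    · rw [h1] at hq; cases hq
    · rw [h1] at hq; cases hq
      exact ⟨hA _ h2, by rintro rfl; omega⟩
  rw [Delete, wp_seq, wp_mv, wp_seq]
  refine wp.frame (Update_spec (i := rc p) (D := dead n rc A) (p := p) (s := s.set 80 (s.reg 90)) hb
    (hc.of rfl rfl rfl le_rfl) hcD (by simp [h90]) hpf (F.m20 p hpn) (hsc.c_pos p hpn)
    ((hsc.c_le p hpn).trans F.nh) (notMem_dead hsc hA hp)
    ((dead_card_lt hA hp).trans (by omega)) (by simp [F.r5]) hh) ?_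
  rintro s1 hF1 ⟨⟨c1, hc1, hcD1⟩, t1⟩
  rw [← dead_delete hpn hp] at hcD1
  have m1 : ∀ f, f ≠ 36 → s1.mem f = s.mem f := fun f hf =>
    (hF1.mem f (by simp [hf])).trans rfl
  have f1 : s1.fresh = s.fresh := hF1.fresh (by rfl)
  have r1 : ∀ i, i < 80 → i ≠ 3 → i ≠ 4 → s1.reg i = s.reg i := fun i hi h3 h4 => by
    rw [hF1.reg i (by
      simp [Update, Bump, NextBp, wr, ld, mv, ad, nl, nm, st, ifEq, whileNN, chk]; omega)]
    simp; omega
  have g90 : s1.reg 90 = .ptr p := (hF1.reg 90 (by rfl)).trans (by simp [h90])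
  rw [wp_seq]
  refine wp.frame (Unlink_spec g90 (by omega) rfl rfl ?_ ?_ ?_ ?_) ?_
  · rw [m1 10 (by decide), f1]
    exact fun q hq => ⟨(vlt hpr q hq).1.trans_le F.fr, (vlt hpr q hq).2⟩
  · rw [m1 11 (by decide), f1]
    exact fun q hq => ⟨(vlt hnx q hq).1.trans_le F.fr, (vlt hnx q hq).2⟩
  · rw [m1 10 (by decide)]; exact vk hpr
  · rw [m1 11 (by decide)]; exact vk hnx
  rintro s2 hF2 ⟨h108, h109, t2, q1, q2, q3, q4⟩
  rw [m1 10 (by decide), m1 11 (by decide)] at *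
  have m2 : ∀ f, f ≠ 36 → f ≠ 10 → f ≠ 11 → s2.mem f = s.mem f := fun f h1 h2 h3 =>
    (hF2.mem f (by simp [Unlink, h2, h3])).trans (m1 f h1)
  have f2 : s2.fresh = s.fresh := (hF2.fresh (by rfl)).trans f1
  have r2 : ∀ i, i = 5 ∨ i = 6 ∨ i = 7 ∨ i = 8 → s2.reg i = s.reg i := fun i hi =>
    (hF2.reg i (by rcases hi with rfl | rfl | rfl | rfl <;> rfl)).trans
      (r1 i (by omega) (by omega) (by omega))
  have g90' : s2.reg 90 = .ptr p := (hF2.reg 90 (by rfl)).trans g90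
  have F2 : Fix n h tb cl rx rc s2 := F.of r2 (fun f hf => m2 f (by omega) (by omega) (by omega))
    f2.ge
  rw [wp_seq]
  refine wp.frame (Drop_spec (rs := 109) (v := s.mem 11 p) (s₀ := s) (A := A) (p := p) (r := rx)
    (c := rc) (by unfold Flds; decide) F2
    (.inr rfl) hsc conv_skip H.left hp hnx q1 q2 (m2 _ (by decide) (by decide) (by decide))
    (m2 _ (by decide) (by decide) (by decide)) (m2 _ (by decide) (by decide) (by decide))
    (m2 _ (by decide) (by decide) (by decide)) g90' h109) ?_
  rintro s3 hF3 ⟨hL, t3⟩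
  have m3 : ∀ f, f ≠ 43 → f ≠ 24 → f ≠ 14 → s3.mem f = s2.mem f := fun f h1 h2 h3 =>
    hF3.mem f (by simp [h1, h2, h3])
  have f3 : s3.fresh = s2.fresh := hF3.fresh (by rfl)
  have F3 : Fix n h tb cl rx rc s3 := F2.of
    (fun i hi => hF3.reg i (by rcases hi with rfl | rfl | rfl | rfl <;> rfl))
    (fun f hf => m3 f (by omega) (by omega) (by omega)) f3.ge
  have g3 : s3.reg 90 = .ptr p := (hF3.reg 90 (by rfl)).trans g90'
  have g108 : s3.reg 108 = s.mem 10 p := (hF3.reg 108 (by rfl)).trans h108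
  -- The mirror of the mirrored order is the order itself, since ranks are at most n; truncation
  -- does no harm.
  have hrev : ∀ q ∈ A, rc q = rev n (rev n rc) q := fun q hq => by
    have := hsc.c_le q (hA q hq); unfold rev; omega
  refine wp.frame (Drop_spec (rs := 108) (v := s.mem 10 p) (s₀ := s) (A := A) (p := p)
    (r := rev n rx) (c := rev n rc) (by unfold Flds; decide) F3
    (.inl rfl) hsc.mirror (convR hB) H.right hp (hpr.congr hp hrev) ?_ ?_ ?_ ?_ ?_ ?_ g3 g108) ?_
  · intro q hq
    rw [m3 11 (by decide) (by decide) (by decide)]; exact q3 q hq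
  · intro q hq
    rw [m3 11 (by decide) (by decide) (by decide)]; exact q4 q hq
  any_goals
    rw [m3 _ (by decide) (by decide) (by decide), m2 _ (by decide) (by decide) (by decide)]
  rintro s4 hF4 ⟨hR, t4⟩
  have m4 : ∀ f, f ≠ 44 → f ≠ 25 → f ≠ 15 → s4.mem f = s3.mem f := fun f h1 h2 h3 =>
    hF4.mem f (by simp [ConvR, h1, h2, h3])
  have f4 : s4.fresh = s3.fresh := hF4.fresh (by rfl)
  have cnt : ∀ f, f = 35 ∨ f = 32 ∨ f = 36 → s4.mem f = s1.mem f := fun f hf => by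
    rw [m4 f (by omega) (by omega) (by omega), m3 f (by omega) (by omega) (by omega)]
    exact hF2.mem f (by rcases hf with rfl | rfl | rfl <;> rfl)
  refine ⟨⟨hL.of ?_ ?_ ?_ ?_ ?_, hR, c1, hc1.of (cnt _ (by tauto)) (cnt _ (by tauto))
    (cnt _ (by tauto)) (by omega), hcD1⟩, ?_⟩
  any_goals exact m4 _ (by decide) (by decide) (by decide)
  simp only [M.set_time] at t1
  linarith

/-! ### Answering a query -/

/-- For the first point of a colour, leave its rank among the survivors in field 22 of the
representative of the colour. -/
def ActF : Program := mv 80 98 ;; Rank ;; ld 83 98 21 ;; st 83 22 81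

/-- For the last point of a colour, report its rank plus one minus the rank left by the first point.
The 1 is added before the truncated subtraction. -/
def ActL : Program :=
  mv 80 98 ;; Rank ;; ad 81 81 5 ;; ld 83 98 21 ;; ld 83 83 22 ;; sb 81 81 83 ;; ld 83 98 3 ;; rt 83 81

/-- Answer the query in register 70, the fields 60 and 61 of which bound the ranks of its points. -/
def Answer : Program :=
  rq 70 ;; ld 92 70 60 ;; ld 93 70 61 ;; ifLt 92 93 (mv 94 92 ;; Dfs 43 14 ActF ;; sb 94 7 93 ;;
    Dfs 44 15 ActL) .skip

/-- Field 21 refers to a representative of the colour of a point. -/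
structure RepS (n : ℕ) (cl rep : ℕ → ℕ) (s : M) : Prop where
  m21 : ∀ p < n, s.mem 21 p = .ptr (rep p)
  lt : ∀ p < n, rep p < n
  iff : ∀ p < n, ∀ q < n, rep p = rep q ↔ cl p = cl q

/-- The rank of a point in the order `rc`, among the points in `A`. -/
noncomputable def rankIn (n : ℕ) (rc : ℕ → ℕ) (A : Set ℕ) (p : ℕ) : ℕ :=
  rc p - cntI (dead n rc A) 0 (rc p - 1)

theorem Rank_spec' {B n h tb b p : ℕ} {cl rx rc : ℕ → ℕ} {A : Set ℕ} {s : M} (hb : b ≠ 0)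
    (F : Fix n h tb cl rx rc s) (H : Alive n h tb b cl rx rc A s) (hp : p < n)
    (h98 : s.reg 98 = .ptr p) :
    wp B (mv 80 98 ;; Rank) s fun s' => s'.reg 81 = .num (rankIn n rc A p) ∧
      s'.time ≤ s.time + 7 * (h / b) + 21 := by
  obtain ⟨c, hc, hcD⟩ := H.cnt
  rw [wp_seq, wp_mv]
  refine wp.mono (Rank_spec (p := p) (i := rc p) (s := s.set 80 (s.reg 98)) hb (hc.of rfl rfl rfl le_rfl) hcD (by simp [h98])
    (hp.trans_le F.fr) (F.m6 p hp) (F.m20 p hp) (F.scene.c_pos p hp)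
    ((F.scene.c_le p hp).trans F.nh)) ?_
  rintro s' ⟨h1, h2⟩
  refine ⟨h1, ?_⟩
  simp only [M.set_time] at h2
  omega

theorem Same.fix {n h tb : ℕ} {cl rx rc : ℕ → ℕ} {act : Program} {s s' : M}
    (F : Fix n h tb cl rx rc s) (hs : Same act s s')
    (hr : ∀ i, i = 5 ∨ i = 6 ∨ i = 7 ∨ i = 8 → wr act i = false)
    (hm : ∀ f, f = 3 ∨ f = 5 ∨ f = 6 ∨ f = 20 ∨ f = 30 ∨ f = 31 ∨ f = 33 → wf act f = false) :
    Fix n h tb cl rx rc s' :=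
  F.of (fun i hi => hs.reg i (by omega) (by omega) (by omega) (hr i hi))
    (fun f hf => hs.mem f (hm f hf)) hs.fresh.ge

/-- The heap breaks ties by rank, whereas the search compares keys alone; the lexicographic order
implies the weak order of the keys. -/
theorem Half.dfsKey {n h tb : ℕ} {cl rx r c : ℕ → ℕ} {ln ky T ND : ℕ} {A : Set ℕ} {s : M}
    (H : Half n h tb cl rx r c ln ky T ND A s) {kf : ℕ → ℕ}
    (hkf : ∀ p ∈ A, s.mem ky p = .num (kf p) ∧ FKey cl r A p (kf p)) :
    ∀ p ∈ A, ∀ q ∈ A, (hpOf ky T ND).key s p ≤ (hpOf ky T ND).key s q → kf p ≤ kf q := by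
  intro p hp q hq hle
  simp only [HP.key, keyOf, (hkf p hp).1, (hkf q hq).1, Prod.Lex.toLex_le_toLex] at hle
  rcases hle with h1 | ⟨h1, -⟩
  · simp only [Val.toReal, Nat.cast_lt] at h1; exact h1.le
  · simp only [Val.toReal, Nat.cast_inj] at h1; exact h1.le

section
variable {B n h tb b : ℕ} {cl rx rc rep : ℕ → ℕ} {A : Set ℕ} {s : M}

/-- Each colour has at most one first point in the range, so the value left at a representative is
not overwritten during the traversal. -/
theorem firsts_spec (hb : b ≠ 0) (F : Fix n h tb cl rx rc s) (H : Alive n h tb b cl rx rc A s)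
    (hrep : RepS n cl rep s) {kf : ℕ → ℕ}
    (hkf : ∀ p ∈ A, s.mem 14 p = .num (kf p) ∧ FKey cl rx A p (kf p)) {lo hi : ℕ}
    (h92 : s.reg 92 = .num lo) (h93 : s.reg 93 = .num hi) (h94 : s.reg 94 = .num lo) (hlo : lo < hi) :
    wp B (Dfs 43 14 ActF) s fun s' => ∃ l : List ℕ, l.Nodup ∧
      (∀ p, p ∈ l ↔ p ∈ A ∧ lo < rx p ∧ rx p ≤ hi ∧ kf p ≤ lo) ∧
      (∀ p ∈ l, s'.mem 22 (rep p) = .num (rankIn n rc A p)) ∧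
      s'.time ≤ s.time + (7 * (h / b) + 66) * l.length + 84 * h + 26 := by
  have hA := H.left.heap.sub
  have hyp : DfsHyp B 43 14 ActF h tb ((hpOf 14 43 24).key s) (s.mem 24) rx kf A lo hi lo s
      (fun l mem _ => (∀ p ∈ l, p ∈ A ∧ lo < rx p ∧ rx p ≤ hi ∧ kf p ≤ lo) ∧
        ∀ p ∈ l, mem 22 (rep p) = .num (rankIn n rc A p)) (7 * (h / b) + 24) := by
    refine ⟨F.tree, H.left.heap.heap, H.left.dfsKey hkf, fun p hp => (hkf p hp).1,
      fun p hp => F.m5 p (hA p hp), fun p hp => (hA p hp).trans_le F.fr, h92, h93, h94,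
      fun f hf => by rcases hf with rfl | rfl | rfl | rfl | rfl | rfl <;> rfl,
      fun i h1 h2 => by interval_cases i <;> rfl, rfl, ?_⟩
    rintro l p s' hs ⟨hJ1, hJ2⟩ h98 hp h1 h2 h3
    have F' : Fix n h tb cl rx rc s' := hs.fix F
      (fun i hi => by rcases hi with rfl | rfl | rfl | rfl <;> rfl)
      (fun f hf => by rcases hf with rfl | rfl | rfl | rfl | rfl | rfl | rfl <;> rfl)
    have H' : Alive n h tb b cl rx rc A s' := H.of (fun f hf => hs.mem f (by
      simp only [List.mem_cons, List.not_mem_nil, or_false] at hf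
      rcases hf with rfl | rfl | rfl | rfl | rfl | rfl | rfl | rfl | rfl | rfl | rfl | rfl <;> rfl))
      hs.fresh.ge
    have hpn := hA p hp
    have e21 := hs.mem 21 (by rfl)
    have assoc : ∀ {a b c : Program} {s : M} {Q : M → Prop}, wp B ((a ;; b) ;; c) s Q →
        wp B (a ;; b ;; c) s Q := fun hh => by simpa only [wp_seq] using hh
    rw [ActF]
    refine assoc ?_
    rw [wp_seq]
    refine wp.frame (Rank_spec' hb F' H' hpn h98) ?_
    rintro s1 hF1 ⟨h81, t1⟩
    have g98 : s1.reg 98 = .ptr p := (hF1.reg 98 (by rfl)).trans h98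
    have f1 : s1.fresh = s'.fresh := hF1.fresh (by rfl)
    have g21 : s1.mem 21 p = .ptr (rep p) := by
      rw [hF1.mem 21 (by rfl), e21]; exact hrep.m21 p hpn
    have g22 : s1.mem 22 = s'.mem 22 := hF1.mem 22 (by rfl)
    have hlt := hrep.lt p hpn
    have hfr := F'.fr
    refine wp.abs fun R hR => ?_
    simp [g98, f1, hpn.trans_le hfr, g21, hlt.trans_le hfr, h81, g22]
    simp only [hR]
    have hJ1' : ∀ q ∈ l ++ [p], q ∈ A ∧ lo < rx q ∧ rx q ≤ hi ∧ kf q ≤ lo := by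
      intro q hq
      rcases List.mem_append.1 hq with hq | hq
      · exact hJ1 q hq
      · rw [List.mem_singleton.1 hq]; exact ⟨hp, h1, h2, h3⟩
    refine ⟨⟨hJ1', fun q hq => ?_⟩, by simp; omega⟩
    obtain ⟨a1, a2, a3, a4⟩ := hJ1' q hq
    -- Equal representatives mean equal colours, and two first points of one colour coincide.
    by_cases hqp : rep q = rep p
    · have hcl := (hrep.iff q (hA q a1) p hpn).1 hqp
      obtain rfl := (hkf q a1).2.unique F.scene hA a1 hp (hkf p hp).2 a2 h1 a4 h3 hcl
      simp
    · have hql : q ∈ l := by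
        rcases List.mem_append.1 hq with hq | hq
        · exact hq
        · exact absurd (by rw [List.mem_singleton.1 hq]) hqp
      simp [hqp, hJ2 q hql, g22]
  refine (hyp.spec hlo ⟨by simp, by simp⟩).mono ?_
  rintro s' ⟨l, h1, h2, ⟨h3, h4⟩, h5⟩
  exact ⟨l, h1, h2, h4, h5⟩

theorem lasts_spec (hb : b ≠ 0) (hB : n + 1 ≤ B) (F : Fix n h tb cl rx rc s)
    (H : Alive n h tb b cl rx rc A s)
    (hrep : RepS n cl rep s) {kl g : ℕ → ℕ}
    (hkl : ∀ p ∈ A, s.mem 15 p = .num (kl p) ∧ FKey cl (rev n rx) A p (kl p)) {lo hi thr : ℕ}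
    (h92 : s.reg 92 = .num lo) (h93 : s.reg 93 = .num hi) (h94 : s.reg 94 = .num thr) (hlo : lo < hi)
    (hg : ∀ p ∈ A, lo < rx p → rx p ≤ hi → kl p ≤ thr → s.mem 22 (rep p) = .num (g p)) :
    wp B (Dfs 44 15 ActL) s fun s' => ∃ l : List ℕ, l.Nodup ∧
      (∀ p, p ∈ l ↔ p ∈ A ∧ lo < rx p ∧ rx p ≤ hi ∧ kl p ≤ thr) ∧
      s'.out = s.out ++ l.map (fun p => .tuple (cl p) (rankIn n rc A p + 1 - g p)) ∧
      s'.time ≤ s.time + (7 * (h / b) + 69) * l.length + 84 * h + 26 := by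
  have hA := H.left.heap.sub
  have hyp : DfsHyp B 44 15 ActL h tb ((hpOf 15 44 25).key s) (s.mem 25) rx kl A lo hi thr s
      (fun l _ out => out = s.out ++ l.map (fun p => .tuple (cl p) (rankIn n rc A p + 1 - g p)))
      (7 * (h / b) + 27) := by
    refine ⟨F.tree, H.right.heap.heap, H.right.dfsKey hkl, fun p hp => (hkl p hp).1,
      fun p hp => F.m5 p (hA p hp), fun p hp => (hA p hp).trans_le F.fr, h92, h93, h94,
      fun f hf => by rcases hf with rfl | rfl | rfl | rfl | rfl | rfl <;> rfl,
      fun i h1 h2 => by interval_cases i <;> rfl, rfl, ?_⟩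
    rintro l p s' hs hJ h98 hp h1 h2 h3
    have F' : Fix n h tb cl rx rc s' := hs.fix F
      (fun i hi => by rcases hi with rfl | rfl | rfl | rfl <;> rfl)
      (fun f hf => by rcases hf with rfl | rfl | rfl | rfl | rfl | rfl | rfl <;> rfl)
    have H' : Alive n h tb b cl rx rc A s' := H.of (fun f hf => hs.mem f (by
      simp only [List.mem_cons, List.not_mem_nil, or_false] at hf
      rcases hf with rfl | rfl | rfl | rfl | rfl | rfl | rfl | rfl | rfl | rfl | rfl | rfl <;> rfl))
      hs.fresh.ge
    have hpn := hA p hp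
    have e21 := hs.mem 21 (by rfl)
    have e22 := hs.mem 22 (by rfl)
    have assoc : ∀ {a b c : Program} {s : M} {Q : M → Prop}, wp B ((a ;; b) ;; c) s Q →
        wp B (a ;; b ;; c) s Q := fun hh => by simpa only [wp_seq] using hh
    rw [ActL]
    refine assoc ?_
    rw [wp_seq]
    refine wp.frame (Rank_spec' hb F' H' hpn h98) ?_
    rintro s1 hF1 ⟨h81, t1⟩
    have g98 : s1.reg 98 = .ptr p := (hF1.reg 98 (by rfl)).trans h98
    have g5 : s1.reg 5 = .num 1 := (hF1.reg 5 (by rfl)).trans F'.r5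
    have f1 : s1.fresh = s'.fresh := hF1.fresh (by rfl)
    have g21 : s1.mem 21 p = .ptr (rep p) := by
      rw [hF1.mem 21 (by rfl), e21]; exact hrep.m21 p hpn
    have g22 : s1.mem 22 (rep p) = .num (g p) := by
      rw [hF1.mem 22 (by rfl), e22]; exact hg p hp h1 h2 h3
    have g3 : s1.mem 3 p = .color (cl p) := by rw [hF1.mem 3 (by rfl)]; exact F'.m3 p hpn
    have go : s1.out = s'.out := hF1.out (by rfl)
    have hlt := hrep.lt p hpn
    have hfr := F'.fr
    have hrk : rankIn n rc A p < B := by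
      have := F.scene.c_le p hpn
      unfold rankIn; omega
    refine wp.abs fun R hR => ?_
    simp [g98, f1, hpn.trans_le hfr, g21, hlt.trans_le hfr, h81, g22, g5, hrk, g3]
    simp only [hR]
    refine ⟨by simp [go, hJ], by simp; omega⟩
  exact hyp.spec hlo (by simp)

/-- An injection of n points into {1, …, n} is onto. -/
theorem Scene.surj {r c : ℕ → ℕ} (H : Scene n cl r c) {x : ℕ} (h1 : 1 ≤ x) (h2 : x ≤ n) :
    ∃ p < n, c p = x := by
  have hsub : (Finset.range n).image c ⊆ Finset.Icc 1 n := by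
    intro y hy
    obtain ⟨p, hp, rfl⟩ := Finset.mem_image.1 hy
    rw [Finset.mem_range] at hp
    exact Finset.mem_Icc.2 ⟨H.c_pos p hp, H.c_le p hp⟩
  have heq := Finset.eq_of_subset_of_card_le hsub (by
    rw [Finset.card_image_of_injOn fun p hp q hq h => H.c_inj p (by simpa using hp) q
      (by simpa using hq) h]
    simp)
  obtain ⟨p, hp, e⟩ := Finset.mem_image.1 (heq ▸ Finset.mem_Icc.2 ⟨h1, h2⟩ :
    x ∈ (Finset.range n).image c)
  exact ⟨p, Finset.mem_range.1 hp, e⟩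

/-- The number of points of `A` of colour `c` and rank in `(lo, hi]`. -/
noncomputable def frq (cl rx : ℕ → ℕ) (A : Set ℕ) (lo hi c : ℕ) : ℕ :=
  Set.ncard {q | q ∈ A ∧ cl q = c ∧ lo < rx q ∧ rx q ≤ hi}

/-- Between f and l in the colour order there are exactly the survivors of their colour in the
range, so `card_between` turns the difference of ranks into the frequency. -/
theorem frq_of_first_last (H : Scene n cl rx rc) (hA : ∀ p ∈ A, p < n) {f l kf kl lo hi : ℕ}
    (hf : f ∈ A) (hl : l ∈ A) (hcl : cl f = cl l) (hF : FKey cl rx A f kf)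
    (hL : FKey cl (rev n rx) A l kl) (hflo : lo < rx f) (hfl : rx f ≤ rx l) (hkf : kf ≤ lo)
    (hlhi : rx l ≤ hi) (hkl : kl ≤ n - hi) (hhn : hi ≤ n) :
    0 < frq cl rx A lo hi (cl l) ∧
      rankIn n rc A l + 1 - rankIn n rc A f = frq cl rx A lo hi (cl l) := by
  have hiff := fun q hq => first_last_iff (q := q) H hA hf hl hq hcl hF hL hflo hkf hlhi hkl hhn
  have hle := ((hiff f hf).1 ⟨rfl, hflo, hfl.trans hlhi⟩).2
  have hset : {q | q ∈ A ∧ cl q = cl l ∧ lo < rx q ∧ rx q ≤ hi} =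
      {q | q ∈ A ∧ rc f ≤ rc q ∧ rc q ≤ rc l} := by
    ext q
    exact and_congr_right fun hq => by rw [← hiff q hq, hcl]
  refine ⟨?_, ?_⟩
  · refine (Set.ncard_pos ((Set.finite_Iio n).subset fun q hq => hA q hq.1)).2
      ⟨l, hl, rfl, by omega, hlhi⟩
  · rw [frq, hset, card_between H hA (fun x => H.surj) hf hl hle, rankIn, rankIn]

/-- One search leaves the rank of the first point of each colour at its representative, the next
reports from the last points. The cost is logarithmic in the number of leaves plus two rank queries
per reported colour. -/
theorem Answer_spec (hb : b ≠ 0) (hB : n + 1 ≤ B) (F : Fix n h tb cl rx rc s)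
    (H : Alive n h tb b cl rx rc A s) (hrep : RepS n cl rep s) {a lo hi : ℕ}
    (h70 : s.reg 70 = .ptr a) (haf : a < s.fresh) (h60 : s.mem 60 a = .num lo)
    (h61 : s.mem 61 a = .num hi) (hhi : hi ≤ n) :
    wp B Answer s fun s' => ∃ l : List (ℕ × ℕ), l.Nodup ∧
      (∀ c f, (c, f) ∈ l ↔ 0 < f ∧ f = frq cl rx A lo hi c) ∧
      s'.out = s.out ++ .query a :: l.map (fun t => .tuple t.1 t.2) ∧
      s'.time ≤ s.time + (14 * (h / b) + 135) * l.length + 168 * h + 80 := by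
  have hA := H.left.heap.sub
  have h7 := F.r7
  refine wp.abs fun R hR => ?_
  rw [Answer]
  simp [h70, haf, h60, h61]
  refine ⟨fun hlt => ?_, fun hle => ?_⟩
  swap
  · simp only [hR]
    -- An empty interval of ranks, which includes the case of x₁ > x₂: the query is announced with
    -- no tuples.
    refine ⟨[], by simp, fun c f => ?_, by simp, by simp; omega⟩
    have : frq cl rx A lo hi c = 0 := by
      rw [frq, Set.ncard_eq_zero ((Set.finite_Iio n).subset fun q hq => hA q hq.1)]
      ext q
      simp only [Set.mem_ofPred_eq, Set.mem_empty_iff_false, iff_false]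
      omega
    simp [this]; omega
  choose! kf hkf using H.left.key
  choose! kl hkl using H.right.key
  have eA : ∀ {s' : M}, (∀ f, f ≠ 22 → s'.mem f = s.mem f) → s'.fresh = s.fresh →
      Alive n h tb b cl rx rc A s' ∧ RepS n cl rep s' :=
    fun hm hf => ⟨H.of (fun f hf => hm f (by
      simp only [List.mem_cons, List.not_mem_nil, or_false] at hf; omega)) hf.ge,
      by rw [hm 21 (by omega)]; exact hrep.m21, hrep.lt, hrep.iff⟩
  set s0 := (((s.emit (.query a)).set 92 (.num lo)).set 93 (.num hi)).tick.set 94 (.num lo) with hs0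
  have A0 := eA (s' := s0) (fun _ _ => rfl) rfl
  have r0 : ∀ i, i = 5 ∨ i = 6 ∨ i = 7 ∨ i = 8 → s0.reg i = s.reg i := fun i hi => by
    simp only [hs0, M.set_reg, M.tick_reg, M.emit_reg]; repeat' rw [if_neg (by omega)]
  refine wp.frame (firsts_spec (lo := lo) (hi := hi) (kf := kf)
    (rep := rep) (s := s0) hb (F.of r0 (fun _ _ => rfl) le_rfl) A0.1 A0.2 hkf
    (by simp [hs0]) (by simp [hs0]) (by simp [hs0]) hlt) ?_
  rintro s1 hF1 ⟨lF, nF, memF, tmpF, t1⟩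
  have g1 : ∀ i, i = 5 ∨ i = 6 ∨ i = 7 ∨ i = 8 → s1.reg i = s.reg i := fun i hi =>
    (hF1.reg i (by rcases hi with rfl | rfl | rfl | rfl <;> rfl)).trans (r0 i hi)
  have m1 : ∀ f, f ≠ 22 → s1.mem f = s.mem f := fun f hf => (hF1.mem f (by
    simp [wf_Dfs, ActF, Rank, Ne.symm hf, hf])).trans rfl
  have f1 : s1.fresh = s.fresh := hF1.fresh (by rfl)
  have o1 : s1.out = s.out ++ [.query a] := hF1.out (by rfl)
  have g92 : s1.reg 92 = .num lo := (hF1.reg 92 (by rfl)).trans (by simp [hs0])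
  have g93 : s1.reg 93 = .num hi := (hF1.reg 93 (by rfl)).trans (by simp [hs0])
  refine ⟨n, (g1 7 (by simp)).trans h7, hi, g93, ?_⟩
  have key : ∀ p, p ∈ A → lo < rx p → rx p ≤ hi →
      ∃ f ∈ A, cl f = cl p ∧ lo < rx f ∧ rx f ≤ rx p ∧ kf f ≤ lo :=
    fun p hp h1 _ => exists_first rx kf (fun q hq => (hkf q hq).2) hp h1
  have keyl : ∀ p, p ∈ A → rx p ≤ hi →
      ∃ l ∈ A, cl l = cl p ∧ rx p ≤ rx l ∧ rx l ≤ hi ∧ kl l ≤ n - hi := fun p hp h1 => by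
    have := F.scene.r_le p (hA p hp)
    -- In the mirrored scene, rank at most `hi` means reversed rank above n - hi; hence the
    -- threshold of the second search.
    obtain ⟨l, hl, e1, e2, e3, e4⟩ := exists_first (lo := n - hi) (rev n rx) kl
      (fun q hq => (hkl q hq).2) hp (by unfold rev; omega)
    have := F.scene.r_le l (hA l hl)
    unfold rev at e2 e3
    exact ⟨l, hl, e1, by omega, by omega, e4⟩
  choose! fst hfst using key
  have A1 := eA (s' := s1.set 94 (.num (n - hi))) m1 f1
  refine wp.frame (lasts_spec (lo := lo) (hi := hi) (thr := n - hi) (kl := kl) (rep := rep)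
    (s := s1.set 94 (.num (n - hi)))
    (g := fun p => rankIn n rc A (fst p)) hb hB (F.of (fun i hi => by
      rw [M.set_reg, if_neg (by omega)]; exact g1 i hi) (fun f hf => m1 f (by omega)) f1.ge)
    A1.1 A1.2 (fun p hp => by
      rw [M.set_mem, m1 15 (by omega)]; exact hkl p hp) (by simp [g92]) (by simp [g93]) (by simp) hlt
    (fun p hp h1 h2 _ => ?_)) ?_
  · obtain ⟨e1, e2, e3, e4, e5⟩ := hfst p hp h1 h2
    rw [M.set_mem, (hrep.iff p (hA p hp) _ (hA _ e1)).2 e2.symm]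
    exact tmpF _ ((memF _).2 ⟨e1, e3, e4.trans h2, e5⟩)
  rintro s2 - ⟨lL, nL, memL, o2, t2⟩
  have main : ∀ p ∈ lL, 0 < frq cl rx A lo hi (cl p) ∧
      rankIn n rc A p + 1 - rankIn n rc A (fst p) = frq cl rx A lo hi (cl p) := fun p hp => by
    obtain ⟨hp, h1, h2, h3⟩ := (memL p).1 hp
    obtain ⟨e1, e2, e3, e4, e5⟩ := hfst p hp h1 h2
    exact frq_of_first_last F.scene hA e1 hp e2 (hkf _ e1).2 (hkl p hp).2 e3 e4 e5 h2 h3 hhi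
  have injL : ∀ p ∈ lL, ∀ q ∈ lL, cl p = cl q → p = q := fun p hp q hq e => by
    obtain ⟨hp, h1, h2, h3⟩ := (memL p).1 hp
    obtain ⟨hq, k1, k2, k3⟩ := (memL q).1 hq
    exact (hkl p hp).2.unique (lo := n - hi) F.scene.mirror hA hp hq (hkl q hq).2
      (by unfold rev; omega) (by unfold rev; omega) h3 k3 e
  have injF : ∀ p ∈ lF, ∀ q ∈ lF, cl p = cl q → p = q := fun p hp q hq e => by
    obtain ⟨hp, h1, h2, h3⟩ := (memF p).1 hp
    obtain ⟨hq, k1, k2, k3⟩ := (memF q).1 hq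
    exact (hkf p hp).2.unique F.scene hA hp hq (hkf q hq).2 h1 k1 h3 k3 e
  -- Every colour with a first point has a last point, so the first search too is paid for by the
  -- reported tuples.
  have hlen : lF.length ≤ lL.length := by
    have : (lF.map cl).Subperm (lL.map cl) := by
      refine List.Nodup.subperm (List.Nodup.map_on injF nF) fun c hc => ?_
      obtain ⟨p, hp, rfl⟩ := List.mem_map.1 hc
      obtain ⟨hp, h1, h2, h3⟩ := (memF p).1 hp
      obtain ⟨l, e1, e2, e3, e4, e5⟩ := keyl p hp h2
      exact List.mem_map.2 ⟨l, (memL l).2 ⟨e1, by omega, e4, e5⟩, e2⟩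
    simpa using this.length_le
  rw [hR]
  refine ⟨lL.map fun p => (cl p, rankIn n rc A p + 1 - rankIn n rc A (fst p)),
    List.Nodup.map_on (fun p hp q hq e => injL p hp q hq (Prod.mk.inj e).1) nL, fun c f => ?_, ?_, ?_⟩
  · rw [List.mem_map]
    constructor
    · rintro ⟨p, hp, e⟩
      obtain ⟨rfl, rfl⟩ := Prod.mk.inj e
      rw [(main p hp).2]
      exact ⟨(main p hp).1, rfl⟩
    · rintro ⟨h1, rfl⟩
      obtain ⟨q, hq, rfl, e1, e2⟩ := Set.nonempty_of_ncard_ne_zero h1.ne'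
      obtain ⟨l, e3, e4, e5, e6, e7⟩ := keyl q hq e2
      have hl := (memL l).2 ⟨e3, by omega, e6, e7⟩
      exact ⟨l, hl, by rw [(main l hl).2, e4]⟩
  · rw [o2]
    simp [o1, Function.comp_def]
  · have := Nat.mul_le_mul_left (7 * (h / b) + 66) hlen
    simp only [hs0, M.set_time, M.tick_time, M.emit_time] at t1 t2
    rw [List.length_map]
    have e : (14 * (h / b) + 135) * lL.length =
      (7 * (h / b) + 66) * lL.length + (7 * (h / b) + 69) * lL.length := by ring
    omega
end

/-! ### The initial keys and representatives -/

section
variable {K : Type*} [LinearOrder K] {n : ℕ} {κ : ℕ → K} {pt rk : ℕ → ℕ}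

theorem Ranked.inj (H : Ranked n κ pt rk) {p q : ℕ} (hp : p < n) (hq : q < n) (h : rk p = rk q) :
    p = q := by rw [← H.pt_rk p hp, h, H.pt_rk q hq]

theorem Ranked.prev (H : Ranked n κ pt rk) {p : ℕ} (hp : p < n) :
    Prev rk {p | p < n} p (if rk p = 1 then .nil else .ptr (pt (rk p - 1))) := by
  have h1 := H.rk_pos p hp
  have h2 := H.rk_le p hp
  split_ifs with h
  · exact .inl ⟨rfl, fun q hq => by have := H.rk_pos q hq; omega⟩
  · refine .inr ⟨_, H.pt_lt _ (by omega) (by omega), rfl, ?_, fun q hq hlt => ?_⟩ <;>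
      rw [H.rk_pt _ (by omega) (by omega)] <;> omega

theorem Ranked.prev_rev (H : Ranked n κ pt rk) {p : ℕ} (hp : p < n) :
    Prev (rev n rk) {p | p < n} p (if rk p = n then .nil else .ptr (pt (rk p + 1))) := by
  have h1 := H.rk_pos p hp
  have h2 := H.rk_le p hp
  have e : ∀ q, rev n rk q = n + 1 - rk q := fun _ => rfl
  simp only [Prev, e]
  split_ifs with h
  · exact .inl ⟨rfl, fun q hq => by have := H.rk_le q hq; omega⟩
  · refine .inr ⟨_, H.pt_lt _ (by omega) (by omega), rfl, ?_, fun q hq hlt => ?_⟩ <;>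
      rw [H.rk_pt _ (by omega) (by omega)]
    · omega
    · have := H.rk_le q hq; omega

/-- Sorting by colour and then by x-rank makes colours contiguous, and the x-ranks, being distinct,
settle the order within a colour. -/
theorem Scene.of_ranked {cl rx rc ptc : ℕ → ℕ} (hx : Ranked n κ pt rx)
    (hc : Ranked n (fun p => toLex ((cl p : ℝ), (rx p : ℝ))) ptc rc) : Scene n cl rx rc := by
  have key : ∀ p < n, ∀ q < n, rc p < rc q → cl p < cl q ∨ cl p = cl q ∧ rx p ≤ rx q :=
    fun p hp q hq h => by
      have := hc.mono p hp q hq h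
      simpa [Prod.Lex.toLex_le_toLex] using this
  refine ⟨fun p hp q hq => hx.inj hp hq, hx.rk_pos, hx.rk_le, fun p hp q hq => hc.inj hp hq,
    hc.rk_pos, hc.rk_le, fun p hp q hq s hs h1 h2 h3 => ?_, fun p hp q hq h => ⟨fun h1 => ?_,
    fun h1 => ?_⟩⟩
  · have := key p hp q hq h1
    have := key q hq s hs h2
    omega
  · rcases key p hp q hq h1 with h2 | ⟨-, h2⟩
    · omega
    · refine h2.lt_of_ne fun h3 => ?_
      rw [hx.inj hp hq h3] at h1; omega
  · rcases Nat.lt_trichotomy (rc p) (rc q) with h2 | h2 | h2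
    · exact h2
    · rw [hc.inj hp hq h2] at h1; omega
    · have := key q hq p hp h2; omega

end

/-- Set the representative of the point in register 91. -/
def SetRep : Program :=
  ld 102 91 11 ;; nl 103 ;; mv 107 91 ;; ifEq 102 103 .skip (ld 105 91 3 ;; ld 106 102 3 ;;
    ifEq 105 106 (ld 107 102 21) .skip) ;; st 91 21 107

/-- The points are visited from last to first in the colour order, so that the successor of a point
already has its representative. -/
def InitKeys : Program :=
  mv 91 32 ;; whileNN 91 (SetRep ;; mv 101 91 ;; SetKey 10 14 .skip ;; SetKey 11 15 ConvR ;;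
    ld 91 91 10)

def Init : Program := InitKeys ;; InsAll (hpOf 14 43 24) ;; InsAll (hpOf 15 44 25)

section
variable {K : Type*} [LinearOrder K] {B n : ℕ} {κ : ℕ → K} {cl rx rc ptc : ℕ → ℕ} {s : M}

/-- The part of `RepS` for the points of ranks above `c`. -/
def RepFrom (n c : ℕ) (cl rc rep : ℕ → ℕ) (s : M) : Prop :=
  (∀ p < n, c < rc p → s.mem 21 p = .ptr (rep p) ∧ rep p < n ∧ c < rc (rep p)) ∧
    ∀ p < n, ∀ q < n, c < rc p → c < rc q → (rep p = rep q ↔ cl p = cl q)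

/-- A point takes over the representative of its successor if the colours agree. Otherwise its
colour has not occurred yet, by contiguity, and it represents itself. -/
theorem SetRep_spec {rep : ℕ → ℕ} {c p : ℕ} (H : Scene n cl rx rc) (hc : Ranked n κ ptc rc)
    (hR : RepFrom n c cl rc rep s) (hp : p < n) (hpc : rc p = c) (h91 : s.reg 91 = .ptr p)
    (hfr : n ≤ s.fresh) (m3 : ∀ p < n, s.mem 3 p = .color (cl p))
    (m11 : s.mem 11 p = if rc p = n then .nil else .ptr (ptc (rc p + 1))) :
    wp B SetRep s fun s' => s'.time ≤ s.time + 9 ∧ ∃ rep, RepFrom n (c - 1) cl rc rep s' := by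
  have hc1 := H.c_pos p hp
  have hc2 := H.c_le p hp
  obtain ⟨hR1, hR2⟩ := hR
  have hcp : ∀ q < n, c - 1 < rc q → q = p ∨ c < rc q := fun q hq h => by
    by_cases h1 : rc q = rc p
    · exact .inl (hc.inj hq hp h1)
    · exact .inr (by omega)
  have fin : ∀ (t : ℕ) (s' : M), s'.mem 21 = Function.update (s.mem 21) p (.ptr t) → t < n →
      c - 1 < rc t → (∀ q < n, c < rc q → (t = rep q ↔ cl p = cl q)) →
      RepFrom n (c - 1) cl rc (Function.update rep p t) s' := by
    intro t s' h21 h1 h2 h3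
    have hne : ∀ q, c < rc q → q ≠ p := by rintro q hq rfl; omega
    refine ⟨fun q hq h => ?_, fun q hq q' hq' h h' => ?_⟩
    · rw [h21]
      rcases hcp q hq h with rfl | h4
      · simp [h1, h2]
      · obtain ⟨a1, a2, a3⟩ := hR1 q hq h4
        simp only [Function.update_of_ne (hne q h4)]
        exact ⟨a1, a2, by omega⟩
    · rcases hcp q hq h with rfl | h4 <;> rcases hcp q' hq' h' with h5 | h5
      · simp [h5]
      · simp [Function.update_of_ne (hne q' h5), h3 q' hq' h5]
      · rw [h5, Function.update_self, Function.update_of_ne (hne q h4), eq_comm, h3 q hq h4, eq_comm]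
      · rw [Function.update_of_ne (hne q h4), Function.update_of_ne (hne q' h5), hR2 q hq q' hq' h4 h5]
  have hpf := hp.trans_le hfr
  refine wp.abs fun R hR => ?_
  by_cases hcn : rc p = n
  · rw [if_pos hcn] at m11
    simp [SetRep, h91, hpf, m11]
    simp only [hR]
    refine ⟨by simp, _, fin p _ (by simp) hp (by omega) fun q hq h => ?_⟩
    have := H.c_le q hq; omega
  · rw [if_neg hcn] at m11
    obtain ⟨w, hw⟩ : ∃ w, w = ptc (rc p + 1) := ⟨_, rfl⟩
    rw [← hw] at m11
    have hwn : w < n := hw ▸ hc.pt_lt _ (by omega) (by omega)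
    have hwc : rc w = c + 1 := by rw [hw, hc.rk_pt _ (by omega) (by omega), hpc]
    obtain ⟨a1, a2, a3⟩ := hR1 w hwn (by omega)
    simp [SetRep, h91, hpf, m11, m3 p hp, hwn.trans_le hfr, m3 w hwn, a1]
    refine ⟨fun hcol => ?_, fun hcol => ?_⟩
    · simp only [hR]
      refine ⟨by simp, _, fin (rep w) _ (by simp) a2 (by omega) fun q hq h => ?_⟩
      rw [hR2 w hwn q hq (by omega) h, hcol]
    · simp only [hR]
      refine ⟨by simp, _, fin p _ (by simp) hp (by omega) fun q hq h => ?_⟩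
      obtain ⟨b1, b2, b3⟩ := hR1 q hq h
      refine ⟨fun he => by rw [← he] at b3; omega, fun he => absurd ?_ hcol⟩
      by_cases hqw : q = w
      · rw [he, hqw]
      · have : rc w ≠ rc q := fun h' => hqw (hc.inj hwn hq h').symm
        exact (H.conv p hp w hwn q hq (by omega) (by omega) he).symm

/-- The data used for setting the keys. -/
structure KeysPre (n : ℕ) (cl rx rc ptc : ℕ → ℕ) (s : M) : Prop where
  r5 : s.reg 5 = .num 1
  r6 : s.reg 6 = .num 0
  r7 : s.reg 7 = .num n
  fr : n ≤ s.fresh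
  m3 : ∀ p < n, s.mem 3 p = .color (cl p)
  m5 : ∀ p < n, s.mem 5 p = .num (rx p)
  m10 : ∀ p < n, s.mem 10 p = if rc p = 1 then .nil else .ptr (ptc (rc p - 1))
  m11 : ∀ p < n, s.mem 11 p = if rc p = n then .nil else .ptr (ptc (rc p + 1))

theorem KeysPre.of {s' : M} (H : KeysPre n cl rx rc ptc s)
    (hr : ∀ i, i = 5 ∨ i = 6 ∨ i = 7 → s'.reg i = s.reg i)
    (hm : ∀ f, f = 3 ∨ f = 5 ∨ f = 10 ∨ f = 11 → s'.mem f = s.mem f) (hf : s.fresh ≤ s'.fresh) :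
    KeysPre n cl rx rc ptc s' := by
  refine ⟨?_, ?_, ?_, H.fr.trans hf, ?_, ?_, ?_, ?_⟩
  · rw [hr 5 (by tauto)]; exact H.r5
  · rw [hr 6 (by tauto)]; exact H.r6
  · rw [hr 7 (by tauto)]; exact H.r7
  · rw [hm 3 (by tauto)]; exact H.m3
  · rw [hm 5 (by tauto)]; exact H.m5
  · rw [hm 10 (by tauto)]; exact H.m10
  · rw [hm 11 (by tauto)]; exact H.m11

def KeysFrom (n c : ℕ) (cl r rc : ℕ → ℕ) (ky : ℕ) (s : M) : Prop :=
  ∀ p < n, c < rc p → ∃ k, s.mem ky p = .num k ∧ FKey cl r {p | p < n} p k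

theorem KeysFrom.step {r : ℕ → ℕ} {c p k ky : ℕ} {s' : M} (hc : Ranked n κ ptc rc)
    (H : KeysFrom n c cl r rc ky s) (hp : p < n) (hpc : rc p = c)
    (h : s'.mem ky = Function.update (s.mem ky) p (.num k)) (hk : FKey cl r {p | p < n} p k) :
    KeysFrom n (c - 1) cl r rc ky s' := by
  intro q hq h1
  rw [h]
  by_cases hqp : q = p
  · subst hqp; exact ⟨k, by simp, hk⟩
  · have : rc q ≠ rc p := fun h => hqp (hc.inj hq hp h)
    obtain ⟨k', a1, a2⟩ := H q hq (by omega)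
    exact ⟨k', by rw [Function.update_of_ne hqp, a1], a2⟩

@[simp] theorem wf_SetRep (f : ℕ) : wf SetRep f = (f == 21) := by simp [SetRep]
@[simp] theorem wf_ConvR (f : ℕ) : wf ConvR f = false := by simp [ConvR]
@[simp] theorem wf_InitKeys (f : ℕ) : wf InitKeys f = (f == 21 || (f == 14 || f == 15)) := by
  simp [InitKeys]

theorem InitKeys_spec (H : Scene n cl rx rc) (hc : Ranked n κ ptc rc) (hB : n + 1 ≤ B)
    (P : KeysPre n cl rx rc ptc s) (h32 : s.reg 32 = .ptr (ptc n)) (hn : n ≠ 0) :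
    wp B InitKeys s fun s' => s'.time ≤ s.time + 39 * n + 5 ∧ (∃ rep, RepFrom n 0 cl rc rep s') ∧
      KeysFrom n 0 cl rx rc 14 s' ∧ KeysFrom n 0 cl (rev n rx) rc 15 s' := by
  rw [InitKeys, wp_seq, wp_mv]
  refine wp_while (fun c s' => c ≤ n ∧ s'.reg 91 = (if c = 0 then .nil else .ptr (ptc c)) ∧
    (∃ rep, RepFrom n c cl rc rep s') ∧ KeysFrom n c cl rx rc 14 s' ∧
    KeysFrom n c cl (rev n rx) rc 15 s' ∧ s'.time + 39 * c ≤ s.time + 39 * n + 1) n (by decide)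
    ?_ ?_ ?_
  · have hno : ∀ p < n, ¬ n < rc p := fun p hp => (H.c_le p hp).not_gt
    exact ⟨le_rfl, by simp [hn, h32], ⟨id, fun p hp h => absurd h (hno p hp), fun p hp _ _ h =>
      absurd h (hno p hp)⟩, fun p hp h => absurd h (hno p hp), fun p hp h => absurd h (hno p hp),
      by simp; omega⟩
  · rintro c s' hF ⟨hcn, hcur, ⟨rep, hrep⟩, hK, hL, ht⟩ hne
    have hc0 : c ≠ 0 := by rintro rfl; exact hne (by simpa using hcur)
    rw [if_neg hc0] at hcur
    obtain ⟨p, hp⟩ : ∃ p, p = ptc c := ⟨_, rfl⟩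
    rw [← hp] at hcur
    have hpn : p < n := hp ▸ hc.pt_lt _ (by omega) hcn
    have hpc : rc p = c := by rw [hp, hc.rk_pt _ (by omega) hcn]
    have P0 : KeysPre n cl rx rc ptc (s'.ent .nil) := P.of
      (fun i hi => by
        rw [M.ent_reg, if_neg (by omega), if_neg (by omega)]
        refine (hF.reg i (by rcases hi with rfl | rfl | rfl <;> rfl)).trans ?_
        rw [M.set_reg, if_neg (by omega)])
      (fun f hf => hF.mem f (by
        simp only [wf_whileNN, wf_seq, wf_SetRep, wf_mv, wf_SetKey, wf_skip, wf_ConvR, wf_ld]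
        rcases hf with rfl | rfl | rfl | rfl <;> rfl)) hF.le
    rw [wp_seq]
    refine wp.frame (SetRep_spec (s := s'.ent .nil) H hc hrep hpn hpc (by simp [hcur]) P0.fr P0.m3
      (P0.m11 p hpn)) ?_
    rintro s1 hF1 ⟨t1, rep', hrep'⟩
    have P1 : KeysPre n cl rx rc ptc s1 := P0.of
      (fun i hi => hF1.reg i (by rcases hi with rfl | rfl | rfl <;> rfl))
      (fun f hf => hF1.mem f (by rw [wf_SetRep]; rcases hf with rfl | rfl | rfl | rfl <;> rfl)) hF1.le
    have g91 : s1.reg 91 = .ptr p := (hF1.reg 91 (by rfl)).trans (by simp [hcur])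
    rw [wp_seq, wp_mv, g91, wp_seq]
    refine wp.frame (SetKey_spec (p := p) (s := s1.set 101 (.ptr p)) (c := rc) (A := {p | p < n}) H
      (conv_skip (B := B)) (fun p hp => hp) hpn P1.fr (by simp) (by simp [P1.r5]) (by simp [P1.r6])
      (by simp [P1.r7]) P1.m3 P1.m5 (by rw [M.set_mem, P1.m10 p hpn]; exact hc.prev hpn)) ?_
    rintro s2 hF2 ⟨t2, k, hk1, hk2⟩
    have P2 : KeysPre n cl rx rc ptc s2 := P1.of
      (fun i hi => (hF2.reg i (by rcases hi with rfl | rfl | rfl <;> rfl)).trans (by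
        rw [M.set_reg, if_neg (by omega)]))
      (fun f hf => hF2.mem f (by rcases hf with rfl | rfl | rfl | rfl <;> rfl)) hF2.le
    have g101 : s2.reg 101 = .ptr p := (hF2.reg 101 (by rfl)).trans (by simp)
    rw [wp_seq]
    refine wp.frame (SetKey_spec (p := p) (s := s2) (c := rev n rc) (A := {p | p < n}) H.mirror
      (convR hB) (fun p hp => hp) hpn P2.fr g101 P2.r5 P2.r6
      P2.r7 P2.m3 P2.m5 (by rw [P2.m11 p hpn]; exact hc.prev_rev hpn)) ?_
    rintro s3 hF3 ⟨t3, k', hk3, hk4⟩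
    have g91' : s3.reg 91 = .ptr p := (hF3.reg 91 (by rfl)).trans ((hF2.reg 91 (by rfl)).trans
      (by simp [g91]))
    have f3 : s3.fresh = s2.fresh := hF3.fresh (by rfl)
    have e10 : s3.mem 10 p = if rc p = 1 then .nil else .ptr (ptc (rc p - 1)) := by
      rw [hF3.mem 10 (by rfl)]; exact P2.m10 p hpn
    have e21 : s3.mem 21 = s1.mem 21 := (hF3.mem 21 (by rfl)).trans (hF2.mem 21 (by rfl))
    rw [wp_ld]
    refine ⟨p, g91', by rw [f3]; exact hpn.trans_le P2.fr, c - 1, by omega, by omega, ?_,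
      ⟨rep', ?_⟩, ?_, ?_, ?_⟩
    · simp only [M.set_reg, if_true, e10, hpc]
      by_cases h1 : c = 1
      · simp [h1]
      · rw [if_neg h1, if_neg (by omega)]
    · unfold RepFrom at hrep' ⊢
      rwa [M.set_mem, e21]
    · refine KeysFrom.step hc hK hpn hpc ?_ hk2
      rw [M.set_mem, hF3.mem 14 (by rfl), hk1, M.set_mem, hF1.mem 14 (by rfl), M.ent_mem]
    · refine KeysFrom.step hc hL hpn hpc ?_ hk4
      rw [M.set_mem, hk3, hF2.mem 15 (by rfl), M.set_mem, hF1.mem 15 (by rfl), M.ent_mem]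
    · simp at t1 t2 t3 ⊢; omega
  · rintro c s' hF ⟨hcn, hcur, hrep, hK, hL, ht⟩ hnil
    have hc0 : c = 0 := by
      by_contra h
      rw [hnil, if_neg h] at hcur; cases hcur
    subst hc0
    exact ⟨by simp; omega, hrep, hK, hL⟩

theorem Init_spec {h tb b : ℕ} (H : Scene n cl rx rc) (hc : Ranked n κ ptc rc) (hB : n + 1 ≤ B)
    (P : KeysPre n cl rx rc ptc s) (h32 : s.reg 32 = .ptr (ptc n)) (hn : n ≠ 0) (ht : TreeS h tb s)
    (hl : PtList n s) (hnh : n ≤ 2 ^ h) (hm6 : ∀ p < n, s.mem 6 p = .num (rc p))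
    (hm20 : ∀ p < n, s.mem 20 p = .ptr (tb + (2 ^ h + rc p - 1))) (hcnt : CntS h tb b (fun _ => 0) s)
    (h43 : ∀ k e, IsNode h k e → s.mem 43 (tb + k) = .nil)
    (h44 : ∀ k e, IsNode h k e → s.mem 44 (tb + k) = .nil) :
    wp B Init s fun s' => s'.time ≤ s.time + n * (180 * (h + 1)) + 39 * n + 15 ∧
      Fix n h tb cl rx rc s' ∧ Alive n h tb b cl rx rc {p | p < n} s' ∧
      ∃ rep, RepS n cl rep s' := by
  rw [Init, wp_seq]
  refine wp.frame (InitKeys_spec H hc hB P h32 hn) ?_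
  rintro s1 hF1 ⟨t1, ⟨rep, hrep⟩, hK, hL⟩
  have m1 : ∀ f, f ≠ 21 → f ≠ 14 → f ≠ 15 → s1.mem f = s.mem f := fun f a b c =>
    hF1.mem f (by simp [a, b, c])
  have r1 : ∀ i, i = 0 ∨ i = 5 ∨ i = 6 ∨ i = 7 ∨ i = 8 → s1.reg i = s.reg i := fun i hi =>
    hF1.reg i (by rcases hi with rfl | rfl | rfl | rfl | rfl <;> rfl)
  have P1 := P.of (fun i hi => r1 i (by omega)) (fun f hf => m1 f (by omega) (by omega) (by omega))
    hF1.le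
  have F1 : Fix n h tb cl rx rc s1 :=
    ⟨ht.of (r1 8 (by omega)) (m1 30 (by omega) (by omega) (by omega))
      (m1 31 (by omega) (by omega) (by omega)) (m1 33 (by omega) (by omega) (by omega)) hF1.le, H, hnh,
      P1.fr, P1.r5, P1.r6, P1.r7, P1.m3, P1.m5, by rw [m1 6 (by omega) (by omega) (by omega)]; exact hm6,
      by rw [m1 20 (by omega) (by omega) (by omega)]; exact hm20⟩
  have l1 : PtList n s1 := ⟨by rw [r1 0 (by omega)]; exact hl.head, by
    rw [m1 0 (by omega) (by omega) (by omega)]; exact hl.next⟩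
  have k14 : ∀ p < n, ∃ k, s1.mem 14 p = .num k ∧ FKey cl rx {p | p < n} p k :=
    fun p hp => hK p hp (H.c_pos p hp)
  have k15 : ∀ p < n, ∃ k, s1.mem 15 p = .num k ∧ FKey cl (rev n rx) {p | p < n} p k :=
    fun p hp => hL p hp (H.c_pos p hp)
  have O : ∀ ky T ND, T = 43 ∨ T = 44 → ND = 24 ∨ ND = 25 → ky = 14 ∨ ky = 15 → (hpOf ky T ND).OK :=
    fun ky T ND h1 h2 h3 => by constructor <;> simp only <;> omega
  rw [wp_seq]
  refine wp.frame (InsAll_spec (n := n) (ix := rx) (O 14 43 24 (by tauto) (by tauto) (by tauto)) (by simp)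
    F1.tree (F1.pts fun p hp => (k14 p hp).imp fun _ h => h.1) ⟨heap_empty fun k e hk => by
      rw [m1 43 (by omega) (by omega) (by omega)]; exact h43 k e hk, by simp⟩ l1) ?_
  rintro s2 hF2 ⟨H2, t2⟩
  have m2 : ∀ f, f ≠ 43 → f ≠ 24 → s2.mem f = s1.mem f := fun f a b => hF2.mem f (by simp [a, b])
  have r2 : ∀ i, i = 0 ∨ i = 5 ∨ i = 6 ∨ i = 7 ∨ i = 8 → s2.reg i = s1.reg i := fun i hi =>
    hF2.reg i (by rcases hi with rfl | rfl | rfl | rfl | rfl <;> rfl)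
  have F2 : Fix n h tb cl rx rc s2 := F1.of (fun i hi => r2 i (by omega))
    (fun f hf => m2 f (by omega) (by omega)) hF2.le
  have l2 : PtList n s2 := ⟨by rw [r2 0 (by omega)]; exact l1.head, by
    rw [m2 0 (by omega) (by omega)]; exact l1.next⟩
  refine wp.frame (InsAll_spec (n := n) (ix := rx) (O 15 44 25 (by tauto) (by tauto) (by tauto)) (by simp)
    F2.tree (F2.pts fun p hp => by
      rw [m2 15 (by omega) (by omega)]; exact (k15 p hp).imp fun _ h => h.1) ⟨heap_empty fun k e hk => by
      rw [m2 44 (by omega) (by omega), m1 44 (by omega) (by omega) (by omega)]; exact h44 k e hk,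
      by simp⟩ l2) ?_
  rintro s3 hF3 ⟨H3, t3⟩
  have m3 : ∀ f, f ≠ 44 → f ≠ 25 → s3.mem f = s2.mem f := fun f a b => hF3.mem f (by simp [a, b])
  have m : ∀ f, f ≠ 44 → f ≠ 25 → f ≠ 43 → f ≠ 24 → s3.mem f = s1.mem f := fun f a b c d =>
    (m3 f a b).trans (m2 f c d)
  have F3 : Fix n h tb cl rx rc s3 := F2.of
    (fun i hi => hF3.reg i (by rcases hi with rfl | rfl | rfl | rfl <;> rfl))
    (fun f hf => m3 f (by omega) (by omega)) hF3.le
  refine ⟨by nlinarith, F3, ⟨⟨?_, ?_, ?_, ?_⟩, ⟨?_, ?_, ?_, H3⟩, (fun _ => 0), ?_, ?_⟩, rep, ?_, ?_, ?_⟩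
  · intro p hp
    rw [m 10 (by omega) (by omega) (by omega) (by omega), P1.m10 p hp]; exact hc.prev hp
  · rw [m 14 (by omega) (by omega) (by omega) (by omega)]; exact k14
  · rw [m 14 (by omega) (by omega) (by omega) (by omega)]
    exact fun p hp => (k14 p hp).imp fun _ h => h.1
  · exact H2.of (m3 _ (by simp) (by simp)) (m3 _ (by simp) (by simp)) (m3 _ (by simp) (by simp))
      (m3 _ (by simp) (by simp))
  · intro p hp
    rw [m 11 (by omega) (by omega) (by omega) (by omega), P1.m11 p hp]; exact hc.prev_rev hp
  · rw [m 15 (by omega) (by omega) (by omega) (by omega)]; exact k15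
  · rw [m 15 (by omega) (by omega) (by omega) (by omega)]
    exact fun p hp => (k15 p hp).imp fun _ h => h.1
  · have e : ∀ f, 32 ≤ f → f ≤ 36 → s3.mem f = s.mem f := fun f a b =>
      (m f (by omega) (by omega) (by omega) (by omega)).trans (m1 f (by omega) (by omega) (by omega))
    exact hcnt.of (e 35 (by omega) (by omega)) (e 32 (by omega) (by omega)) (e 36 (by omega) (by omega))
      ((hF1.le.trans hF2.le).trans hF3.le)
  · have : dead n rc {p | p < n} = ∅ := by
      ext x
      rw [mem_dead]
      simp only [Finset.notMem_empty, iff_false]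
      rintro ⟨p, h1, h2, -⟩
      exact h2 h1
    rw [this]; exact cntOK_empty h b
  · rw [m 21 (by omega) (by omega) (by omega) (by omega)]
    exact fun p hp => (hrep.1 p hp (H.c_pos p hp)).1
  · exact fun p hp => (hrep.1 p hp (H.c_pos p hp)).2.1
  · exact fun p hp q hq => hrep.2 p hp q hq (H.c_pos p hp) (H.c_pos q hq)

end

/-! ### Linked lists and the output stream -/

/-- The records in `l` are linked by the field `nx`, starting with the pointer `v`. -/
def LinkList (nx : ℕ → Val) : Val → List ℕ → Prop
  | v, [] => v = .nil
  | v, a :: l => v = .ptr a ∧ LinkList nx (nx a) l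

theorem LinkList.congr {nx nx' : ℕ → Val} {v : Val} {l : List ℕ} (H : LinkList nx v l)
    (h : ∀ a ∈ l, nx' a = nx a) : LinkList nx' v l := by
  induction l generalizing v with
  | nil => exact H
  | cons a l ih =>
    refine ⟨H.1, ?_⟩
    rw [h a (by simp)]
    exact ih H.2 fun b hb => h b (by simp [hb])

/-- `l` lists the positive values of `F` with their arguments. -/
def Lists (F : ℕ → ℕ) (l : List (ℕ × ℕ)) : Prop :=
  l.Nodup ∧ ∀ c f, (c, f) ∈ l ↔ 0 < f ∧ f = F c

/-- The stream answers the queries in the list; `F a c` is the frequency of `c` in the query `a`. -/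
inductive Answered (F : ℕ → ℕ → ℕ) : List ℕ → List Event → Prop where
  | nil : Answered F [] []
  | snoc {L : List ℕ} {o : List Event} {a : ℕ} {l : List (ℕ × ℕ)} (h : Answered F L o)
      (hl : Lists (F a) l) :
      Answered F (L ++ [a]) (o ++ .query a :: l.map fun t => .tuple t.1 t.2)

/-! ### Preparing the queries -/

/-- For the query in register 70, store the number of points the coordinate in field 1 of which is
below that in field `fq` in field `ft`. -/
def PrepX (strict : Bool) (fq ft : ℕ) : Program :=
  ld 60 70 fq ;; Loc 1 45 strict ;; nl 63 ;; mv 64 6 ;; ifEq 62 63 .skip (ld 64 62 5) ;; st 70 ft 64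

/-- Put the query in register 70 into the list of the last point below it. -/
def PrepY : Program :=
  ld 60 70 3 ;; Loc 2 47 true ;; nl 63 ;;
    ifEq 62 63 (rq 70) (ld 64 62 23 ;; st 70 62 64 ;; st 62 23 70)

def Prep : Program :=
  mv 70 1 ;; whileNN 70 (PrepX true 1 60 ;; PrepX false 2 61 ;; PrepY ;; ld 70 70 0)

@[simp] theorem wf_Loc (kf Mx f : ℕ) (b : Bool) : wf (Loc kf Mx b) f = false := by
  cases b <;> simp [Loc]

@[simp] theorem wf_PrepX (b : Bool) (fq ft f : ℕ) : wf (PrepX b fq ft) f = (f == ft) := by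
  simp [PrepX]

@[simp] theorem wf_PrepY (f : ℕ) : wf PrepY f = (f == 62 || f == 23) := by
  simp [PrepY]

section
variable {K : Type*} [LinearOrder K] {B n h tb : ℕ} {κ : ℕ → K} {pt rk : ℕ → ℕ} {X : ℕ → ℝ} {x : ℝ}
  {s : M}

/-- The last point below `x` in an order by the coordinate `X` in field `kf`. -/
theorem Loc_spec' {kf Mx : ℕ} {strict : Bool} (ht : TreeS h tb s) (hM : MaxCol h tb n pt (s.mem Mx))
    (hn : n ≠ 0) (hnh : n ≤ 2 ^ h) (hr : Ranked n κ pt rk) (hκ : ∀ p < n, ∀ q < n, κ p ≤ κ q → X p ≤ X q)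
    (hX : ∀ p < n, s.mem kf p = .coord (X p)) (hfr : n ≤ s.fresh) (h60 : s.reg 60 = .coord x) :
    wp B (Loc kf Mx strict) s fun s' => s'.time ≤ s.time + 40 * (h + 1) ∧
      ∃ c ≤ n, (c = 0 ∧ s'.reg 62 = .nil ∨ 1 ≤ c ∧ s'.reg 62 = .ptr (pt c)) ∧
        ∀ p < n, ((if strict then X p < x else X p ≤ x) ↔ rk p ≤ c) := by
  have hlt := hr.pt_lt
  refine (Loc_spec (pt := pt) (pred := fun r => if strict then X (pt r) < x else X (pt r) ≤ x) ht hM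
    (Nat.one_le_iff_ne_zero.2 hn) hnh (fun r h1 h2 => (hlt r h1 h2).trans_le hfr) h60 ?_ ?_ ?_).mono ?_
  · intro r h1 h2
    simp [hX _ (hlt r h1 h2)]
  · intro r h1 h2
    simp [hX _ (hlt r h1 h2)]
  · intro r r' h1 h2 h3 h4
    have : X (pt r) ≤ X (pt r') := by
      rcases h2.eq_or_lt with rfl | h2
      · exact le_rfl
      · refine hκ _ (hlt r h1 (by omega)) _ (hlt r' (by omega) h3) (hr.mono _ (hlt r h1 (by omega)) _ (hlt r' (by omega) h3) ?_)
        rwa [hr.rk_pt r h1 (by omega), hr.rk_pt r' (by omega) h3]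
    cases strict
    · exact this.trans (by simpa using h4)
    · exact this.trans_lt (by simpa using h4)
  · rintro s' ⟨h1, c, h2, h3, h4⟩
    refine ⟨h1, c, h2, h3, fun p hp => ?_⟩
    rw [← h4 _ (hr.rk_pos p hp) (hr.rk_le p hp), hr.pt_rk p hp]

theorem PrepX_spec {strict : Bool} {fq ft a : ℕ} (ht : TreeS h tb s)
    (hM : MaxCol h tb n pt (s.mem 45)) (hn : n ≠ 0) (hnh : n ≤ 2 ^ h) (hr : Ranked n κ pt rk)
    (hκ : ∀ p < n, ∀ q < n, κ p ≤ κ q → X p ≤ X q) (hX : ∀ p < n, s.mem 1 p = .coord (X p)) (hfr : n ≤ s.fresh)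
    (m5 : ∀ p < n, s.mem 5 p = .num (rk p)) (h6 : s.reg 6 = .num 0) (h70 : s.reg 70 = .ptr a)
    (haf : a < s.fresh) (hq : s.mem fq a = .coord x) :
    wp B (PrepX strict fq ft) s fun s' => s'.time ≤ s.time + 40 * (h + 1) + 6 ∧
      ∃ c ≤ n, s'.mem ft = Function.update (s.mem ft) a (.num c) ∧
        ∀ p < n, ((if strict then X p < x else X p ≤ x) ↔ rk p ≤ c) := by
  rw [PrepX, wp_seq, wp_ld]
  refine ⟨a, h70, haf, ?_⟩
  rw [hq, wp_seq]
  refine wp.frame (Loc_spec' (s := s.set 60 (.coord x)) (x := x) (ht.of (by simp) rfl rfl rfl le_rfl) hM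
    hn hnh hr hκ hX hfr (by simp)) ?_
  rintro s1 hF ⟨t1, c, hc, h62, hiff⟩
  have wr1 : ∀ i, i < 60 → i ≠ 3 → i ≠ 4 → wr (Loc 1 45 strict) i = false := fun i a1 a2 a3 => by
    cases strict <;> simp [Loc, wr, nl, mv, ld, ifLt, ifEq, whileNN, chk, nm] <;> omega
  have wr70 : wr (Loc 1 45 strict) 70 = false := by cases strict <;> rfl
  have g70 : s1.reg 70 = .ptr a := (hF.reg 70 wr70).trans (by simp [h70])
  have g6 : s1.reg 6 = .num 0 := (hF.reg 6 (wr1 6 (by omega) (by omega) (by omega))).trans (by simp [h6])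
  have f1 : s1.fresh = s.fresh := hF.fresh (by cases strict <;> rfl)
  have m : ∀ f, s1.mem f = s.mem f := fun f => hF.mem f (by simp)
  refine wp.abs fun R hR => ?_
  rcases h62 with ⟨rfl, h62⟩ | ⟨hc1, h62⟩
  · simp [h62, g70, g6, f1, haf]
    simp only [hR]
    exact ⟨by simp at t1 ⊢; omega, 0, by omega, by simp [m], hiff⟩
  · have hlt := hr.pt_lt c hc1 hc
    simp [h62, g70, g6, f1, haf, m, m5 _ hlt, hlt.trans_le hfr, hr.rk_pt c hc1 hc]
    simp only [hR]
    exact ⟨by simp at t1 ⊢; omega, c, hc, by simp [m], hiff⟩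

theorem PrepY_spec {a : ℕ} (ht : TreeS h tb s)
    (hM : MaxCol h tb n pt (s.mem 47)) (hn : n ≠ 0) (hnh : n ≤ 2 ^ h) (hr : Ranked n κ pt rk)
    (hκ : ∀ p < n, ∀ q < n, κ p ≤ κ q → X p ≤ X q) (hX : ∀ p < n, s.mem 2 p = .coord (X p)) (hfr : n ≤ s.fresh)
    (h70 : s.reg 70 = .ptr a) (haf : a < s.fresh) (hq : s.mem 3 a = .coord x) :
    wp B PrepY s fun s' => s'.time ≤ s.time + 40 * (h + 1) + 6 ∧
      ∃ c ≤ n, (∀ p < n, (X p < x ↔ rk p ≤ c)) ∧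
        (c = 0 ∧ s'.mem 62 = s.mem 62 ∧ s'.mem 23 = s.mem 23 ∧ s'.out = s.out ++ [.query a] ∨
          1 ≤ c ∧ s'.mem 62 = Function.update (s.mem 62) a (s.mem 23 (pt c)) ∧
            s'.mem 23 = Function.update (s.mem 23) (pt c) (.ptr a) ∧ s'.out = s.out) := by
  rw [PrepY, wp_seq, wp_ld]
  refine ⟨a, h70, haf, ?_⟩
  rw [hq, wp_seq]
  refine wp.frame (Loc_spec' (s := s.set 60 (.coord x)) (x := x) (ht.of (by simp) rfl rfl rfl le_rfl) hM
    hn hnh hr hκ hX hfr (by simp)) ?_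
  rintro s1 hF ⟨t1, c, hc, h62, hiff⟩
  have g70 : s1.reg 70 = .ptr a := (hF.reg 70 (by rfl)).trans (by simp [h70])
  have f1 : s1.fresh = s.fresh := hF.fresh (by rfl)
  have o1 : s1.out = s.out := hF.out (by rfl)
  have m : ∀ f, s1.mem f = s.mem f := fun f => hF.mem f (by simp)
  refine wp.abs fun R hR => ?_
  rcases h62 with ⟨rfl, h62⟩ | ⟨hc1, h62⟩
  · simp [h62, g70]
    simp only [hR]
    exact ⟨by simp at t1 ⊢; omega, 0, by omega, by simpa using hiff, .inl ⟨rfl, by simp [m], by simp [m],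
      by simp [o1]⟩⟩
  · have hlt := hr.pt_lt c hc1 hc
    simp [h62, g70, f1, haf, m, hlt.trans_le hfr]
    simp only [hR]
    exact ⟨by simp at t1 ⊢; omega, c, hc, by simpa using hiff, .inr ⟨hc1, by simp [m], by simp [m],
      by simp [o1]⟩⟩

end

/-- The list of the queries, which start at address `n`. -/
structure QList (n m : ℕ) (x₁ x₂ y : ℕ → ℝ) (s : M) : Prop where
  head : s.reg 1 = listPtr n m 0
  next : ∀ j < m, s.mem 0 (n + j) = listPtr n m (j + 1)
  m1 : ∀ j < m, s.mem 1 (n + j) = .coord (x₁ (n + j))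
  m2 : ∀ j < m, s.mem 2 (n + j) = .coord (x₂ (n + j))
  m3 : ∀ j < m, s.mem 3 (n + j) = .coord (y (n + j))
  fr : n + m ≤ s.fresh

/-- The points in `X ⁻¹ [x₁, x₂]` are those of ranks in `(lo, hi]`, and these bounds are stored with
the query `a`. -/
def Ready (n : ℕ) (rx : ℕ → ℕ) (X : ℕ → ℝ) (x₁ x₂ : ℝ) (a : ℕ) (s : M) : Prop :=
  ∃ lo hi, s.mem 60 a = .num lo ∧ s.mem 61 a = .num hi ∧ hi ≤ n ∧
    ∀ p < n, (X p < x₁ ↔ rx p ≤ lo) ∧ (X p ≤ x₂ ↔ rx p ≤ hi)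

/-- The first `i` queries have been prepared: those above the `cY a ≠ 0` lowest points are in the list
of the last one of these, and the others are answered. -/
structure Prepared (n i : ℕ) (rx : ℕ → ℕ) (X x₁ x₂ : ℕ → ℝ) (pt cY : ℕ → ℕ) (F : ℕ → ℕ → ℕ)
    (W : ℕ → List ℕ) (L : List ℕ) (s : M) : Prop where
  ready : ∀ a, n ≤ a → a < n + i → Ready n rx X (x₁ a) (x₂ a) a s
  mem : ∀ p < n, ∀ a, a ∈ W p ↔ (n ≤ a ∧ a < n + i) ∧ cY a ≠ 0 ∧ pt (cY a) = p
  nodup : ∀ p < n, (W p).Nodup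
  link : ∀ p < n, LinkList (s.mem 62) (s.mem 23 p) (W p)
  ans : Answered F L s.out
  nodupL : L.Nodup
  memL : ∀ a, a ∈ L ↔ (n ≤ a ∧ a < n + i) ∧ cY a = 0

/-- What the preparation of the queries uses. -/
structure PrepPre (n h tb : ℕ) (ptx rx pty : ℕ → ℕ) (X Y : ℕ → ℝ) (s : M) : Prop where
  tree : TreeS h tb s
  nh : n ≤ 2 ^ h
  mx : MaxCol h tb n ptx (s.mem 45)
  my : MaxCol h tb n pty (s.mem 47)
  m1 : ∀ p < n, s.mem 1 p = .coord (X p)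
  m2 : ∀ p < n, s.mem 2 p = .coord (Y p)
  m5 : ∀ p < n, s.mem 5 p = .num (rx p)
  r6 : s.reg 6 = .num 0

theorem PrepPre.of {n h tb : ℕ} {ptx rx pty : ℕ → ℕ} {X Y : ℕ → ℝ} {s s' : M}
    (H : PrepPre n h tb ptx rx pty X Y s) (h8 : s'.reg 8 = s.reg 8) (h6 : s'.reg 6 = s.reg 6)
    (hm : ∀ f, f = 1 ∨ f = 2 ∨ f = 5 ∨ f = 30 ∨ f = 31 ∨ f = 33 ∨ f = 45 ∨ f = 47 →
      s'.mem f = s.mem f) (hf : s.fresh ≤ s'.fresh) : PrepPre n h tb ptx rx pty X Y s' := by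
  refine ⟨H.tree.of h8 (hm 30 (by tauto)) (hm 31 (by tauto)) (hm 33 (by tauto)) hf, H.nh,
    ?_, ?_, ?_, ?_, ?_, ?_⟩
  · rw [hm 45 (by tauto)]; exact H.mx
  · rw [hm 47 (by tauto)]; exact H.my
  · rw [hm 1 (by tauto)]; exact H.m1
  · rw [hm 2 (by tauto)]; exact H.m2
  · rw [hm 5 (by tauto)]; exact H.m5
  · rw [h6]; exact H.r6

theorem Ready.of {n : ℕ} {rx : ℕ → ℕ} {X : ℕ → ℝ} {x₁ x₂ : ℝ} {a : ℕ} {s s' : M}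
    (H : Ready n rx X x₁ x₂ a s) (h60 : s'.mem 60 a = s.mem 60 a) (h61 : s'.mem 61 a = s.mem 61 a) :
    Ready n rx X x₁ x₂ a s' := by
  rwa [Ready, h60, h61]

section
variable {n i h tb : ℕ} {rx pt ry cY : ℕ → ℕ} {X Y x₁ x₂ y : ℕ → ℝ} {F : ℕ → ℕ → ℕ}
  {W : ℕ → List ℕ} {L : List ℕ} {s s' : M}

theorem Prepared.answered (H : Prepared n i rx X x₁ x₂ pt cY F W L s) (hc : cY (n + i) = 0)
    (hF : ∀ c, F (n + i) c = 0)
    (h60 : ∀ a ≠ n + i, s'.mem 60 a = s.mem 60 a) (h61 : ∀ a ≠ n + i, s'.mem 61 a = s.mem 61 a)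
    (hr : Ready n rx X (x₁ (n + i)) (x₂ (n + i)) (n + i) s') (h62 : s'.mem 62 = s.mem 62)
    (h23 : s'.mem 23 = s.mem 23) (ho : s'.out = s.out ++ [.query (n + i)]) :
    Prepared n (i + 1) rx X x₁ x₂ pt cY F W (L ++ [n + i]) s' := by
  have split : ∀ a, (n ≤ a ∧ a < n + (i + 1)) ↔ (n ≤ a ∧ a < n + i) ∨ a = n + i := by omega
  refine ⟨fun a h1 h2 => ?_, fun p hp a => ?_, H.nodup, ?_, ?_, ?_, fun a => ?_⟩
  · rcases (split a).1 ⟨h1, h2⟩ with ⟨h3, h4⟩ | rfl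
    · exact (H.ready a h3 h4).of (h60 a (by omega)) (h61 a (by omega))
    · exact hr
  · rw [H.mem p hp, split]
    constructor
    · exact fun h => ⟨.inl h.1, h.2⟩
    · rintro ⟨h1 | rfl, h2⟩
      · exact ⟨h1, h2⟩
      · exact absurd hc h2.1
  · rw [h62, h23]; exact H.link
  · rw [ho]
    exact H.ans.snoc (l := []) ⟨by simp, fun c f => by simp [hF]; omega⟩
  · refine List.nodup_append.2 ⟨H.nodupL, by simp, fun a ha b hb => ?_⟩
    have := (H.memL a).1 ha
    rw [List.mem_singleton] at hb
    omega
  · rw [List.mem_append, H.memL, split, List.mem_singleton]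
    constructor
    · rintro (h | rfl)
      · exact ⟨.inl h.1, h.2⟩
      · exact ⟨.inr rfl, hc⟩
    · rintro ⟨h1 | rfl, h2⟩
      · exact .inl ⟨h1, h2⟩
      · exact .inr rfl

theorem Prepared.pushed (H : Prepared n i rx X x₁ x₂ pt cY F W L s) (hc : cY (n + i) ≠ 0)
    (hpt : pt (cY (n + i)) < n)
    (h60 : ∀ a ≠ n + i, s'.mem 60 a = s.mem 60 a) (h61 : ∀ a ≠ n + i, s'.mem 61 a = s.mem 61 a)
    (hr : Ready n rx X (x₁ (n + i)) (x₂ (n + i)) (n + i) s')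
    (h62 : s'.mem 62 = Function.update (s.mem 62) (n + i) (s.mem 23 (pt (cY (n + i)))))
    (h23 : s'.mem 23 = Function.update (s.mem 23) (pt (cY (n + i))) (.ptr (n + i)))
    (ho : s'.out = s.out) :
    Prepared n (i + 1) rx X x₁ x₂ pt cY F
      (Function.update W (pt (cY (n + i))) ((n + i) :: W (pt (cY (n + i))))) L s' := by
  have split : ∀ a, (n ≤ a ∧ a < n + (i + 1)) ↔ (n ≤ a ∧ a < n + i) ∨ a = n + i := by omega
  have hnot : ∀ p < n, n + i ∉ W p := fun p hp h => by have := (H.mem p hp _).1 h; omega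
  have hlink : ∀ p < n, LinkList (s'.mem 62) (s.mem 23 p) (W p) := fun p hp =>
    (H.link p hp).congr fun a ha => by
      have : a ≠ n + i := by rintro rfl; exact hnot p hp ha
      rw [h62, Function.update_of_ne this]
  refine ⟨fun a h1 h2 => ?_, fun p hp a => ?_, fun p hp => ?_, fun p hp => ?_, by rw [ho]; exact H.ans,
    H.nodupL, fun a => ?_⟩
  · rcases (split a).1 ⟨h1, h2⟩ with ⟨h3, h4⟩ | rfl
    · exact (H.ready a h3 h4).of (h60 a (by omega)) (h61 a (by omega))
    · exact hr
  · rw [split]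
    have : a ∈ Function.update W (pt (cY (n + i))) ((n + i) :: W (pt (cY (n + i)))) p ↔
        a ∈ W p ∨ a = n + i ∧ pt (cY (n + i)) = p := by
      by_cases hpe : p = pt (cY (n + i))
      · subst hpe; simp [or_comm]
      · simp [Function.update_of_ne hpe, Ne.symm hpe]
    rw [this, H.mem p hp]
    constructor
    · rintro (h1 | ⟨rfl, h1⟩)
      · exact ⟨.inl h1.1, h1.2⟩
      · exact ⟨.inr rfl, hc, h1⟩
    · rintro ⟨h1 | rfl, h2⟩
      · exact .inl ⟨h1, h2⟩
      · exact .inr ⟨rfl, h2.2⟩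
  · by_cases hpe : p = pt (cY (n + i))
    · subst hpe
      simpa using ⟨hnot _ hp, H.nodup _ hp⟩
    · rw [Function.update_of_ne hpe]; exact H.nodup p hp
  · by_cases hpe : p = pt (cY (n + i))
    · subst hpe
      rw [h23, Function.update_self, Function.update_self]
      refine ⟨rfl, ?_⟩
      have := hlink _ hp
      rwa [h62, Function.update_self, ← h62]
    · rw [h23, Function.update_of_ne hpe, Function.update_of_ne hpe]
      exact hlink p hp
  · rw [H.memL, split]
    constructor
    · exact fun h => ⟨.inl h.1, h.2⟩
    · rintro ⟨h1 | rfl, h2⟩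
      · exact ⟨h1, h2⟩
      · exact absurd h2 hc

theorem QList.of {m : ℕ} (H : QList n m x₁ x₂ y s) (h1 : s'.reg 1 = s.reg 1)
    (hm : ∀ f < 4, s'.mem f = s.mem f) (hf : s.fresh ≤ s'.fresh) : QList n m x₁ x₂ y s' := by
  refine ⟨by rw [h1]; exact H.head, ?_, ?_, ?_, ?_, H.fr.trans hf⟩
  · rw [hm 0 (by omega)]; exact H.next
  · rw [hm 1 (by omega)]; exact H.m1
  · rw [hm 2 (by omega)]; exact H.m2
  · rw [hm 3 (by omega)]; exact H.m3

/-- All ranks from 1 to n occur, so an initial segment of them determines its length. -/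
theorem Ranked.eq_of_le_iff {K : Type*} [LinearOrder K] {κ : ℕ → K} {c c' : ℕ}
    (H : Ranked n κ pt ry) (hc : c ≤ n) (hc' : c' ≤ n) (h : ∀ p < n, ry p ≤ c ↔ ry p ≤ c') :
    c = c' := by
  rcases Nat.lt_trichotomy c c' with h1 | h1 | h1
  · have := h _ (H.pt_lt c' (by omega) hc')
    rw [H.rk_pt c' (by omega) hc'] at this; omega
  · exact h1
  · have := h _ (H.pt_lt c (by omega) hc)
    rw [H.rk_pt c (by omega) hc] at this; omega

/-- Each query is translated into ranks by three searches. A query above no point is answered at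
once, since no point will lead to it during the sweep; any other waits at the highest point below
it. -/
theorem Prep_spec {K K' : Type*} [LinearOrder K] [LinearOrder K'] {B m : ℕ} {κ : ℕ → K} {κ' : ℕ → K'}
    {ptx : ℕ → ℕ} (P : PrepPre n h tb ptx rx pt X Y s) (hn : n ≠ 0)
    (hx : Ranked n κ ptx rx) (hκ : ∀ p < n, ∀ q < n, κ p ≤ κ q → X p ≤ X q)
    (hy : Ranked n κ' pt ry) (hκ' : ∀ p < n, ∀ q < n, κ' p ≤ κ' q → Y p ≤ Y q) (Q : QList n m x₁ x₂ y s)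
    (h23 : ∀ p < n, s.mem 23 p = .nil) (ho : s.out = [])
    (hcY : ∀ a, n ≤ a → a < n + m → cY a ≤ n ∧ ∀ p < n, (Y p < y a ↔ ry p ≤ cY a))
    (hF : ∀ a, n ≤ a → a < n + m → cY a = 0 → ∀ c, F a c = 0) :
    wp B Prep s fun s' => s'.time ≤ s.time + m * (120 * (h + 1) + 23) + 5 ∧
      ∃ W L, Prepared n m rx X x₁ x₂ pt cY F W L s' := by
  rw [Prep, wp_seq, wp_mv]
  refine wp_list (base := n) (len := m) (fun i s' => s'.time ≤ s.time + i * (120 * (h + 1) + 23) + 1 ∧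
    ∃ W L, Prepared n i rx X x₁ x₂ pt cY F W L s') (by decide) (by simp [Q.head]) ?_ ?_ ?_
  · refine ⟨by simp, fun _ => [], [], by omega, fun p hp a => ?_, by simp, ?_, ?_, by simp, fun a => ?_⟩
    · simp
    · exact h23
    · rw [M.set_out, ho]; exact .nil
    · simp
  · rintro i hi s' hF' ⟨ht, W, L, H⟩ hcur
    have P0 : PrepPre n h tb ptx rx pt X Y (s'.ent .nil) := P.of
      (by simpa using hF'.reg 8 (by rfl)) (by simpa using hF'.reg 6 (by rfl))
      (fun f hf => hF'.mem f (by rcases hf with rfl | rfl | rfl | rfl | rfl | rfl | rfl | rfl <;> simp))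
      hF'.le
    have Q0 : QList n m x₁ x₂ y (s'.ent .nil) := Q.of (by simpa using hF'.reg 1 (by rfl))
      (fun f hf => hF'.mem f (by
        simp only [wf_whileNN, wf_seq, wf_PrepX, wf_PrepY, wf_ld]; interval_cases f <;> rfl)) hF'.le
    have haf : n + i < s'.fresh := lt_of_lt_of_le (by omega) Q0.fr
    have nfr := Q0.fr
    rw [M.ent_fresh] at nfr
    rw [wp_seq]
    refine wp.frame (PrepX_spec (a := n + i) (ft := 60) (s := s'.ent .nil) P0.tree P0.mx hn P0.nh hx hκ P0.m1
      (by simp; omega) P0.m5 P0.r6 (by simp [hcur]) haf (Q0.m1 i hi)) ?_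
    rintro s1 hF1 ⟨t1, lo, hlo, e60, ilo⟩
    have m1 : ∀ f, f ≠ 60 → s1.mem f = s'.mem f := fun f hf => hF1.mem f (by simp [hf])
    have f1 : s1.fresh = s'.fresh := hF1.fresh (by rfl)
    have P1 : PrepPre n h tb ptx rx pt X Y s1 := P0.of (hF1.reg 8 (by rfl)) (hF1.reg 6 (by rfl))
      (fun f hf => m1 f (by omega)) hF1.le
    have Q1 : QList n m x₁ x₂ y s1 := Q0.of (hF1.reg 1 (by rfl)) (fun f hf => m1 f (by omega)) hF1.le
    rw [wp_seq]
    refine wp.frame (PrepX_spec (a := n + i) (ft := 61) P1.tree P1.mx hn P1.nh hx hκ P1.m1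
      (by omega) P1.m5 P1.r6 ((hF1.reg 70 (by rfl)).trans (by simp [hcur])) (by omega) (Q1.m2 i hi)) ?_
    rintro s2 hF2 ⟨t2, hi', hhi, e61, ihi⟩
    have m2 : ∀ f, f ≠ 61 → s2.mem f = s1.mem f := fun f hf => hF2.mem f (by simp [hf])
    have f2 : s2.fresh = s1.fresh := hF2.fresh (by rfl)
    have P2 : PrepPre n h tb ptx rx pt X Y s2 := P1.of (hF2.reg 8 (by rfl)) (hF2.reg 6 (by rfl))
      (fun f hf => m2 f (by omega)) hF2.le
    have Q2 : QList n m x₁ x₂ y s2 := Q1.of (hF2.reg 1 (by rfl)) (fun f hf => m2 f (by omega)) hF2.le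
    have g70 : s2.reg 70 = .ptr (n + i) := (hF2.reg 70 (by rfl)).trans ((hF1.reg 70 (by rfl)).trans
      (by simp [hcur]))
    rw [wp_seq]
    refine wp.frame (PrepY_spec (a := n + i) P2.tree P2.my hn P2.nh hy hκ' P2.m2
      (by omega) g70 (by omega) (Q2.m3 i hi)) ?_
    rintro s3 hF3 ⟨t3, c, hc, hiff, hcase⟩
    have m3 : ∀ f, f ≠ 62 → f ≠ 23 → s3.mem f = s2.mem f := fun f hf hf' => hF3.mem f (by simp [hf, hf'])
    -- The count found by the search agrees with the number `cY` fixed in advance, as both cut off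
    -- the same points.
    have hcc : c = cY (n + i) := hy.eq_of_le_iff hc (hcY _ (by omega) (by omega)).1 fun p hp => by
      rw [← hiff p hp, (hcY _ (by omega) (by omega)).2 p hp]
    have o2 : s2.out = s'.out := (hF2.out (by rfl)).trans (hF1.out (by rfl))
    have x60 : s3.mem 60 = Function.update (s'.mem 60) (n + i) (.num lo) := by
      rw [m3 60 (by omega) (by omega), m2 60 (by omega), e60, M.ent_mem]
    have x61 : s3.mem 61 = Function.update (s'.mem 61) (n + i) (.num hi') := by
      rw [m3 61 (by omega) (by omega), e61, m1 61 (by omega)]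
    have x62 : s2.mem 62 = s'.mem 62 := (m2 62 (by omega)).trans (m1 62 (by omega))
    have x23 : s2.mem 23 = s'.mem 23 := (m2 23 (by omega)).trans (m1 23 (by omega))
    have hr : Ready n rx X (x₁ (n + i)) (x₂ (n + i)) (n + i) s3 :=
      ⟨lo, hi', by simp [x60], by simp [x61], hhi, fun p hp =>
        ⟨by simpa using ilo p hp, by simpa using ihi p hp⟩⟩
    have y60 : ∀ a ≠ n + i, s3.mem 60 a = s'.mem 60 a := fun a ha => by
      rw [x60, Function.update_of_ne ha]
    have y61 : ∀ a ≠ n + i, s3.mem 61 a = s'.mem 61 a := fun a ha => by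
      rw [x61, Function.update_of_ne ha]
    rw [wp_ld]
    refine ⟨n + i, (hF3.reg 70 (by rfl)).trans g70, by rw [hF3.fresh (by rfl)]; omega, ⟨?_, ?_⟩, ?_⟩
    · simp at t1 t2 t3 ⊢
      nlinarith
    · rcases hcase with ⟨h0, h62, h23', hout⟩ | ⟨h1, h62, h23', hout⟩
      · rw [h0] at hcc
        exact ⟨W, _, H.answered (s' := s3.set 70 _) hcc.symm (hF _ (by omega) (by omega) hcc.symm) y60 y61 hr
          (h62.trans x62) (h23'.trans x23) (by rw [M.set_out, hout, o2])⟩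
      · rw [hcc] at h1 hc h62 h23'
        exact ⟨_, L, H.pushed (s' := s3.set 70 _) (by omega) (hy.pt_lt _ h1 hc) y60 y61 hr
          (by rw [M.set_mem, h62, x62, x23]) (by rw [M.set_mem, h23', x23]) (by rw [M.set_out, hout, o2])⟩
    · simp only [M.set_reg, if_true]
      rw [m3 0 (by omega) (by omega), Q2.next i hi]
  · rintro s' hF' ⟨ht, W, L, H⟩ hnil
    exact ⟨by simp; omega, W, L, H.ready, H.mem, H.nodup, H.link, H.ans, H.nodupL, H.memL⟩

end

/-! ### The sweep -/

/-- Answer the queries in the list of the point in register 90. -/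
def Bucket : Program := ld 70 90 23 ;; whileNN 70 (Answer ;; ld 70 70 62)

/-- Visit the points in descending order by `y`. -/
def Sweep : Program := mv 90 32 ;; whileNN 90 (Bucket ;; Delete ;; ld 90 90 12)

@[simp] theorem wf_Answer (f : ℕ) : wf Answer f = (f == 22) := by
  simp [Answer, ActF, ActL, Rank]

section
variable {B n h tb b : ℕ} {cl rx rc rep : ℕ → ℕ} {A : Set ℕ} {s : M} {F : ℕ → ℕ → ℕ}

/-- Everything needed for answering queries. -/
structure Live (n h tb b : ℕ) (cl rx rc rep : ℕ → ℕ) (A : Set ℕ) (s : M) : Prop where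
  fix : Fix n h tb cl rx rc s
  alive : Alive n h tb b cl rx rc A s
  rep : RepS n cl rep s

theorem Live.of {s' : M} (H : Live n h tb b cl rx rc rep A s)
    (hr : ∀ i, i = 5 ∨ i = 6 ∨ i = 7 ∨ i = 8 → s'.reg i = s.reg i)
    (hm : ∀ f ∈ [3, 5, 6, 20, 30, 31, 33, 10, 11, 14, 15, 24, 25, 32, 35, 36, 43, 44, 21],
      s'.mem f = s.mem f) (hf : s.fresh ≤ s'.fresh) : Live n h tb b cl rx rc rep A s' := by
  simp only [List.mem_cons, List.not_mem_nil, or_false] at hm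
  refine ⟨H.fix.of hr (fun f hf => hm f (by omega)) hf, H.alive.of (fun f hf => hm f ?_) hf,
    ⟨by rw [hm 21 (by omega)]; exact H.rep.m21, H.rep.lt, H.rep.iff⟩⟩
  simp only [List.mem_cons, List.not_mem_nil, or_false] at hf
  omega

/-- The fields 60 and 61 of the query `a` are such that its answer is right. -/
def Right (n : ℕ) (cl rx : ℕ → ℕ) (A : Set ℕ) (F : ℕ → ℕ) (a : ℕ) (s : M) : Prop :=
  ∃ lo hi, s.mem 60 a = .num lo ∧ s.mem 61 a = .num hi ∧ hi ≤ n ∧ ∀ c, frq cl rx A lo hi c = F c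

/-- The time is charged to the growth of the output stream: a query adds one item and its tuples.
Writing old and new length on opposite sides avoids subtraction. -/
theorem Bucket_spec (hb : b ≠ 0) (hB : n + 1 ≤ B) (H : Live n h tb b cl rx rc rep A s) {p : ℕ}
    (h90 : s.reg 90 = .ptr p) (hp : p < s.fresh) {l L : List ℕ}
    (hl : LinkList (s.mem 62) (s.mem 23 p) l) (hlf : ∀ a ∈ l, a < s.fresh)
    (hR : ∀ a ∈ l, Right n cl rx A (F a) a s) (hL : Answered F L s.out) :
    wp B Bucket s fun s' => Live n h tb b cl rx rc rep A s' ∧ Answered F (L ++ l) s'.out ∧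
      s'.time + (14 * (h / b) + 135) * s.out.length ≤
        s.time + (14 * (h / b) + 135) * s'.out.length + (168 * h + 90) * l.length + 5 := by
  have nine : ∀ f ∈ [3, 5, 6, 20, 30, 31, 33, 10, 11, 14, 15, 24, 25, 32, 35, 36, 43, 44, 21],
      f ≠ 22 := by decide
  rw [Bucket, wp_seq, wp_ld]
  refine ⟨p, h90, hp, ?_⟩
  refine wp_while (fun k s' => ∃ l₁ l₂, l = l₁ ++ l₂ ∧ k = l₂.length ∧
    LinkList (s'.mem 62) (s'.reg 70) l₂ ∧ Answered F (L ++ l₁) s'.out ∧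
    s'.time + (14 * (h / b) + 135) * s.out.length ≤
      s.time + (14 * (h / b) + 135) * s'.out.length + (168 * h + 90) * l₁.length + 1) l.length
    (by decide) ?_ ?_ ?_
  · exact ⟨[], l, rfl, rfl, by simpa using hl, by simpa using hL, by simp; omega⟩
  · rintro k s' hF ⟨l₁, l₂, rfl, rfl, h1, h2, h3⟩ hne
    rcases l₂ with _ | ⟨a, l₂⟩
    · exact absurd h1 hne
    obtain ⟨h70, h1⟩ := h1
    have hm : ∀ f, f ≠ 22 → s'.mem f = s.mem f := fun f hf => hF.mem f (by simp [hf])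
    have hr : ∀ i, i = 5 ∨ i = 6 ∨ i = 7 ∨ i = 8 → s'.reg i = s.reg i := fun i hi =>
      (hF.reg i (by rcases hi with rfl | rfl | rfl | rfl <;> rfl)).trans (by
        rw [M.set_reg, if_neg (by omega)])
    have hfr : s'.fresh = s.fresh := hF.fresh (by rfl)
    have L0 : Live n h tb b cl rx rc rep A (s'.ent .nil) := H.of (fun i hi => by
      rw [M.ent_reg, if_neg (by omega), if_neg (by omega), hr i hi]) (fun f hf => hm f (nine f hf)) hfr.ge
    have ha : a < s.fresh := hlf a (by simp)
    obtain ⟨lo, hi, e60, e61, ehi, efr⟩ := hR a (by simp)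
    rw [wp_seq]
    refine wp.frame (Answer_spec (s := s'.ent .nil) hb hB L0.fix L0.alive L0.rep (a := a) (by simp [h70])
      (by simp [hfr, ha]) (by rw [M.ent_mem, hm 60 (by omega)]; exact e60)
      (by rw [M.ent_mem, hm 61 (by omega)]; exact e61) ehi) ?_
    rintro s1 hF1 ⟨ll, n1, m1, o1, t1⟩
    have f1 : s1.fresh = s.fresh := (hF1.fresh (by rfl)).trans hfr
    rw [wp_ld]
    refine ⟨a, (hF1.reg 70 (by rfl)).trans (by simp [h70]), by rw [f1]; exact ha, ?_⟩
    refine ⟨l₂.length, by simp, l₁ ++ [a], l₂, by simp, rfl, ?_, ?_, ?_⟩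
    · have e62 : s1.mem 62 = s'.mem 62 := hF1.mem 62 (by rfl)
      simpa [e62] using h1
    · rw [M.set_out, o1, ← List.append_assoc]
      exact h2.snoc ⟨n1, fun c f => by rw [m1, efr]⟩
    · simp only [M.set_time, M.set_out, o1, M.ent_out, M.ent_time, List.length_append, List.length_cons,
        List.length_map, List.length_nil] at t1 ⊢
      rw [show s'.out.length + (ll.length + 1) = s'.out.length + ll.length + 1 by ring, mul_add, mul_add,
        mul_add]
      omega
  · rintro k s' hF ⟨l₁, l₂, rfl, rfl, h1, h2, h3⟩ hnil
    rcases l₂ with _ | ⟨a, l₂⟩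
    · refine ⟨H.of (fun i hi => ?_) (fun f hf => hF.mem f ?_) hF.le, by simpa using h2, ?_⟩
      · rw [M.ent_reg, if_neg (by omega), if_neg (by omega)]
        exact (hF.reg i (by rcases hi with rfl | rfl | rfl | rfl <;> rfl)).trans (by
          rw [M.set_reg, if_neg (by omega)])
      · simp [nine f hf]
      · simp only [List.append_nil, M.ent_time, M.ent_out]; omega
    · rw [h1.1] at hnil; cases hnil

theorem Ready.right {X x₁ x₂ : ℕ → ℝ} {G : ℕ → ℕ} {a : ℕ} (H : Ready n rx X (x₁ a) (x₂ a) a s)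
    (hA : ∀ p ∈ A, p < n)
    (hG : ∀ c, G c = Set.ncard {p | p ∈ A ∧ cl p = c ∧ x₁ a ≤ X p ∧ X p ≤ x₂ a}) :
    Right n cl rx A G a s := by
  obtain ⟨lo, hi, h1, h2, h3, h4⟩ := H
  refine ⟨lo, hi, h1, h2, h3, fun c => ?_⟩
  rw [hG, frq]
  congr 1
  ext p
  refine and_congr_right fun hp => and_congr_right fun _ => ?_
  obtain ⟨h5, h6⟩ := h4 p (hA p hp)
  rw [← h6, ← not_le, ← h5, not_lt]

/-- Before the point of y-rank c is deleted, the survivors are the points of y-rank at most c, which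
for the queries waiting there are exactly the points below them. The answers are thus the required
frequencies. -/
theorem Sweep_spec {K : Type*} [LinearOrder K] {κ : ℕ → K} {m : ℕ} {pt ry cY : ℕ → ℕ}
    {X x₁ x₂ : ℕ → ℝ} {W : ℕ → List ℕ} {L : List ℕ} (hb : b ≠ 0) (hB : n + 1 ≤ B) (hn : n ≠ 0)
    (hh : 1 ≤ h) (H : Live n h tb b cl rx rc rep {p | p < n} s) (hfr : n + m ≤ s.fresh)
    (hy : Ranked n κ pt ry) (h32 : s.reg 32 = .ptr (pt n))
    (h12 : ∀ p < n, s.mem 12 p = if ry p = 1 then .nil else .ptr (pt (ry p - 1)))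
    (P : Prepared n m rx X x₁ x₂ pt cY F W L s) (hcY : ∀ a, n ≤ a → a < n + m → cY a ≤ n)
    (hF : ∀ a, n ≤ a → a < n + m → ∀ c, F a c =
      Set.ncard {p | p ∈ {p | p < n ∧ ry p ≤ cY a} ∧ cl p = c ∧ x₁ a ≤ X p ∧ X p ≤ x₂ a}) :
    wp B Sweep s fun s' => ∃ L' : List ℕ, L'.Nodup ∧ (∀ a, a ∈ L' ↔ n ≤ a ∧ a < n + m) ∧
      Answered F L' s'.out ∧
      s'.time ≤ s.time + (14 * (h / b) + 135) * s'.out.length + (168 * h + 90) * L'.length +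
        n * ((h / b + 1) * (8 * 2 ^ b + 11) + 320 * (h + 2) + 70) + 5 := by
  obtain ⟨td, htd⟩ : ∃ td, td = (h / b + 1) * (8 * 2 ^ b + 11) + 320 * (h + 2) + 70 := ⟨_, rfl⟩
  rw [← htd, Sweep, wp_seq, wp_mv]
  -- `c` points survive; answered are the queries above no point and those above more than `c`
  -- points.
  refine wp_while (fun c s' => c ≤ n ∧ s'.reg 90 = (if c = 0 then .nil else .ptr (pt c)) ∧
    Live n h tb b cl rx rc rep {p | p < n ∧ ry p ≤ c} s' ∧ ∃ L' : List ℕ, L'.Nodup ∧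
    (∀ a, a ∈ L' ↔ (n ≤ a ∧ a < n + m) ∧ (cY a = 0 ∨ c < cY a)) ∧ Answered F L' s'.out ∧
    s'.time + td * c ≤ s.time + (14 * (h / b) + 135) * s'.out.length + (168 * h + 90) * L'.length +
      td * n + 1) n (by decide) ?_ ?_ ?_
  · have e : {p | p < n ∧ ry p ≤ n} = {p | p < n} := by
      ext p; exact ⟨fun h => h.1, fun h => ⟨h, hy.rk_le p h⟩⟩
    refine ⟨le_rfl, by simp [hn, h32], ?_, L, P.nodupL, fun a => ?_, P.ans, ?_⟩
    · rw [e]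
      exact H.of (fun i hi => by rw [M.set_reg, if_neg (by omega)]) (fun _ _ => rfl) le_rfl
    · rw [P.memL]
      refine and_congr_right fun ha => ⟨fun h => .inl h, fun h => h.resolve_right ?_⟩
      have := hcY a ha.1 ha.2
      omega
    · simp only [M.set_time, M.set_out]; omega
  · rintro c s' hF' ⟨hcn, hcur, HL, L', nL, mL, aL, ht⟩ hne
    have hc0 : c ≠ 0 := by rintro rfl; exact hne (by simpa using hcur)
    rw [if_neg hc0] at hcur
    obtain ⟨p, hp⟩ : ∃ p, p = pt c := ⟨_, rfl⟩
    rw [← hp] at hcur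
    have hpn : p < n := hp ▸ hy.pt_lt _ (by omega) hcn
    have hpc : ry p = c := by rw [hp, hy.rk_pt _ (by omega) hcn]
    have m0 : ∀ f, f = 12 ∨ f = 23 ∨ f = 60 ∨ f = 61 ∨ f = 62 → s'.mem f = s.mem f := fun f hf =>
      hF'.mem f (by rcases hf with rfl | rfl | rfl | rfl | rfl <;> rfl)
    have f0 : s'.fresh = s.fresh := hF'.fresh (by rfl)
    have hW : ∀ a, a ∈ W p ↔ (n ≤ a ∧ a < n + m) ∧ cY a = c := fun a => by
      rw [P.mem p hpn]
      refine and_congr_right fun ha => ⟨fun h => ?_, fun h => ⟨by omega, by rw [h, hp]⟩⟩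
      rw [← hpc, ← h.2, hy.rk_pt _ (by omega) (hcY a ha.1 ha.2)]
    rw [wp_seq]
    refine wp.frame (Bucket_spec (s := s'.ent .nil) (p := p) (l := W p) (L := L') (F := F) hb hB
      (HL.of (fun i hi => by rw [M.ent_reg, if_neg (by omega), if_neg (by omega)]) (fun _ _ => rfl) le_rfl)
      (by simp [hcur]) ?_ ?_ (fun a ha => ?_) (fun a ha => ?_) aL) ?_
    · rw [M.ent_fresh]; omega
    · rw [M.ent_mem, m0 62 (by omega), m0 23 (by omega)]; exact P.link p hpn
    · have := (hW a).1 ha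
      rw [M.ent_fresh]; omega
    · obtain ⟨⟨h1, h2⟩, h3⟩ := (hW a).1 ha
      refine ((P.ready a h1 h2).of (s' := s'.ent .nil) (by rw [M.ent_mem, m0 60 (by omega)])
        (by rw [M.ent_mem, m0 61 (by omega)])).right (fun q hq => hq.1) ?_
      rw [← h3]; exact hF a h1 h2
    rintro s1 hF1 ⟨HL1, a1, t1⟩
    have g90 : s1.reg 90 = .ptr p := (hF1.reg 90 (by rfl)).trans (by simp [hcur])
    rw [wp_seq]
    refine wp.frame (Delete_spec hb hh hB HL1.fix HL1.alive ⟨hpn, hpc.le⟩ g90) ?_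
    rintro s2 hF2 ⟨HA, t2⟩
    have f2 : s2.fresh = s.fresh := (hF2.fresh (by rfl)).trans ((hF1.fresh (by rfl)).trans f0)
    have o2 : s2.out = s1.out := hF2.out (by rfl)
    have g12 : s2.mem 12 = s.mem 12 := (hF2.mem 12 (by rfl)).trans ((hF1.mem 12 (by rfl)).trans
      (m0 12 (by omega)))
    have eA : {q | q < n ∧ ry q ≤ c} \ {p} = {q | q < n ∧ ry q ≤ c - 1} := by
      ext q
      constructor
      · rintro ⟨⟨h1, h2⟩, h3⟩
        have : ry q ≠ ry p := fun h => h3 (hy.inj h1 hpn h)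
        exact ⟨h1, by omega⟩
      · rintro ⟨h1, h2⟩
        exact ⟨⟨h1, by omega⟩, by rintro rfl; omega⟩
    have HL2 : Live n h tb b cl rx rc rep {q | q < n ∧ ry q ≤ c - 1} s2 :=
      ⟨HL1.fix.of (fun i hi => hF2.reg i (by rcases hi with rfl | rfl | rfl | rfl <;> rfl))
        (fun f hf => hF2.mem f (by rcases hf with rfl | rfl | rfl | rfl | rfl | rfl | rfl <;> rfl)) hF2.le,
        eA ▸ HA, ⟨by rw [hF2.mem 21 (by rfl)]; exact HL1.rep.m21, HL1.rep.lt, HL1.rep.iff⟩⟩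
    rw [wp_ld]
    refine ⟨p, (hF2.reg 90 (by rfl)).trans g90, by omega, c - 1, by omega, by omega, ?_,
      HL2.of (fun i hi => by rw [M.set_reg, if_neg (by omega)]) (fun _ _ => rfl) le_rfl, L' ++ W p, ?_,
      fun a => ?_, by rw [M.set_out, o2]; exact a1, ?_⟩
    · simp only [M.set_reg, if_true, g12, h12 p hpn, hpc]
      by_cases h1 : c = 1
      · simp [h1]
      · rw [if_neg h1, if_neg (by omega)]
    · refine List.nodup_append.2 ⟨nL, P.nodup p hpn, fun a ha a' ha' he => ?_⟩
      have h1 := (mL a).1 ha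
      have h2 := (hW a').1 ha'
      rw [he] at h1; omega
    · rw [List.mem_append, mL, hW]
      omega
    · obtain ⟨d, rfl⟩ : ∃ d, c = d + 1 := ⟨c - 1, by omega⟩
      simp only [M.set_time, M.set_out, o2, M.ent_out, M.ent_time, List.length_append, add_tsub_cancel_right,
        mul_add, mul_one] at t1 t2 ht htd ⊢
      omega
  · rintro c s' hF' ⟨hcn, hcur, HL, L', nL, mL, aL, ht⟩ hnil
    have hc0 : c = 0 := by
      by_contra h
      rw [hnil, if_neg h] at hcur; cases hcur
    subst hc0
    refine ⟨L', nL, fun a => ?_, aL, ?_⟩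
    · rw [mL]; omega
    · simp only [M.ent_time, M.ent_out]
      rw [mul_comm n]; omega

end

/-! ### The program -/

/-- Build the tree. -/
def Build : Program := Count ;; Levels ;; Bfs

/-- The sorting heaps place the points by their input numbers in field 4. For x and for y the second
key, the colour, merely breaks ties; for the colour order it is field 5, the x-rank. -/
abbrev PX : HP := ⟨1, 3, 4, 40, 16⟩
abbrev PC : HP := ⟨3, 5, 4, 41, 17⟩
abbrev PY : HP := ⟨2, 3, 4, 42, 18⟩

/-- Each sort leaves the last point of its order in register 32. `Init` starts from the one by
colour and the sweep from the highest one, which is why the sort by y comes after `Init`. -/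
def Main : Program :=
  Build ;; SortBy PX 5 8 9 45 19 ;; SortBy PC 6 10 11 46 20 ;; Init ;; SortBy PY 7 12 13 47 26 ;;
    Prep ;; Sweep

section
variable {B n m h tb : ℕ} {s : M}

theorem Build_spec {sp : ℕ} (hl : PtList n s) (hn : 2 ≤ n) (hsp : 2 ≤ sp) (hspn : sp ≤ n)
    (hB : 4 * n ≤ B) (hfr : n ≤ s.fresh) (h2 : s.reg 2 = .num sp)
    (hnil : ∀ f, 4 ≤ f → ∀ a, s.mem f a = .nil) :
    wp B Build s fun s' => ∃ h tb, n ≤ 2 ^ h ∧ 2 ^ h < 2 * n ∧ TreeS h tb s' ∧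
      CntS h tb (Nat.log 2 sp) (fun _ => 0) s' ∧ s'.fresh ≤ s.fresh + h + 2 * 2 ^ h ∧
      s'.reg 5 = .num 1 ∧ s'.reg 6 = .num 0 ∧ s'.reg 7 = .num n ∧
      (∀ p < n, s'.mem 4 p = .num (p + 1)) ∧ s'.time ≤ s.time + 9 * n + 12 * h + 40 * 2 ^ h + 34 := by
  have hb0 : Nat.log 2 sp ≠ 0 := (Nat.log_pos (by norm_num) hsp).ne'
  rw [Build, wp_seq]
  refine wp.frame (Count_spec hl (by omega) (by omega) hfr) ?_
  rintro s1 hF1 ⟨t1, a5, a6, a7, a4⟩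
  have f1 : s1.fresh = s.fresh := hF1.fresh (by rfl)
  rw [wp_seq]
  refine wp.frame (Levels_spec hn hsp hspn hB ((hF1.reg 2 (by rfl)).trans h2) a5 a7
    (fun a => by rw [hF1.mem 51 (by rfl)]; exact hnil _ (by omega) a)
    (fun a => by rw [hF1.mem 52 (by rfl)]; exact hnil _ (by omega) a)) ?_
  rintro s2 hF2 ⟨h, hn1, hn2, hL, f2, t2⟩
  have hnl : ∀ f, 30 ≤ f → f ≤ 36 → ∀ a, s2.mem f a = .nil := fun f h1 h2 a => by
    rw [hF2.mem f (by interval_cases f <;> rfl), hF1.mem f (by interval_cases f <;> rfl)]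
    exact hnil f (by omega) a
  refine wp.frame (Bfs_spec hL f2 ((hF2.reg 5 (by rfl)).trans a5) ((hF2.reg 6 (by rfl)).trans a6) hb0 hnl)
    ?_
  rintro s3 hF3 ⟨hT, hI, f3, t3⟩
  refine ⟨h, _, hn1, hn2, hT, hI.cntS hb0 f3.ge, by omega, (hF3.reg 5 (by rfl)).trans
    ((hF2.reg 5 (by rfl)).trans a5), (hF3.reg 6 (by rfl)).trans ((hF2.reg 6 (by rfl)).trans a6),
    (hF3.reg 7 (by rfl)).trans ((hF2.reg 7 (by rfl)).trans a7), fun p hp => ?_, by omega⟩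
  rw [hF3.mem 4 (by rfl), hF2.mem 4 (by rfl)]
  exact a4 p hp

/-- The input, together with the tree. -/
structure Base (n m h tb : ℕ) (X Y : ℕ → ℝ) (cl : ℕ → ℕ) (x₁ x₂ y : ℕ → ℝ) (s : M) : Prop where
  tree : TreeS h tb s
  pts : PtList n s
  qs : QList n m x₁ x₂ y s
  r5 : s.reg 5 = .num 1
  r6 : s.reg 6 = .num 0
  r7 : s.reg 7 = .num n
  m1 : ∀ p < n, s.mem 1 p = .coord (X p)
  m2 : ∀ p < n, s.mem 2 p = .coord (Y p)
  m3 : ∀ p < n, s.mem 3 p = .color (cl p)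
  m4 : ∀ p < n, s.mem 4 p = .num (p + 1)

theorem Base.of {X Y : ℕ → ℝ} {cl : ℕ → ℕ} {x₁ x₂ y : ℕ → ℝ} {s' : M}
    (H : Base n m h tb X Y cl x₁ x₂ y s) (hr : ∀ i ∈ [0, 1, 5, 6, 7, 8], s'.reg i = s.reg i)
    (hm : ∀ f ∈ [0, 1, 2, 3, 4, 30, 31, 33], s'.mem f = s.mem f) (hf : s.fresh ≤ s'.fresh) :
    Base n m h tb X Y cl x₁ x₂ y s' := by
  refine ⟨H.tree.of (hr 8 (by simp)) (hm 30 (by simp)) (hm 31 (by simp)) (hm 33 (by simp)) hf,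
    ⟨?_, ?_⟩, H.qs.of (hr 1 (by simp)) (fun f hf => hm f (by interval_cases f <;> simp)) hf,
    ?_, ?_, ?_, ?_, ?_, ?_, ?_⟩
  · rw [hr 0 (by simp)]; exact H.pts.head
  · rw [hm 0 (by simp)]; exact H.pts.next
  · rw [hr 5 (by simp)]; exact H.r5
  · rw [hr 6 (by simp)]; exact H.r6
  · rw [hr 7 (by simp)]; exact H.r7
  · rw [hm 1 (by simp)]; exact H.m1
  · rw [hm 2 (by simp)]; exact H.m2
  · rw [hm 3 (by simp)]; exact H.m3
  · rw [hm 4 (by simp)]; exact H.m4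

theorem Base.sortBy {X Y : ℕ → ℝ} {cl : ℕ → ℕ} {x₁ x₂ y : ℕ → ℝ}
    (H : Base n m h tb X Y cl x₁ x₂ y s) (hn : 1 ≤ n) (hnh : n ≤ 2 ^ h) (hB : n ≤ B) {P : HP}
    {R Lp Ln Mx LF : ℕ} (hP : SortOK P R Lp Ln Mx LF) (hix : P.ix = 4)
    (hc₁ : ∀ p < n, ∀ q < n, (s.mem P.k₁ p).Cmp (s.mem P.k₁ q))
    (hc₂ : ∀ p < n, ∀ q < n, (s.mem P.k₂ p).Cmp (s.mem P.k₂ q))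
    (hnil : ∀ f, f = P.T ∨ f = Ln ∨ f = Mx → ∀ a, s.mem f a = .nil) :
    wp B (SortBy P R Lp Ln Mx LF) s fun s' => s'.time ≤ s.time + n * (190 * (h + 2)) + 15 ∧
      ∃ pt rk, Ranked n (P.key s) pt rk ∧ SortRes n h tb R Lp Ln Mx LF pt rk s' ∧
        s'.reg 32 = .ptr (pt n) := by
  have := H.qs.fr
  refine SortBy_spec (ix := fun p => p + 1) hP H.tree
    ⟨by rw [hix]; exact H.m4, by omega, by omega, hc₁, hc₂, by omega⟩
    H.pts (fun _ _ _ => hnil _ (.inl rfl) _) hn hnh hB H.r5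
    (fun _ _ => hnil _ (.inr (.inl rfl)) _) (fun _ _ _ => hnil _ (.inr (.inr rfl)) _)

theorem Ranked.congr {K K' : Type*} [LinearOrder K] [LinearOrder K'] {κ : ℕ → K} {κ' : ℕ → K'}
    {pt rk : ℕ → ℕ} (H : Ranked n κ pt rk) (h : ∀ p < n, ∀ q < n, κ p ≤ κ q → κ' p ≤ κ' q) :
    Ranked n κ' pt rk :=
  ⟨H.pt_lt, H.rk_pt, H.rk_pos, H.rk_le, H.pt_rk, fun p hp q hq hlt => h p hp q hq (H.mono p hp q hq hlt)⟩

/-- The number of points of colour `c` in the range of the query `a`. -/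
noncomputable def cfreq (n : ℕ) (X Y : ℕ → ℝ) (cl : ℕ → ℕ) (x₁ x₂ y : ℕ → ℝ) (a c : ℕ) : ℕ :=
  Set.ncard {p | p < n ∧ cl p = c ∧ x₁ a ≤ X p ∧ X p ≤ x₂ a ∧ Y p < y a}

/-- In an order by Y the points below y form an initial segment; the largest rank in it is the cut.
-/
theorem Ranked.exists_below {K : Type*} [LinearOrder K] {κ : ℕ → K} {pt rk : ℕ → ℕ} {Y : ℕ → ℝ}
    (H : Ranked n κ pt rk) (hκ : ∀ p < n, ∀ q < n, κ p ≤ κ q → Y p ≤ Y q) (y : ℝ) :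
    ∃ c ≤ n, ∀ p < n, (Y p < y ↔ rk p ≤ c) := by
  classical
  refine ⟨Nat.findGreatest (fun r => 1 ≤ r ∧ Y (pt r) < y) n, Nat.findGreatest_le n, fun p hp =>
    ⟨fun h => Nat.le_findGreatest (H.rk_le p hp) ⟨H.rk_pos p hp, by rwa [H.pt_rk p hp]⟩, fun h => ?_⟩⟩
  obtain ⟨c, hc⟩ : ∃ c, c = Nat.findGreatest (fun r => 1 ≤ r ∧ Y (pt r) < y) n := ⟨_, rfl⟩
  rw [← hc] at h
  have h1 := H.rk_pos p hp
  obtain ⟨h2, h3⟩ := Nat.findGreatest_of_ne_zero hc.symm (by omega)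
  have hcn : c ≤ n := hc ▸ Nat.findGreatest_le n
  have hpc := H.rk_pt c h2 hcn
  rcases h.eq_or_lt with h4 | h4
  · rwa [← h4, H.pt_rk p hp] at h3
  · exact (hκ p hp _ (H.pt_lt c h2 hcn) (H.mono p hp _ (H.pt_lt c h2 hcn) (by omega))).trans_lt h3

theorem Main_spec {X Y : ℕ → ℝ} {cl : ℕ → ℕ} {x₁ x₂ y : ℕ → ℝ} {sp : ℕ} (hl : PtList n s)
    (hq : QList n m x₁ x₂ y s) (hn : 2 ≤ n) (hsp : 2 ≤ sp) (hspn : sp ≤ n)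
    (hB : 4 * n ≤ B) (h2 : s.reg 2 = .num sp) (hnil : ∀ f, 4 ≤ f → ∀ a, s.mem f a = .nil)
    (m1 : ∀ p < n, s.mem 1 p = .coord (X p)) (m2 : ∀ p < n, s.mem 2 p = .coord (Y p))
    (m3 : ∀ p < n, s.mem 3 p = .color (cl p)) (ho : s.out = []) :
    wp B Main s fun s' => ∃ h, n ≤ 2 ^ h ∧ 2 ^ h < 2 * n ∧ s'.fresh ≤ s.fresh + h + 2 * 2 ^ h ∧
      ∃ L : List ℕ, L.Nodup ∧ (∀ a, a ∈ L ↔ n ≤ a ∧ a < n + m) ∧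
      Answered (cfreq n X Y cl x₁ x₂ y) L s'.out ∧
      s'.time ≤ s.time + (14 * (h / Nat.log 2 sp) + 135) * s'.out.length + (168 * h + 90) * L.length +
        m * (120 * (h + 1) + 23) +
        n * ((h / Nat.log 2 sp + 1) * (8 * 2 ^ Nat.log 2 sp + 11) + 1070 * (h + 2) + 118) +
        12 * h + 40 * 2 ^ h + 104 := by
  have hb : Nat.log 2 sp ≠ 0 := (Nat.log_pos (by norm_num) hsp).ne'
  have hfr := hq.fr
  rw [Main, wp_seq]
  refine wp.frame (Build_spec hl hn hsp hspn hB (by omega) h2 hnil) ?_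
  rintro s1 hF1 ⟨h, tb, hn1, hn2, hT, hC, f1, a5, a6, a7, a4, t1⟩
  have B1 : Base n m h tb X Y cl x₁ x₂ y s1 := ⟨hT, ⟨(hF1.reg 0 (by rfl)).trans hl.head, by
    rw [hF1.mem 0 (by rfl)]; exact hl.next⟩, hq.of (hF1.reg 1 (by rfl))
    (fun f hf => hF1.mem f (by interval_cases f <;> rfl)) hF1.le, a5, a6, a7,
    by rw [hF1.mem 1 (by rfl)]; exact m1, by rw [hF1.mem 2 (by rfl)]; exact m2,
    by rw [hF1.mem 3 (by rfl)]; exact m3, a4⟩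
  have n1 : ∀ f ∈ [9, 11, 13, 23, 40, 41, 42, 43, 44, 45, 46, 47], ∀ a, s1.mem f a = .nil := fun f hf a => by
    rw [hF1.mem f (by revert f; decide)]
    exact hnil f (by revert f; decide) a
  have hh : 1 ≤ h := by
    by_contra h0
    have : h = 0 := by omega
    subst this; omega
  rw [wp_seq]
  refine wp.frame (B1.sortBy (P := PX) (R := 5) (Lp := 8) (Ln := 9) (Mx := 45) (LF := 19) (by omega) hn1
    (by omega) (by unfold SortOK; decide) rfl (fun p hp q hq => by simp [B1.m1 p hp, B1.m1 q hq])
    (fun p hp q hq => by simp [B1.m3 p hp, B1.m3 q hq]) (fun f hf a => ?_)) ?_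
  · exact n1 f (by rcases hf with rfl | rfl | rfl <;> simp) a
  rintro s2 hF2 ⟨t2, ptx, rx, hx, Rx, -⟩
  have B2 : Base n m h tb X Y cl x₁ x₂ y s2 := B1.of
    (fun i hi => hF2.reg i (by revert i; decide)) (fun f hf => hF2.mem f (by revert f; decide)) hF2.le
  have n2 : ∀ f ∈ [11, 13, 23, 41, 42, 43, 44, 46, 47], ∀ a, s2.mem f a = .nil := fun f hf a => by
    rw [hF2.mem f (by revert f; decide)]
    exact n1 f (by revert f; decide) a
  have x5 := Rx.cR
  rw [wp_seq]
  refine wp.frame (B2.sortBy (P := PC) (R := 6) (Lp := 10) (Ln := 11) (Mx := 46) (LF := 20) (by omega) hn1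
    (by omega) (by unfold SortOK; decide) rfl (fun p hp q hq => by simp [B2.m3 p hp, B2.m3 q hq])
    (fun p hp q hq => by simp [x5 p hp, x5 q hq]) (fun f hf a => ?_)) ?_
  · exact n2 f (by rcases hf with rfl | rfl | rfl <;> simp) a
  rintro s3 hF3 ⟨t3, ptc, rc, hc, Rc, r32⟩
  have hc' : Ranked n (fun p => toLex ((cl p : ℝ), (rx p : ℝ))) ptc rc := hc.congr fun p hp q hq h => by
    simpa only [HP.key, keyOf, B2.m3 p hp, B2.m3 q hq, x5 p hp, x5 q hq, Val.toReal] using h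
  have S := Scene.of_ranked hx hc'
  have B3 : Base n m h tb X Y cl x₁ x₂ y s3 := B2.of
    (fun i hi => hF3.reg i (by revert i; decide)) (fun f hf => hF3.mem f (by revert f; decide)) hF3.le
  have n3 : ∀ f ∈ [13, 23, 42, 43, 44, 47], ∀ a, s3.mem f a = .nil := fun f hf a => by
    rw [hF3.mem f (by revert f; decide)]
    exact n2 f (by revert f; decide) a
  have C3 : CntS h tb (Nat.log 2 sp) (fun _ => 0) s3 := hC.of
    ((hF3.mem 35 (by rfl)).trans (hF2.mem 35 (by rfl))) ((hF3.mem 32 (by rfl)).trans (hF2.mem 32 (by rfl)))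
    ((hF3.mem 36 (by rfl)).trans (hF2.mem 36 (by rfl))) (hF2.le.trans hF3.le)
  have g3 := B3.qs.fr
  rw [wp_seq]
  refine wp.frame (Init_spec (b := Nat.log 2 sp) S hc' (by omega) ⟨B3.r5, B3.r6, B3.r7, by omega, B3.m3,
    by rw [hF3.mem 5 (by rfl)]; exact x5, Rc.cLp, Rc.cLn⟩ r32 (by omega) B3.tree B3.pts hn1 Rc.cR Rc.cLF C3
    (fun _ _ _ => n3 43 (by simp) _) (fun _ _ _ => n3 44 (by simp) _)) ?_
  rintro s4 hF4 ⟨t4, Fx, Al, rep, hrep⟩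
  have B4 : Base n m h tb X Y cl x₁ x₂ y s4 := B3.of
    (fun i hi => hF4.reg i (by revert i; decide)) (fun f hf => hF4.mem f (by revert f; decide)) hF4.le
  have n4 : ∀ f ∈ [13, 23, 42, 47], ∀ a, s4.mem f a = .nil := fun f hf a => by
    rw [hF4.mem f (by revert f; decide)]
    exact n3 f (by revert f; decide) a
  rw [wp_seq]
  refine wp.frame (B4.sortBy (P := PY) (R := 7) (Lp := 12) (Ln := 13) (Mx := 47) (LF := 26) (by omega) hn1
    (by omega) (by unfold SortOK; decide) rfl (fun p hp q hq => by simp [B4.m2 p hp, B4.m2 q hq])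
    (fun p hp q hq => by simp [B4.m3 p hp, B4.m3 q hq]) (fun f hf a => ?_)) ?_
  · exact n4 f (by rcases hf with rfl | rfl | rfl <;> simp) a
  rintro s5 hF5 ⟨t5, pty, ry, hy, Ry, r32'⟩
  have B5 : Base n m h tb X Y cl x₁ x₂ y s5 := B4.of
    (fun i hi => hF5.reg i (by revert i; decide)) (fun f hf => hF5.mem f (by revert f; decide)) hF5.le
  have L5 : Live n h tb (Nat.log 2 sp) cl rx rc rep {p | p < n} s5 := Live.of ⟨Fx, Al, hrep⟩
    (fun i hi => hF5.reg i (by rcases hi with rfl | rfl | rfl | rfl <;> rfl))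
    (fun f hf => hF5.mem f (by revert f; decide)) hF5.le
  have c45 : MaxCol h tb n ptx (s5.mem 45) := by
    rw [hF5.mem 45 (by rfl), hF4.mem 45 (by rfl), hF3.mem 45 (by rfl)]; exact Rx.cMx
  have o5 : s5.out = [] := by
    rw [hF5.out (by rfl), hF4.out (by rfl), hF3.out (by rfl), hF2.out (by rfl), hF1.out (by rfl), ho]
  have κx : ∀ p < n, ∀ q < n, PX.key s1 p ≤ PX.key s1 q → X p ≤ X q := fun p hp q hq h => by
    simp only [HP.key, keyOf, B1.m1 p hp, B1.m1 q hq, Prod.Lex.toLex_le_toLex, Val.toReal] at h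
    exact h.elim le_of_lt fun h => h.1.le
  have κy : ∀ p < n, ∀ q < n, PY.key s4 p ≤ PY.key s4 q → Y p ≤ Y q := fun p hp q hq h => by
    simp only [HP.key, keyOf, B4.m2 p hp, B4.m2 q hq, Prod.Lex.toLex_le_toLex, Val.toReal] at h
    exact h.elim le_of_lt fun h => h.1.le
  choose cY hcY using fun a => hy.exists_below κy (y a)
  have hset : ∀ a c, cfreq n X Y cl x₁ x₂ y a c =
      Set.ncard {p | p ∈ {p | p < n ∧ ry p ≤ cY a} ∧ cl p = c ∧ x₁ a ≤ X p ∧ X p ≤ x₂ a} := fun a c => by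
    rw [cfreq]
    congr 1
    ext p
    constructor
    · rintro ⟨h1, h2, h3, h4, h5⟩
      exact ⟨⟨h1, ((hcY a).2 p h1).1 h5⟩, h2, h3, h4⟩
    · rintro ⟨⟨h1, h5⟩, h2, h3, h4⟩
      exact ⟨h1, h2, h3, h4, ((hcY a).2 p h1).2 h5⟩
  rw [wp_seq]
  refine wp.frame (Prep_spec (F := cfreq n X Y cl x₁ x₂ y) (cY := cY) ⟨B5.tree, hn1, c45, Ry.cMx, B5.m1, B5.m2,
    L5.fix.m5, B5.r6⟩ (by omega) hx κx hy κy B5.qs (fun p _ => ?_) o5 (fun a _ _ => hcY a)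
    (fun a _ _ h0 c => ?_)) ?_
  · rw [hF5.mem 23 (by rfl)]; exact n4 23 (by simp) p
  · rw [hset, Set.ncard_eq_zero ((Set.finite_Iio n).subset fun q hq => hq.1.1)]
    ext p
    simp only [Set.mem_ofPred_eq, Set.mem_empty_iff_false, iff_false]
    rintro ⟨⟨h1, h2⟩, -⟩
    have := hy.rk_pos p h1
    omega
  rintro s6 hF6 ⟨t6, W, L, hP⟩
  have L6 := L5.of (s' := s6) (fun i hi => hF6.reg i (by rcases hi with rfl | rfl | rfl | rfl <;> rfl))
    (fun f hf => hF6.mem f (by revert f; decide)) hF6.le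
  have B6 := B5.qs.fr
  refine wp.frame (Sweep_spec hb (by omega) (by omega) hh L6 (B6.trans hF6.le) hy
    ((hF6.reg 32 (by rfl)).trans r32') (by rw [hF6.mem 12 (by rfl)]; exact Ry.cLp) hP
    (fun a _ _ => (hcY a).1) (fun a _ _ => hset a)) ?_
  rintro s7 hF7 ⟨L', nL, mL, aL, t7⟩
  refine ⟨h, hn1, hn2, ?_, L', nL, mL, aL, ?_⟩
  · rw [hF7.fresh (by rfl), hF6.fresh (by rfl), hF5.fresh (by rfl), hF4.fresh (by rfl),
      hF3.fresh (by rfl), hF2.fresh (by rfl)]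
    exact f1
  · generalize (14 * (h / Nat.log 2 sp) + 135) * s7.out.length = u1 at *
    generalize (168 * h + 90) * L'.length = u2 at *
    generalize (h / Nat.log 2 sp + 1) * (8 * 2 ^ Nat.log 2 sp + 11) = u3 at *
    generalize m * (120 * (h + 1) + 23) = u4 at *
    generalize 2 ^ h = u5 at *
    nlinarith
end

/-! ### The initial configuration -/

section
variable {n m φ : ℕ} (P : Fin n → ColoredPoint φ) (Q : Fin m → Query) (s : ℕ)

noncomputable def initM : M where
  reg := (initial P Q s).reg
  mem f a := match (initial P Q s).heap a with
    | some ρ => ρ f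
    | none => .nil
  fresh := n + m
  out := []
  time := 0

theorem initM_pt (f : ℕ) {p : ℕ} (hp : p < n) : (initM P Q s).mem f p = pointRecord P ⟨p, hp⟩ f := by
  simp [initM, initial, hp]

theorem initM_qu (f : ℕ) {j : ℕ} (hj : j < m) :
    (initM P Q s).mem f (n + j) = queryRecord n Q ⟨j, hj⟩ f := by
  simp [initM, initial, hj]

theorem initM_none (f : ℕ) {a : ℕ} (ha : n + m ≤ a) : (initM P Q s).mem f a = .nil := by
  simp [initM, initial, show ¬ a < n by omega, show ¬ a - n < m by omega]

theorem listPtr_magnitude (a b c : ℕ) : (listPtr a b c).magnitude = 0 := by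
  unfold listPtr; split_ifs <;> rfl

theorem initM_magnitude (f a : ℕ) : ((initM P Q s).mem f a).magnitude = 0 := by
  by_cases h1 : a < n
  · rw [initM_pt P Q s f h1]
    unfold pointRecord
    split <;> first | exact listPtr_magnitude _ _ _ | rfl
  · by_cases h2 : a < n + m
    · obtain ⟨j, rfl⟩ : ∃ j, a = n + j := ⟨a - n, by omega⟩
      rw [initM_qu P Q s f (show j < m by omega)]
      unfold queryRecord
      split <;> first | exact listPtr_magnitude _ _ _ | rfl
    · rw [initM_none P Q s f (by omega)]; rfl

theorem initM_nil (f : ℕ) (hf : 4 ≤ f) (a : ℕ) : (initM P Q s).mem f a = .nil := by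
  obtain ⟨g, rfl⟩ : ∃ g, f = g + 4 := ⟨f - 4, by omega⟩
  by_cases h1 : a < n
  · rw [initM_pt P Q s _ h1]; rfl
  · by_cases h2 : a < n + m
    · obtain ⟨j, rfl⟩ : ∃ j, a = n + j := ⟨a - n, by omega⟩
      rw [initM_qu P Q s _ (show j < m by omega)]; rfl
    · exact initM_none P Q s _ (by omega)

theorem rel_initM {B : ℕ} (hs : s ≤ B) : Rel B (initial P Q s) (initM P Q s) := by
  refine ⟨rfl, fun a => ?_, rfl, rfl, rfl, rfl, rfl, hs, fun r => ?_, fun f a => ?_,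
    fun f a ha => initM_none P Q s f ha⟩
  · show (initial P Q s).heap a = if a < n + m then _ else _
    by_cases h1 : a < n
    · rw [if_pos (by omega)]
      simp only [initM_pt P Q s _ h1]
      simp [initial, h1]
    · by_cases h2 : a < n + m
      · rw [if_pos h2]
        obtain ⟨j, rfl⟩ : ∃ j, a = n + j := ⟨a - n, by omega⟩
        simp only [initM_qu P Q s _ (show j < m by omega)]
        simp [initial, show j < m by omega]
      · rw [if_neg h2]
        simp [initial, h1, show ¬ a - n < m by omega]
  · show ((initial P Q s).reg r).magnitude ≤ B
    unfold initial
    simp only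
    split
    · rw [listPtr_magnitude]; exact Nat.zero_le _
    · rw [listPtr_magnitude]; exact Nat.zero_le _
    · exact hs
    · exact Nat.zero_le _
  · rw [initM_magnitude]; exact Nat.zero_le _

noncomputable def ptX (p : ℕ) : ℝ := if h : p < n then (P ⟨p, h⟩).pos.1 else 0
noncomputable def ptY (p : ℕ) : ℝ := if h : p < n then (P ⟨p, h⟩).pos.2 else 0
def ptC (p : ℕ) : ℕ := if h : p < n then (P ⟨p, h⟩).color else 0

/-- A coordinate of the query at the address `a`. -/
noncomputable def qu (n : ℕ) (Q : Fin m → Query) (g : Query → ℝ) (a : ℕ) : ℝ :=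
  if h : a - n < m then g (Q ⟨a - n, h⟩) else 0

theorem qu_add (g : Query → ℝ) (j : Fin m) : qu n Q g (n + j) = g (Q j) := by simp [qu]

/-- The frequencies in the numbering of records by addresses. -/
noncomputable def frequency : ℕ → ℕ → ℕ :=
  cfreq n (ptX P) (ptY P) (ptC P) (qu n Q Query.x₁) (qu n Q Query.x₂) (qu n Q Query.y)

theorem frequency_eq (j : Fin m) (c : Fin φ) : frequency P Q (n + j) c = freq P (Q j) c := by
  rw [frequency, cfreq, freq, ← Set.ncard_image_of_injective _ Fin.val_injective]
  congr 1
  ext p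
  simp only [qu_add, Set.mem_image, Set.mem_ofPred_eq, Query.range, Set.mem_prod, Set.mem_Icc,
    Set.mem_Iio]
  constructor
  · rintro ⟨hp, h1, h2, h3, h4⟩
    simp only [ptX, ptY, ptC, hp, dif_pos] at h1 h2 h3 h4
    exact ⟨⟨p, hp⟩, ⟨Fin.ext h1, ⟨h2, h3⟩, h4⟩, rfl⟩
  · rintro ⟨i, ⟨h1, ⟨h2, h3⟩, h4⟩, rfl⟩
    refine ⟨i.2, ?_⟩
    simp only [ptX, ptY, ptC, i.2, dif_pos]
    exact ⟨by rw [h1], h2, h3, h4⟩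

theorem lt_of_frequency_pos {a c : ℕ} (h : 0 < frequency P Q a c) : c < φ := by
  obtain ⟨p, hp, h1, -⟩ := Set.nonempty_of_ncard_ne_zero h.ne'
  rw [ptC, dif_pos hp] at h1
  rw [← h1]
  exact Fin.is_lt _

/-- Colours on the stream are natural numbers. Those with positive frequency come from points and so
lie in the palette. -/
theorem exists_isAnswer (j : Fin m) {l : List (ℕ × ℕ)} (hl : Lists (frequency P Q (n + j)) l) :
    ∃ l' : List (Fin φ × ℕ), IsAnswer P (Q j) l' ∧ l'.map (fun t => ((t.1 : ℕ), t.2)) = l := by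
  have lift : ∀ l : List (ℕ × ℕ), (∀ t ∈ l, t.1 < φ) →
      ∃ l' : List (Fin φ × ℕ), l'.map (fun t => ((t.1 : ℕ), t.2)) = l := by
    intro l
    induction l with
    | nil => exact fun _ => ⟨[], rfl⟩
    | cons t l ih =>
      intro h
      obtain ⟨l', h'⟩ := ih fun t ht => h t (by simp [ht])
      exact ⟨(⟨t.1, h t (by simp)⟩, t.2) :: l', by simp [h']⟩
  have hinj : Function.Injective fun t : Fin φ × ℕ => ((t.1 : ℕ), t.2) := by
    rintro ⟨a, b⟩ ⟨c, d⟩ h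
    obtain ⟨h1, h2⟩ := Prod.mk.inj h
    exact Prod.ext (Fin.ext h1) h2
  obtain ⟨l', h'⟩ := lift l fun t ht => by
    obtain ⟨h1, h2⟩ := (hl.2 t.1 t.2).1 ht
    exact lt_of_frequency_pos P Q (h2 ▸ h1)
  refine ⟨l', ⟨List.Nodup.of_map _ (h' ▸ hl.1), fun c f => ?_⟩, h'⟩
  rw [← frequency_eq, ← hl.2 c f, ← h']
  exact (List.mem_map_of_injective hinj (a := (c, f))).symm

/-- A colour determines its frequency, so an answer has one pair for each colour that occurs. -/
theorem length_of_isAnswer {q : Query} {l : List (Fin φ × ℕ)} (h : IsAnswer P q l) :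
    l.length = outputSize P q := by
  have hn : (l.map Prod.fst).Nodup := List.Nodup.map_on (fun a ha b hb hab => by
    have h1 := ((h.2 a.1 a.2).1 ha).2
    have h2 := ((h.2 b.1 b.2).1 hb).2
    exact Prod.ext hab (by rw [h1, h2, hab])) h.1
  have e : {c : Fin φ | 0 < freq P q c} = ((l.map Prod.fst).toFinset : Set (Fin φ)) := by
    ext c
    simp only [Set.mem_ofPred_eq, List.coe_toFinset, List.mem_map]
    constructor
    · exact fun hc => ⟨(c, freq P q c), (h.2 _ _).2 ⟨hc, rfl⟩, rfl⟩
    · rintro ⟨⟨c', f⟩, ht, rfl⟩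
      obtain ⟨h1, h2⟩ := (h.2 _ _).1 ht
      exact h2 ▸ h1
  rw [outputSize, e, Set.ncard_coe_finset, List.toFinset_card_of_nodup hn, List.length_map]

/-- Absence of repetitions lets the answers be collected in one function of the query: adding a new
query does not disturb the old values. -/
theorem Answered.exists_lists {F : ℕ → ℕ → ℕ} {L : List ℕ} {o : List Event} (h : Answered F L o)
    (hL : L.Nodup) : ∃ g : ℕ → List (ℕ × ℕ), (∀ a ∈ L, Lists (F a) (g a)) ∧
      o = L.flatMap fun a => .query a :: (g a).map fun t => .tuple t.1 t.2 := by
  induction h with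
  | nil => exact ⟨fun _ => [], by simp, rfl⟩
  | @snoc L o a l h hl ih =>
    obtain ⟨n1, -, n2⟩ := List.nodup_append.1 hL
    obtain ⟨g, h1, h2⟩ := ih n1
    have hne : ∀ b ∈ L, b ≠ a := fun b hb => n2 b hb a (by simp)
    refine ⟨Function.update g a l, fun b hb => ?_, ?_⟩
    · rcases List.mem_append.1 hb with hb | hb
      · rw [Function.update_of_ne (hne b hb)]; exact h1 b hb
      · rw [List.mem_singleton.1 hb, Function.update_self]; exact hl
    · rw [List.flatMap_append, h2]
      congr 1
      · refine List.flatMap_congr fun b hb => ?_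
        rw [Function.update_of_ne (hne b hb)]
      · simp

/-- A stream that answers every query once has the desired form and length. -/
theorem Answered.answersAll {L : List ℕ} {o : List Event} (h : Answered (frequency P Q) L o)
    (hL : L.Nodup) (hm : ∀ a, a ∈ L ↔ n ≤ a ∧ a < n + m) :
    AnswersAll P Q o ∧ o.length = m + totalOutputSize P Q ∧ L.length = m := by
  obtain ⟨g, h1, h2⟩ := h.exists_lists hL
  have hlen : L.length = m := by
    rw [← List.toFinset_card_of_nodup hL, show L.toFinset = Finset.Ico n (n + m) by
      ext a; simp [hm], Nat.card_Ico]
    omega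
  have hget : ∀ i : Fin m, n ≤ L[i]'(hlen.symm ▸ i.2) ∧ L[i]'(hlen.symm ▸ i.2) < n + m := fun i =>
    (hm _).1 (List.getElem_mem _)
  -- Query records start at address n, so subtracting n from the announced addresses gives the order
  -- of the queries.
  let e : Fin m → Fin m := fun i => ⟨L[i]'(hlen.symm ▸ i.2) - n, by have := hget i; omega⟩
  have he : Function.Injective e := fun i j hij => by
    have h3 := Fin.val_eq_of_eq hij
    have h4 := hget i
    have h5 := hget j
    simp only [e] at h3
    exact Fin.ext ((List.Nodup.getElem_inj_iff hL).1
      (show L[(i : ℕ)]'(hlen.symm ▸ i.2) = L[(j : ℕ)]'(hlen.symm ▸ j.2) by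
        simp only [Fin.getElem_fin] at h3 h4 h5; omega))
  let order : Equiv.Perm (Fin m) := Equiv.ofBijective e (Finite.injective_iff_bijective.1 he)
  have hLo : L = (List.ofFn order).map fun j : Fin m => n + (j : ℕ) := by
    refine List.ext_getElem (by simp [hlen]) fun i hi hi' => ?_
    have h4 := hget ⟨i, hlen ▸ hi⟩
    simp only [Fin.getElem_fin] at h4
    simp [order, e]
    omega
  have hex : ∀ j : Fin m, ∃ l' : List (Fin φ × ℕ), IsAnswer P (Q j) l' ∧
      l'.map (fun t => ((t.1 : ℕ), t.2)) = g (n + j) := fun j =>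
    exists_isAnswer P Q j (h1 _ ((hm _).2 ⟨by omega, by omega⟩))
  choose ans ha hg using hex
  have ho : o = (List.ofFn order).flatMap (block n m ans) := by
    rw [h2, hLo, List.flatMap_map]
    refine List.flatMap_congr fun j _ => ?_
    rw [block, ← hg]
    simp
  refine ⟨⟨order, ans, ha, ho⟩, ?_, hlen⟩
  rw [ho, List.length_flatMap, List.map_ofFn, List.sum_ofFn, totalOutputSize]
  simp only [Function.comp_def, block, List.length_cons, List.length_map, length_of_isAnswer P (ha _),
    Finset.sum_add_distrib, Finset.sum_const, Finset.card_univ, Fintype.card_fin, smul_eq_mul, mul_one]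
  rw [add_comm, Equiv.sum_comp order fun j => outputSize P (Q j)]

end

/-! ### The bounds -/

/-- A bound for the running time of `Main` in terms of the height `h` of the tree and the distance `b`
of the marked levels. -/
def cost (n h b m K : ℕ) : ℕ :=
  (14 * (h / b) + 135) * (m + K) + (168 * h + 90) * m + m * (120 * (h + 1) + 23) +
    n * ((h / b + 1) * (8 * 2 ^ b + 11) + 1070 * (h + 2) + 118) + 12 * h + 40 * 2 ^ h + 104

/-- With L = log n and l = log_s n, the estimates are h ≤ 3L, ⌊h/b⌋ ≤ 4l and 2^b ≤ s. Since l ≥ 1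
and L ≥ 2/3, additive constants can be absorbed. -/
theorem cost_le {n h sp : ℕ} (m K : ℕ) (hsp : 2 ≤ sp) (hspn : sp ≤ n) (hh : 2 ^ h < 2 * n) :
    (cost n h (Nat.log 2 sp) m K : ℝ) ≤ 20000 * ((n : ℝ) * Real.log n ^ 2 * sp * Real.logb sp n +
      m * Real.log n + K * Real.logb sp n) := by
  obtain ⟨b, hb⟩ : ∃ b, b = Nat.log 2 sp := ⟨_, rfl⟩
  have hb0 : 1 ≤ b := hb ▸ Nat.log_pos (by norm_num) hsp
  have hb1 : 2 ^ b ≤ sp := hb ▸ Nat.pow_log_le_self 2 (by omega)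
  have hb2 : sp < 2 ^ (b + 1) := hb ▸ Nat.lt_pow_succ_log_self (by norm_num) sp
  rw [← hb, cost]
  have l2 := Real.log_two_gt_d9
  have hspR : (2 : ℝ) ≤ sp := by exact_mod_cast hsp
  have hnR : (sp : ℝ) ≤ n := by exact_mod_cast hspn
  obtain ⟨S, hS⟩ : ∃ S : ℝ, S = sp := ⟨_, rfl⟩
  obtain ⟨L, hL⟩ : ∃ L, L = Real.log n := ⟨_, rfl⟩
  obtain ⟨l, hl⟩ : ∃ l, l = Real.logb sp n := ⟨_, rfl⟩
  obtain ⟨q, hq⟩ : ∃ q, q = h / b := ⟨_, rfl⟩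
  have hls : Real.log 2 ≤ Real.log sp := Real.log_le_log (by norm_num) hspR
  have hlL : Real.log sp ≤ L := hL ▸ Real.log_le_log (by linarith) hnR
  have hll : l * Real.log sp = L := by
    rw [hl, hL, Real.logb, div_mul_cancel₀]; linarith
  have hl1 : 1 ≤ l := by
    by_contra hlt
    have : l * Real.log sp < 1 * Real.log sp := mul_lt_mul_of_pos_right (by linarith) (by linarith)
    linarith
  -- From 2^h ≤ 2n and log 2 ≤ L.
  have hlog : (h : ℝ) * Real.log 2 ≤ 2 * L := by
    have h1 : ((2 : ℝ) ^ h) ≤ 2 * n := by exact_mod_cast hh.le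
    have h2 := Real.log_le_log (by positivity) h1
    rw [Real.log_pow, Real.log_mul (by norm_num) (by linarith), ← hL] at h2
    linarith
  have hhL : (h : ℝ) ≤ 3 * L := by nlinarith [(Nat.cast_nonneg h : (0 : ℝ) ≤ h)]
  have hql : (q : ℝ) ≤ 4 * l := by
    have h1 : (q : ℝ) * b ≤ h := by exact_mod_cast hq ▸ Nat.div_mul_le_self h b
    -- From s ≤ 2^(b+1) and b ≥ 1; the factor 2 pays for rounding log₂ s down.
    have h2 : Real.log sp ≤ 2 * b * Real.log 2 := by
      have h3 : (sp : ℝ) ≤ 2 ^ (b + 1) := by exact_mod_cast hb2.le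
      have h4 := Real.log_le_log (by linarith) h3
      rw [Real.log_pow] at h4
      have h5 : (1 : ℝ) ≤ b := by exact_mod_cast hb0
      push_cast at h4
      nlinarith
    have h3 : (q : ℝ) * Real.log sp ≤ 4 * l * Real.log sp := by
      calc (q : ℝ) * Real.log sp ≤ q * (2 * b * Real.log 2) :=
            mul_le_mul_of_nonneg_left h2 (Nat.cast_nonneg q)
        _ = 2 * (q * b) * Real.log 2 := by ring
        _ ≤ 2 * h * Real.log 2 := by gcongr
        _ ≤ 4 * l * Real.log sp := by linarith
    exact le_of_mul_le_mul_right h3 (by linarith)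
  have hlL' : l ≤ 3 / 2 * L := by nlinarith
  have hpb : (2 : ℝ) ^ b ≤ S := by rw [hS]; exact_mod_cast hb1
  have hph : (2 : ℝ) ^ h ≤ 2 * n := by exact_mod_cast hh.le
  have hL1 : 1 ≤ 3 / 2 * L := by linarith
  rw [← hq]
  push_cast
  rw [← hL, ← hl, ← hS]
  rw [← hS] at hspR hnR
  generalize (n : ℝ) = N at *
  generalize (q : ℝ) = q' at *
  generalize (h : ℝ) = h' at *
  have hm : (0 : ℝ) ≤ m := Nat.cast_nonneg m
  have hK : (0 : ℝ) ≤ K := Nat.cast_nonneg K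
  generalize (m : ℝ) = M at *
  generalize (K : ℝ) = K at *
  -- The n-dependent cost is bounded by multiples of u and n log n; `e1` and `e2` then bring in the
  -- factor L² of the claim, whose only role is that it is bounded away from 0 and, for n log n,
  -- that it supplies one logarithm.
  obtain ⟨u, hu⟩ : ∃ u, u = N * S * l := ⟨_, rfl⟩
  have hN : 0 ≤ N := by linarith
  have hNu : N ≤ u := by
    have : 1 ≤ S * l := by nlinarith
    rw [hu, mul_assoc]
    nlinarith
  have hT : N * L ^ 2 * S * l = u * L ^ 2 := by rw [hu]; ring
  have e1 : u ≤ 9 / 4 * (u * L ^ 2) := by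
    have : 1 ≤ 9 / 4 * L ^ 2 := by nlinarith
    nlinarith
  have e2 : N * L ≤ 3 / 2 * (u * L ^ 2) := by
    have h1 : N * L ≤ u * L := mul_le_mul_of_nonneg_right hNu (by linarith)
    have h2 : u * L * 1 ≤ u * L * (3 / 2 * L) :=
      mul_le_mul_of_nonneg_left hL1 (mul_nonneg (by linarith) (by linarith))
    linarith
  have d1 : (14 * q' + 135) * (M + K) ≤ 191 * (l * K) + 300 * (M * L) := by
    have h1 : (14 * q' + 135) * (M + K) ≤ (191 * l) * (M + K) :=
      mul_le_mul_of_nonneg_right (by linarith) (by linarith)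
    have h2 : l * M ≤ 3 / 2 * L * M := mul_le_mul_of_nonneg_right hlL' hm
    have h3 : 0 ≤ M * L := mul_nonneg hm (by linarith)
    linarith
  have d2 : (168 * h' + 90) * M ≤ 650 * (M * L) := by
    have h1 : (168 * h' + 90) * M ≤ (650 * L) * M := mul_le_mul_of_nonneg_right (by linarith) hm
    linarith
  have d3 : M * (120 * (h' + 1) + 23) ≤ 600 * (M * L) := by
    have h1 : M * (120 * (h' + 1) + 23) ≤ M * (600 * L) := mul_le_mul_of_nonneg_left (by linarith) hm
    linarith
  have d4 : N * ((q' + 1) * (8 * 2 ^ b + 11) + 1070 * (h' + 2) + 118) ≤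
      70 * u + 6600 * (N * L) := by
    have h1 : (q' + 1) * (8 * 2 ^ b + 11) ≤ (5 * l) * (14 * S) :=
      mul_le_mul (by linarith) (by linarith) (by positivity) (by linarith)
    have h2 : N * ((q' + 1) * (8 * 2 ^ b + 11) + 1070 * (h' + 2) + 118) ≤
        N * ((5 * l) * (14 * S) + 6600 * L) := mul_le_mul_of_nonneg_left (by linarith) hN
    rw [hu]
    linarith
  have d5 : 12 * h' + 40 * 2 ^ h + 104 ≤ 36 * (N * L) + 184 * u := by
    have h1 : L * 1 ≤ L * N := mul_le_mul_of_nonneg_left (by linarith) (by linarith)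
    linarith
  rw [hT]
  have c1 : 0 ≤ u * L ^ 2 := mul_nonneg (by linarith) (sq_nonneg L)
  have c2 : 0 ≤ M * L := mul_nonneg hm (by linarith)
  have c3 : 0 ≤ l * K := mul_nonneg (by linarith) hK
  linarith

end FreqReport

theorem mainTheorem8 :
    ∃ (prog : FreqReport.Program) (C : ℝ),
      ∀ (n m φ s : ℕ) (P : Fin n → FreqReport.ColoredPoint φ) (Q : Fin m → FreqReport.Query),
        2 ≤ s → s ≤ n →
        ∃ σ : FreqReport.State,
          FreqReport.Exec prog (FreqReport.initial P Q s) σ ∧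
          FreqReport.AnswersAll P Q σ.out ∧
          (σ.time : ℝ) ≤ C * ((n : ℝ) * Real.log n ^ 2 * s * Real.logb s n + m * Real.log n +
            (FreqReport.totalOutputSize P Q : ℝ) * Real.logb s n) ∧
          (σ.peak : ℝ) ≤ C * (n + m) ∧
          (σ.maxNum : ℝ) ≤ C * (n + m) := by
  refine ⟨FreqReport.Main, 20000, fun n m φ s P Q hs hsn => ?_⟩
  -- The bound 4(n + m) on integers covers the doublings in `Levels`, all ranks and counters, and
  -- the parameter s that is present initially.
  obtain ⟨t, hex, h, hn1, hn2, hf, L, hL, hm, hans, ht⟩ := FreqReport.Main_spec (B := 4 * (n + m)) (n := n)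
    (m := m) (s := FreqReport.initM P Q s) (X := FreqReport.ptX P) (Y := FreqReport.ptY P)
    (cl := FreqReport.ptC P) (x₁ := FreqReport.qu n Q FreqReport.Query.x₁)
    (x₂ := FreqReport.qu n Q FreqReport.Query.x₂) (y := FreqReport.qu n Q FreqReport.Query.y) (sp := s)
    ⟨rfl, fun i hi => by rw [FreqReport.initM_pt P Q s 0 hi]; rfl⟩
    ⟨rfl, fun j hj => by rw [FreqReport.initM_qu P Q s 0 hj]; rfl,
      fun j hj => by rw [FreqReport.initM_qu P Q s 1 hj, FreqReport.qu_add Q _ ⟨j, hj⟩]; rfl,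
      fun j hj => by rw [FreqReport.initM_qu P Q s 2 hj, FreqReport.qu_add Q _ ⟨j, hj⟩]; rfl,
      fun j hj => by rw [FreqReport.initM_qu P Q s 3 hj, FreqReport.qu_add Q _ ⟨j, hj⟩]; rfl, le_rfl⟩
    (hs.trans hsn) hs hsn (by omega) rfl (FreqReport.initM_nil P Q s)
    (fun p hp => by rw [FreqReport.initM_pt P Q s 1 hp, FreqReport.ptX, dif_pos hp]; rfl)
    (fun p hp => by rw [FreqReport.initM_pt P Q s 2 hp, FreqReport.ptY, dif_pos hp]; rfl)
    (fun p hp => by rw [FreqReport.initM_pt P Q s 3 hp, FreqReport.ptC, dif_pos hp]; rfl) rfl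
  obtain ⟨σ, hσ, hr⟩ := hex.exec _ (FreqReport.rel_initM P Q s (by omega))
  obtain ⟨hA, hlen, hLm⟩ := FreqReport.Answered.answersAll P Q hans hL hm
  refine ⟨σ, hσ, by rw [hr.out]; exact hA, ?_, ?_, ?_⟩
  · refine le_trans ?_ (FreqReport.cost_le m (FreqReport.totalOutputSize P Q) hs hsn hn2)
    rw [hlen, hLm] at ht
    rw [hr.time]
    have h0 : (FreqReport.initM P Q s).time = 0 := rfl
    rw [h0, zero_add] at ht
    exact_mod_cast ht.trans (by unfold FreqReport.cost; omega)
  -- The records are the input, h + 1 heights and 2 · 2^h - 1 nodes; with h < 2^h < 2n this is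
  -- linear.
  · have h1 : h < 2 ^ h := Nat.lt_two_pow_self
    have h2 : (FreqReport.initM P Q s).fresh = n + m := rfl
    have h3 : σ.peak ≤ 20000 * (n + m) := by rw [hr.peak]; omega
    exact_mod_cast h3
  · have h3 : σ.maxNum ≤ 20000 * (n + m) := hr.maxNum.trans (by omega)
    exact_mod_cast h3
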